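/- **Setting.** All vector spaces are over $\mathbb C$. Fix an integer $n\ge 1$, a finite-dimensional simple Lie algebra $\mathfrak g$, commuting automorphisms $\sigma_0,\dots,\sigma_n$ of $\mathfrak g$ of finite orders $m_0,\dots,m_n$, primitive $m_i$-th roots of unity $\xi_i$, and an invariant symmetric bilinear form $(\cdot,\cdot)$ on $\mathfrak g$ that is a positive real multiple of the Killing form. For $(k_0,k)\in\mathbb Z\times\mathbb Z^n$ let $\mathfrak g(\bar k_0,\bar k)=\{x\in\mathfrak g:\sigma_i x=\xi_i^{k_i}x,\ 0\le i\le n\}$; put $\Gamma_0=m_0\mathbb Z$ and $\Gamma=m_1\mathbb Z\oplus\cdots\oplus m_n\mathbb Z$. The twisted full toroidal Lie algebra $\tau$ is $$\tau=\bigoplus_{(k_0,k)}\mathfrak g(\bar k_0,\bar k)\otimes t_0^{k_0}t^k\ \oplus\ Z\ \oplus\ D,$$ where $Z$ is spanned by the symbols $t_0^{s_0}t^sK_i$ modulo the relations $\sum_{i=0}^n s_i\,t_0^{s_0}t^sK_i=0$, and $D$ has basis $t_0^{s_0}t^sd_i$ ($0\le i\le n$, $s_0\in\Gamma_0$, $s\in\Gamma$).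 Write $t(r)=t_0^{r_0}t^r$ and $X(k)=X\otimes t(k)$ for multi-indices in $\mathbb Z^{n+1}$. The brackets are: $Z$ commutes with $Z$ and with all $X(k)$, and $$[X(k),Y(l)]=[X,Y](k+l)+(X,Y)\sum_i k_i\,t(k+l)K_i,\qquad [t(r)d_a,X(k)]=k_aX(k+r),$$ $$[t(r)d_a,t(s)K_b]=s_a\,t(r+s)K_b+\delta_{ab}\sum_p r_p\,t(r+s)K_p,$$ $$[t(r)d_a,t(s)d_b]=s_a\,t(r+s)d_b-r_b\,t(r+s)d_a+(-\mu s_ar_b+\nu r_as_b)\sum_p r_p\,t(r+s)K_p$$ for fixed $\mu,\nu\in\mathbb C$. Assume that $\mathfrak g(\bar0,\bar0)$ is simple, with a Cartan subalgebra $\mathfrak h(0)$ that is contained in a Cartan subalgebra of $\mathfrak g$. Let $\Delta_0^\times$ be the root system of $(\mathfrak g(\bar 0,\bar 0),\mathfrak h(0))$, and let $\Delta_{0,en}$ consist of $0$, of $\Delta_0^\times$ and, if $\Delta_0^\times$ has type $B_l$ ($l\ge1$, $B_1=A_1$), of the doubles of the short roots. Assume that the set of weights $\Delta(\mathfrak g,\mathfrak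 h(0))$ (zero included) of $\mathfrak h(0)$ on $\mathfrak g$ is contained in $\Delta_{0,en}$. Fix simple roots $\alpha_1,\dots,\alpha_p$ of $\Delta_0^\times$. For a weight $\alpha$ of $\mathfrak h(0)$ and $k_0\in\mathbb Z$, call $\alpha+k_0\delta_0$ positive if $k_0>0$, or if $k_0=0$ and $\alpha$ is a nonzero nonnegative integral combination of $\alpha_1,\dots,\alpha_p$. With $\mathfrak g(\bar k_0,\bar k,\alpha)$ the $\alpha$-weight space of $\mathfrak g(\bar k_0,\bar k)$, let $\tau^+$ be spanned by the $\mathfrak g(\bar k_0,\bar k,\alpha)\otimes t_0^{k_0}t^k$ with $\alpha+k_0\delta_0$ positive and by the $t_0^{s_0}t^sK_i$, $t_0^{s_0}t^sd_i$ with $s_0>0$; let $\tau^0$ be spanned by the $\mathfrak g(\bar 0,\bar k,0)\otimes t^k$ and the $t^sK_i$, $t^sd_i$. Let $H=\mathfrak h(0)\oplus\sum_i\mathbb CK_i\oplus\sum_i\mathbb Cd_i$. A $\tau$-module is *integrable* if it is the direct sum of its $H$-weight spaces, these are finite-dimensional, and for every $\alpha\ne0$ each element of $\mathfrak g(\bar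 k_0,\bar k,\alpha)\otimes t_0^{k_0}t^k$ acts locally nilpotently. **Theorem.** Let $V$ be an irreducible integrable $\tau$-module on which $K_0$ acts as a real scalar $C_0>0$ and $K_1,\dots,K_n$ act as $0$. Let $T=\{v\in V:\tau^+v=0\}$ and $M=\mathrm{Ind}_{\tau^0+\tau^+}^{\tau}T=U(\tau)\otimes_{U(\tau^0+\tau^+)}T$. Then: 1. $T$ is a (nonzero) irreducible $\tau^0$-module. 2. Among the submodules of $M$ that meet $T=1\otimes T$ trivially there is a largest one, $M^{rad}$, and $V\cong M/M^{rad}$ as $\tau$-modules. 3. Let $\mathring{\mathfrak g}=\{X\in\mathfrak g:\sigma_0X=X,\ [\mathfrak h(0),X]=0\}$ and $\mathring{\mathfrak g}_{\bar l}=\{X\in\mathring{\mathfrak g}:\sigma_iX=\xi_i^{l_i}X,\ 1\le i\le n\}$ for $l\in\mathbb Z^n$. For every weight $\lambda$ of $T$, with $\alpha=(\lambda(d_1),\dots,\lambda(d_n))$, there exist a subgroup $\Gamma'$ with $\Gamma\subseteq\Gamma'\subseteq\mathbb Z^n$, a finite-dimensional irreducible $\mathfrak{gl}_n$-module $V_1$,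 and a finite-dimensional irreducible $\mathring{\mathfrak g}$-module $V_2=\bigoplus_{q\in\mathbb Z^n/\Gamma'}V_{2,q}$, graded so that $\mathring{\mathfrak g}_{\bar l}V_{2,q}\subseteq V_{2,q+l}$, such that, as a $\tau^0$-module, $$T\;\cong\;\bigoplus_{k\in\mathbb Z^n}V_1\otimes V_{2,k+\Gamma'}\otimes t^k,$$ where, for $r\in\Gamma$, $u\in\mathbb C^n$, $D(u,r)=\sum_{i=1}^n u_it^rd_i$, $X\in\mathring{\mathfrak g}_{\bar l}$, $E_{ji}$ the matrix units and $(u,w)=\sum_{i=1}^nu_iw_i$, $$D(u,r)(v_1\otimes v_2\otimes t^k)=(u,k+\alpha)\,v_1\otimes v_2\otimes t^{k+r}+\sum_{i,j=1}^nu_ir_j\,(E_{ji}v_1)\otimes v_2\otimes t^{k+r},$$ $$X(l)(v_1\otimes v_2\otimes t^k)=v_1\otimes Xv_2\otimes t^{k+l},\qquad t^rd_0(v_1\otimes v_2\otimes t^k)=\lambda(d_0)\,v_1\otimes v_2\otimes t^{k+r},$$ $$t^rK_0(v_1\otimes v_2\otimes t^k)=C_0\,v_1\otimes v_2\otimes t^{k+r},\qquad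 t^rK_p(v_1\otimes v_2\otimes t^k)=0\quad(1\le p\le n).$$ -/

import Mathlib

set_option linter.unusedSimpArgs false

noncomputable section

/-- The lattice of exponents `(k₀, k₁, …, kₙ)`. -/
abbrev Expo (n : ℕ) : Type := Fin (n + 1) → ℤ

/-- Coefficient vectors: `u` stands for `∑ uᵢ dᵢ` or for `∑ uᵢ Kᵢ`. -/
abbrev Coef (n : ℕ) : Type := Fin (n + 1) → ℂ

/-- An exponent regarded as a complex vector. -/
def Expo.toCoef {n : ℕ} (k : Expo n) : Coef n := fun i => (k i : ℂ)

/-- The bilinear pairing `∑ uᵢ wᵢ`. -/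
def Coef.dot {n : ℕ} (u w : Coef n) : ℂ := ∑ i, u i * w i

section Algebra

variable {n : ℕ}

@[simp] lemma Expo.toCoef_add (k l : Expo n) : (k + l).toCoef = k.toCoef + l.toCoef := by
  ext i; simp [Expo.toCoef]

@[simp] lemma Coef.add_dot (u v w : Coef n) : (u + v).dot w = u.dot w + v.dot w := by
  simp [Coef.dot, add_mul, Finset.sum_add_distrib]

@[simp] lemma Coef.dot_add (u v w : Coef n) : u.dot (v + w) = u.dot v + u.dot w := by
  simp [Coef.dot, mul_add, Finset.sum_add_distrib]

@[simp] lemma Coef.smul_dot (a : ℂ) (u v : Coef n) : (a • u).dot v = a * u.dot v := by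
  simp [Coef.dot, Finset.mul_sum, mul_assoc]

@[simp] lemma Coef.dot_smul (a : ℂ) (u v : Coef n) : u.dot (a • v) = a * u.dot v := by
  simp [Coef.dot, Finset.mul_sum, mul_left_comm]

@[simp] lemma Coef.sub_dot (u v w : Coef n) : (u - v).dot w = u.dot w - v.dot w := by
  simp [Coef.dot, sub_mul, Finset.sum_sub_distrib]

/-- The bilinear map on exponent-graded spaces with `(t^r a, t^s b) ↦ t^(r+s) F r s a b`. -/
def gradedBilin {M N P : Type*} [AddCommGroup M] [Module ℂ M] [AddCommGroup N] [Module ℂ N]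
    [AddCommGroup P] [Module ℂ P] (F : Expo n → Expo n → M →ₗ[ℂ] N →ₗ[ℂ] P) :
    (Expo n →₀ M) →ₗ[ℂ] (Expo n →₀ N) →ₗ[ℂ] (Expo n →₀ P) :=
  Finsupp.lsum ℂ fun r => LinearMap.flip
    (Finsupp.lsum ℂ fun s => (F r s).flip.compr₂ (Finsupp.lsingle (r + s)))

@[simp] lemma gradedBilin_single {M N P : Type*} [AddCommGroup M] [Module ℂ M] [AddCommGroup N]
    [Module ℂ N] [AddCommGroup P] [Module ℂ P] (F : Expo n → Expo n → M →ₗ[ℂ] N →ₗ[ℂ] P)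
    (r s : Expo n) (a : M) (b : N) :
    gradedBilin F (Finsupp.single r a) (Finsupp.single s b) =
      Finsupp.single (r + s) (F r s a b) := by
  simp [gradedBilin]

/-- The relations `dA`: the span of the elements `∑ kᵢ t^k Kᵢ` in `ΩA`. -/
def exactForms (n : ℕ) : Submodule ℂ (Expo n →₀ Coef n) :=
  Submodule.span ℂ (Set.range fun k : Expo n => Finsupp.single k k.toCoef)

/-- `Z = ΩA / dA`. -/
abbrev CenterSpace (n : ℕ) : Type := (Expo n →₀ Coef n) ⧸ exactForms n

/-- The class of `∑ wᵢ t^k Kᵢ` in `ΩA / dA`. -/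
def kahler (k : Expo n) (w : Coef n) : CenterSpace n :=
  (exactForms n).mkQ (Finsupp.single k w)

lemma kahler_self (k : Expo n) : kahler k k.toCoef = 0 := by
  rw [kahler, Submodule.mkQ_apply, Submodule.Quotient.mk_eq_zero]
  exact Submodule.subset_span ⟨k, rfl⟩

lemma kahler_add (k : Expo n) (v w : Coef n) : kahler k (v + w) = kahler k v + kahler k w := by
  simp [kahler]

lemma kahler_sub (k : Expo n) (v w : Coef n) : kahler k (v - w) = kahler k v - kahler k w := by
  simp [kahler]

lemma kahler_smul (k : Expo n) (a : ℂ) (w : Coef n) : kahler k (a • w) = a • kahler k w := by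
  simp only [kahler, ← map_smul, Finsupp.smul_single]

/-- The bracket of derivations:
`[t^r ∑ u_a d_a, t^s ∑ v_b d_b] = t^(r+s) ((u·s) ∑ v_b d_b - (v·r) ∑ u_a d_a)`. -/
def derBracket (n : ℕ) : (Expo n →₀ Coef n) →ₗ[ℂ] (Expo n →₀ Coef n) →ₗ[ℂ] (Expo n →₀ Coef n) :=
  gradedBilin fun r s => LinearMap.mk₂ ℂ
    (fun u v => u.dot s.toCoef • v - v.dot r.toCoef • u)
    (fun _ _ _ => by simp; module) (fun _ _ _ => by simp; module)
    (fun _ _ _ => by simp; module) (fun _ _ _ => by simp; module)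

/-- The action of derivations on `ΩA`:
`t^r ∑ u_a d_a . t^s ∑ w_b K_b = t^(r+s) ((u·s) ∑ w_b K_b + (u·w) ∑ r_p K_p)`. -/
def derOmega (n : ℕ) : (Expo n →₀ Coef n) →ₗ[ℂ] (Expo n →₀ Coef n) →ₗ[ℂ] (Expo n →₀ Coef n) :=
  gradedBilin fun r s => LinearMap.mk₂ ℂ
    (fun u w => u.dot s.toCoef • w + u.dot w • r.toCoef)
    (fun _ _ _ => by simp; module) (fun _ _ _ => by simp; module)
    (fun _ _ _ => by simp; module) (fun _ _ _ => by simp; module)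

lemma derOmega_exact (d w : Expo n →₀ Coef n) (hw : w ∈ exactForms n) :
    derOmega n d w ∈ exactForms n := by
  induction hw using Submodule.span_induction with
  | mem w hw =>
    obtain ⟨k, rfl⟩ := hw
    induction d using Finsupp.induction_linear with
    | zero => simp
    | add d e hd he => simpa using add_mem hd he
    | single r u =>
      have : derOmega n (Finsupp.single r u) (Finsupp.single k k.toCoef) =
          u.dot k.toCoef • Finsupp.single (r + k) (r + k).toCoef := by
        simp [derOmega, add_comm]
      rw [this]
      exact Submodule.smul_mem _ _ (Submodule.subset_span ⟨_, rfl⟩)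
  | zero => simp
  | add x y _ _ hx hy => simpa using add_mem hx hy
  | smul a x _ hx => simpa using Submodule.smul_mem _ a hx

/-- The induced action of derivations on `Z = ΩA / dA`. -/
def derCenter (n : ℕ) : (Expo n →₀ Coef n) →ₗ[ℂ] CenterSpace n →ₗ[ℂ] CenterSpace n :=
  ((exactForms n).liftQ ((derOmega n).flip.compr₂ (exactForms n).mkQ) (by
    intro w hw
    refine LinearMap.ext fun d => ?_
    simpa using derOmega_exact d w hw)).flip

/-- The cocycle `μ φ₁ + ν φ₂` on derivations with values in `Z`. -/
def derCocycle (n : ℕ) (μ ν : ℂ) :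
    (Expo n →₀ Coef n) →ₗ[ℂ] (Expo n →₀ Coef n) →ₗ[ℂ] CenterSpace n :=
  (gradedBilin fun r s => LinearMap.mk₂ ℂ
    (fun u v => (-(μ * (u.dot s.toCoef * v.dot r.toCoef))
      + ν * (u.dot r.toCoef * v.dot s.toCoef)) • r.toCoef)
    (fun _ _ _ => by simp; module) (fun _ _ _ => by simp; module)
    (fun _ _ _ => by simp; module) (fun _ _ _ => by simp; module)).compr₂ (exactForms n).mkQ

variable {g : Type*} [LieRing g] [LieAlgebra ℂ g]

/-- The pointwise bracket of `g ⊗ A`: `[X(k), Y(l)] = [X, Y](k + l)`. -/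
def loopBracket (n : ℕ) (g : Type*) [LieRing g] [LieAlgebra ℂ g] :
    (Expo n →₀ g) →ₗ[ℂ] (Expo n →₀ g) →ₗ[ℂ] (Expo n →₀ g) :=
  gradedBilin fun _ _ => (LieModule.toEnd ℂ g g : g →ₗ[ℂ] Module.End ℂ g)

/-- The central term `(X, Y) ∑ kᵢ t^(k+l) Kᵢ` for the form `(X, Y) = c κ(X, Y)`. -/
def loopCocycle (n : ℕ) (g : Type*) [LieRing g] [LieAlgebra ℂ g] (c : ℂ) :
    (Expo n →₀ g) →ₗ[ℂ] (Expo n →₀ g) →ₗ[ℂ] CenterSpace n :=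
  (gradedBilin fun k _ => LinearMap.mk₂ ℂ
    (fun X Y => (c * killingForm ℂ g X Y) • k.toCoef)
    (fun _ _ _ => by simp; module) (fun _ _ _ => by simp; module)
    (fun _ _ _ => by simp; module) (fun _ _ _ => by simp; module)).compr₂ (exactForms n).mkQ

/-- The action of derivations on `g ⊗ A`: `t^r ∑ u_a d_a . X(k) = (u·k) X(k + r)`. -/
def derLoop (n : ℕ) (g : Type*) [LieRing g] [LieAlgebra ℂ g] :
    (Expo n →₀ Coef n) →ₗ[ℂ] (Expo n →₀ g) →ₗ[ℂ] (Expo n →₀ g) :=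
  gradedBilin fun _ k => LinearMap.mk₂ ℂ (fun u X => u.dot k.toCoef • X)
    (fun _ _ _ => by simp; module) (fun _ _ _ => by simp; module)
    (fun _ _ _ => by simp) (fun _ _ _ => by module)

@[simp] lemma derBracket_single (r s : Expo n) (u v : Coef n) :
    derBracket n (Finsupp.single r u) (Finsupp.single s v) =
      Finsupp.single (r + s) (u.dot s.toCoef • v - v.dot r.toCoef • u) := by
  simp [derBracket]

@[simp] lemma derCenter_kahler (r s : Expo n) (u w : Coef n) :
    derCenter n (Finsupp.single r u) (kahler s w) =
      kahler (r + s) (u.dot s.toCoef • w + u.dot w • r.toCoef) := by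
  simp [derCenter, kahler, derOmega]

@[simp] lemma derCocycle_single (μ ν : ℂ) (r s : Expo n) (u v : Coef n) :
    derCocycle n μ ν (Finsupp.single r u) (Finsupp.single s v) =
      kahler (r + s) ((-(μ * (u.dot s.toCoef * v.dot r.toCoef))
        + ν * (u.dot r.toCoef * v.dot s.toCoef)) • r.toCoef) := by
  simp [derCocycle, kahler]

@[simp] lemma loopBracket_single (k l : Expo n) (X Y : g) :
    loopBracket n g (Finsupp.single k X) (Finsupp.single l Y) =
      Finsupp.single (k + l) ⁅X, Y⁆ := by
  simp [loopBracket]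

@[simp] lemma loopCocycle_single (c : ℂ) (k l : Expo n) (X Y : g) :
    loopCocycle n g c (Finsupp.single k X) (Finsupp.single l Y) =
      kahler (k + l) ((c * killingForm ℂ g X Y) • k.toCoef) := by
  simp [loopCocycle, kahler]

@[simp] lemma derLoop_single (r k : Expo n) (u : Coef n) (X : g) :
    derLoop n g (Finsupp.single r u) (Finsupp.single k X) =
      Finsupp.single (r + k) (u.dot k.toCoef • X) := by
  simp [derLoop]

lemma kahler_induction {p : CenterSpace n → Prop} (z : CenterSpace n) (h0 : p 0)
    (hadd : ∀ x y, p x → p y → p (x + y)) (hs : ∀ k w, p (kahler k w)) : p z := by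
  obtain ⟨w, rfl⟩ := (exactForms n).mkQ_surjective z
  induction w using Finsupp.induction_linear with
  | zero => simpa using h0
  | add x y hx hy => simpa using hadd _ _ hx hy
  | single k w => exact hs k w

lemma derBracket_antisymm (d e : Expo n →₀ Coef n) : derBracket n d e = -derBracket n e d := by
  induction d using Finsupp.induction_linear with
  | zero => simp
  | add d d' h h' => simp only [map_add, LinearMap.add_apply, h, h']; abel
  | single r u =>
    induction e using Finsupp.induction_linear with
    | zero => simp
    | add d d' h h' => simp only [map_add, LinearMap.add_apply, h, h']; abel
    | single s v => simp [add_comm s r, ← Finsupp.single_neg, -Finsupp.single_sub]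

lemma loopBracket_antisymm (x y : Expo n →₀ g) : loopBracket n g x y = -loopBracket n g y x := by
  induction x using Finsupp.induction_linear with
  | zero => simp
  | add d d' h h' => simp only [map_add, LinearMap.add_apply, h, h']; abel
  | single r u =>
    induction y using Finsupp.induction_linear with
    | zero => simp
    | add d d' h h' => simp only [map_add, LinearMap.add_apply, h, h']; abel
    | single s v => simp [add_comm s r, ← Finsupp.single_neg]

lemma kahler_eq_of_sub {k : Expo n} {v w : Coef n} (a : ℂ) (h : v = w + a • k.toCoef) :
    kahler k v = kahler k w := by
  rw [h, kahler_add, kahler_smul, kahler_self]; simp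

lemma loopCocycle_antisymm (c : ℂ) (x y : Expo n →₀ g) :
    loopCocycle n g c x y = -loopCocycle n g c y x := by
  induction x using Finsupp.induction_linear with
  | zero => simp
  | add d d' h h' => simp only [map_add, LinearMap.add_apply, h, h']; abel
  | single r u =>
    induction y using Finsupp.induction_linear with
    | zero => simp
    | add d d' h h' => simp only [map_add, LinearMap.add_apply, h, h']; abel
    | single s v =>
      rw [loopCocycle_single, loopCocycle_single, add_comm s r, ← neg_one_smul ℂ (kahler _ _),
        ← kahler_smul]
      refine kahler_eq_of_sub (c * killingForm ℂ g u v) ?_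
      rw [LieModule.traceForm_comm ℂ g g v u, Expo.toCoef_add]
      module

lemma derCocycle_antisymm (μ ν : ℂ) (x y : Expo n →₀ Coef n) :
    derCocycle n μ ν x y = -derCocycle n μ ν y x := by
  induction x using Finsupp.induction_linear with
  | zero => simp
  | add d d' h h' => simp only [map_add, LinearMap.add_apply, h, h']; abel
  | single r u =>
    induction y using Finsupp.induction_linear with
    | zero => simp
    | add d d' h h' => simp only [map_add, LinearMap.add_apply, h, h']; abel
    | single s v =>
      rw [derCocycle_single, derCocycle_single, add_comm s r, ← neg_one_smul ℂ (kahler _ _),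
        ← kahler_smul]
      refine kahler_eq_of_sub (-(μ * (u.dot s.toCoef * v.dot r.toCoef))
        + ν * (u.dot r.toCoef * v.dot s.toCoef)) ?_
      rw [Expo.toCoef_add]
      module

lemma derBracket_jacobi (d e f : Expo n →₀ Coef n) :
    derBracket n d (derBracket n e f) =
      derBracket n (derBracket n d e) f + derBracket n e (derBracket n d f) := by
  induction d using Finsupp.induction_linear with
  | zero => simp
  | add d d' h h' => simp only [map_add, LinearMap.add_apply, h, h']; abel
  | single r u =>
    induction e using Finsupp.induction_linear with
    | zero => simp
    | add d d' h h' => simp only [map_add, LinearMap.add_apply, h, h']; abel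
    | single s v =>
      induction f using Finsupp.induction_linear with
      | zero => simp
      | add d d' h h' => simp only [map_add, LinearMap.add_apply, h, h']; abel
      | single p w =>
        simp only [derBracket_single]
        rw [show r + s + p = r + (s + p) by abel, show s + (r + p) = r + (s + p) by abel,
          ← Finsupp.single_add]
        congr 1
        simp only [Expo.toCoef_add, Coef.sub_dot, Coef.dot_add, Coef.smul_dot]
        module

lemma derLoop_derBracket (d e : Expo n →₀ Coef n) (x : Expo n →₀ g) :
    derLoop n g (derBracket n d e) x =
      derLoop n g d (derLoop n g e x) - derLoop n g e (derLoop n g d x) := by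
  induction d using Finsupp.induction_linear with
  | zero => simp
  | add d d' h h' => simp only [map_add, LinearMap.add_apply, h, h']; abel
  | single r u =>
    induction e using Finsupp.induction_linear with
    | zero => simp
    | add d d' h h' => simp only [map_add, LinearMap.add_apply, h, h']; abel
    | single s v =>
      induction x using Finsupp.induction_linear with
      | zero => simp
      | add d d' h h' => simp only [map_add, LinearMap.add_apply, h, h']; abel
      | single p w =>
        simp only [derBracket_single, derLoop_single]
        rw [show r + s + p = r + (s + p) by abel, show s + (r + p) = r + (s + p) by abel,
          ← Finsupp.single_sub]
        congr 1
        simp only [Expo.toCoef_add, Coef.sub_dot, Coef.dot_add, Coef.smul_dot]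
        module

lemma derLoop_loopBracket (d : Expo n →₀ Coef n) (x y : Expo n →₀ g) :
    derLoop n g d (loopBracket n g x y) =
      loopBracket n g (derLoop n g d x) y + loopBracket n g x (derLoop n g d y) := by
  induction d using Finsupp.induction_linear with
  | zero => simp
  | add d d' h h' => simp only [map_add, LinearMap.add_apply, h, h']; abel
  | single r u =>
    induction x using Finsupp.induction_linear with
    | zero => simp
    | add d d' h h' => simp only [map_add, LinearMap.add_apply, h, h']; abel
    | single k X =>
      induction y using Finsupp.induction_linear with
      | zero => simp
      | add d d' h h' => simp only [map_add, LinearMap.add_apply, h, h']; abel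
      | single l Y =>
        simp only [loopBracket_single, derLoop_single]
        rw [show r + k + l = r + (k + l) by abel, show k + (r + l) = r + (k + l) by abel,
          ← Finsupp.single_add]
        congr 1
        simp only [Expo.toCoef_add, Coef.dot_add, smul_lie, lie_smul]
        module

lemma loopBracket_jacobi (x y z : Expo n →₀ g) :
    loopBracket n g x (loopBracket n g y z) =
      loopBracket n g (loopBracket n g x y) z + loopBracket n g y (loopBracket n g x z) := by
  induction x using Finsupp.induction_linear with
  | zero => simp
  | add d d' h h' => simp only [map_add, LinearMap.add_apply, h, h']; abel
  | single r u =>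
    induction y using Finsupp.induction_linear with
    | zero => simp
    | add d d' h h' => simp only [map_add, LinearMap.add_apply, h, h']; abel
    | single k X =>
      induction z using Finsupp.induction_linear with
      | zero => simp
      | add d d' h h' => simp only [map_add, LinearMap.add_apply, h, h']; abel
      | single l Y =>
        simp only [loopBracket_single]
        rw [show r + k + l = r + (k + l) by abel, show k + (r + l) = r + (k + l) by abel,
          ← Finsupp.single_add, leibniz_lie]

lemma loopCocycle_jacobi (c : ℂ) (x y z : Expo n →₀ g) :
    loopCocycle n g c x (loopBracket n g y z) =
      loopCocycle n g c (loopBracket n g x y) z + loopCocycle n g c y (loopBracket n g x z) := by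
  induction x using Finsupp.induction_linear with
  | zero => simp
  | add d d' h h' => simp only [map_add, LinearMap.add_apply, h, h']; abel
  | single r X =>
    induction y using Finsupp.induction_linear with
    | zero => simp
    | add d d' h h' => simp only [map_add, LinearMap.add_apply, h, h']; abel
    | single k Y =>
      induction z using Finsupp.induction_linear with
      | zero => simp
      | add d d' h h' => simp only [map_add, LinearMap.add_apply, h, h']; abel
      | single l W =>
        simp only [loopBracket_single, loopCocycle_single]
        rw [show r + k + l = r + (k + l) by abel, show k + (r + l) = r + (k + l) by abel,
          ← kahler_add]
        congr 1
        have h1 : killingForm ℂ g ⁅X, Y⁆ W = killingForm ℂ g X ⁅Y, W⁆ :=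
          LieModule.traceForm_apply_lie_apply ℂ g g X Y W
        have h2 : killingForm ℂ g Y ⁅X, W⁆ = -killingForm ℂ g X ⁅Y, W⁆ := by
          rw [← h1, ← lie_skew X Y, map_neg, LinearMap.neg_apply, neg_neg]
          exact (LieModule.traceForm_apply_lie_apply ℂ g g Y X W).symm
        rw [h1, h2, Expo.toCoef_add]
        module

lemma derCenter_loopCocycle (c : ℂ) (d : Expo n →₀ Coef n) (x y : Expo n →₀ g) :
    derCenter n d (loopCocycle n g c x y) =
      loopCocycle n g c (derLoop n g d x) y + loopCocycle n g c x (derLoop n g d y) := by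
  induction d using Finsupp.induction_linear with
  | zero => simp
  | add d d' h h' => simp only [map_add, LinearMap.add_apply, h, h']; abel
  | single r u =>
    induction x using Finsupp.induction_linear with
    | zero => simp
    | add d d' h h' => simp only [map_add, LinearMap.add_apply, h, h']; abel
    | single k X =>
      induction y using Finsupp.induction_linear with
      | zero => simp
      | add d d' h h' => simp only [map_add, LinearMap.add_apply, h, h']; abel
      | single l Y =>
        simp only [loopCocycle_single, derLoop_single, derCenter_kahler]
        rw [show r + k + l = r + (k + l) by abel, show k + (r + l) = r + (k + l) by abel,
          ← kahler_add]
        congr 1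
        simp only [Expo.toCoef_add, Coef.dot_add, Coef.dot_smul, map_smul, LinearMap.smul_apply,
          smul_eq_mul]
        module

lemma derCenter_derBracket (d e : Expo n →₀ Coef n) (z : CenterSpace n) :
    derCenter n (derBracket n d e) z =
      derCenter n d (derCenter n e z) - derCenter n e (derCenter n d z) := by
  induction d using Finsupp.induction_linear with
  | zero => simp
  | add d d' h h' => simp only [map_add, LinearMap.add_apply, h, h']; abel
  | single r u =>
    induction e using Finsupp.induction_linear with
    | zero => simp
    | add d d' h h' => simp only [map_add, LinearMap.add_apply, h, h']; abel
    | single s v =>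
      induction z using kahler_induction with
      | h0 => simp
      | hadd d d' h h' => simp only [map_add, h, h']; abel
      | hs p w =>
        simp only [derBracket_single, derCenter_kahler]
        rw [show r + s + p = r + (s + p) by abel, show s + (r + p) = r + (s + p) by abel,
          ← kahler_sub]
        congr 1
        simp only [Expo.toCoef_add, Coef.sub_dot, Coef.dot_add, Coef.smul_dot, Coef.dot_smul]
        module

lemma derCocycle_jacobi (μ ν : ℂ) (d e f : Expo n →₀ Coef n) :
    derCenter n d (derCocycle n μ ν e f) + derCocycle n μ ν d (derBracket n e f) =
      (derCocycle n μ ν (derBracket n d e) f - derCenter n f (derCocycle n μ ν d e)) +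
      (derCenter n e (derCocycle n μ ν d f) + derCocycle n μ ν e (derBracket n d f)) := by
  induction d using Finsupp.induction_linear with
  | zero => simp
  | add d d' h h' =>
    simp only [map_add, LinearMap.add_apply]
    linear_combination (norm := module) h + h'
  | single r u =>
    induction e using Finsupp.induction_linear with
    | zero => simp
    | add d d' h h' =>
      simp only [map_add, LinearMap.add_apply]
      linear_combination (norm := module) h + h'
    | single s v =>
      induction f using Finsupp.induction_linear with
      | zero => simp
      | add d d' h h' =>
        simp only [map_add, LinearMap.add_apply]
        linear_combination (norm := module) h + h'
      | single p w =>
        simp only [derBracket_single, derCocycle_single, derCenter_kahler]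
        rw [show r + s + p = r + (s + p) by abel, show s + (r + p) = r + (s + p) by abel,
          show p + (r + s) = r + (s + p) by abel,
          ← kahler_sub, ← kahler_add, ← kahler_add, ← kahler_add]
        refine kahler_eq_of_sub ((-(μ * (u.dot s.toCoef * v.dot r.toCoef))
          + ν * (u.dot r.toCoef * v.dot s.toCoef)) * w.dot r.toCoef) ?_
        simp only [Expo.toCoef_add, Coef.sub_dot, Coef.dot_add, Coef.smul_dot, Coef.dot_smul]
        module

end Algebra

/-! ### The full toroidal Lie algebra -/

/-- The full toroidal Lie algebra `g ⊗ A ⊕ ΩA/dA ⊕ Der A`, where `A` is the algebra of Laurent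
polynomials in `t₀, …, tₙ`, for the invariant form `c κ` (`κ` the Killing form) and the cocycle
`μ φ₁ + ν φ₂`. -/
@[nolint unusedArguments]
def FullToroidal (n : ℕ) (g : Type*) [LieRing g] [LieAlgebra ℂ g] (_c _μ _ν : ℂ) : Type _ :=
  (Expo n →₀ g) × CenterSpace n × (Expo n →₀ Coef n)

namespace FullToroidal

variable {n : ℕ} {g : Type*} [LieRing g] [LieAlgebra ℂ g] {c μ ν : ℂ}

instance : AddCommGroup (FullToroidal n g c μ ν) :=
  inferInstanceAs (AddCommGroup ((Expo n →₀ g) × CenterSpace n × (Expo n →₀ Coef n)))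

instance : Module ℂ (FullToroidal n g c μ ν) :=
  inferInstanceAs (Module ℂ ((Expo n →₀ g) × CenterSpace n × (Expo n →₀ Coef n)))

/-- The component in `g ⊗ A`. -/
def loopPart : FullToroidal n g c μ ν →ₗ[ℂ] (Expo n →₀ g) :=
  LinearMap.fst ℂ (Expo n →₀ g) (CenterSpace n × (Expo n →₀ Coef n))

/-- The component in `ΩA / dA`. -/
def centerPart : FullToroidal n g c μ ν →ₗ[ℂ] CenterSpace n :=
  LinearMap.fst ℂ (CenterSpace n) (Expo n →₀ Coef n) ∘ₗ
    LinearMap.snd ℂ (Expo n →₀ g) (CenterSpace n × (Expo n →₀ Coef n))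

/-- The component in `Der A`. -/
def derPart : FullToroidal n g c μ ν →ₗ[ℂ] (Expo n →₀ Coef n) :=
  LinearMap.snd ℂ (CenterSpace n) (Expo n →₀ Coef n) ∘ₗ
    LinearMap.snd ℂ (Expo n →₀ g) (CenterSpace n × (Expo n →₀ Coef n))

/-- The element with prescribed components. -/
def mk (x : Expo n →₀ g) (z : CenterSpace n) (d : Expo n →₀ Coef n) : FullToroidal n g c μ ν :=
  (x, z, d)

@[simp] lemma loopPart_mk (x : Expo n →₀ g) (z : CenterSpace n) (d : Expo n →₀ Coef n) :
    loopPart (mk x z d : FullToroidal n g c μ ν) = x := rfl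

@[simp] lemma centerPart_mk (x : Expo n →₀ g) (z : CenterSpace n) (d : Expo n →₀ Coef n) :
    centerPart (mk x z d : FullToroidal n g c μ ν) = z := rfl

@[simp] lemma derPart_mk (x : Expo n →₀ g) (z : CenterSpace n) (d : Expo n →₀ Coef n) :
    derPart (mk x z d : FullToroidal n g c μ ν) = d := rfl

lemma ext' {x y : FullToroidal n g c μ ν} (h1 : loopPart x = loopPart y)
    (h2 : centerPart x = centerPart y) (h3 : derPart x = derPart y) : x = y :=
  Prod.ext h1 (Prod.ext h2 h3)

instance : Bracket (FullToroidal n g c μ ν) (FullToroidal n g c μ ν) where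
  bracket x y := mk
    (loopBracket n g (loopPart x) (loopPart y) + derLoop n g (derPart x) (loopPart y)
      - derLoop n g (derPart y) (loopPart x))
    (loopCocycle n g c (loopPart x) (loopPart y) + derCenter n (derPart x) (centerPart y)
      - derCenter n (derPart y) (centerPart x) + derCocycle n μ ν (derPart x) (derPart y))
    (derBracket n (derPart x) (derPart y))

@[simp] lemma loopPart_lie (x y : FullToroidal n g c μ ν) : loopPart ⁅x, y⁆ =
    loopBracket n g (loopPart x) (loopPart y) + derLoop n g (derPart x) (loopPart y)
      - derLoop n g (derPart y) (loopPart x) := rfl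

@[simp] lemma centerPart_lie (x y : FullToroidal n g c μ ν) : centerPart ⁅x, y⁆ =
    loopCocycle n g c (loopPart x) (loopPart y) + derCenter n (derPart x) (centerPart y)
      - derCenter n (derPart y) (centerPart x) + derCocycle n μ ν (derPart x) (derPart y) := rfl

@[simp] lemma derPart_lie (x y : FullToroidal n g c μ ν) :
    derPart ⁅x, y⁆ = derBracket n (derPart x) (derPart y) := rfl

lemma self_eq_zero_of_antisymm {M : Type*} [AddCommGroup M] [Module ℂ M] {a : M} (h : a = -a) :
    a = 0 := by
  have h2 : (2 : ℂ) • a = 0 := by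
    rw [two_smul]
    exact add_eq_zero_iff_eq_neg.mpr h
  exact (smul_eq_zero.mp h2).resolve_left two_ne_zero

instance : LieRing (FullToroidal n g c μ ν) where
  add_lie x y z := by
    apply ext' <;> simp only [loopPart_lie, centerPart_lie, derPart_lie, map_add,
      LinearMap.add_apply] <;> abel
  lie_add x y z := by
    apply ext' <;> simp only [loopPart_lie, centerPart_lie, derPart_lie, map_add,
      LinearMap.add_apply] <;> abel
  lie_self x := by
    apply ext'
    · simp [self_eq_zero_of_antisymm (loopBracket_antisymm (loopPart x) (loopPart x))]
    · simp [self_eq_zero_of_antisymm (loopCocycle_antisymm c (loopPart x) (loopPart x)),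
        self_eq_zero_of_antisymm (derCocycle_antisymm μ ν (derPart x) (derPart x))]
    · simp [self_eq_zero_of_antisymm (derBracket_antisymm (derPart x) (derPart x))]
  leibniz_lie x y z := by
    apply ext'
    · simp only [loopPart_lie, derPart_lie, map_add, map_sub, LinearMap.add_apply,
        LinearMap.sub_apply, derLoop_derBracket, derLoop_loopBracket]
      rw [loopBracket_jacobi, loopBracket_antisymm (loopPart y) (derLoop n g _ (loopPart x)),
        loopBracket_antisymm (derLoop n g (derPart z) _) (loopPart y)]
      abel
    · simp only [loopPart_lie, centerPart_lie, derPart_lie, map_add, map_sub,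
        LinearMap.add_apply, LinearMap.sub_apply, derCenter_derBracket, derCenter_loopCocycle]
      have h1 := derCocycle_jacobi μ ν (derPart x) (derPart y) (derPart z)
      have h2 := loopCocycle_jacobi c (loopPart x) (loopPart y) (loopPart z)
      have h3 := loopCocycle_antisymm c (loopPart y) (derLoop n g (derPart z) (loopPart x))
      linear_combination (norm := module) h1 + h2 + h3
    · exact derBracket_jacobi _ _ _

instance : LieAlgebra ℂ (FullToroidal n g c μ ν) where
  lie_smul a x y := by
    apply ext' <;> simp only [loopPart_lie, centerPart_lie, derPart_lie, map_smul,
      LinearMap.smul_apply] <;> module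

/-- `X(k) = X ⊗ t^k`. -/
def loopEl (k : Expo n) (X : g) : FullToroidal n g c μ ν := mk (Finsupp.single k X) 0 0

/-- `∑ wᵢ t^k Kᵢ`. -/
def centerEl (k : Expo n) (w : Coef n) : FullToroidal n g c μ ν := mk 0 (kahler k w) 0

/-- `∑ uᵢ t^k dᵢ`. -/
def derEl (k : Expo n) (u : Coef n) : FullToroidal n g c μ ν := mk 0 0 (Finsupp.single k u)

lemma loopEl_smul (k : Expo n) (a : ℂ) (X : g) :
    (loopEl k (a • X) : FullToroidal n g c μ ν) = a • loopEl k X := by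
  apply ext' <;> simp [loopEl]

lemma lie_loopEl_loopEl (k l : Expo n) (X Y : g) :
    ⁅(loopEl k X : FullToroidal n g c μ ν), (loopEl l Y : FullToroidal n g c μ ν)⁆ =
      loopEl (k + l) ⁅X, Y⁆ + centerEl (k + l) ((c * killingForm ℂ g X Y) • k.toCoef) := by
  apply ext' <;> simp [loopEl, centerEl]

lemma lie_derEl_loopEl (r k : Expo n) (u : Coef n) (X : g) :
    ⁅(derEl r u : FullToroidal n g c μ ν), (loopEl k X : FullToroidal n g c μ ν)⁆ =
      loopEl (r + k) (u.dot k.toCoef • X) := by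
  apply ext' <;> simp [loopEl, derEl]

lemma lie_derEl_centerEl (r s : Expo n) (u w : Coef n) :
    ⁅(derEl r u : FullToroidal n g c μ ν), (centerEl s w : FullToroidal n g c μ ν)⁆ =
      centerEl (r + s) (u.dot s.toCoef • w + u.dot w • r.toCoef) := by
  apply ext' <;> simp [centerEl, derEl]

lemma lie_derEl_derEl (r s : Expo n) (u v : Coef n) :
    ⁅(derEl r u : FullToroidal n g c μ ν), (derEl s v : FullToroidal n g c μ ν)⁆ =
      derEl (r + s) (u.dot s.toCoef • v - v.dot r.toCoef • u) +
      centerEl (r + s) ((-(μ * (u.dot s.toCoef * v.dot r.toCoef))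
        + ν * (u.dot r.toCoef * v.dot s.toCoef)) • r.toCoef) := by
  apply ext' <;> simp [centerEl, derEl, -Finsupp.single_sub]

lemma lie_loopEl_centerEl (k s : Expo n) (X : g) (w : Coef n) :
    ⁅(loopEl k X : FullToroidal n g c μ ν), (centerEl s w : FullToroidal n g c μ ν)⁆ = 0 := by
  apply ext' <;> simp [centerEl, loopEl]

lemma lie_centerEl_centerEl (r s : Expo n) (u w : Coef n) :
    ⁅(centerEl r u : FullToroidal n g c μ ν), (centerEl s w : FullToroidal n g c μ ν)⁆ = 0 := by
  apply ext' <;> simp [centerEl]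

/-- The span of all `X ⊗ t^k` with `X ∈ S k`, and all `t^s Kᵢ`, `t^s dᵢ` with `s ∈ E`. -/
def genSpan (S : Expo n → Set g) (E : Set (Expo n)) : Submodule ℂ (FullToroidal n g c μ ν) :=
  Submodule.span ℂ
    ({x | ∃ k, ∃ X ∈ S k, x = loopEl k X} ∪ {x | ∃ s ∈ E, ∃ w, x = centerEl s w} ∪
      {x | ∃ s ∈ E, ∃ u, x = derEl s u})

lemma loopEl_mem_genSpan {S : Expo n → Set g} {E : Set (Expo n)} {k : Expo n} {X : g}
    (h : X ∈ S k) : (loopEl k X : FullToroidal n g c μ ν) ∈ genSpan S E :=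
  Submodule.subset_span (Or.inl (Or.inl ⟨k, X, h, rfl⟩))

lemma centerEl_mem_genSpan {S : Expo n → Set g} {E : Set (Expo n)} {s : Expo n} (h : s ∈ E)
    (w : Coef n) : (centerEl s w : FullToroidal n g c μ ν) ∈ genSpan S E :=
  Submodule.subset_span (Or.inl (Or.inr ⟨s, h, w, rfl⟩))

lemma derEl_mem_genSpan {S : Expo n → Set g} {E : Set (Expo n)} {s : Expo n} (h : s ∈ E)
    (u : Coef n) : (derEl s u : FullToroidal n g c μ ν) ∈ genSpan S E :=
  Submodule.subset_span (Or.inr ⟨s, h, u, rfl⟩)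

lemma lie_mem_genSpan {S S' S'' : Expo n → Set g} {E E' E'' : Set (Expo n)}
    (h1 : ∀ k l, ∀ X ∈ S k, ∀ Y ∈ S' l, ⁅X, Y⁆ ∈ S'' (k + l))
    (h2 : ∀ k l, ∀ X ∈ S k, ∀ Y ∈ S' l, killingForm ℂ g X Y ≠ 0 → k + l ∈ E'')
    (h3 : ∀ s ∈ E, ∀ l, ∀ Y ∈ S' l, Y ∈ S'' (s + l))
    (h4 : ∀ s ∈ E', ∀ k, ∀ X ∈ S k, X ∈ S'' (s + k))
    (h5 : ∀ s ∈ E, ∀ s' ∈ E', s + s' ∈ E'')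
    {x y : FullToroidal n g c μ ν} (hx : x ∈ genSpan S E) (hy : y ∈ genSpan S' E') :
    ⁅x, y⁆ ∈ (genSpan S'' E'' : Submodule ℂ (FullToroidal n g c μ ν)) := by
  induction hx using Submodule.span_induction with
  | zero => simp
  | add x x' _ _ hx hx' => simpa using add_mem hx hx'
  | smul a x _ hx => simpa using Submodule.smul_mem _ a hx
  | mem x hx =>
    induction hy using Submodule.span_induction with
    | zero => simp
    | add x x' _ _ hx hx' => simpa using add_mem hx hx'
    | smul a x _ hx => simpa using Submodule.smul_mem _ a hx
    | mem y hy =>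
      rcases hx with (⟨k, X, hX, rfl⟩ | ⟨s, hs, w, rfl⟩) | ⟨s, hs, u, rfl⟩ <;>
      rcases hy with (⟨k', X', hX', rfl⟩ | ⟨s', hs', w', rfl⟩) | ⟨s', hs', u', rfl⟩
      · rw [lie_loopEl_loopEl]
        refine add_mem (loopEl_mem_genSpan (h1 _ _ _ hX _ hX')) ?_
        by_cases h : killingForm ℂ g X X' = 0
        · have : (centerEl (k + k') ((c * killingForm ℂ g X X') • k.toCoef) :
              FullToroidal n g c μ ν) = 0 := by
            apply ext' <;> simp [centerEl, h, kahler]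
          rw [this]
          exact zero_mem _
        · exact centerEl_mem_genSpan (h2 _ _ _ hX _ hX' h) _
      · rw [lie_loopEl_centerEl]; exact zero_mem _
      · rw [← lie_skew, lie_derEl_loopEl, loopEl_smul]
        exact neg_mem (Submodule.smul_mem _ _ (loopEl_mem_genSpan (h4 _ hs' _ _ hX)))
      · rw [← lie_skew, lie_loopEl_centerEl, neg_zero]; exact zero_mem _
      · rw [lie_centerEl_centerEl]; exact zero_mem _
      · rw [← lie_skew, lie_derEl_centerEl, add_comm s' s]
        exact neg_mem (centerEl_mem_genSpan (h5 _ hs _ hs') _)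
      · rw [lie_derEl_loopEl, loopEl_smul]
        exact Submodule.smul_mem _ _ (loopEl_mem_genSpan (h3 _ hs _ _ hX'))
      · rw [lie_derEl_centerEl]
        exact centerEl_mem_genSpan (h5 _ hs _ hs') _
      · rw [lie_derEl_derEl]
        exact add_mem (derEl_mem_genSpan (h5 _ hs _ hs') _) (centerEl_mem_genSpan (h5 _ hs _ hs') _)

end FullToroidal

/-! ### Twisting -/

/-- The data of the twisted full toroidal Lie algebra: commuting automorphisms `σᵢ` of `g` of finite
orders `mᵢ`, primitive `mᵢ`-th roots of unity `ξᵢ`, an invariant form `c κ` on `g` that is a positive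
multiple of the Killing form `κ`, and the coefficients of the cocycle `μ φ₁ + ν φ₂`. -/
structure TwistData (n : ℕ) (g : Type*) [LieRing g] [LieAlgebra ℂ g] where
  /-- the orders -/
  m : Fin (n + 1) → ℕ
  m_pos : ∀ i, 0 < m i
  /-- the automorphisms -/
  σ : Fin (n + 1) → g ≃ₗ⁅ℂ⁆ g
  σ_comm : ∀ i j x, σ i (σ j x) = σ j (σ i x)
  σ_order : ∀ i k, (∀ x, (σ i)^[k] x = x) ↔ m i ∣ k
  /-- the roots of unity -/
  ξ : Fin (n + 1) → ℂ
  ξ_prim : ∀ i, IsPrimitiveRoot (ξ i) (m i)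
  /-- the scale of the invariant form -/
  c : ℝ
  c_pos : 0 < c
  /-- coefficient of the first cocycle -/
  μ : ℂ
  /-- coefficient of the second cocycle -/
  ν : ℂ

namespace TwistData

variable {n : ℕ} {g : Type*} [LieRing g] [LieAlgebra ℂ g] (D : TwistData n g)

lemma ξ_ne_zero (i : Fin (n + 1)) : D.ξ i ≠ 0 := (D.ξ_prim i).ne_zero (D.m_pos i).ne'

/-- `g(k̄₀, k̄)`: the simultaneous eigenspace `σᵢ x = ξᵢ^(kᵢ) x`. -/
def grad (k : Expo n) : Submodule ℂ g where
  carrier := {x | ∀ i, D.σ i x = D.ξ i ^ k i • x}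
  add_mem' hx hy i := by rw [map_add, hx i, hy i, smul_add]
  zero_mem' i := by rw [map_zero, smul_zero]
  smul_mem' a x hx i := by simp [hx i, smul_comm a]

/-- `g(0̄, 0̄)`: the subalgebra of common fixed points. -/
def fixed : LieSubalgebra ℂ g where
  carrier := {x | ∀ i, D.σ i x = x}
  add_mem' hx hy i := by simp [hx i, hy i]
  zero_mem' i := by simp
  smul_mem' a x hx i := by simp [hx i]
  lie_mem' {x y} hx hy i := by rw [LieEquiv.map_lie, hx i, hy i]

/-- `Γ₀ ⊕ Γ`. -/
def lattice : AddSubgroup (Expo n) where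
  carrier := {s | ∀ i, (D.m i : ℤ) ∣ s i}
  add_mem' hx hy i := dvd_add (hx i) (hy i)
  zero_mem' _ := dvd_zero _
  neg_mem' hx i := (dvd_neg).mpr (hx i)

lemma mem_grad_add {k s : Expo n} (hs : s ∈ D.lattice) {X : g} (hX : X ∈ D.grad k) :
    X ∈ D.grad (s + k) := by
  intro i
  obtain ⟨a, ha⟩ := hs i
  rw [hX i, Pi.add_apply, zpow_add₀ (D.ξ_ne_zero i), ha, zpow_mul, zpow_natCast,
    (D.ξ_prim i).pow_eq_one, one_zpow, one_mul]

lemma lie_mem_grad {k l : Expo n} {X Y : g} (hX : X ∈ D.grad k) (hY : Y ∈ D.grad l) :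
    ⁅X, Y⁆ ∈ D.grad (k + l) := by
  intro i
  rw [LieEquiv.map_lie, hX i, hY i, Pi.add_apply, zpow_add₀ (D.ξ_ne_zero i), smul_lie, lie_smul,
    smul_smul]

lemma add_mem_lattice {k l : Expo n} {X Y : g} (hX : X ∈ D.grad k) (hY : Y ∈ D.grad l)
    (h : killingForm ℂ g X Y ≠ 0) : k + l ∈ D.lattice := by
  intro i
  have h1 := LieAlgebra.killingForm_of_equiv_apply (R := ℂ) (D.σ i) X Y
  rw [hX i, hY i] at h1
  simp only [map_smul, LinearMap.smul_apply, smul_eq_mul] at h1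
  rw [← mul_assoc, ← zpow_add₀ (D.ξ_ne_zero i)] at h1
  have h2 : D.ξ i ^ (k i + l i) = 1 := by
    rw [add_comm]
    exact mul_right_cancel₀ h (by rw [h1, one_mul])
  exact ((D.ξ_prim i).zpow_eq_one_iff_dvd _).mp h2

/-- The untwisted full toroidal Lie algebra that contains `τ`. -/
abbrev Full : Type _ := FullToroidal n g (D.c : ℂ) D.μ D.ν

/-- The twisted full toroidal Lie algebra `τ = L(g, σ) ⊕ Z(m₀, m) ⊕ D(m₀, m)`, spanned by the
`X ⊗ t^k` with `X ∈ g(k̄₀, k̄)` and by the `t^s Kᵢ`, `t^s dᵢ` with `s ∈ Γ₀ ⊕ Γ`. -/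
def tau : LieSubalgebra ℂ D.Full where
  __ := FullToroidal.genSpan (fun k => (D.grad k : Set g)) (D.lattice : Set (Expo n))
  lie_mem' hx hy := FullToroidal.lie_mem_genSpan
    (fun _ _ _ hX _ hY => D.lie_mem_grad hX hY)
    (fun _ _ _ hX _ hY h => D.add_mem_lattice hX hY h)
    (fun _ hs _ _ hY => D.mem_grad_add hs hY)
    (fun _ hs _ _ hX => D.mem_grad_add hs hX)
    (fun _ hs _ hs' => add_mem hs hs') hx hy

/-- `X(k)` in `τ`. -/
def loopEl (k : Expo n) (X : g) (hX : X ∈ D.grad k) : D.tau :=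
  ⟨FullToroidal.loopEl k X, FullToroidal.loopEl_mem_genSpan hX⟩

/-- `∑ wᵢ t^s Kᵢ` in `τ`. -/
def centerEl (s : Expo n) (hs : s ∈ D.lattice) (w : Coef n) : D.tau :=
  ⟨FullToroidal.centerEl s w, FullToroidal.centerEl_mem_genSpan hs w⟩

/-- `∑ uᵢ t^s dᵢ` in `τ`. -/
def derEl (s : Expo n) (hs : s ∈ D.lattice) (u : Coef n) : D.tau :=
  ⟨FullToroidal.derEl s u, FullToroidal.derEl_mem_genSpan hs u⟩

/-- `Kᵢ`. -/
def K (i : Fin (n + 1)) : D.tau := D.centerEl 0 (zero_mem _) (Pi.single i 1)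

/-- `dᵢ`. -/
def d (i : Fin (n + 1)) : D.tau := D.derEl 0 (zero_mem _) (Pi.single i 1)

lemma fixed_mem_grad (x : D.fixed) : (x : g) ∈ D.grad 0 := by
  intro i
  simpa using x.2 i

variable (h₀ : LieSubalgebra ℂ D.fixed)

/-- `h ∈ h(0)` as an element of `τ`. -/
def cartanEl (h : h₀) : D.tau := D.loopEl 0 ((h : D.fixed) : g) (D.fixed_mem_grad _)

/-- The simultaneous eigenspace in `g` of `h(0)` for `α`. -/
def rootSpace (α : Module.Dual ℂ h₀) : Submodule ℂ g where
  carrier := {x | ∀ h : h₀, ⁅((h : D.fixed) : g), x⁆ = α h • x}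
  add_mem' hx hy h := by simp [hx h, hy h]
  zero_mem' h := by simp
  smul_mem' a x hx h := by simp [hx h, smul_comm a]

/-- `Δ(g, h(0))`, which includes zero. -/
def weightsOfG : Set (Module.Dual ℂ h₀) := {α | D.rootSpace h₀ α ≠ ⊥}

/-- `g(k̄₀, k̄, α)`. -/
def gradRoot (k : Expo n) (α : Module.Dual ℂ h₀) : Submodule ℂ g :=
  D.grad k ⊓ D.rootSpace h₀ α

/-- The sum of those root spaces `τ_(α + k₀ δ₀ + δ_k)` for which `P k₀ α` holds. -/
def rootPart (P : ℤ → Module.Dual ℂ h₀ → Prop) : Submodule ℂ D.tau :=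
  (FullToroidal.genSpan (fun k => {X | ∃ α, P (k 0) α ∧ X ∈ D.gradRoot h₀ k α})
    {s | s ∈ D.lattice ∧ P (s 0) 0} : Submodule ℂ D.Full).comap D.tau.toSubmodule.subtype

variable {h₀} in
lemma lie_mem_rootSpace {α β : Module.Dual ℂ h₀} {X Y : g} (hX : X ∈ D.rootSpace h₀ α)
    (hY : Y ∈ D.rootSpace h₀ β) : ⁅X, Y⁆ ∈ D.rootSpace h₀ (α + β) := by
  intro h
  rw [leibniz_lie, hX h, hY h, smul_lie, lie_smul, LinearMap.add_apply, add_smul]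

variable {h₀} in
lemma add_eq_zero_of_killingForm {α β : Module.Dual ℂ h₀} {X Y : g} (hX : X ∈ D.rootSpace h₀ α)
    (hY : Y ∈ D.rootSpace h₀ β) (h : killingForm ℂ g X Y ≠ 0) : α + β = 0 := by
  ext x
  have h1 : killingForm ℂ g ⁅X, ((x : D.fixed) : g)⁆ Y =
      killingForm ℂ g X ⁅((x : D.fixed) : g), Y⁆ :=
    LieModule.traceForm_apply_lie_apply ℂ g g _ _ _
  rw [← lie_skew, hX x, hY x] at h1
  simp only [map_neg, map_smul, LinearMap.neg_apply, LinearMap.smul_apply, smul_eq_mul] at h1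
  have h2 : (α x + β x) * killingForm ℂ g X Y = 0 := by linear_combination -h1
  simpa using (mul_eq_zero.mp h2).resolve_right h

variable {h₀} in
lemma lie_mem_rootPart {P Q R : ℤ → Module.Dual ℂ h₀ → Prop}
    (hPQ : ∀ a b α β, P a α → Q b β → R (a + b) (α + β)) {x y : D.tau}
    (hx : x ∈ D.rootPart h₀ P) (hy : y ∈ D.rootPart h₀ Q) : ⁅x, y⁆ ∈ D.rootPart h₀ R := by
  refine FullToroidal.lie_mem_genSpan ?_ ?_ ?_ ?_ ?_ hx hy
  · rintro k l X ⟨α, hα, hX⟩ Y ⟨β, hβ, hY⟩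
    exact ⟨α + β, hPQ _ _ _ _ hα hβ, D.lie_mem_grad hX.1 hY.1, D.lie_mem_rootSpace hX.2 hY.2⟩
  · rintro k l X ⟨α, hα, hX⟩ Y ⟨β, hβ, hY⟩ h
    refine ⟨D.add_mem_lattice hX.1 hY.1 h, ?_⟩
    rw [← D.add_eq_zero_of_killingForm hX.2 hY.2 h]
    exact hPQ _ _ _ _ hα hβ
  · rintro s ⟨hs, hP⟩ l Y ⟨β, hβ, hY⟩
    refine ⟨β, ?_, D.mem_grad_add hs hY.1, hY.2⟩
    simpa using hPQ _ _ _ _ hP hβ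
  · rintro s ⟨hs, hQ⟩ k X ⟨α, hα, hX⟩
    refine ⟨α, ?_, D.mem_grad_add hs hX.1, hX.2⟩
    simpa [add_comm] using hPQ _ _ _ _ hα hQ
  · rintro s ⟨hs, hP⟩ s' ⟨hs', hQ⟩
    exact ⟨add_mem hs hs', by simpa using hPQ _ _ _ _ hP hQ⟩

/-! ### Finite root systems and the triangular decomposition -/

section Roots

variable [FiniteDimensional ℂ g] [LieAlgebra.IsSimple ℂ D.fixed] [h₀.IsCartanSubalgebra]

/-- The root system `Δ₀` of the simple Lie algebra `g(0̄, 0̄)` with respect to `h(0)`. -/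
abbrev roots := LieAlgebra.IsKilling.rootSystem h₀

/-- `Δ₀` is of type `B_l` for some `l ≥ 1` (with `B₁ = A₁`). -/
def IsTypeB : Prop :=
  ∃ (b : (D.roots h₀).Base) (l : ℕ) (e : b.support ≃ Fin l),
    b.cartanMatrix.reindex e e = CartanMatrix.B l

/-- `α` is a short root of `Δ₀`: a root of minimal length. -/
def IsShort (i : h₀.root) : Prop :=
  ∀ j, ((D.roots h₀).RootForm ((D.roots h₀).root i) ((D.roots h₀).root i)).re ≤
    ((D.roots h₀).RootForm ((D.roots h₀).root j) ((D.roots h₀).root j)).re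

/-- `Δ_{0,en}`: zero, the roots of `Δ₀` and, in type `B_l`, the doubles of the short roots. -/
def enlargedRoots : Set (Module.Dual ℂ h₀) :=
  {0} ∪ Set.range (D.roots h₀).root ∪
    {α | D.IsTypeB h₀ ∧ ∃ i, D.IsShort h₀ i ∧ α = (2 : ℂ) • (D.roots h₀).root i}

variable {h₀}
variable (b : (D.roots h₀).Base)

/-- Nonnegative integral combinations of the simple roots. -/
def posCone : AddSubmonoid (Module.Dual ℂ h₀) :=
  AddSubmonoid.closure ((D.roots h₀).root '' b.support)

/-- Positivity of `α + k₀ δ₀` with respect to the simple roots `α₁, …, α_p` of `Δ₀` and the affine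
simple root: `k₀ > 0`, or `k₀ = 0` and `α` is a nonzero nonnegative combination of `α₁, …, α_p`. -/
def IsPos (a : ℤ) (α : Module.Dual ℂ h₀) : Prop :=
  0 < a ∨ (a = 0 ∧ α ≠ 0 ∧ α ∈ D.posCone b)

/-- `α + k₀ δ₀` is zero or positive. -/
def IsNonneg (a : ℤ) (α : Module.Dual ℂ h₀) : Prop := (a = 0 ∧ α = 0) ∨ D.IsPos b a α

lemma isNonneg_iff {a : ℤ} {α : Module.Dual ℂ h₀} :
    D.IsNonneg b a α ↔ 0 < a ∨ (a = 0 ∧ α ∈ D.posCone b) := by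
  unfold IsNonneg IsPos
  by_cases h : α = 0
  · have := zero_mem (D.posCone b)
    subst h
    tauto
  · tauto

lemma posCone_eq_zero {α β : Module.Dual ℂ h₀} (hα : α ∈ D.posCone b) (hβ : β ∈ D.posCone b)
    (h : α + β = 0) : β = 0 := by
  have key : ∀ γ ∈ D.posCone b, ∃ f : h₀.root →₀ ℂ, f ∈ Finsupp.supported ℂ ℂ (b.support : Set _) ∧
      (∀ i, ∃ m : ℕ, f i = m) ∧ Finsupp.linearCombination ℂ (D.roots h₀).root f = γ := by
    intro γ hγ
    induction hγ using AddSubmonoid.closure_induction with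
    | mem x hx =>
      obtain ⟨i, hi, rfl⟩ := hx
      refine ⟨Finsupp.single i 1, Finsupp.single_mem_supported ℂ _ hi, fun j => ?_, by simp⟩
      classical
      by_cases hij : i = j
      · exact ⟨1, by simp [hij]⟩
      · exact ⟨0, by simp [hij]⟩
    | zero => exact ⟨0, zero_mem _, fun i => ⟨0, by simp⟩, by simp⟩
    | add x y _ _ hx hy =>
      obtain ⟨f, hf, hf', rfl⟩ := hx
      obtain ⟨f₂, hf₂, hf₂', rfl⟩ := hy
      refine ⟨f + f₂, add_mem hf hf₂, fun i => ?_, by simp⟩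
      obtain ⟨a, ha⟩ := hf' i
      obtain ⟨a₂, ha₂⟩ := hf₂' i
      exact ⟨a + a₂, by simp [ha, ha₂]⟩
  obtain ⟨f, hf, hf', rfl⟩ := key α hα
  obtain ⟨f₂, hf₂, hf₂', rfl⟩ := key β hβ
  rw [← map_add] at h
  have h0 : f + f₂ = 0 := (linearIndepOn_iff.mp b.linearIndepOn_root) _ (add_mem hf hf₂) h
  have h2 : f₂ = 0 := by
    ext i
    obtain ⟨a, ha⟩ := hf' i
    obtain ⟨a₂, ha₂⟩ := hf₂' i
    have := DFunLike.congr_fun h0 i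
    rw [Finsupp.add_apply, ha, ha₂] at this
    have h3 : a + a₂ = 0 := by
      rw [Finsupp.coe_zero, Pi.zero_apply] at this
      exact_mod_cast this
    rw [ha₂, Finsupp.coe_zero, Pi.zero_apply]
    have : a₂ = 0 := by omega
    simp [this]
  rw [h2, map_zero]

/-- `τ⁺`. -/
def tauPos : Submodule ℂ D.tau := D.rootPart h₀ (D.IsPos b)

/-- `τ⁰ + τ⁺`. -/
def tauNonneg : LieSubalgebra ℂ D.tau where
  __ := D.rootPart h₀ (D.IsNonneg b)
  lie_mem' hx hy := D.lie_mem_rootPart (fun a a' α β hP hQ => by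
    rw [isNonneg_iff] at *
    rcases hP with hP | ⟨rfl, hP⟩ <;> rcases hQ with hQ | ⟨rfl, hQ⟩
    · exact Or.inl (by omega)
    · exact Or.inl (by omega)
    · exact Or.inl (by omega)
    · exact Or.inr ⟨by simp, add_mem hP hQ⟩) hx hy

lemma lie_mem_tauPos {x y : D.tau} (hx : x ∈ D.tauNonneg b) (hy : y ∈ D.tauPos b) :
    ⁅x, y⁆ ∈ D.tauPos b :=
  D.lie_mem_rootPart (P := D.IsNonneg b) (fun a a' α β hP hQ => by
    rw [isNonneg_iff] at hP
    rcases hP with hP | ⟨rfl, hP⟩ <;> rcases hQ with hQ | ⟨rfl, hQ, hQ'⟩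
    · exact Or.inl (by omega)
    · exact Or.inl (by omega)
    · exact Or.inl (by omega)
    · exact Or.inr ⟨by simp, fun h => hQ (D.posCone_eq_zero b hP hQ' h), add_mem hP hQ'⟩) hx hy

end Roots

/-! ### Modules -/

section Modules

variable (V : Type*) [AddCommGroup V] [Module ℂ V] [LieRingModule D.tau V] [LieModule ℂ D.tau V]

/-- Elements of `H*` for `H = h(0) ⊕ ∑ ℂ Kᵢ ⊕ ∑ ℂ dᵢ`, given by the restriction to `h(0)` and the
values on the `Kᵢ` and the `dᵢ`. -/
structure Weight where
  /-- restriction to `h(0)` -/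
  onCartan : Module.Dual ℂ h₀
  /-- values on the `Kᵢ` -/
  onK : Coef n
  /-- values on the `dᵢ` -/
  onD : Coef n

variable {h₀} in
/-- The weight space `V_λ`. -/
def weightSpace (wt : D.Weight h₀) : Submodule ℂ V where
  carrier := {v | (∀ h, ⁅D.cartanEl h₀ h, v⁆ = wt.onCartan h • v) ∧
    (∀ i, ⁅D.K i, v⁆ = wt.onK i • v) ∧ ∀ i, ⁅D.d i, v⁆ = wt.onD i • v}
  add_mem' hx hy := ⟨fun h => by rw [lie_add, hx.1, hy.1, smul_add],
    fun i => by rw [lie_add, hx.2.1, hy.2.1, smul_add],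
    fun i => by rw [lie_add, hx.2.2, hy.2.2, smul_add]⟩
  zero_mem' := ⟨fun h => by simp, fun i => by simp, fun i => by simp⟩
  smul_mem' a x hx := ⟨fun h => by rw [lie_smul, hx.1, smul_comm],
    fun i => by rw [lie_smul, hx.2.1, smul_comm], fun i => by rw [lie_smul, hx.2.2, smul_comm]⟩

/-- Integrable modules: weight modules with finite-dimensional weight spaces (the sum of the weight
spaces is automatically direct) on which all real root vectors act locally nilpotently. -/
structure IsIntegrable : Prop where
  iSup_weightSpace : (⨆ wt : D.Weight h₀, D.weightSpace V wt) = ⊤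
  finite_weightSpace : ∀ wt : D.Weight h₀, FiniteDimensional ℂ (D.weightSpace V wt)
  locally_nilpotent : ∀ (k : Expo n) (α : Module.Dual ℂ h₀), α ≠ 0 →
    ∀ (X : g) (hX : X ∈ D.gradRoot h₀ k α) (v : V),
      ∃ N : ℕ, (LieModule.toEnd ℂ D.tau V (D.loopEl k X hX.1) ^ N) v = 0

variable [FiniteDimensional ℂ g] [LieAlgebra.IsSimple ℂ D.fixed]
variable {h₀} [h₀.IsCartanSubalgebra] (b : (D.roots h₀).Base)

/-- The highest weight space `T = {v | τ⁺ v = 0}`, a module for `τ⁰ + τ⁺` with `τ⁺` acting by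
zero. -/
def topSpace : LieSubmodule ℂ (D.tauNonneg b) V where
  carrier := {v | ∀ x ∈ D.tauPos b, ⁅x, v⁆ = 0}
  add_mem' hx hy z hz := by rw [lie_add, hx z hz, hy z hz, add_zero]
  zero_mem' z _ := lie_zero z
  smul_mem' a x hx z hz := by rw [lie_smul, hx z hz, smul_zero]
  lie_mem {x v} hv z hz := by
    have h1 : ⁅z, (x : D.tau)⁆ ∈ D.tauPos b := by
      rw [← lie_skew]
      exact neg_mem (D.lie_mem_tauPos b x.2 hz)
    have h2 : ⁅z, ⁅(x : D.tau), v⁆⁆ = 0 := by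
      rw [leibniz_lie, hv _ h1, hv z hz, lie_zero, add_zero]
    exact h2

end Modules

/-! ### The degree zero part -/

section DegreeZero

/-- An exponent `l ∈ ℤⁿ` regarded as `(0, l)`. -/
def expo0 (l : Fin n → ℤ) : Expo n := Fin.cons 0 l

/-- `Γ = m₁ ℤ ⊕ … ⊕ mₙ ℤ`. -/
def Γ : AddSubgroup (Fin n → ℤ) where
  carrier := {r | ∀ i, (D.m i.succ : ℤ) ∣ r i}
  add_mem' hx hy := fun i : Fin n => dvd_add (a := (D.m i.succ : ℤ)) (hx i) (hy i)
  zero_mem' := fun _ : Fin n => dvd_zero _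
  neg_mem' hx := fun i : Fin n => (dvd_neg (a := (D.m i.succ : ℤ))).mpr (hx i)

lemma expo0_mem {r : Fin n → ℤ} (hr : r ∈ D.Γ) : expo0 r ∈ D.lattice := by
  intro i
  refine Fin.cases ?_ (fun j => ?_) i
  · simp [expo0]
  · simpa [expo0] using hr j

/-- `g° = {X ∈ g | σ₀ X = X, [h, X] = 0 for all h ∈ h(0)}`. -/
def gCirc : LieSubalgebra ℂ g where
  carrier := {X | D.σ 0 X = X ∧ ∀ h : h₀, ⁅((h : D.fixed) : g), X⁆ = 0}
  add_mem' hx hy := ⟨by rw [map_add, hx.1, hy.1], fun h => by rw [lie_add, hx.2, hy.2, add_zero]⟩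
  zero_mem' := ⟨map_zero _, fun h => lie_zero _⟩
  smul_mem' a x hx := ⟨by rw [map_smul, hx.1], fun h => by rw [lie_smul, hx.2, smul_zero]⟩
  lie_mem' {x y} hx hy := ⟨by rw [LieEquiv.map_lie, hx.1, hy.1], fun h => by
    rw [leibniz_lie, hx.2, hy.2, zero_lie, lie_zero, add_zero]⟩

/-- `g°_l̄ = {X ∈ g° | σᵢ X = ξᵢ^(lᵢ) X, 1 ≤ i ≤ n}`. -/
def gCircGrad (l : Fin n → ℤ) : Submodule ℂ (D.gCirc h₀) where
  carrier := {X | ∀ i : Fin n, D.σ i.succ (X : g) = D.ξ i.succ ^ l i • (X : g)}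
  add_mem' {x y} hx hy i := by
    change D.σ i.succ ((x : g) + y) = D.ξ i.succ ^ l i • ((x : g) + y)
    rw [map_add, hx i, hy i, smul_add]
  zero_mem' i := by simp
  smul_mem' a x hx i := by
    change D.σ i.succ (a • (x : g)) = D.ξ i.succ ^ l i • (a • (x : g))
    rw [map_smul, hx i, smul_comm]

variable {h₀} in
lemma gCircGrad_mem {l : Fin n → ℤ} {X : D.gCirc h₀} (hX : X ∈ D.gCircGrad h₀ l) :
    (X : g) ∈ D.gradRoot h₀ (expo0 l) 0 := by
  refine ⟨fun i => ?_, fun h => ?_⟩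
  · refine Fin.cases ?_ (fun j => ?_) i
    · simpa [expo0] using X.2.1
    · simpa [expo0] using hX j
  · rw [LinearMap.zero_apply, zero_smul]
    exact X.2.2 h

variable [FiniteDimensional ℂ g] [LieAlgebra.IsSimple ℂ D.fixed]
variable {h₀} [h₀.IsCartanSubalgebra] (b : (D.roots h₀).Base)

/-- `X(l)` in `τ⁰`, for `X ∈ g°_l̄`. -/
def zeroLoop (l : Fin n → ℤ) (X : D.gCirc h₀) (hX : X ∈ D.gCircGrad h₀ l) : D.tauNonneg b :=
  ⟨D.loopEl (expo0 l) X (D.gCircGrad_mem hX).1,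
    FullToroidal.loopEl_mem_genSpan ⟨0, Or.inl ⟨rfl, rfl⟩, D.gCircGrad_mem hX⟩⟩

/-- `t^r K_p` in `τ⁰`, for `r ∈ Γ` and `0 ≤ p ≤ n`. -/
def zeroK (r : Fin n → ℤ) (hr : r ∈ D.Γ) (p : Fin (n + 1)) : D.tauNonneg b :=
  ⟨D.centerEl (expo0 r) (D.expo0_mem hr) (Pi.single p 1),
    FullToroidal.centerEl_mem_genSpan (E := {s | s ∈ D.lattice ∧ D.IsNonneg b (s 0) 0})
      ⟨D.expo0_mem hr, Or.inl ⟨rfl, rfl⟩⟩ _⟩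

/-- `t^r d₀` in `τ⁰`, for `r ∈ Γ`. -/
def zeroD₀ (r : Fin n → ℤ) (hr : r ∈ D.Γ) : D.tauNonneg b :=
  ⟨D.derEl (expo0 r) (D.expo0_mem hr) (Pi.single 0 1),
    FullToroidal.derEl_mem_genSpan (E := {s | s ∈ D.lattice ∧ D.IsNonneg b (s 0) 0})
      ⟨D.expo0_mem hr, Or.inl ⟨rfl, rfl⟩⟩ _⟩

/-- `D(u, r) = ∑ uᵢ t^r dᵢ` (`1 ≤ i ≤ n`) in `τ⁰`, for `r ∈ Γ` and `u ∈ ℂⁿ`. -/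
def zeroD (u : Fin n → ℂ) (r : Fin n → ℤ) (hr : r ∈ D.Γ) : D.tauNonneg b :=
  ⟨D.derEl (expo0 r) (D.expo0_mem hr) (Fin.cons 0 u),
    FullToroidal.derEl_mem_genSpan (E := {s | s ∈ D.lattice ∧ D.IsNonneg b (s 0) 0})
      ⟨D.expo0_mem hr, Or.inl ⟨rfl, rfl⟩⟩ _⟩

end DegreeZero

end TwistData

/-! ### Loop modules over `gl_n ⊕ g°` -/

attribute [local instance 100] LieRing.ofAssociativeRing

open scoped TensorProduct

/-- The operator `w ⊗ t^k ↦ F k w ⊗ t^(k + r)` on `W ⊗ ℂ[t₁^±, …, tₙ^±]`. -/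
def loopOp {n : ℕ} {W : Type*} [AddCommGroup W] [Module ℂ W] (r : Fin n → ℤ)
    (F : (Fin n → ℤ) → Module.End ℂ W) : Module.End ℂ ((Fin n → ℤ) →₀ W) :=
  Finsupp.lsum ℂ fun k => Finsupp.lsingle (k + r) ∘ₗ F k

/-- For a family of subspaces `V₂(k̄)` of `V₂` indexed by `ℤⁿ / Γ'`: the subspace
`⨁_k V₁ ⊗ V₂(k̄) ⊗ t^k` of `V₁ ⊗ V₂ ⊗ ℂ[t₁^±, …, tₙ^±]`. -/
def gradedLoop {n : ℕ} (V₁ : Type*) {V₂ : Type*} [AddCommGroup V₁] [Module ℂ V₁] [AddCommGroup V₂]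
    [Module ℂ V₂] {Γ' : AddSubgroup (Fin n → ℤ)} (gr : (Fin n → ℤ) ⧸ Γ' → Submodule ℂ V₂) :
    Submodule ℂ ((Fin n → ℤ) →₀ V₁ ⊗[ℂ] V₂) :=
  ⨅ k : Fin n → ℤ, (LinearMap.range ((gr (k : (Fin n → ℤ) ⧸ Γ')).subtype.lTensor V₁)).comap
    (Finsupp.lapply k)

namespace TwistData

variable {n : ℕ} {g : Type*} [LieRing g] [LieAlgebra ℂ g] (D : TwistData n g)
variable [FiniteDimensional ℂ g] [LieAlgebra.IsSimple ℂ D.fixed]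
variable {h₀ : LieSubalgebra ℂ D.fixed} [h₀.IsCartanSubalgebra] (b : (D.roots h₀).Base)

/-- `Ψ` identifies the `τ⁰`-module `T` with `⨁_k V₁ ⊗ V₂(k̄) ⊗ t^k`, where `τ⁰` acts by
* `D(u, r) (v₁ ⊗ v₂ ⊗ t^k) = (u, k + α) v₁ ⊗ v₂ ⊗ t^(k+r) + ∑ uᵢ rⱼ E_{ji} v₁ ⊗ v₂ ⊗ t^(k+r)`,
* `X(l) (v₁ ⊗ v₂ ⊗ t^k) = v₁ ⊗ X v₂ ⊗ t^(k+l)`,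
* `t^r K₀ (v₁ ⊗ v₂ ⊗ t^k) = C₀ v₁ ⊗ v₂ ⊗ t^(k+r)`, and `t^r K_p` acts by zero for `p ≥ 1`,
* `t^r d₀ (v₁ ⊗ v₂ ⊗ t^k) = a₀ v₁ ⊗ v₂ ⊗ t^(k+r)`. -/
structure IsLoopRealization {V : Type*} [AddCommGroup V] [Module ℂ V] [LieRingModule D.tau V]
    [LieModule ℂ D.tau V] (C₀ a₀ : ℂ) (α : Fin n → ℂ)
    {V₁ V₂ : Type*} [AddCommGroup V₁] [Module ℂ V₁] [LieRingModule (Matrix (Fin n) (Fin n) ℂ) V₁]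
    [LieModule ℂ (Matrix (Fin n) (Fin n) ℂ) V₁]
    [AddCommGroup V₂] [Module ℂ V₂] [LieRingModule (D.gCirc h₀) V₂] [LieModule ℂ (D.gCirc h₀) V₂]
    {Γ' : AddSubgroup (Fin n → ℤ)} (gr : (Fin n → ℤ) ⧸ Γ' → Submodule ℂ V₂)
    (Ψ : D.topSpace V b →ₗ[ℂ] ((Fin n → ℤ) →₀ V₁ ⊗[ℂ] V₂)) : Prop where
  injective : Function.Injective Ψ
  range_eq : LinearMap.range Ψ = gradedLoop V₁ gr
  map_D : ∀ (u : Fin n → ℂ) (r : Fin n → ℤ) (hr : r ∈ D.Γ) (v : D.topSpace V b),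
    Ψ ⁅D.zeroD b u r hr, v⁆ = loopOp r (fun k =>
      (∑ i, u i * (k i + α i)) • LinearMap.id +
      (LieModule.toEnd ℂ (Matrix (Fin n) (Fin n) ℂ) V₁
        (∑ i, ∑ j, Matrix.single j i (u i * r j))).rTensor V₂) (Ψ v)
  map_X : ∀ (l : Fin n → ℤ) (X : D.gCirc h₀) (hX : X ∈ D.gCircGrad h₀ l) (v : D.topSpace V b),
    Ψ ⁅D.zeroLoop b l X hX, v⁆ =
      loopOp l (fun _ => (LieModule.toEnd ℂ (D.gCirc h₀) V₂ X).lTensor V₁) (Ψ v)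
  map_K₀ : ∀ (r : Fin n → ℤ) (hr : r ∈ D.Γ) (v : D.topSpace V b),
    Ψ ⁅D.zeroK b r hr 0, v⁆ = loopOp r (fun _ => C₀ • LinearMap.id) (Ψ v)
  map_K : ∀ (r : Fin n → ℤ) (hr : r ∈ D.Γ) (p : Fin n) (v : D.topSpace V b),
    Ψ ⁅D.zeroK b r hr p.succ, v⁆ = 0
  map_D₀ : ∀ (r : Fin n → ℤ) (hr : r ∈ D.Γ) (v : D.topSpace V b),
    Ψ ⁅D.zeroD₀ b r hr, v⁆ = loopOp r (fun _ => a₀ • LinearMap.id) (Ψ v)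

end TwistData

/-! ### Induced modules -/

section Induced

variable {L : Type*} [LieRing L] [LieAlgebra ℂ L] (p : LieSubalgebra ℂ L)
variable (T : Type*) [AddCommGroup T] [Module ℂ T] [LieRingModule p T] [LieModule ℂ p T]

/-- The `U(L)`-submodule of `U(L) ⊗ T` generated by the `y ⊗ t - 1 ⊗ y t` for `y ∈ p`. -/
def indRelations :
    Submodule (UniversalEnvelopingAlgebra ℂ L) (UniversalEnvelopingAlgebra ℂ L ⊗[ℂ] T) :=
  Submodule.span _ (Set.range fun yt : p × T =>
    UniversalEnvelopingAlgebra.ι ℂ (yt.1 : L) ⊗ₜ[ℂ] yt.2 - 1 ⊗ₜ[ℂ] ⁅yt.1, yt.2⁆)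

/-- The induced module `Ind_p^L T = U(L) ⊗_{U(p)} T`. -/
def LieInd : Type _ := (UniversalEnvelopingAlgebra ℂ L ⊗[ℂ] T) ⧸ indRelations p T

namespace LieInd

instance : AddCommGroup (LieInd p T) :=
  inferInstanceAs (AddCommGroup ((UniversalEnvelopingAlgebra ℂ L ⊗[ℂ] T) ⧸ indRelations p T))

instance : Module (UniversalEnvelopingAlgebra ℂ L) (LieInd p T) :=
  inferInstanceAs (Module (UniversalEnvelopingAlgebra ℂ L)
    ((UniversalEnvelopingAlgebra ℂ L ⊗[ℂ] T) ⧸ indRelations p T))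

instance : Module ℂ (LieInd p T) :=
  inferInstanceAs (Module ℂ ((UniversalEnvelopingAlgebra ℂ L ⊗[ℂ] T) ⧸ indRelations p T))

instance : IsScalarTower ℂ (UniversalEnvelopingAlgebra ℂ L) (LieInd p T) :=
  inferInstanceAs (IsScalarTower ℂ (UniversalEnvelopingAlgebra ℂ L)
    ((UniversalEnvelopingAlgebra ℂ L ⊗[ℂ] T) ⧸ indRelations p T))

instance : LieRingModule L (LieInd p T) where
  bracket x m := UniversalEnvelopingAlgebra.ι ℂ x • m
  add_lie x y m := by rw [map_add, add_smul]
  lie_add x m m' := smul_add _ _ _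
  leibniz_lie x y m := by
    rw [LieHom.map_lie, LieRing.of_associative_ring_bracket, sub_smul, mul_smul, mul_smul]
    abel

instance : LieModule ℂ L (LieInd p T) where
  smul_lie a x m := by
    change UniversalEnvelopingAlgebra.ι ℂ (a • x) • m = a • (UniversalEnvelopingAlgebra.ι ℂ x • m)
    rw [map_smul, smul_assoc]
  lie_smul a x m := smul_algebra_smul_comm a (UniversalEnvelopingAlgebra.ι ℂ x) m

/-- The canonical map `T → Ind_p^L T`, `t ↦ 1 ⊗ t`. -/
def ofBase : T →ₗ[ℂ] LieInd p T :=
  ((indRelations p T).mkQ.restrictScalars ℂ) ∘ₗ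
    TensorProduct.mk ℂ (UniversalEnvelopingAlgebra ℂ L) T 1

end LieInd

end Induced

end

attribute [local instance 100] LieRing.ofAssociativeRing

open scoped TensorProduct

set_option linter.unusedSimpArgs false
set_option linter.unusedSectionVars false
attribute [local instance 100] LieRing.ofAssociativeRing


/-! ### Modules graded by the eigenvalues of one element -/

section EigenGrading

/-- An eigenvector is contained in every invariant subspace that contains its sum with a
combination of eigenvectors for other eigenvalues. -/
lemma Submodule.left_mem_of_add_mem_of_eigenspace {M : Type*} [AddCommGroup M] [Module ℂ M]
    {f : Module.End ℂ M} {N : Submodule ℂ M} (hN : ∀ x ∈ N, f x ∈ N) {c : ℂ} {a b : M}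
    (ha : f a = c • a) (hb : b ∈ ⨆ d : {d : ℂ // d ≠ c}, f.eigenspace d) (hab : a + b ∈ N) :
    a ∈ N := by
  have key : ∃ q : Polynomial ℂ, Polynomial.aeval f q b = 0 ∧ q.eval c ≠ 0 := by
    clear hab
    induction hb using Submodule.iSup_induction' with
    | mem d x hx =>
      refine ⟨Polynomial.X - Polynomial.C (d : ℂ), ?_, ?_⟩
      · have := Module.End.mem_eigenspace_iff.mp hx
        simp [this, Module.algebraMap_end_apply]
      · simpa [sub_eq_zero] using d.2.symm
    | zero => exact ⟨1, by simp, by simp⟩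
    | add x y _ _ hx hy =>
      obtain ⟨q, h1, h2⟩ := hx
      obtain ⟨q', h1', h2'⟩ := hy
      refine ⟨q * q', ?_, by simp [h2, h2']⟩
      rw [map_add]
      conv_lhs => enter [1]; rw [mul_comm]
      rw [map_mul, map_mul, Module.End.mul_apply, Module.End.mul_apply, h1, h1', map_zero, map_zero,
        add_zero]
  obtain ⟨q, h1, h2⟩ := key
  have hq : ∀ q : Polynomial ℂ, ∀ x ∈ N, Polynomial.aeval f q x ∈ N := by
    intro q
    induction q using Polynomial.induction_on' with
    | add p q hp hq => intro x hx; simpa using add_mem (hp x hx) (hq x hx)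
    | monomial n r =>
      intro x hx
      rw [Polynomial.aeval_monomial, Module.End.mul_apply, Module.algebraMap_end_apply]
      refine N.smul_mem _ ?_
      induction n with
      | zero => simpa using hx
      | succ n ih => rw [pow_succ']; exact hN _ ih
  have h3 := hq q _ hab
  rw [map_add, h1, add_zero] at h3
  by_cases h0 : a = 0
  · rw [h0]; exact zero_mem _
  · rw [Module.End.aeval_apply_of_hasEigenvector
      (Module.End.hasEigenvector_iff.mpr ⟨Module.End.mem_eigenspace_iff.mpr ha, h0⟩)] at h3
    have := N.smul_mem (q.eval c)⁻¹ h3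
    rwa [inv_smul_smul₀ h2] at this

variable {L : Type*} [LieRing L] [LieAlgebra ℂ L]

/-- The eigenspace of an element of a Lie algebra on a module. -/
def opWeight (E : L) (M : Type*) [AddCommGroup M] [Module ℂ M] [LieRingModule L M]
    [LieModule ℂ L M] (c : ℂ) : Submodule ℂ M :=
  (LieModule.toEnd ℂ L M E).eigenspace c

variable {E : L} {M : Type*} [AddCommGroup M] [Module ℂ M] [LieRingModule L M] [LieModule ℂ L M]

lemma mem_opWeight {c : ℂ} {v : M} : v ∈ opWeight E M c ↔ ⁅E, v⁆ = c • v := by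
  simp [opWeight, Module.End.mem_eigenspace_iff]

lemma lie_mem_opWeight {c d : ℂ} {x : L} {v : M} (hx : x ∈ opWeight E L d)
    (hv : v ∈ opWeight E M c) : ⁅x, v⁆ ∈ opWeight E M (c + d) := by
  rw [mem_opWeight] at *
  rw [leibniz_lie, hx, hv, smul_lie, lie_smul, add_comm, add_smul]

/-- The sum of the eigenspaces below `c`. -/
def lowPart (E : L) (M : Type*) [AddCommGroup M] [Module ℂ M] [LieRingModule L M]
    [LieModule ℂ L M] (c : ℂ) : Submodule ℂ M :=
  ⨆ i : ℕ, opWeight E M (c - (i + 1))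

lemma lowPart_le (c : ℂ) : lowPart E M c ≤
    ⨆ d : {d : ℂ // d ≠ c}, (LieModule.toEnd ℂ L M E).eigenspace d := by
  refine iSup_le fun i => ?_
  have : c - (i + 1) ≠ c := by
    intro h
    have h2 : ((i : ℂ) + 1) = 0 := by linear_combination -h
    exact (Nat.cast_add_one_ne_zero i) h2
  exact le_iSup (fun d : {d : ℂ // d ≠ c} => (LieModule.toEnd ℂ L M E).eigenspace d) ⟨_, this⟩

lemma opWeight_inf_lowPart {c : ℂ} {v : M} (hv : v ∈ opWeight E M c) (hv' : v ∈ lowPart E M c) :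
    v = 0 := by
  have := Submodule.left_mem_of_add_mem_of_eigenspace (N := ⊥)
    (f := LieModule.toEnd ℂ L M E) (a := v) (b := -v) (c := c) (by simp)
    (by simpa using mem_opWeight.mp hv) (neg_mem (lowPart_le c hv')) (by simp)
  simpa using this

lemma lie_mem_lowPart {c : ℂ} {j : ℕ} {x : L} {v : M} (hx : x ∈ opWeight E L (-(j + 1)))
    (hv : v ∈ opWeight E M c ⊔ lowPart E M c) : ⁅x, v⁆ ∈ lowPart E M c := by
  obtain ⟨a, ha, b, hb, rfl⟩ := Submodule.mem_sup.mp hv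
  rw [lie_add]
  refine add_mem ?_ ?_
  · refine Submodule.mem_iSup_of_mem j ?_
    have := lie_mem_opWeight hx ha
    rwa [← sub_eq_add_neg] at this
  · induction hb using Submodule.iSup_induction' with
    | zero => simp
    | add y z _ _ hy hz =>
      rw [lie_add]
      exact add_mem (hy (Submodule.add_mem _ (Submodule.mem_sup_left ha) (Submodule.mem_sup_right ‹_›)))
        (hz (Submodule.add_mem _ (Submodule.mem_sup_left ha) (Submodule.mem_sup_right ‹_›)))
    | mem i y hy =>
      refine Submodule.mem_iSup_of_mem (i + j + 1) ?_
      have := lie_mem_opWeight hx hy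
      convert this using 1
      push_cast
      ring_nf

/-- The subspaces obtained from `T` by applying at most `k` lowering elements. -/
def lowering (E : L) (T : Submodule ℂ M) : ℕ → Submodule ℂ M
  | 0 => T
  | k + 1 => lowering E T k ⊔
      Submodule.span ℂ {u | ∃ i : ℕ, ∃ y ∈ opWeight E L (-(i + 1)), ∃ w ∈ lowering E T k, u = ⁅y, w⁆}

/-- Every element is the sum of an element of `p` and of lowering elements. -/
def IsNonnegPart (E : L) (p : LieSubalgebra ℂ L) : Prop :=
  ∀ x : L, ∃ y ∈ ⨆ i : ℕ, opWeight E L (-(i + 1)), ∃ z ∈ p, x = y + z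

lemma lie_mem_lowering {T : Submodule ℂ M} {k : ℕ} {y : L} (hy : y ∈ ⨆ i : ℕ, opWeight E L (-(i + 1)))
    {w : M} (hw : w ∈ lowering E T k) : ⁅y, w⁆ ∈ lowering E T (k + 1) := by
  induction hy using Submodule.iSup_induction' with
  | zero => simp
  | add a b _ _ ha hb => rw [add_lie]; exact add_mem ha hb
  | mem i a ha => exact Submodule.mem_sup_right (Submodule.subset_span ⟨i, a, ha, w, hw, rfl⟩)

lemma nonneg_lie_mem_lowering {p : LieSubalgebra ℂ L} (hp : IsNonnegPart E p) {T : Submodule ℂ M}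
    (hT : ∀ z ∈ p, ∀ v ∈ T, ⁅z, v⁆ ∈ T) (k : ℕ) :
    ∀ z ∈ p, ∀ w ∈ lowering E T k, ⁅z, w⁆ ∈ lowering E T k := by
  induction k with
  | zero => exact hT
  | succ k ih =>
    intro z hz w hw
    obtain ⟨a, ha, b, hb, rfl⟩ := Submodule.mem_sup.mp hw
    rw [lie_add]
    refine add_mem (Submodule.mem_sup_left (ih z hz a ha)) ?_
    clear hw ha
    induction hb using Submodule.span_induction with
    | zero => simp
    | add u v _ _ hu hv => rw [lie_add]; exact add_mem hu hv
    | smul c u _ hu => rw [lie_smul]; exact Submodule.smul_mem _ _ hu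
    | mem u hu =>
      obtain ⟨i, y, hy, w, hw, rfl⟩ := hu
      rw [leibniz_lie]
      obtain ⟨y', hy', z', hz', hyz⟩ := hp ⁅z, y⁆
      rw [hyz, add_lie]
      refine add_mem (add_mem (lie_mem_lowering hy' hw) (Submodule.mem_sup_left (ih z' hz' w hw))) ?_
      exact lie_mem_lowering (Submodule.mem_iSup_of_mem i hy) (ih z hz w hw)

lemma lowering_mono (T : Submodule ℂ M) : Monotone (lowering E T) :=
  monotone_nat_of_le_succ fun _ => le_sup_left

/-- A subspace that is stable under the nonnegative part generates a submodule that, apart from the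
subspace itself, only has lower eigenvalues. -/
lemma lieSpan_le_sup_lowPart {p : LieSubalgebra ℂ L} (hp : IsNonnegPart E p) {T : Submodule ℂ M}
    (hT : ∀ z ∈ p, ∀ v ∈ T, ⁅z, v⁆ ∈ T) {c : ℂ} (hTc : T ≤ opWeight E M c) :
    (LieSubmodule.lieSpan ℂ L (T : Set M) : Submodule ℂ M) ≤ T ⊔ lowPart E M c := by
  let N : LieSubmodule ℂ L M :=
    { __ := ⨆ k, lowering E T k
      lie_mem := by
        intro x m hm
        obtain ⟨k, hk⟩ := (Submodule.mem_iSup_of_directed _ (lowering_mono T).directed_le).mp hm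
        obtain ⟨y, hy, z, hz, rfl⟩ := hp x
        rw [add_lie]
        exact add_mem (Submodule.mem_iSup_of_mem (k + 1) (lie_mem_lowering hy hk))
          (Submodule.mem_iSup_of_mem k (nonneg_lie_mem_lowering hp hT k z hz m hk)) }
  have h1 : LieSubmodule.lieSpan ℂ L (T : Set M) ≤ N :=
    LieSubmodule.lieSpan_le.mpr fun v hv => Submodule.mem_iSup_of_mem (p := lowering E T) 0 hv
  have h2 : ∀ k, lowering E T k ≤ T ⊔ lowPart E M c := by
    intro k
    induction k with
    | zero => exact le_sup_left
    | succ k ih =>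
      refine sup_le ih (Submodule.span_le.mpr ?_)
      rintro _ ⟨i, y, hy, w, hw, rfl⟩
      exact Submodule.mem_sup_right (lie_mem_lowPart hy (sup_le_sup_right hTc _ (ih hw)))
  intro v hv
  exact iSup_le h2 (h1 hv)

section Irreducible

variable {V : Type*} [AddCommGroup V] [Module ℂ V] [LieRingModule L V] [LieModule ℂ L V]
  [LieModule.IsIrreducible ℂ L V]

lemma mem_sup_lowPart_of_isIrreducible {p : LieSubalgebra ℂ L} (hp : IsNonnegPart E p)
    {T : Submodule ℂ V} (hT : ∀ z ∈ p, ∀ v ∈ T, ⁅z, v⁆ ∈ T) {c : ℂ} (hTc : T ≤ opWeight E V c)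
    (h0 : T ≠ ⊥) (v : V) : v ∈ T ⊔ lowPart E V c := by
  refine lieSpan_le_sup_lowPart hp hT hTc ?_
  have : Nontrivial (LieSubmodule.lieSpan ℂ L (T : Set V)) := by
    obtain ⟨t, ht, ht0⟩ := Submodule.exists_mem_ne_zero_of_ne_bot h0
    exact ⟨⟨⟨t, LieSubmodule.subset_lieSpan ht⟩, 0, fun h => ht0 (congrArg Subtype.val h)⟩⟩
  rw [LieSubmodule.eq_top_of_isIrreducible ℂ L V (LieSubmodule.lieSpan ℂ L (T : Set V))]
  exact Submodule.mem_top

lemma eq_or_eq_sub_of_opWeight {p : LieSubalgebra ℂ L} (hp : IsNonnegPart E p)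
    {T : Submodule ℂ V} (hT : ∀ z ∈ p, ∀ v ∈ T, ⁅z, v⁆ ∈ T) {c : ℂ} (hTc : T ≤ opWeight E V c)
    (h0 : T ≠ ⊥) {d : ℂ} {v : V} (hv : v ∈ opWeight E V d) (hv0 : v ≠ 0) :
    d = c ∨ ∃ i : ℕ, d = c - (i + 1) := by
  by_contra hd
  push Not at hd
  apply hv0
  have h1 : T ⊔ lowPart E V c ≤
      ⨆ e : {e : ℂ // e ≠ d}, (LieModule.toEnd ℂ L V E).eigenspace e := by
    refine sup_le (hTc.trans ?_) (iSup_le fun i => ?_)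
    · exact le_iSup (fun e : {e : ℂ // e ≠ d} => (LieModule.toEnd ℂ L V E).eigenspace e)
        ⟨c, hd.1.symm⟩
    · exact le_iSup (fun e : {e : ℂ // e ≠ d} => (LieModule.toEnd ℂ L V E).eigenspace e)
        ⟨_, (hd.2 i).symm⟩
  have := Submodule.left_mem_of_add_mem_of_eigenspace (N := ⊥)
    (f := LieModule.toEnd ℂ L V E) (a := v) (b := -v) (c := d) (by simp)
    (by simpa using mem_opWeight.mp hv)
    (neg_mem (h1 (mem_sup_lowPart_of_isIrreducible hp hT hTc h0 v))) (by simp)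
  simpa using this

/-- The parts of a Lie algebra that is graded by the eigenvalues of `E`: `p` is the nonnegative
part and `pos` the positive one. -/
structure IsTriangular (E : L) (p : LieSubalgebra ℂ L) (pos : Submodule ℂ L) : Prop where
  nonneg : IsNonnegPart E p
  mem : E ∈ p
  pos_le : pos ≤ ⨆ i : ℕ, opWeight E L (i + 1)
  split : ∀ z ∈ p, ∃ a ∈ opWeight E L 0, ∃ b ∈ pos, z = a + b

lemma IsTriangular.stable {p : LieSubalgebra ℂ L} {pos : Submodule ℂ L}
    (h : IsTriangular E p pos)
    (T : LieSubmodule ℂ p V) (hT : ∀ v, v ∈ T ↔ ∀ x ∈ pos, ⁅x, v⁆ = 0) (d : ℂ) :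
    ∀ z ∈ p, ∀ v ∈ (T : Submodule ℂ V) ⊓ opWeight E V d,
      ⁅z, v⁆ ∈ (T : Submodule ℂ V) ⊓ opWeight E V d := by
  intro z hz v hv
  have h1 : ⁅z, v⁆ ∈ T := T.lie_mem (x := ⟨z, hz⟩) hv.1
  refine ⟨h1, ?_⟩
  obtain ⟨a, ha, b, hb, rfl⟩ := h.split z hz
  rw [add_lie, (hT v).mp hv.1 b hb, add_zero]
  simpa using lie_mem_opWeight ha hv.2

/-- The space of highest weight vectors is an eigenspace. -/
lemma IsTriangular.highest_eq_opWeight {p : LieSubalgebra ℂ L} {pos : Submodule ℂ L}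
    (h : IsTriangular E p pos)
    (T : LieSubmodule ℂ p V) (hT : ∀ v, v ∈ T ↔ ∀ x ∈ pos, ⁅x, v⁆ = 0) {c : ℂ} {v₀ : V}
    (h0 : v₀ ≠ 0) (hv₀ : v₀ ∈ T) (hc : v₀ ∈ opWeight E V c) :
    (T : Submodule ℂ V) = opWeight E V c := by
  have ne : (T : Submodule ℂ V) ⊓ opWeight E V c ≠ ⊥ := fun hb =>
    h0 ((Submodule.mem_bot ℂ).mp (hb ▸ (⟨hv₀, hc⟩ : v₀ ∈ (T : Submodule ℂ V) ⊓ opWeight E V c)))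
  apply le_antisymm
  · intro v hv
    obtain ⟨a, ha, b, hb, rfl⟩ := Submodule.mem_sup.mp
      (mem_sup_lowPart_of_isIrreducible h.nonneg (h.stable T hT c) inf_le_right ne v)
    have hbT : b ∈ (T : Submodule ℂ V) := by
      have := sub_mem hv ha.1
      rwa [add_sub_cancel_left] at this
    suffices b = 0 by rw [this, add_zero]; exact ha.2
    obtain ⟨f, hf, hfb⟩ := (Submodule.mem_iSup_iff_exists_finsupp _ _).mp hb
    have hfi : ∀ i, f i = 0 := by
      intro i
      have hfT : f i ∈ (T : Submodule ℂ V) := by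
        refine Submodule.left_mem_of_add_mem_of_eigenspace (f := LieModule.toEnd ℂ L V E)
          (b := b - f i) (c := c - (i + 1)) ?_ (mem_opWeight.mp (hf i)) ?_ ?_
        · intro x hx
          exact T.lie_mem (x := ⟨E, h.mem⟩) hx
        · rw [← hfb, Finsupp.sum]
          have : (∑ j ∈ f.support, f j) - f i = ∑ j ∈ f.support.erase i, f j := by
            by_cases hi : i ∈ f.support
            · rw [← Finset.add_sum_erase _ _ hi, add_sub_cancel_left]
            · rw [Finset.erase_eq_of_notMem hi, Finsupp.notMem_support_iff.mp hi, sub_zero]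
          rw [this]
          refine Submodule.sum_mem _ fun j hj => ?_
          refine Submodule.mem_iSup_of_mem ⟨c - (j + 1), ?_⟩ (hf j)
          intro he
          have : (j : ℂ) = i := by linear_combination -he
          exact Finset.ne_of_mem_erase hj (by exact_mod_cast this)
        · rwa [add_sub_cancel]
      by_contra hne
      have ne' : (T : Submodule ℂ V) ⊓ opWeight E V (c - (i + 1)) ≠ ⊥ := fun hb =>
        hne ((Submodule.mem_bot ℂ).mp (hb ▸
          (⟨hfT, hf i⟩ : f i ∈ (T : Submodule ℂ V) ⊓ opWeight E V (c - (i + 1)))))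
      rcases eq_or_eq_sub_of_opWeight h.nonneg (h.stable T hT _) inf_le_right ne' hc h0 with
        he | ⟨j, he⟩
      · have : ((i : ℂ) + 1) = 0 := by linear_combination he
        exact Nat.cast_add_one_ne_zero i this
      · have : ((i + j + 1 : ℕ) : ℂ) + 1 = 0 := by push_cast; linear_combination he
        exact Nat.cast_add_one_ne_zero _ this
    rw [← hfb, Finsupp.sum]
    exact Finset.sum_eq_zero fun i _ => hfi i
  · intro v hv
    refine (hT v).mpr fun x hx => ?_
    have hx' := h.pos_le hx
    clear hx
    induction hx' using Submodule.iSup_induction' with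
    | zero => exact zero_lie v
    | add a b _ _ ha hb => rw [add_lie, ha, hb, add_zero]
    | mem i x hx' =>
      by_contra hne
      rcases eq_or_eq_sub_of_opWeight h.nonneg (h.stable T hT c) inf_le_right ne
        (lie_mem_opWeight hx' hv) hne with he | ⟨j, he⟩
      · have : ((i : ℂ) + 1) = 0 := by linear_combination he
        exact Nat.cast_add_one_ne_zero i this
      · have : ((i + j + 1 : ℕ) : ℂ) + 1 = 0 := by push_cast; linear_combination he
        exact Nat.cast_add_one_ne_zero _ this

/-- The space of highest weight vectors is irreducible. -/
lemma IsTriangular.isIrreducible_highest {p : LieSubalgebra ℂ L} {pos : Submodule ℂ L}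
    (h : IsTriangular E p pos)
    (T : LieSubmodule ℂ p V) (hT : ∀ v, v ∈ T ↔ ∀ x ∈ pos, ⁅x, v⁆ = 0) {c : ℂ} {v₀ : V}
    (h0 : v₀ ≠ 0) (hv₀ : v₀ ∈ T) (hc : v₀ ∈ opWeight E V c) :
    LieModule.IsIrreducible ℂ p T := by
  have hTc := h.highest_eq_opWeight T hT h0 hv₀ hc
  have : Nontrivial T := ⟨⟨⟨v₀, hv₀⟩, 0, fun he => h0 (congrArg Subtype.val he)⟩⟩
  refine LieModule.IsIrreducible.mk fun N hN => ?_
  set T₁ : Submodule ℂ V := (N : Submodule ℂ T).map (T : Submodule ℂ V).subtype with hT₁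
  have hs : ∀ z ∈ p, ∀ v ∈ T₁, ⁅z, v⁆ ∈ T₁ := by
    rintro z hz _ ⟨w, hw, rfl⟩
    exact ⟨(⁅(⟨z, hz⟩ : p), (⟨w.1, w.2⟩ : T)⁆ : T), N.lie_mem (m := (⟨w.1, w.2⟩ : T)) hw, rfl⟩
  have hc' : T₁ ≤ opWeight E V c := by
    rw [← hTc]
    rintro _ ⟨w, hw, rfl⟩
    exact w.2
  have hne : T₁ ≠ ⊥ := by
    intro hb
    refine hN ((LieSubmodule.eq_bot_iff N).mpr fun x hx => Subtype.ext ?_)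
    have : (x : V) ∈ T₁ := ⟨x, hx, rfl⟩
    rw [hb] at this
    exact (Submodule.mem_bot ℂ).mp this
  rw [eq_top_iff]
  intro v _
  obtain ⟨a, ha, b, hb, hab⟩ := Submodule.mem_sup.mp
    (mem_sup_lowPart_of_isIrreducible h.nonneg hs hc' hne (v : V))
  have hvc : (v : V) ∈ opWeight E V c := hTc ▸ v.2
  have hb0 : b = 0 := by
    refine opWeight_inf_lowPart (c := c) ?_ hb
    have := sub_mem hvc (hc' ha)
    rwa [← hab, add_sub_cancel_left] at this
  obtain ⟨w, hw, hwa⟩ := ha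
  have : w = v := Subtype.ext (by rw [← hab, hb0, add_zero]; exact hwa)
  exact this ▸ hw

section Induced

variable {p : LieSubalgebra ℂ L} {pos : Submodule ℂ L} (T : LieSubmodule ℂ p V)

/-- The map `U(L) ⊗ T → V`. -/
def tensorToModule : UniversalEnvelopingAlgebra ℂ L ⊗[ℂ] T →ₗ[ℂ] V :=
  TensorProduct.lift
    ((LinearMap.lcomp ℂ V (T : Submodule ℂ V).subtype).comp
      (UniversalEnvelopingAlgebra.lift ℂ (LieModule.toEnd ℂ L V)).toLinearMap)

lemma tensorToModule_tmul (u : UniversalEnvelopingAlgebra ℂ L) (t : T) :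
    tensorToModule T (u ⊗ₜ t) = UniversalEnvelopingAlgebra.lift ℂ (LieModule.toEnd ℂ L V) u t := rfl

lemma tensorToModule_smul (u : UniversalEnvelopingAlgebra ℂ L)
    (x : UniversalEnvelopingAlgebra ℂ L ⊗[ℂ] T) :
    tensorToModule T (u • x) =
      UniversalEnvelopingAlgebra.lift ℂ (LieModule.toEnd ℂ L V) u (tensorToModule T x) := by
  induction x using TensorProduct.induction_on with
  | zero => simp
  | add x y hx hy => rw [smul_add, map_add, hx, hy, map_add, map_add]
  | tmul w t =>
    rw [TensorProduct.smul_tmul', smul_eq_mul, tensorToModule_tmul, tensorToModule_tmul, map_mul,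
      Module.End.mul_apply]

lemma tensorToModule_eq_zero {x : UniversalEnvelopingAlgebra ℂ L ⊗[ℂ] T}
    (hx : x ∈ indRelations p T) : tensorToModule T x = 0 := by
  induction hx using Submodule.span_induction with
  | zero => simp
  | add x y _ _ hx hy => rw [map_add, hx, hy, add_zero]
  | smul u x _ hx => rw [tensorToModule_smul, hx, map_zero]
  | mem x hx =>
    obtain ⟨⟨y, t⟩, rfl⟩ := hx
    rw [map_sub, tensorToModule_tmul, tensorToModule_tmul, map_one,
      UniversalEnvelopingAlgebra.lift_ι_apply]
    exact sub_self _

/-- The homomorphism from the induced module that extends the inclusion of `T`. -/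
def indToModule : LieInd p T →ₗ⁅ℂ, L⁆ V where
  __ := ((indRelations p T).restrictScalars ℂ).liftQ (tensorToModule T)
    (fun _ hx => tensorToModule_eq_zero T hx)
  map_lie' := by
    intro x m
    obtain ⟨m, rfl⟩ := (indRelations p T).mkQ_surjective m
    change tensorToModule T (UniversalEnvelopingAlgebra.ι ℂ x • m) = ⁅x, tensorToModule T m⁆
    rw [tensorToModule_smul, UniversalEnvelopingAlgebra.lift_ι_apply]
    rfl

lemma indToModule_ofBase (t : T) : indToModule T (LieInd.ofBase p T t) = t := by
  change tensorToModule T (1 ⊗ₜ t) = t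
  rw [tensorToModule_tmul, map_one]
  rfl

lemma lie_ofBase (x : p) (t : T) :
    ⁅(x : L), LieInd.ofBase p T t⁆ = LieInd.ofBase p T ⁅x, t⁆ := by
  change (indRelations p T).mkQ (UniversalEnvelopingAlgebra.ι ℂ (x : L) • (1 ⊗ₜ[ℂ] t)) =
    (indRelations p T).mkQ (1 ⊗ₜ[ℂ] ⁅x, t⁆)
  rw [TensorProduct.smul_tmul', smul_eq_mul, mul_one, ← sub_eq_zero, ← map_sub,
    Submodule.mkQ_apply, Submodule.Quotient.mk_eq_zero]
  exact Submodule.subset_span ⟨(x, t), rfl⟩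

lemma lieSpan_ofBase :
    LieSubmodule.lieSpan ℂ L (Set.range (LieInd.ofBase p T)) = ⊤ := by
  set N := LieSubmodule.lieSpan ℂ L (Set.range (LieInd.ofBase p T))
  let S : Subalgebra ℂ (UniversalEnvelopingAlgebra ℂ L) :=
    { carrier := {u | ∀ m ∈ N, u • m ∈ N}
      mul_mem' := fun ha hb m hm => by rw [mul_smul]; exact ha _ (hb _ hm)
      add_mem' := fun ha hb m hm => by rw [add_smul]; exact add_mem (ha _ hm) (hb _ hm)
      algebraMap_mem' := fun r m hm => by
        rw [algebraMap_smul]; exact Submodule.smul_mem N.toSubmodule r hm }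
  let i : L →ₗ⁅ℂ⁆ S :=
    { toFun := fun x => ⟨UniversalEnvelopingAlgebra.ι ℂ x, fun m hm => N.lie_mem (x := x) hm⟩
      map_add' := fun x y => Subtype.ext (map_add _ x y)
      map_smul' := fun a x => Subtype.ext (map_smul _ a x)
      map_lie' := fun {x y} => Subtype.ext (LieHom.map_lie _ x y) }
  have h1 : S.val.comp (UniversalEnvelopingAlgebra.lift ℂ i) = AlgHom.id ℂ _ := by
    apply UniversalEnvelopingAlgebra.hom_ext
    ext x
    simp [i]
  have h2 : ∀ u : UniversalEnvelopingAlgebra ℂ L, u ∈ S := by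
    intro u
    have := DFunLike.congr_fun h1 u
    rw [AlgHom.comp_apply, AlgHom.id_apply] at this
    rw [← this]
    exact (UniversalEnvelopingAlgebra.lift ℂ i u).2
  rw [eq_top_iff]
  intro m _
  obtain ⟨m, rfl⟩ := (indRelations p T).mkQ_surjective m
  induction m using TensorProduct.induction_on with
  | zero => rw [map_zero]; exact zero_mem _
  | add x y hx hy => rw [map_add]; exact add_mem (hx trivial) (hy trivial)
  | tmul u t =>
    have : (indRelations p T).mkQ (u ⊗ₜ[ℂ] t) = u • LieInd.ofBase p T t := by
      change _ = (indRelations p T).mkQ (u • (1 ⊗ₜ[ℂ] t))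
      rw [TensorProduct.smul_tmul', smul_eq_mul, mul_one]
    rw [this]
    exact h2 u _ (LieSubmodule.subset_lieSpan ⟨t, rfl⟩)

lemma map_mem_lowPart {M' : Type*} [AddCommGroup M'] [Module ℂ M'] [LieRingModule L M']
    [LieModule ℂ L M'] (φ : M →ₗ⁅ℂ, L⁆ M') {c : ℂ} {v : M} (hv : v ∈ lowPart E M c) :
    φ v ∈ lowPart E M' c := by
  induction hv using Submodule.iSup_induction' with
  | zero => simp
  | add x y _ _ hx hy => rw [map_add]; exact add_mem hx hy
  | mem i x hx =>
    refine Submodule.mem_iSup_of_mem i ?_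
    rw [mem_opWeight] at hx ⊢
    rw [← LieModuleHom.map_lie, hx, map_smul]

/-- The largest submodule of the induced module that meets `T` trivially. -/
lemma IsTriangular.exists_isGreatest (h : IsTriangular E p pos)
    (hT : ∀ v, v ∈ T ↔ ∀ x ∈ pos, ⁅x, v⁆ = 0) {c : ℂ} {v₀ : V}
    (h0 : v₀ ≠ 0) (hv₀ : v₀ ∈ T) (hc : v₀ ∈ opWeight E V c) :
    ∃ Mrad : LieSubmodule ℂ L (LieInd p T),
      IsGreatest {N : LieSubmodule ℂ L (LieInd p T) | (N : Submodule ℂ (LieInd p T)) ⊓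
        LinearMap.range (LieInd.ofBase p T) = ⊥} Mrad ∧
      Nonempty (V ≃ₗ⁅ℂ, L⁆ (LieInd p T ⧸ Mrad)) := by
  have hTc := h.highest_eq_opWeight T hT h0 hv₀ hc
  have hrange : (indToModule T).range = ⊤ := by
    have : Nontrivial (indToModule T).range :=
      ⟨⟨⟨v₀, ⟨_, indToModule_ofBase T ⟨v₀, hv₀⟩⟩⟩, 0, fun he => h0 (congrArg Subtype.val he)⟩⟩
    exact LieSubmodule.eq_top_of_isIrreducible ℂ L V _
  refine ⟨(indToModule T).ker, ⟨?_, ?_⟩, ?_⟩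
  · refine (Submodule.eq_bot_iff _).mpr ?_
    rintro _ ⟨hx, t, rfl⟩
    have h1 : indToModule T (LieInd.ofBase p T t) = 0 := by simpa using hx
    rw [indToModule_ofBase] at h1
    rw [Subtype.ext (a2 := (0 : T)) h1, map_zero]
  · intro N hN
    have hT₁ : LinearMap.range (LieInd.ofBase p T) ≤ opWeight E (LieInd p T) c := by
      rintro _ ⟨t, rfl⟩
      rw [mem_opWeight]
      have h1 := lie_ofBase T ⟨E, h.mem⟩ t
      have h2 : (t : V) ∈ opWeight E V c := hTc ▸ t.2
      have h3 : ⁅(⟨E, h.mem⟩ : p), t⁆ = c • t := Subtype.ext (mem_opWeight.mp h2)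
      rw [h3, map_smul] at h1
      exact h1
    have hdec : ∀ m : LieInd p T, m ∈ LinearMap.range (LieInd.ofBase p T) ⊔
        lowPart E (LieInd p T) c := by
      intro m
      refine lieSpan_le_sup_lowPart h.nonneg ?_ hT₁ ?_
      · rintro z hz _ ⟨t, rfl⟩
        exact ⟨_, (lie_ofBase T ⟨z, hz⟩ t).symm⟩
      · rw [LinearMap.coe_range, lieSpan_ofBase]
        exact LieSubmodule.mem_top m
    have hlow : ∀ m ∈ N, m ∈ lowPart E (LieInd p T) c := by
      intro m hm
      obtain ⟨a, ha, b, hb, rfl⟩ := Submodule.mem_sup.mp (hdec m)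
      have haN : a ∈ N := Submodule.left_mem_of_add_mem_of_eigenspace
        (f := LieModule.toEnd ℂ L (LieInd p T) E) (N := N.toSubmodule)
        (fun x hx => N.lie_mem (x := E) hx) (mem_opWeight.mp (hT₁ ha)) (lowPart_le c hb) hm
      have : a ∈ (N : Submodule ℂ (LieInd p T)) ⊓ LinearMap.range (LieInd.ofBase p T) := ⟨haN, ha⟩
      rw [show (N : Submodule ℂ (LieInd p T)) ⊓ LinearMap.range (LieInd.ofBase p T) = ⊥ from hN,
        Submodule.mem_bot] at this
      rwa [this, zero_add]
    by_contra hle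
    have : Nontrivial (N.map (indToModule T)) := by
      obtain ⟨m, hm, hm'⟩ := Set.not_subset.mp hle
      refine ⟨⟨⟨_, (LieSubmodule.mem_map _).mpr ⟨m, hm, rfl⟩⟩, 0, fun he => hm' ?_⟩⟩
      have := congrArg Subtype.val he
      simpa using this
    have htop := LieSubmodule.eq_top_of_isIrreducible ℂ L V (N.map (indToModule T))
    have hv : v₀ ∈ N.map (indToModule T) := htop ▸ LieSubmodule.mem_top v₀
    obtain ⟨m, hm, hmv⟩ := (LieSubmodule.mem_map _).mp hv
    exact h0 (opWeight_inf_lowPart hc (hmv ▸ map_mem_lowPart _ (hlow m hm)))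
  · let e : (LieInd p T ⧸ (indToModule T).ker) ≃ₗ[ℂ] V :=
      LinearMap.quotKerEquivOfSurjective (indToModule T : LieInd p T →ₗ[ℂ] V)
      (fun v => by
        have : v ∈ (indToModule T).range := hrange ▸ LieSubmodule.mem_top v
        simpa using this)
    have he : ∀ (x : L) (m : LieInd p T ⧸ (indToModule T).ker), e ⁅x, m⁆ = ⁅x, e m⁆ := by
      intro x m
      obtain ⟨m, rfl⟩ := LieSubmodule.Quotient.surjective_mk' _ m
      exact LieModuleHom.map_lie (indToModule T) x m
    refine ⟨{ e.symm with map_lie' := ?_ }⟩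
    intro x v
    change e.symm ⁅x, v⁆ = ⁅x, e.symm v⁆
    rw [LinearEquiv.symm_apply_eq, he, LinearEquiv.apply_symm_apply]

end Induced

end Irreducible

end EigenGrading


/-! ### Operators that satisfy the relations of `sl₂` -/

section Sl2

variable {V : Type*} [AddCommGroup V] [Module ℂ V]

/-- Operators with `[e, f] = h`, `[h, e] = 2e`, `[h, f] = -2f`. -/
structure IsSl2Ops (e f h : Module.End ℂ V) : Prop where
  ef : ∀ v, e (f v) = f (e v) + h v
  he : ∀ v, h (e v) = e (h v) + (2 : ℂ) • e v
  hf : ∀ v, h (f v) = f (h v) - (2 : ℂ) • f v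

/-- Local nilpotency. -/
def LocNilp (e : Module.End ℂ V) : Prop := ∀ v, ∃ N : ℕ, (e ^ N) v = 0

lemma pow_succ_apply (e : Module.End ℂ V) (t : ℕ) (v : V) : (e ^ (t + 1)) v = e ((e ^ t) v) := by
  rw [pow_succ', Module.End.mul_apply]

lemma pow_apply_eq_zero_of_le {e : Module.End ℂ V} {v : V} {s t : ℕ} (hst : s ≤ t)
    (h : (e ^ s) v = 0) : (e ^ t) v = 0 := by
  obtain ⟨k, rfl⟩ := Nat.exists_eq_add_of_le hst
  rw [add_comm, pow_add, Module.End.mul_apply, h, map_zero]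

lemma LocNilp.exists_max {e : Module.End ℂ V} (he : LocNilp e) {v : V} {s : ℕ}
    (hv : (e ^ s) v ≠ 0) : ∃ t, s ≤ t ∧ (e ^ t) v ≠ 0 ∧ (e ^ (t + 1)) v = 0 := by
  classical
  have hex := he v
  set N := Nat.find hex
  have hN : (e ^ N) v = 0 := Nat.find_spec hex
  have hsN : s < N := by
    by_contra hlt
    exact hv (pow_apply_eq_zero_of_le (not_lt.mp hlt) hN)
  refine ⟨N - 1, by omega, Nat.find_min hex (by omega), ?_⟩
  rwa [Nat.sub_add_cancel (by omega)]

namespace IsSl2Ops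

variable {e f h : Module.End ℂ V}

lemma symm (H : IsSl2Ops e f h) : IsSl2Ops f e (-h) where
  ef v := by rw [H.ef, LinearMap.neg_apply]; abel
  he v := by simp only [LinearMap.neg_apply, H.hf, map_neg]; abel
  hf v := by simp only [LinearMap.neg_apply, H.he, map_neg]; abel

lemma h_pow_e (H : IsSl2Ops e f h) {M : ℂ} {v : V} (hv : h v = M • v) (t : ℕ) :
    h ((e ^ t) v) = (M + 2 * t) • (e ^ t) v := by
  induction t with
  | zero => simp [hv]
  | succ t ih =>
    rw [pow_succ', Module.End.mul_apply, H.he, ih, map_smul]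
    push_cast
    module

lemma h_pow_f (H : IsSl2Ops e f h) {M : ℂ} {v : V} (hv : h v = M • v) (t : ℕ) :
    h ((f ^ t) v) = (M - 2 * t) • (f ^ t) v := by
  have := H.symm.h_pow_e (M := -M) (v := v) (by simp [hv]) t
  rw [LinearMap.neg_apply, neg_eq_iff_eq_neg] at this
  rw [this]
  module

lemma pow_e_f (H : IsSl2Ops e f h) {M : ℂ} {v : V} (hv : h v = M • v) (t : ℕ) :
    (e ^ (t + 1)) (f v) = f ((e ^ (t + 1)) v) + ((t + 1) * (M + t)) • (e ^ t) v := by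
  induction t with
  | zero => simp [H.ef, hv]
  | succ t ih =>
    rw [pow_succ_apply e (t + 1), ih, map_add, H.ef, map_smul, H.h_pow_e hv, ← pow_succ_apply,
      ← pow_succ_apply]
    push_cast
    module

lemma pow_e_f_ne_zero (H : IsSl2Ops e f h) (he : LocNilp e) {M : ℝ} (hM : 0 < M) {v : V}
    (hv : h v = (M : ℂ) • v) {s : ℕ} (hs : (e ^ s) v ≠ 0) : (e ^ (s + 1)) (f v) ≠ 0 := by
  obtain ⟨t, hst, h1, h2⟩ := he.exists_max hs
  intro h0
  have h3 := pow_apply_eq_zero_of_le (Nat.succ_le_succ hst) h0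
  rw [Nat.succ_eq_add_one, H.pow_e_f hv, h2, map_zero, zero_add, smul_eq_zero] at h3
  rcases h3 with h3 | h3
  · have : ((t + 1 : ℝ) * (M + t)) = 0 := by exact_mod_cast h3
    have : 0 < ((t + 1 : ℝ) * (M + t)) := by positivity
    linarith
  · exact h1 h3

lemma f_ne_zero (H : IsSl2Ops e f h) (he : LocNilp e) {M : ℝ} (hM : 0 < M) {v : V}
    (hv : h v = (M : ℂ) • v) (h0 : v ≠ 0) : f v ≠ 0 := by
  intro hf
  have := H.pow_e_f_ne_zero he hM hv (s := 0) (by simpa using h0)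
  rw [hf, map_zero] at this
  exact this rfl

lemma e_pow_f_prim (H : IsSl2Ops e f h) {M : ℂ} {v : V} (hv : h v = M • v) (hev : e v = 0)
    (t : ℕ) : e ((f ^ (t + 1)) v) = ((t + 1) * (M - t)) • (f ^ t) v := by
  induction t with
  | zero => simp [H.ef, hv, hev]
  | succ t ih =>
    rw [pow_succ_apply f (t + 1), H.ef, ih, map_smul, H.h_pow_f hv, ← pow_succ_apply]
    push_cast
    module

lemma exists_nat (H : IsSl2Ops e f h) (hf : LocNilp f) {M : ℂ} {v : V} (hv : h v = M • v)
    (hev : e v = 0) (h0 : v ≠ 0) : ∃ N : ℕ, M = N ∧ (f ^ (N + 1)) v = 0 := by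
  obtain ⟨t, -, h1, h2⟩ := hf.exists_max (v := v) (s := 0) (by simpa using h0)
  refine ⟨t, ?_, h2⟩
  have h3 := H.e_pow_f_prim hv hev t
  rw [h2, map_zero, eq_comm, smul_eq_zero] at h3
  rcases (mul_eq_zero.mp (h3.resolve_right h1)) with h4 | h4
  · exact absurd h4 (Nat.cast_add_one_ne_zero t)
  · exact sub_eq_zero.mp h4

lemma exists_int (H : IsSl2Ops e f h) (he : LocNilp e) (hf : LocNilp f) {M : ℂ} {v : V}
    (hv : h v = M • v) (h0 : v ≠ 0) : ∃ z : ℤ, M = z := by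
  obtain ⟨t, -, h1, h2⟩ := he.exists_max (v := v) (s := 0) (by simpa using h0)
  obtain ⟨N, hN, -⟩ := H.exists_nat hf (H.h_pow_e hv t)
    (by rw [← Module.End.mul_apply, ← pow_succ']; exact h2) h1
  refine ⟨(N : ℤ) - 2 * t, ?_⟩
  push_cast
  linear_combination hN

lemma pow_e_pow_f (H : IsSl2Ops e f h) {N : ℕ} {v : V} (hv : h v = (N : ℂ) • v) (hev : e v = 0) :
    (e ^ N) ((f ^ N) v) = ((N.factorial : ℂ) ^ 2) • v := by
  have key : ∀ t ≤ N, (e ^ t) ((f ^ t) v) =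
      ((t.factorial : ℂ) * N.descFactorial t) • v := by
    intro t ht
    induction t with
    | zero => simp
    | succ t ih =>
      rw [pow_succ, Module.End.mul_apply, H.e_pow_f_prim hv hev, map_smul, ih (by omega), smul_smul,
        Nat.factorial_succ, Nat.descFactorial_succ]
      congr 1
      rw [Nat.cast_mul, Nat.cast_mul, Nat.cast_sub (by omega)]
      push_cast
      ring
  rw [key N le_rfl, Nat.descFactorial_self, sq]

end IsSl2Ops

end Sl2


/-! ### Weights of a finite-dimensional Lie algebra -/

section Diagonalizable

/-- A subspace that is stable under a commuting family of semisimple operators is spanned by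
simultaneous eigenvectors. -/
lemma Submodule.le_iSup_inf_iInf_eigenspace {ι W : Type*} [AddCommGroup W] [Module ℂ W]
    [FiniteDimensional ℂ W] (f : ι → Module.End ℂ W) (hc : ∀ i j, Commute (f i) (f j))
    (hf : ∀ i, (f i).IsSemisimple) (p : Submodule ℂ W) (hp : ∀ i, ∀ x ∈ p, f i x ∈ p) :
    p ≤ ⨆ χ : ι → ℂ, p ⊓ ⨅ i, (f i).eigenspace (χ i) := by
  have h1 := Module.End.iSup_iInf_maxGenEigenspace_eq_top_of_iSup_maxGenEigenspace_eq_top_of_commute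
    (fun i => (f i).restrict (hp i)) (fun i j _ => by
      ext x
      exact DFunLike.congr_fun (hc i j).eq (x : W))
    (fun i => Module.End.iSup_maxGenEigenspace_eq_top _)
  have h2 := congrArg (Submodule.map p.subtype) h1
  rw [Submodule.map_top, Submodule.range_subtype, Submodule.map_iSup] at h2
  refine h2.ge.trans (iSup_mono fun χ => ?_)
  rintro _ ⟨x, hx, rfl⟩
  refine ⟨x.2, ?_⟩
  simp only [Submodule.mem_iInf, SetLike.mem_coe] at hx ⊢
  intro i
  have h3 := hx i
  have h4 : (x : W) ∈ (f i).maxGenEigenspace (χ i) := by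
    rw [Module.End.mem_maxGenEigenspace] at h3 ⊢
    obtain ⟨k, hk⟩ := h3
    refine ⟨k, ?_⟩
    have h5 : ∀ (k : ℕ) (y : p), ((((f i).restrict (hp i) - χ i • 1) ^ k) y : W) =
        ((f i - χ i • 1) ^ k) (y : W) := by
      intro k
      induction k with
      | zero => intro y; simp
      | succ k ih =>
        intro y
        rw [pow_succ, Module.End.mul_apply, ih, pow_succ, Module.End.mul_apply]
        rfl
    rw [← h5, hk]
    rfl
  rwa [(hf i).isFinitelySemisimple.maxGenEigenspace_eq_eigenspace] at h4

end Diagonalizable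

namespace TwistData

variable {n : ℕ} {g : Type*} [LieRing g] [LieAlgebra ℂ g] (D : TwistData n g)
variable {h₀ : LieSubalgebra ℂ D.fixed}

lemma exists_dual_of_mem {χ : h₀ → ℂ} {v : g} (hv : ∀ x : h₀, ⁅((x : D.fixed) : g), v⁆ = χ x • v)
    (h0 : v ≠ 0) : ∃ α : Module.Dual ℂ h₀, ∀ x, χ x = α x := by
  refine ⟨⟨⟨χ, fun x y => ?_⟩, fun a x => ?_⟩, fun x => rfl⟩
  · have := hv (x + y)
    rw [show (((x + y : h₀) : D.fixed) : g) = ((x : D.fixed) : g) + ((y : D.fixed) : g) from rfl,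
      add_lie, hv, hv, ← add_smul] at this
    exact (smul_left_injective ℂ h0 this).symm
  · have := hv (a • x)
    rw [show (((a • x : h₀) : D.fixed) : g) = a • ((x : D.fixed) : g) from rfl,
      smul_lie, hv, smul_smul] at this
    exact (smul_left_injective ℂ h0 this).symm

section

variable [FiniteDimensional ℂ g] [LieAlgebra.IsSimple ℂ g]
variable [LieAlgebra.IsSimple ℂ D.fixed] [h₀.IsCartanSubalgebra]
variable {h : LieSubalgebra ℂ g} [h.IsCartanSubalgebra]

lemma cartan_lie_cartan (x y : h₀) : ⁅((x : D.fixed) : g), ((y : D.fixed) : g)⁆ = 0 := by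
  have : ⁅x, y⁆ = 0 := trivial_lie_zero h₀ h₀ x y
  have h2 := congrArg (fun z : h₀ => ((z : D.fixed) : g)) this
  simpa using h2

lemma grad_le_iSup (hh : ∀ x : h₀, ((x : D.fixed) : g) ∈ h) (k : Expo n) :
    D.grad k ≤ ⨆ α, D.gradRoot h₀ k α := by
  refine (Submodule.le_iSup_inf_iInf_eigenspace
    (fun x : h₀ => LieAlgebra.ad ℂ g ((x : D.fixed) : g)) ?_ ?_ (D.grad k) ?_).trans ?_
  · intro x y
    rw [commute_iff_lie_eq, ← LieHom.map_lie, D.cartan_lie_cartan, map_zero]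
  · intro x
    exact LieAlgebra.IsKilling.isSemisimple_ad_of_mem_isCartanSubalgebra (hh x)
  · intro x v hv
    have := D.lie_mem_grad (D.fixed_mem_grad (x : D.fixed)) hv
    simpa using this
  · refine iSup_le fun χ v hv => ?_
    by_cases h0 : v = 0
    · rw [h0]; exact zero_mem _
    have h1 : ∀ x : h₀, ⁅((x : D.fixed) : g), v⁆ = χ x • v := by
      intro x
      have := (Submodule.mem_iInf _).mp hv.2 x
      simpa [Module.End.mem_eigenspace_iff] using this
    obtain ⟨α, hα⟩ := D.exists_dual_of_mem h1 h0
    exact Submodule.mem_iSup_of_mem α ⟨hv.1, fun x => by rw [h1, hα]⟩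

lemma mem_posCone_or {α : Module.Dual ℂ h₀} (b : (D.roots h₀).Base) (hα : α ∈ D.enlargedRoots h₀) :
    α ∈ D.posCone b ∨ -α ∈ D.posCone b := by
  rcases hα with (hα | ⟨i, rfl⟩) | ⟨-, i, -, rfl⟩
  · rw [Set.mem_singleton_iff] at hα
    exact Or.inl (hα ▸ zero_mem _)
  · exact b.root_mem_or_neg_mem i
  · have h2 : (2 : ℂ) • (D.roots h₀).root i = (D.roots h₀).root i + (D.roots h₀).root i :=
      two_smul _ _
    rcases b.root_mem_or_neg_mem i with h1 | h1
    · exact Or.inl (h2 ▸ add_mem h1 h1)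
    · right
      rw [h2, neg_add]
      exact add_mem h1 h1

lemma finite_enlargedRoots : (D.enlargedRoots h₀).Finite := by
  refine ((Set.finite_singleton _).union (Set.finite_range _)).union
    ((Set.finite_range fun i => (2 : ℂ) • (D.roots h₀).root i).subset ?_)
  rintro _ ⟨-, i, -, rfl⟩
  exact ⟨i, rfl⟩

lemma exists_int_root_coroot (i j : h₀.root) :
    ∃ z : ℤ, (D.roots h₀).root i ((D.roots h₀).coroot j) = z := by
  obtain ⟨z, hz⟩ := (D.roots h₀).exists_value (S := ℤ) i j
  refine ⟨z, ?_⟩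
  rw [algebraMap_int_eq, eq_intCast] at hz
  rw [hz]
  rfl

lemma exists_int_of_mem_enlargedRoots {α : Module.Dual ℂ h₀} (hα : α ∈ D.enlargedRoots h₀)
    (j : h₀.root) : ∃ z : ℤ, α ((D.roots h₀).coroot j) = z := by
  rcases hα with (hα | ⟨i, rfl⟩) | ⟨-, i, -, rfl⟩
  · rw [Set.mem_singleton_iff] at hα
    exact ⟨0, by simp [hα]⟩
  · exact D.exists_int_root_coroot i j
  · obtain ⟨z, hz⟩ := D.exists_int_root_coroot i j
    exact ⟨2 * z, by rw [LinearMap.smul_apply, hz]; push_cast; rfl⟩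

variable (h₀) in
/-- Root vectors of `g(0̄, 0̄)` that span a copy of `sl₂`. -/
structure RootTriple (i : h₀.root) where
  X : g
  Y : g
  X_mem : X ∈ D.gradRoot h₀ 0 ((D.roots h₀).root i)
  Y_mem : Y ∈ D.gradRoot h₀ 0 (-(D.roots h₀).root i)
  lie_eq : ⁅X, Y⁆ = (((D.roots h₀).coroot i : D.fixed) : g)
  X_ne : X ≠ 0

variable (h₀) in
lemma exists_rootTriple (i : h₀.root) : Nonempty (D.RootTriple h₀ i) := by
  have hi : (i : LieModule.Weight ℂ h₀ D.fixed).IsNonZero := by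
    exact (Finset.mem_filter.mp i.2).2
  obtain ⟨H, e, f, ht, he, hf⟩ :=
    LieAlgebra.IsKilling.exists_isSl2Triple_of_weight_isNonZero hi
  have hH := IsSl2Triple.h_eq_coroot hi ht he hf
  refine ⟨⟨e, f, ⟨D.fixed_mem_grad e, fun x => ?_⟩, ⟨D.fixed_mem_grad f, fun x => ?_⟩, ?_, ?_⟩⟩
  · have := LieAlgebra.IsKilling.lie_eq_smul_of_mem_rootSpace he x
    exact congrArg Subtype.val this
  · have := LieAlgebra.IsKilling.lie_eq_smul_of_mem_rootSpace hf x
    exact congrArg Subtype.val this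
  · rw [LieAlgebra.IsKilling.rootSystem_coroot_apply, ← hH, ← ht.lie_e_f]
    rfl
  · intro h0
    exact ht.e_ne_zero (Subtype.ext h0)

variable {D} in
lemma RootTriple.exists_killingForm {i : h₀.root} (t : D.RootTriple h₀ i)
    (hh : ∀ x : h₀, ((x : D.fixed) : g) ∈ h) (hΔ : D.weightsOfG h₀ ⊆ D.enlargedRoots h₀) :
    ∃ q : ℝ, 0 < q ∧ killingForm ℂ g t.X t.Y = q := by
  set H : g := (((D.roots h₀).coroot i : D.fixed) : g) with hHdef
  have hHX : ⁅H, t.X⁆ = (2 : ℂ) • t.X := by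
    rw [hHdef, t.X_mem.2]
    congr 1
    have := (D.roots h₀).root_coroot_two i
    exact this
  have hHY : ⁅H, t.Y⁆ = -(2 : ℂ) • t.Y := by
    rw [hHdef, t.Y_mem.2]
    congr 1
    have := (D.roots h₀).root_coroot_two i
    rw [LinearMap.neg_apply]
    exact congrArg Neg.neg this
  have h1 : killingForm ℂ g H H = 2 * killingForm ℂ g t.X t.Y := by
    have h2 : killingForm ℂ g ⁅t.X, t.Y⁆ H = killingForm ℂ g t.X ⁅t.Y, H⁆ :=
      LieModule.traceForm_apply_lie_apply ℂ g g _ _ _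
    rw [t.lie_eq, ← lie_skew, hHY, ← neg_smul, neg_neg, map_smul, smul_eq_mul] at h2
    exact h2
  let Hh : h := ⟨H, hh _⟩
  have h2 : killingForm ℂ g H H = ∑ χ : LieModule.Weight ℂ h g,
      Module.finrank ℂ (LieModule.genWeightSpace g χ) • (χ Hh * χ Hh) := by
    rw [← LieModule.traceForm_eq_sum_finrank_nsmul_mul ℂ h g Hh Hh]
    rfl
  have h3 : ∀ χ : LieModule.Weight ℂ h g, ∃ z : ℤ, χ Hh = z := by
    intro χ
    obtain ⟨v, hv, hv0⟩ := χ.exists_ne_zero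
    have hv' := LieAlgebra.IsKilling.lie_eq_smul_of_mem_rootSpace (H := h) (α := χ) hv
    let α : Module.Dual ℂ h₀ :=
      { toFun := fun x => χ ⟨_, hh x⟩
        map_add' := fun x y => map_add (χ.toLinear) ⟨_, hh x⟩ ⟨_, hh y⟩
        map_smul' := fun a x => map_smul (χ.toLinear) a ⟨_, hh x⟩ }
    have hα : α ∈ D.weightsOfG h₀ := by
      intro hb
      apply hv0
      rw [← Submodule.mem_bot ℂ, ← hb]
      exact fun x => hv' ⟨_, hh x⟩
    exact D.exists_int_of_mem_enlargedRoots (hΔ hα) i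
  choose z hz using h3
  set S : ℕ := ∑ χ : LieModule.Weight ℂ h g,
      Module.finrank ℂ (LieModule.genWeightSpace g χ) * (z χ).natAbs ^ 2 with hS
  have h4 : killingForm ℂ g H H = S := by
    rw [h2, hS]
    push_cast
    refine Finset.sum_congr rfl fun χ _ => ?_
    rw [hz, nsmul_eq_mul]
    have : (((z χ).natAbs : ℂ)) ^ 2 = (z χ : ℂ) ^ 2 := by
      rw [Nat.cast_natAbs]
      exact_mod_cast congrArg (Int.cast : ℤ → ℂ) (sq_abs (z χ))
    rw [this, sq]
  have h5 : S ≠ 0 := by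
    intro h0
    have h6 : killingForm ℂ g t.X t.Y = 0 := by
      rw [h4, h0, Nat.cast_zero] at h1
      simpa using h1.symm
    have h7 : ∀ χ : LieModule.Weight ℂ h g, χ Hh = 0 := by
      intro χ
      have h8 := (Finset.sum_eq_zero_iff.mp h0) χ (Finset.mem_univ _)
      have h9 : Module.finrank ℂ (LieModule.genWeightSpace g χ) ≠ 0 := by
        intro h10
        obtain ⟨v, hv, hv0⟩ := χ.exists_ne_zero
        have h11 := Module.finrank_zero_iff.mp h10
        exact hv0 (congrArg Subtype.val (h11.elim (⟨v, hv⟩ : LieModule.genWeightSpace g χ) 0))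
      have h11 := (mul_eq_zero.mp h8).resolve_left h9
      have : z χ = 0 := by simpa using h11
      rw [hz, this, Int.cast_zero]
    have h8 : (Hh : g) = 0 := by
      have : Hh = 0 := by
        have h12 : ∀ χ : Module.Dual ℂ h, χ Hh = 0 := by
          intro χ
          have : χ ∈ Submodule.span ℂ (Set.range (LieModule.Weight.toLinear ℂ h g)) := by
            rw [LieAlgebra.IsKilling.span_weight_eq_top]; trivial
          induction this using Submodule.span_induction with
          | zero => rfl
          | add a b _ _ ha hb => rw [LinearMap.add_apply, ha, hb, add_zero]
          | smul c a _ ha => rw [LinearMap.smul_apply, ha, smul_zero]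
          | mem a ha =>
            obtain ⟨χ, rfl⟩ := ha
            exact h7 χ
        exact (Module.forall_dual_apply_eq_zero_iff ℂ Hh).mp h12
      rw [this]
      rfl
    have h9 : H = 0 := h8
    rw [h9, zero_lie, eq_comm, smul_eq_zero] at hHX
    exact hHX.elim two_ne_zero t.X_ne
  refine ⟨(S : ℝ) / 2, by positivity, ?_⟩
  rw [h4] at h1
  push_cast
  linear_combination -h1 / 2

end

end TwistData


/-! ### The grading of `τ` by heights -/

namespace TwistData

variable {n : ℕ} {g : Type*} [LieRing g] [LieAlgebra ℂ g] (D : TwistData n g)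

section Elements

lemma coe_lie_loopEl_loopEl (k l : Expo n) (X Y : g) (hX : X ∈ D.grad k) (hY : Y ∈ D.grad l) :
    ((⁅D.loopEl k X hX, D.loopEl l Y hY⁆ : D.tau) : D.Full) =
      FullToroidal.loopEl (k + l) ⁅X, Y⁆ +
        FullToroidal.centerEl (k + l) ((D.c * killingForm ℂ g X Y) • k.toCoef) :=
  FullToroidal.lie_loopEl_loopEl k l X Y

lemma lie_derEl_loopEl (r k : Expo n) (hr : r ∈ D.lattice) (u : Coef n) (X : g)
    (hX : X ∈ D.grad k) :
    ⁅D.derEl r hr u, D.loopEl k X hX⁆ = u.dot k.toCoef • D.loopEl (r + k) X (D.mem_grad_add hr hX) := by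
  refine Subtype.ext ((FullToroidal.lie_derEl_loopEl r k u X).trans ?_)
  rw [FullToroidal.loopEl_smul]
  rfl

lemma lie_derEl_centerEl (r s : Expo n) (hr : r ∈ D.lattice) (hs : s ∈ D.lattice) (u w : Coef n) :
    ⁅D.derEl r hr u, D.centerEl s hs w⁆ =
      D.centerEl (r + s) (add_mem hr hs) (u.dot s.toCoef • w + u.dot w • r.toCoef) :=
  Subtype.ext (FullToroidal.lie_derEl_centerEl r s u w)

lemma lie_derEl_derEl (r s : Expo n) (hr : r ∈ D.lattice) (hs : s ∈ D.lattice) (u v : Coef n) :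
    ⁅D.derEl r hr u, D.derEl s hs v⁆ =
      D.derEl (r + s) (add_mem hr hs) (u.dot s.toCoef • v - v.dot r.toCoef • u) +
      D.centerEl (r + s) (add_mem hr hs) ((-(D.μ * (u.dot s.toCoef * v.dot r.toCoef))
        + D.ν * (u.dot r.toCoef * v.dot s.toCoef)) • r.toCoef) :=
  Subtype.ext (FullToroidal.lie_derEl_derEl r s u v)

lemma lie_loopEl_centerEl (k s : Expo n) (X : g) (hX : X ∈ D.grad k) (hs : s ∈ D.lattice)
    (w : Coef n) : ⁅D.loopEl k X hX, D.centerEl s hs w⁆ = 0 :=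
  Subtype.ext (FullToroidal.lie_loopEl_centerEl k s X w)

lemma lie_centerEl_centerEl (r s : Expo n) (hr : r ∈ D.lattice) (hs : s ∈ D.lattice)
    (u w : Coef n) : ⁅D.centerEl r hr u, D.centerEl s hs w⁆ = 0 :=
  Subtype.ext (FullToroidal.lie_centerEl_centerEl r s u w)

lemma loopEl_add (k : Expo n) (X Y : g) (hX : X ∈ D.grad k) (hY : Y ∈ D.grad k) :
    D.loopEl k (X + Y) (add_mem hX hY) = D.loopEl k X hX + D.loopEl k Y hY :=
  Subtype.ext (by
    apply FullToroidal.ext' <;> simp [loopEl, FullToroidal.loopEl])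

lemma loopEl_smul (k : Expo n) (a : ℂ) (X : g) (hX : X ∈ D.grad k) :
    D.loopEl k (a • X) (Submodule.smul_mem _ a hX) = a • D.loopEl k X hX :=
  Subtype.ext (FullToroidal.loopEl_smul k a X)

lemma loopEl_zero (k : Expo n) (h0 : (0 : g) ∈ D.grad k) : D.loopEl k 0 h0 = 0 :=
  Subtype.ext (by apply FullToroidal.ext' <;> simp [loopEl, FullToroidal.loopEl])

lemma centerEl_add (s : Expo n) (hs : s ∈ D.lattice) (w w' : Coef n) :
    D.centerEl s hs (w + w') = D.centerEl s hs w + D.centerEl s hs w' :=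
  Subtype.ext (by
    apply FullToroidal.ext' <;> simp [centerEl, FullToroidal.centerEl, kahler_add])

lemma centerEl_smul (s : Expo n) (hs : s ∈ D.lattice) (a : ℂ) (w : Coef n) :
    D.centerEl s hs (a • w) = a • D.centerEl s hs w :=
  Subtype.ext (by
    apply FullToroidal.ext' <;> simp [centerEl, FullToroidal.centerEl, kahler_smul])

lemma centerEl_self (s : Expo n) (hs : s ∈ D.lattice) : D.centerEl s hs s.toCoef = 0 :=
  Subtype.ext (by
    apply FullToroidal.ext' <;> simp [centerEl, FullToroidal.centerEl, kahler_self])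

lemma derEl_add (s : Expo n) (hs : s ∈ D.lattice) (w w' : Coef n) :
    D.derEl s hs (w + w') = D.derEl s hs w + D.derEl s hs w' :=
  Subtype.ext (by apply FullToroidal.ext' <;> simp [derEl, FullToroidal.derEl])

lemma derEl_smul (s : Expo n) (hs : s ∈ D.lattice) (a : ℂ) (w : Coef n) :
    D.derEl s hs (a • w) = a • D.derEl s hs w :=
  Subtype.ext (by apply FullToroidal.ext' <;> simp [derEl, FullToroidal.derEl])

lemma genSpan_induction {S : Expo n → Set g} {F : Set (Expo n)}
    (hS : ∀ k X, X ∈ S k → X ∈ D.grad k) (hF : ∀ s ∈ F, s ∈ D.lattice) {p : D.tau → Prop}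
    (zero : p 0) (add : ∀ x y, p x → p y → p (x + y)) (smul : ∀ (a : ℂ) x, p x → p (a • x))
    (loop : ∀ k X (hX : X ∈ S k), p (D.loopEl k X (hS k X hX)))
    (center : ∀ s (hs : s ∈ F) w, p (D.centerEl s (hF s hs) w))
    (der : ∀ s (hs : s ∈ F) u, p (D.derEl s (hF s hs) u)) (x : D.tau)
    (hx : (x : D.Full) ∈ (FullToroidal.genSpan S F : Submodule ℂ D.Full)) : p x := by
  have key : ∀ y : D.Full, y ∈ (FullToroidal.genSpan S F : Submodule ℂ D.Full) →
      ∃ hy : y ∈ D.tau, p ⟨y, hy⟩ := by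
    intro y hy
    induction hy using Submodule.span_induction with
    | zero => exact ⟨zero_mem _, zero⟩
    | add x y _ _ hx hy =>
      obtain ⟨hx, hx'⟩ := hx
      obtain ⟨hy, hy'⟩ := hy
      exact ⟨add_mem hx hy, add _ _ hx' hy'⟩
    | smul a x _ hx =>
      obtain ⟨hx, hx'⟩ := hx
      exact ⟨D.tau.smul_mem a hx, smul a _ hx'⟩
    | mem y hy =>
      rcases hy with (⟨k, X, hX, rfl⟩ | ⟨s, hs, w, rfl⟩) | ⟨s, hs, u, rfl⟩
      · exact ⟨_, loop k X hX⟩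
      · exact ⟨_, center s hs w⟩
      · exact ⟨_, der s hs u⟩
  exact (key x hx).2

lemma rootPart_induction {h₀ : LieSubalgebra ℂ D.fixed} {P : ℤ → Module.Dual ℂ h₀ → Prop}
    {p : D.tau → Prop}
    (zero : p 0) (add : ∀ x y, p x → p y → p (x + y)) (smul : ∀ (a : ℂ) x, p x → p (a • x))
    (loop : ∀ k α X (hX : X ∈ D.gradRoot h₀ k α), P (k 0) α → p (D.loopEl k X hX.1))
    (center : ∀ s (hs : s ∈ D.lattice) w, P (s 0) 0 → p (D.centerEl s hs w))
    (der : ∀ s (hs : s ∈ D.lattice) u, P (s 0) 0 → p (D.derEl s hs u)) (x : D.tau)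
    (hx : x ∈ D.rootPart h₀ P) : p x :=
  D.genSpan_induction (S := fun k => {X | ∃ α, P (k 0) α ∧ X ∈ D.gradRoot h₀ k α})
    (F := {s | s ∈ D.lattice ∧ P (s 0) 0}) (fun _ _ hX => by obtain ⟨α, -, hX⟩ := hX; exact hX.1)
    (fun _ hs => hs.1) zero add smul
    (fun k X hX => by obtain ⟨α, h1, hX⟩ := hX; exact loop k α X hX h1)
    (fun s hs w => center s hs.1 w hs.2) (fun s hs w => der s hs.1 w hs.2) x hx

lemma loopEl_mem_rootPart {h₀ : LieSubalgebra ℂ D.fixed} {P : ℤ → Module.Dual ℂ h₀ → Prop}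
    {k : Expo n} {α : Module.Dual ℂ h₀} {X : g} (hX : X ∈ D.gradRoot h₀ k α) (hP : P (k 0) α) :
    D.loopEl k X hX.1 ∈ D.rootPart h₀ P :=
  FullToroidal.loopEl_mem_genSpan ⟨α, hP, hX⟩

lemma centerEl_mem_rootPart {h₀ : LieSubalgebra ℂ D.fixed} {P : ℤ → Module.Dual ℂ h₀ → Prop}
    {s : Expo n} (hs : s ∈ D.lattice) (w : Coef n) (hP : P (s 0) 0) :
    D.centerEl s hs w ∈ D.rootPart h₀ P :=
  FullToroidal.centerEl_mem_genSpan (E := {s | s ∈ D.lattice ∧ P (s 0) 0}) ⟨hs, hP⟩ _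

lemma derEl_mem_rootPart {h₀ : LieSubalgebra ℂ D.fixed} {P : ℤ → Module.Dual ℂ h₀ → Prop}
    {s : Expo n} (hs : s ∈ D.lattice) (w : Coef n) (hP : P (s 0) 0) :
    D.derEl s hs w ∈ D.rootPart h₀ P :=
  FullToroidal.derEl_mem_genSpan (E := {s | s ∈ D.lattice ∧ P (s 0) 0}) ⟨hs, hP⟩ _

@[simp] lemma Coef_dot_zero (u : Coef n) : u.dot (Expo.toCoef 0) = 0 := by
  simp [Coef.dot, Expo.toCoef]

@[simp] lemma single_dot (i : Fin (n + 1)) (w : Coef n) :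
    Coef.dot (Pi.single i 1) w = w i := by
  simp [Coef.dot, Pi.single_apply]

lemma toCoef_zero : (0 : Expo n).toCoef = 0 := by
  ext i; simp [Expo.toCoef]

variable {h₀ : LieSubalgebra ℂ D.fixed}

lemma lie_cartanEl_loopEl (x : h₀) {k : Expo n} {α : Module.Dual ℂ h₀} {X : g}
    (hX : X ∈ D.gradRoot h₀ k α) :
    ⁅D.cartanEl h₀ x, D.loopEl k X hX.1⁆ = α x • D.loopEl k X hX.1 := by
  refine Subtype.ext ?_
  rw [cartanEl, D.coe_lie_loopEl_loopEl, hX.2 x, zero_add, toCoef_zero, smul_zero,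
    FullToroidal.loopEl_smul]
  have : (FullToroidal.centerEl k 0 : D.Full) = 0 := by
    apply FullToroidal.ext' <;> simp [FullToroidal.centerEl, kahler]
  rw [this, add_zero]
  rfl

lemma lie_cartanEl_centerEl (x : h₀) {s : Expo n} (hs : s ∈ D.lattice) (w : Coef n) :
    ⁅D.cartanEl h₀ x, D.centerEl s hs w⁆ = 0 :=
  D.lie_loopEl_centerEl _ _ _ _ _ _

lemma lie_cartanEl_derEl (x : h₀) {s : Expo n} (hs : s ∈ D.lattice) (u : Coef n) :
    ⁅D.cartanEl h₀ x, D.derEl s hs u⁆ = 0 := by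
  rw [← lie_skew, cartanEl, D.lie_derEl_loopEl, Coef_dot_zero, zero_smul, neg_zero]

lemma lie_d_loopEl (i : Fin (n + 1)) {k : Expo n} {X : g} (hX : X ∈ D.grad k) :
    ⁅D.d i, D.loopEl k X hX⁆ = (k i : ℂ) • D.loopEl k X hX := by
  rw [d, D.lie_derEl_loopEl, single_dot]
  simp only [zero_add]
  rfl

lemma lie_d_centerEl (i : Fin (n + 1)) {s : Expo n} (hs : s ∈ D.lattice) (w : Coef n) :
    ⁅D.d i, D.centerEl s hs w⁆ = (s i : ℂ) • D.centerEl s hs w := by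
  rw [d, D.lie_derEl_centerEl, single_dot, ← centerEl_smul]
  simp only [zero_add, toCoef_zero, smul_zero, add_zero]
  rfl

lemma lie_d_derEl (i : Fin (n + 1)) {s : Expo n} (hs : s ∈ D.lattice) (u : Coef n) :
    ⁅D.d i, D.derEl s hs u⁆ = (s i : ℂ) • D.derEl s hs u := by
  rw [d, D.lie_derEl_derEl, single_dot, ← derEl_smul, toCoef_zero, smul_zero]
  have : D.centerEl (0 + s) (add_mem (zero_mem _) hs) 0 = 0 := by
    have := D.centerEl_smul (0 + s) (add_mem (zero_mem _) hs) 0 0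
    simpa using this
  rw [this, add_zero]
  have h2 : u.dot 0 = 0 := by simp [Coef.dot]
  simp only [zero_add, h2, zero_smul, sub_zero]
  rfl

end Elements

section Height

variable [FiniteDimensional ℂ g] [LieAlgebra.IsSimple ℂ g]
variable [LieAlgebra.IsSimple ℂ D.fixed] {h₀ : LieSubalgebra ℂ D.fixed} [h₀.IsCartanSubalgebra]
variable {h : LieSubalgebra ℂ g} [h.IsCartanSubalgebra]
variable (b : (D.roots h₀).Base)

lemma exists_rho : ∃ ρ : h₀, ∀ i ∈ b.support, (D.roots h₀).root i ρ = 1 := by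
  have hli : LinearIndependent ℂ (fun i : b.support => (D.roots h₀).root i) :=
    b.linearIndepOn_root
  obtain ⟨φ, hφ⟩ := LinearMap.exists_extend
    ((Finsupp.linearCombination ℂ (fun _ : b.support => (1 : ℂ))).comp hli.repr)
  refine ⟨(Module.evalEquiv ℂ h₀).symm φ, fun i hi => ?_⟩
  rw [Module.apply_evalEquiv_symm_apply]
  have h1 := DFunLike.congr_fun hφ ⟨(D.roots h₀).root i, Submodule.subset_span ⟨⟨i, hi⟩, rfl⟩⟩
  rw [LinearMap.comp_apply, LinearMap.comp_apply, hli.repr_eq_single ⟨i, hi⟩ _ rfl,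
    Finsupp.linearCombination_single, smul_eq_mul, one_mul] at h1
  exact h1

/-- An element `ρ` of `h(0)` on which the simple roots have value one, and a bound for the heights
of the weights of `g`. -/
structure HeightData where
  ρ : h₀
  ρ_root : ∀ i ∈ b.support, (D.roots h₀).root i ρ = 1
  bound : ℕ
  lt_bound : ∀ α ∈ D.enlargedRoots h₀, ∃ z : ℤ, α ρ = z ∧ |z| < bound

variable {D b}

lemma exists_nat_of_mem_posCone {ρ : h₀} (hρ : ∀ i ∈ b.support, (D.roots h₀).root i ρ = 1)
    {α : Module.Dual ℂ h₀} (hα : α ∈ D.posCone b) : ∃ m : ℕ, α ρ = m ∧ (m = 0 → α = 0) := by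
  induction hα using AddSubmonoid.closure_induction with
  | mem x hx =>
    obtain ⟨i, hi, rfl⟩ := hx
    exact ⟨1, by rw [hρ i hi, Nat.cast_one], by simp⟩
  | zero => exact ⟨0, by simp, by simp⟩
  | add x y _ _ hx hy =>
    obtain ⟨m, hm, hm'⟩ := hx
    obtain ⟨k, hk, hk'⟩ := hy
    refine ⟨m + k, by simp [hm, hk], fun h0 => ?_⟩
    rw [hm' (by omega), hk' (by omega), add_zero]

variable (D b)

lemma exists_heightData : Nonempty (D.HeightData b) := by
  obtain ⟨ρ, hρ⟩ := D.exists_rho b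
  have h1 : ∀ α ∈ D.enlargedRoots h₀, ∃ z : ℤ, α ρ = z := by
    intro α hα
    rcases D.mem_posCone_or b hα with h2 | h2
    · obtain ⟨m, hm, -⟩ := exists_nat_of_mem_posCone hρ h2
      exact ⟨m, by simpa using hm⟩
    · obtain ⟨m, hm, -⟩ := exists_nat_of_mem_posCone hρ h2
      refine ⟨-m, ?_⟩
      rw [LinearMap.neg_apply] at hm
      push_cast
      linear_combination -hm
  choose! z hz using h1
  obtain ⟨B, hB⟩ := ((D.finite_enlargedRoots (h₀ := h₀)).image fun α => |z α|).bddAbove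
  refine ⟨⟨ρ, hρ, (B + 1).toNat, fun α hα => ⟨z α, hz α hα, ?_⟩⟩⟩
  have := hB ⟨α, hα, rfl⟩
  have h2 := Int.self_le_toNat (B + 1)
  simp only at this
  omega

namespace HeightData

variable {D b} (H : D.HeightData b)

/-- The element of `τ` that defines the grading by heights. -/
noncomputable def el : D.tau := D.cartanEl h₀ H.ρ + (H.bound : ℂ) • D.d 0

lemma lie_loopEl {k : Expo n} {α : Module.Dual ℂ h₀} {X : g} (hX : X ∈ D.gradRoot h₀ k α) :
    ⁅H.el, D.loopEl k X hX.1⁆ = (α H.ρ + H.bound * k 0) • D.loopEl k X hX.1 := by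
  rw [el, add_lie, smul_lie, D.lie_cartanEl_loopEl _ hX, D.lie_d_loopEl]
  module

lemma lie_centerEl {s : Expo n} (hs : s ∈ D.lattice) (w : Coef n) :
    ⁅H.el, D.centerEl s hs w⁆ = ((H.bound : ℂ) * s 0) • D.centerEl s hs w := by
  rw [el, add_lie, smul_lie, D.lie_cartanEl_centerEl, D.lie_d_centerEl]
  module

lemma lie_derEl {s : Expo n} (hs : s ∈ D.lattice) (w : Coef n) :
    ⁅H.el, D.derEl s hs w⁆ = ((H.bound : ℂ) * s 0) • D.derEl s hs w := by
  rw [el, add_lie, smul_lie, D.lie_cartanEl_derEl, D.lie_d_derEl]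
  module

lemma height_of_isPos {a : ℤ} {α : Module.Dual ℂ h₀} (hα : α ∈ D.enlargedRoots h₀)
    (hP : D.IsPos b a α) : ∃ i : ℕ, α H.ρ + H.bound * a = i + 1 := by
  rcases hP with hP | ⟨rfl, h0, hP⟩
  · obtain ⟨z, hz, hz'⟩ := H.lt_bound α hα
    have h1 : 0 < z + H.bound * a := by
      have := neg_abs_le z
      nlinarith
    refine ⟨(z + H.bound * a - 1).toNat, ?_⟩
    rw [hz]
    have h2 : (((z + H.bound * a - 1).toNat : ℤ) : ℂ) = ((z + H.bound * a - 1 : ℤ) : ℂ) := by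
      rw [Int.toNat_of_nonneg (by omega)]
    push_cast at h2
    rw [h2]
    ring
  · obtain ⟨m, hm, hm'⟩ := exists_nat_of_mem_posCone H.ρ_root hP
    have : m ≠ 0 := fun h => h0 (hm' h)
    refine ⟨m - 1, ?_⟩
    rw [hm, Nat.cast_sub (by omega)]
    push_cast
    ring

lemma height_of_not_isNonneg {a : ℤ} {α : Module.Dual ℂ h₀} (hα : α ∈ D.enlargedRoots h₀)
    (hP : ¬ D.IsNonneg b a α) : ∃ i : ℕ, α H.ρ + H.bound * a = -(i + 1) := by
  rw [isNonneg_iff] at hP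
  push Not at hP
  rcases hP.1.lt_or_eq with h1 | h1
  · obtain ⟨z, hz, hz'⟩ := H.lt_bound α hα
    have h1 : z + H.bound * a < 0 := by
      have := le_abs_self z
      nlinarith
    refine ⟨(-(z + H.bound * a) - 1).toNat, ?_⟩
    rw [hz]
    have h2 : (((-(z + H.bound * a) - 1).toNat : ℤ) : ℂ) = ((-(z + H.bound * a) - 1 : ℤ) : ℂ) := by
      rw [Int.toNat_of_nonneg (by omega)]
    push_cast at h2
    rw [h2]
    ring
  · obtain ⟨m, hm, hm'⟩ := exists_nat_of_mem_posCone H.ρ_root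
      ((D.mem_posCone_or b hα).resolve_left (hP.2 h1))
    have : m ≠ 0 := fun h => hP.2 h1 (by
      have := neg_eq_zero.mp (hm' h)
      rw [this]; exact zero_mem _)
    refine ⟨m - 1, ?_⟩
    rw [Nat.cast_sub (by omega), h1]
    rw [LinearMap.neg_apply] at hm
    push_cast
    linear_combination -hm

lemma mem_enlargedRoots (hΔ : D.weightsOfG h₀ ⊆ D.enlargedRoots h₀) {k : Expo n}
    {α : Module.Dual ℂ h₀} {X : g} (hX : X ∈ D.gradRoot h₀ k α) (h0 : X ≠ 0) :
    α ∈ D.enlargedRoots h₀ :=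
  hΔ fun hb => h0 ((Submodule.mem_bot ℂ).mp (hb ▸ hX.2))

lemma zero_mem_enlargedRoots : (0 : Module.Dual ℂ h₀) ∈ D.enlargedRoots h₀ := Or.inl (Or.inl rfl)

/-- The decomposition of `τ` by heights. -/
lemma isTriangular (hh : ∀ x : h₀, ((x : D.fixed) : g) ∈ h)
    (hΔ : D.weightsOfG h₀ ⊆ D.enlargedRoots h₀) :
    IsTriangular H.el (D.tauNonneg b) (D.tauPos b) where
  mem := by
    refine add_mem ?_ (Submodule.smul_mem _ _ ?_)
    · refine D.loopEl_mem_rootPart (P := D.IsNonneg b) (α := 0)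
        ⟨D.fixed_mem_grad _, fun x => ?_⟩ (Or.inl ⟨rfl, rfl⟩)
      rw [D.cartan_lie_cartan, LinearMap.zero_apply, zero_smul]
    · exact D.derEl_mem_rootPart (P := D.IsNonneg b) (zero_mem _) _ (Or.inl ⟨rfl, rfl⟩)
  pos_le := by
    intro x hx
    refine D.rootPart_induction (p := fun x => x ∈ ⨆ i : ℕ, opWeight H.el D.tau (i + 1))
      (zero_mem _) (fun _ _ => add_mem) (fun a _ => Submodule.smul_mem _ a) ?_ ?_ ?_ x hx
    · intro k α X hX hP
      by_cases h0 : X = 0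
      · subst h0
        rw [D.loopEl_zero]; exact zero_mem _
      obtain ⟨i, hi⟩ := H.height_of_isPos (mem_enlargedRoots hΔ hX h0) hP
      exact Submodule.mem_iSup_of_mem i (mem_opWeight.mpr (by rw [H.lie_loopEl hX, hi]))
    · intro s hs w hP
      obtain ⟨i, hi⟩ := H.height_of_isPos zero_mem_enlargedRoots hP
      rw [LinearMap.zero_apply, zero_add] at hi
      exact Submodule.mem_iSup_of_mem i (mem_opWeight.mpr (by rw [H.lie_centerEl, hi]))
    · intro s hs w hP
      obtain ⟨i, hi⟩ := H.height_of_isPos zero_mem_enlargedRoots hP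
      rw [LinearMap.zero_apply, zero_add] at hi
      exact Submodule.mem_iSup_of_mem i (mem_opWeight.mpr (by rw [H.lie_derEl, hi]))
  split := by
    intro z hz
    have key : ∀ z ∈ D.rootPart h₀ (D.IsNonneg b), z ∈ opWeight H.el D.tau 0 ⊔ D.tauPos b := by
      intro x hx
      refine D.rootPart_induction (p := fun x => x ∈ opWeight H.el D.tau 0 ⊔ D.tauPos b)
        (zero_mem _) (fun _ _ => add_mem) (fun a _ => Submodule.smul_mem _ a) ?_ ?_ ?_ x hx
      · rintro k α X hX (⟨h1, rfl⟩ | hP)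
        · refine Submodule.mem_sup_left (mem_opWeight.mpr ?_)
          rw [H.lie_loopEl hX, h1]
          simp
        · exact Submodule.mem_sup_right (D.loopEl_mem_rootPart hX hP)
      · rintro s hs w (⟨h1, -⟩ | hP)
        · refine Submodule.mem_sup_left (mem_opWeight.mpr ?_)
          rw [H.lie_centerEl, h1]
          simp
        · exact Submodule.mem_sup_right (D.centerEl_mem_rootPart hs w hP)
      · rintro s hs w (⟨h1, -⟩ | hP)
        · refine Submodule.mem_sup_left (mem_opWeight.mpr ?_)
          rw [H.lie_derEl, h1]
          simp
        · exact Submodule.mem_sup_right (D.derEl_mem_rootPart hs w hP)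
    obtain ⟨a, ha, c, hc, h1⟩ := Submodule.mem_sup.mp (key z hz)
    exact ⟨a, ha, c, hc, h1.symm⟩
  nonneg := by
    intro x
    have key : x ∈ (⨆ i : ℕ, opWeight H.el D.tau (-(i + 1))) ⊔ (D.tauNonneg b).toSubmodule := by
      refine D.genSpan_induction (S := fun k => (D.grad k : Set g)) (F := (D.lattice : Set (Expo n)))
        (p := fun x => x ∈ (⨆ i : ℕ, opWeight H.el D.tau (-(i + 1))) ⊔ (D.tauNonneg b).toSubmodule)
        (fun _ _ => id) (fun _ => id)
        (zero_mem _) (fun _ _ => add_mem) (fun a _ => Submodule.smul_mem _ a) ?_ ?_ ?_ x x.2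
      · intro k X hX
        have hX' := D.grad_le_iSup hh k hX
        have : ∃ hX : X ∈ D.grad k, D.loopEl k X hX ∈
            (⨆ i : ℕ, opWeight H.el D.tau (-(i + 1))) ⊔ (D.tauNonneg b).toSubmodule := by
          clear hX
          induction hX' using Submodule.iSup_induction' with
          | zero => exact ⟨zero_mem _, by rw [D.loopEl_zero]; exact zero_mem _⟩
          | add X Y _ _ h1 h2 =>
            obtain ⟨h1, h1'⟩ := h1
            obtain ⟨h2, h2'⟩ := h2
            exact ⟨add_mem h1 h2, by rw [D.loopEl_add _ _ _ h1 h2]; exact add_mem h1' h2'⟩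
          | mem α X hX =>
            refine ⟨hX.1, ?_⟩
            by_cases h0 : X = 0
            · subst h0
              rw [D.loopEl_zero]; exact zero_mem _
            by_cases hP : D.IsNonneg b (k 0) α
            · exact Submodule.mem_sup_right (D.loopEl_mem_rootPart hX hP)
            · obtain ⟨i, hi⟩ := H.height_of_not_isNonneg (mem_enlargedRoots hΔ hX h0) hP
              exact Submodule.mem_sup_left
                (Submodule.mem_iSup_of_mem i (mem_opWeight.mpr (by rw [H.lie_loopEl hX, hi])))
        exact this.2
      · intro s hs w
        by_cases hP : D.IsNonneg b (s 0) 0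
        · exact Submodule.mem_sup_right (D.centerEl_mem_rootPart hs w hP)
        · obtain ⟨i, hi⟩ := H.height_of_not_isNonneg zero_mem_enlargedRoots hP
          rw [LinearMap.zero_apply, zero_add] at hi
          exact Submodule.mem_sup_left
            (Submodule.mem_iSup_of_mem i (mem_opWeight.mpr (by rw [H.lie_centerEl, hi])))
      · intro s hs w
        by_cases hP : D.IsNonneg b (s 0) 0
        · exact Submodule.mem_sup_right (D.derEl_mem_rootPart hs w hP)
        · obtain ⟨i, hi⟩ := H.height_of_not_isNonneg zero_mem_enlargedRoots hP
          rw [LinearMap.zero_apply, zero_add] at hi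
          exact Submodule.mem_sup_left
            (Submodule.mem_iSup_of_mem i (mem_opWeight.mpr (by rw [H.lie_derEl, hi])))
    obtain ⟨a, ha, c, hc, h1⟩ := Submodule.mem_sup.mp key
    exact ⟨a, ha, c, hc, h1.symm⟩

end HeightData

end Height

end TwistData


/-! ### Existence of highest weight vectors -/

namespace TwistData

variable {n : ℕ} {g : Type*} [LieRing g] [LieAlgebra ℂ g] (D : TwistData n g)
variable {h₀ : LieSubalgebra ℂ D.fixed}
variable (V : Type*) [AddCommGroup V] [Module ℂ V] [LieRingModule D.tau V] [LieModule ℂ D.tau V]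

/-- `K₀` acts as the positive scalar `C₀`, and `K₁, …, Kₙ` act as zero. -/
structure HasLevel (C₀ : ℝ) : Prop where
  pos : 0 < C₀
  K_zero : ∀ v : V, ⁅D.K 0, v⁆ = (C₀ : ℂ) • v
  K_succ : ∀ (i : Fin n) (v : V), ⁅D.K i.succ, v⁆ = 0

/-- `w ↦ ∑ wᵢ t^s Kᵢ` as a linear map. -/
noncomputable def centerLin (s : Expo n) (hs : s ∈ D.lattice) : Coef n →ₗ[ℂ] D.tau where
  toFun := D.centerEl s hs
  map_add' := D.centerEl_add s hs
  map_smul' := D.centerEl_smul s hs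

variable {D V}

lemma HasLevel.lie_centerEl_zero {C₀ : ℝ} (hL : D.HasLevel V C₀) (w : Coef n) (v : V) :
    ⁅D.centerEl 0 (zero_mem _) w, v⁆ = (w 0 * C₀) • v := by
  have h1 : D.centerEl 0 (zero_mem _) w = ∑ i, w i • D.K i := by
    have h2 : w = ∑ i, w i • (Pi.single i 1 : Coef n) := by
      rw [← Finset.univ_sum_single w]
      refine Finset.sum_congr rfl fun i _ => ?_
      rw [Finset.univ_sum_single, ← Pi.single_smul, smul_eq_mul, mul_one]
    change D.centerLin 0 (zero_mem _) w = _
    conv_lhs => rw [h2]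
    simp only [map_sum, map_smul]
    rfl
  rw [h1, Fin.sum_univ_succ, add_lie, sum_lie, Finset.sum_eq_zero, smul_lie, hL.K_zero,
    smul_smul, add_zero]
  intro i _
  rw [smul_lie, hL.K_succ, smul_zero]

variable (V) in
/-- The weight space for the translate of `wt` by `s` with prescribed restriction `μ` to `h(0)`. -/
def shiftedWeight (wt : D.Weight h₀) (μ : Module.Dual ℂ h₀) (s : Expo n) : Submodule ℂ V :=
  D.weightSpace V ⟨μ, wt.onK, wt.onD + s.toCoef⟩

variable {wt : D.Weight h₀} {μ : Module.Dual ℂ h₀} {s : Expo n}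

lemma lie_mem_shiftedWeight_of {x : D.tau} {α : Module.Dual ℂ h₀} {k : Expo n}
    (h1 : ∀ y, ⁅D.cartanEl h₀ y, x⁆ = α y • x) (h2 : ∀ i, ⁅D.K i, x⁆ = 0)
    (h3 : ∀ i, ⁅D.d i, x⁆ = (k i : ℂ) • x) {v : V} (hv : v ∈ shiftedWeight V wt μ s) :
    ⁅x, v⁆ ∈ shiftedWeight V wt (μ + α) (s + k) := by
  refine ⟨fun y => ?_, fun i => ?_, fun i => ?_⟩
  · rw [leibniz_lie, h1, hv.1, smul_lie, lie_smul, ← add_smul, LinearMap.add_apply, add_comm]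
  · rw [leibniz_lie, h2, hv.2.1, zero_lie, lie_smul, zero_add]
  · rw [leibniz_lie, h3, hv.2.2, smul_lie, lie_smul, ← add_smul]
    congr 1
    simp only [Pi.add_apply, Expo.toCoef_add, Expo.toCoef]
    ring

lemma lie_K_loopEl (i : Fin (n + 1)) {k : Expo n} {X : g} (hX : X ∈ D.grad k) :
    ⁅D.K i, D.loopEl k X hX⁆ = 0 := by
  rw [← lie_skew, K, D.lie_loopEl_centerEl, neg_zero]

lemma lie_K_centerEl (i : Fin (n + 1)) {k : Expo n} (hk : k ∈ D.lattice) (w : Coef n) :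
    ⁅D.K i, D.centerEl k hk w⁆ = 0 := by
  rw [K, D.lie_centerEl_centerEl]

lemma lie_K_derEl (i : Fin (n + 1)) {k : Expo n} (hk : k ∈ D.lattice) (w : Coef n) :
    ⁅D.K i, D.derEl k hk w⁆ = 0 := by
  rw [← lie_skew, K, D.lie_derEl_centerEl, toCoef_zero]
  have h1 : w.dot 0 = 0 := by simp [Coef.dot]
  have h2 : D.centerEl (k + 0) (add_mem hk (zero_mem _)) k.toCoef = 0 := by
    simpa only [add_zero] using D.centerEl_self k hk
  rw [h1, zero_smul, zero_add, D.centerEl_smul, h2, smul_zero, neg_zero]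

lemma lie_loopEl_mem_shiftedWeight {k : Expo n} {α : Module.Dual ℂ h₀} {X : g}
    (hX : X ∈ D.gradRoot h₀ k α) {v : V} (hv : v ∈ shiftedWeight V wt μ s) :
    ⁅D.loopEl k X hX.1, v⁆ ∈ shiftedWeight V wt (μ + α) (s + k) :=
  lie_mem_shiftedWeight_of (fun y => D.lie_cartanEl_loopEl y hX)
    (fun i => lie_K_loopEl i hX.1) (fun i => D.lie_d_loopEl i hX.1) hv

lemma lie_centerEl_mem_shiftedWeight {k : Expo n} (hk : k ∈ D.lattice) (w : Coef n) {v : V}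
    (hv : v ∈ shiftedWeight V wt μ s) :
    ⁅D.centerEl k hk w, v⁆ ∈ shiftedWeight V wt μ (s + k) := by
  have := lie_mem_shiftedWeight_of (α := 0) (x := D.centerEl k hk w) (k := k)
    (fun y => by rw [D.lie_cartanEl_centerEl, LinearMap.zero_apply, zero_smul])
    (fun i => lie_K_centerEl i hk w) (fun i => D.lie_d_centerEl i hk w) hv
  rwa [add_zero] at this

lemma lie_derEl_mem_shiftedWeight {k : Expo n} (hk : k ∈ D.lattice) (w : Coef n) {v : V}
    (hv : v ∈ shiftedWeight V wt μ s) :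
    ⁅D.derEl k hk w, v⁆ ∈ shiftedWeight V wt μ (s + k) := by
  have := lie_mem_shiftedWeight_of (α := 0) (x := D.derEl k hk w) (k := k)
    (fun y => by rw [D.lie_cartanEl_derEl, LinearMap.zero_apply, zero_smul])
    (fun i => lie_K_derEl i hk w) (fun i => D.lie_d_derEl i hk w) hv
  rwa [add_zero] at this

lemma exists_pow_eq_zero_of_finiteDimensional {W : Type*} [AddCommGroup W] [Module ℂ W]
    {e : Module.End ℂ W} (he : LocNilp e) (p : Submodule ℂ W) [FiniteDimensional ℂ p] :
    ∃ t, ∀ v ∈ p, (e ^ t) v = 0 := by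
  obtain ⟨S, hS⟩ := (Submodule.fg_iff_finiteDimensional p).mpr inferInstance
  choose N hN using he
  refine ⟨S.sup N, fun v hv => ?_⟩
  rw [← hS] at hv
  have : Submodule.span ℂ (S : Set W) ≤ LinearMap.ker (e ^ S.sup N) :=
    Submodule.span_le.mpr fun w hw =>
      pow_apply_eq_zero_of_le (Finset.le_sup (f := N) hw) (hN w)
  exact this hv

section

variable [FiniteDimensional ℂ g] [LieAlgebra.IsSimple ℂ g]
variable [LieAlgebra.IsSimple ℂ D.fixed] [h₀.IsCartanSubalgebra]
variable {h : LieSubalgebra ℂ g} [h.IsCartanSubalgebra]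
variable {i : h₀.root}

lemma RootTriple.X_mem' (t : D.RootTriple h₀ i) {r : Expo n} (hr : r ∈ D.lattice) :
    t.X ∈ D.gradRoot h₀ r ((D.roots h₀).root i) :=
  ⟨by simpa using D.mem_grad_add hr t.X_mem.1, t.X_mem.2⟩

lemma RootTriple.Y_mem' (t : D.RootTriple h₀ i) {r : Expo n} (hr : r ∈ D.lattice) :
    t.Y ∈ D.gradRoot h₀ r (-(D.roots h₀).root i) :=
  ⟨by simpa using D.mem_grad_add hr t.Y_mem.1, t.Y_mem.2⟩

variable (V) in
/-- The operator `X ⊗ t^r`. -/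
noncomputable def RootTriple.opX (t : D.RootTriple h₀ i) {r : Expo n} (hr : r ∈ D.lattice) :
    Module.End ℂ V := LieModule.toEnd ℂ D.tau V (D.loopEl r t.X (t.X_mem' hr).1)

variable (V) in
/-- The operator `Y ⊗ t^r`. -/
noncomputable def RootTriple.opY (t : D.RootTriple h₀ i) {r : Expo n} (hr : r ∈ D.lattice) :
    Module.End ℂ V := LieModule.toEnd ℂ D.tau V (D.loopEl r t.Y (t.Y_mem' hr).1)

/-- The level of `K₀` with respect to the real root `α_i + m δ₀`, per unit of `m`. -/
noncomputable def RootTriple.level (t : D.RootTriple h₀ i) (C₀ : ℝ) : ℝ :=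
  D.c * (killingForm ℂ g t.X t.Y).re * C₀

lemma RootTriple.level_pos {C₀ : ℝ} (hL : D.HasLevel V C₀) (t : D.RootTriple h₀ i)
    (hh : ∀ x : h₀, ((x : D.fixed) : g) ∈ h) (hΔ : D.weightsOfG h₀ ⊆ D.enlargedRoots h₀) :
    0 < t.level C₀ := by
  obtain ⟨q, hq, h1⟩ := t.exists_killingForm hh hΔ
  have := D.c_pos
  have := hL.pos
  rw [level, h1, Complex.ofReal_re]
  positivity

lemma RootTriple.level_eq (t : D.RootTriple h₀ i) (C₀ : ℝ)
    (hh : ∀ x : h₀, ((x : D.fixed) : g) ∈ h) (hΔ : D.weightsOfG h₀ ⊆ D.enlargedRoots h₀) :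
    D.c * killingForm ℂ g t.X t.Y * C₀ = (t.level C₀ : ℂ) := by
  obtain ⟨q, hq, h1⟩ := t.exists_killingForm hh hΔ
  rw [level, h1, Complex.ofReal_re]
  push_cast
  rfl

lemma RootTriple.root_coroot (i : h₀.root) :
    (D.roots h₀).root i ((D.roots h₀).coroot i) = 2 := (D.roots h₀).root_coroot_two i

variable (V) in
/-- The third operator of the `sl₂`-triple of a real root. -/
noncomputable def RootTriple.opH (t : D.RootTriple h₀ i) (C₀ : ℝ) (r : Expo n) : Module.End ℂ V :=
  LieModule.toEnd ℂ D.tau V (D.cartanEl h₀ ((D.roots h₀).coroot i)) +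
    ((t.level C₀ : ℂ) * r 0) • LinearMap.id

lemma RootTriple.isSl2Ops {C₀ : ℝ} (hL : D.HasLevel V C₀) (t : D.RootTriple h₀ i)
    (hh : ∀ x : h₀, ((x : D.fixed) : g) ∈ h) (hΔ : D.weightsOfG h₀ ⊆ D.enlargedRoots h₀)
    {r : Expo n} (hr : r ∈ D.lattice) :
    IsSl2Ops (t.opX V hr) (t.opY V (neg_mem hr)) (t.opH V C₀ r) where
  ef v := by
    have h1 : ⁅D.loopEl r t.X (t.X_mem' hr).1, D.loopEl (-r) t.Y (t.Y_mem' (neg_mem hr)).1⁆ =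
        D.cartanEl h₀ ((D.roots h₀).coroot i) +
          D.centerEl 0 (zero_mem _) ((D.c * killingForm ℂ g t.X t.Y) • r.toCoef) := by
      refine Subtype.ext ((D.coe_lie_loopEl_loopEl _ _ _ _ _ _).trans ?_)
      rw [t.lie_eq]
      simp only [add_neg_cancel]
      rfl
    simp only [opX, opY, opH, LieModule.toEnd_apply_apply, LinearMap.add_apply,
      LinearMap.smul_apply, LinearMap.id_apply]
    rw [leibniz_lie, h1, add_lie, hL.lie_centerEl_zero, Pi.smul_apply, smul_eq_mul,
      ← t.level_eq C₀ hh hΔ, add_comm, Expo.toCoef]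
    congr 3
    ring
  he v := by
    simp only [opX, opY, opH, LieModule.toEnd_apply_apply, LinearMap.add_apply,
      LinearMap.smul_apply, LinearMap.id_apply, lie_add, lie_smul]
    rw [leibniz_lie, D.lie_cartanEl_loopEl _ (t.X_mem' hr), root_coroot, smul_lie]
    abel
  hf v := by
    simp only [opX, opY, opH, LieModule.toEnd_apply_apply, LinearMap.add_apply,
      LinearMap.smul_apply, LinearMap.id_apply, lie_add, lie_smul]
    rw [leibniz_lie, D.lie_cartanEl_loopEl _ (t.Y_mem' (neg_mem hr)), LinearMap.neg_apply,
      root_coroot, smul_lie, neg_smul]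
    abel

lemma RootTriple.opH_apply (t : D.RootTriple h₀ i) (C₀ : ℝ) (r : Expo n) {v : V}
    (hv : v ∈ shiftedWeight V wt μ s) :
    t.opH V C₀ r v = (μ ((D.roots h₀).coroot i) + t.level C₀ * r 0) • v := by
  simp only [opH, LieModule.toEnd_apply_apply, LinearMap.add_apply, LinearMap.smul_apply,
    LinearMap.id_apply]
  rw [hv.1, add_smul]

lemma root_ne_zero (i : h₀.root) : (D.roots h₀).root i ≠ 0 := (D.roots h₀).ne_zero i

lemma RootTriple.locNilp_opX (hV : D.IsIntegrable h₀ V) (t : D.RootTriple h₀ i) {r : Expo n}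
    (hr : r ∈ D.lattice) : LocNilp (t.opX V hr) :=
  hV.locally_nilpotent r _ (root_ne_zero i) t.X (t.X_mem' hr)

lemma RootTriple.locNilp_opY (hV : D.IsIntegrable h₀ V) (t : D.RootTriple h₀ i) {r : Expo n}
    (hr : r ∈ D.lattice) : LocNilp (t.opY V hr) :=
  hV.locally_nilpotent r _ (neg_ne_zero.mpr (root_ne_zero i)) t.Y (t.Y_mem' hr)

lemma exists_int_coroot (hV : D.IsIntegrable h₀ V) {C₀ : ℝ} (hL : D.HasLevel V C₀)
    (hh : ∀ x : h₀, ((x : D.fixed) : g) ∈ h) (hΔ : D.weightsOfG h₀ ⊆ D.enlargedRoots h₀)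
    (hs : shiftedWeight V wt μ s ≠ ⊥) (i : h₀.root) :
    ∃ z : ℤ, μ ((D.roots h₀).coroot i) = z := by
  obtain ⟨v, hv, hv0⟩ := Submodule.exists_mem_ne_zero_of_ne_bot hs
  obtain ⟨t⟩ := D.exists_rootTriple h₀ i
  refine (t.isSl2Ops hL hh hΔ (zero_mem _)).exists_int (t.locNilp_opX hV _) (t.locNilp_opY hV _)
    ?_ hv0
  rw [t.opH_apply C₀ 0 hv]
  simp

/-- Lowering along a real root with positive value. -/
lemma shiftedWeight_sub_root_ne_bot (hV : D.IsIntegrable h₀ V) {C₀ : ℝ} (hL : D.HasLevel V C₀)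
    (hh : ∀ x : h₀, ((x : D.fixed) : g) ∈ h) (hΔ : D.weightsOfG h₀ ⊆ D.enlargedRoots h₀)
    (hs : shiftedWeight V wt μ s ≠ ⊥) (t : D.RootTriple h₀ i) {z : ℤ}
    (hz : μ ((D.roots h₀).coroot i) = z) {r : Expo n} (hr : r ∈ D.lattice)
    (hpos : 0 < z - t.level C₀ * r 0) :
    shiftedWeight V wt (μ - (D.roots h₀).root i) (s + r) ≠ ⊥ := by
  obtain ⟨v, hv, hv0⟩ := Submodule.exists_mem_ne_zero_of_ne_bot hs
  have h1 := (t.isSl2Ops hL hh hΔ (neg_mem hr)).f_ne_zero (t.locNilp_opX hV _) hpos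
    (v := v) (by rw [t.opH_apply C₀ _ hv, hz]; push_cast [Pi.neg_apply]; congr 1; ring) hv0
  refine Submodule.ne_bot_iff _ |>.mpr ⟨_, ?_, h1⟩
  have := lie_loopEl_mem_shiftedWeight (t.Y_mem' (neg_mem (neg_mem hr))) hv
  rw [← sub_eq_add_neg] at this
  convert this using 2
  · rw [neg_neg]
  · rfl

lemma shiftedWeight_add_root_ne_bot (hV : D.IsIntegrable h₀ V) {C₀ : ℝ} (hL : D.HasLevel V C₀)
    (hh : ∀ x : h₀, ((x : D.fixed) : g) ∈ h) (hΔ : D.weightsOfG h₀ ⊆ D.enlargedRoots h₀)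
    (hs : shiftedWeight V wt μ s ≠ ⊥) (t : D.RootTriple h₀ i) {z : ℤ}
    (hz : μ ((D.roots h₀).coroot i) = z) {r : Expo n} (hr : r ∈ D.lattice)
    (hpos : 0 < t.level C₀ * r 0 - z) :
    shiftedWeight V wt (μ + (D.roots h₀).root i) (s - r) ≠ ⊥ := by
  obtain ⟨v, hv, hv0⟩ := Submodule.exists_mem_ne_zero_of_ne_bot hs
  have h1 := (t.isSl2Ops hL hh hΔ (neg_mem hr)).symm.f_ne_zero (t.locNilp_opY hV _) hpos
    (v := v) (by
      rw [LinearMap.neg_apply, t.opH_apply C₀ _ hv, hz, ← neg_smul]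
      push_cast [Pi.neg_apply]; congr 1; ring) hv0
  refine Submodule.ne_bot_iff _ |>.mpr ⟨_, ?_, h1⟩
  have := lie_loopEl_mem_shiftedWeight (t.X_mem' (neg_mem hr)) hv
  rw [← sub_eq_add_neg] at this
  exact this

/-- The exponent `(a, 0, …, 0)`. -/
def expoZero (n : ℕ) (a : ℤ) : Expo n := Fin.cons a 0

@[simp] lemma expoZero_zero (a : ℤ) : expoZero n a 0 = a := rfl

lemma expoZero_mem {a : ℤ} (ha : (D.m 0 : ℤ) ∣ a) : expoZero n a ∈ D.lattice := by
  intro j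
  refine Fin.cases ha (fun j => ?_) j
  simp [expoZero]

lemma exists_multiple_gt (D : TwistData n g) {κ : ℝ} (hκ : 0 < κ) (x : ℝ) :
    ∃ a : ℤ, (D.m 0 : ℤ) ∣ a ∧ 0 ≤ a ∧ x < κ * a := by
  obtain ⟨N, hN⟩ := exists_nat_gt (x / κ)
  refine ⟨D.m 0 * N, dvd_mul_right _ _, by positivity, ?_⟩
  rw [div_lt_iff₀ hκ] at hN
  have h1 : (1 : ℝ) ≤ D.m 0 := by exact_mod_cast D.m_pos 0
  push_cast
  have h2 : (0 : ℝ) ≤ N := by positivity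
  nlinarith [mul_nonneg hκ.le h2]

/-- The weights with fixed restriction to `h(0)` and fixed class modulo `Γ₀ ⊕ Γ` have bounded
`d₀`-values. -/
lemma exists_bound_shiftedWeight (hV : D.IsIntegrable h₀ V) {C₀ : ℝ} (hL : D.HasLevel V C₀)
    (hh : ∀ x : h₀, ((x : D.fixed) : g) ∈ h) (hΔ : D.weightsOfG h₀ ⊆ D.enlargedRoots h₀)
    (i : h₀.root) (wt : D.Weight h₀) (μ : Module.Dual ℂ h₀) (s : Expo n) :
    ∃ J : ℤ, ∀ r ∈ D.lattice, J ≤ r 0 → shiftedWeight V wt μ (s + r) = ⊥ := by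
  by_cases hint : ∃ z : ℤ, μ ((D.roots h₀).coroot i) = z
  swap
  · refine ⟨0, fun r hr _ => ?_⟩
    by_contra h0
    exact hint (exists_int_coroot hV hL hh hΔ h0 i)
  obtain ⟨z, hz⟩ := hint
  obtain ⟨t⟩ := D.exists_rootTriple h₀ i
  have hκ := t.level_pos hL hh hΔ
  obtain ⟨a, ha, -, haz⟩ := exists_multiple_gt D hκ (-z)
  have hfin : FiniteDimensional ℂ (shiftedWeight V wt μ s) := hV.finite_weightSpace _
  obtain ⟨T', hT'⟩ := exists_pow_eq_zero_of_finiteDimensional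
    (t.locNilp_opX hV (expoZero_mem ha)) (shiftedWeight V wt μ s)
  obtain ⟨T, hT⟩ : ∃ T, ∀ v ∈ shiftedWeight V wt μ s,
      (t.opX V (expoZero_mem ha) ^ (T + 1)) v = 0 :=
    ⟨T', fun v hv => pow_apply_eq_zero_of_le (Nat.le_succ _) (hT' v hv)⟩
  obtain ⟨β, hβ, -, hβz⟩ := exists_multiple_gt D hκ (z + 2 * (T + 1))
  refine ⟨(T + 1) * a + (T + 1) * β, fun r hr hJ => ?_⟩
  by_contra hne
  have hcoroot : ∀ j : ℕ, (μ + (j : ℂ) • (D.roots h₀).root i) ((D.roots h₀).coroot i) =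
      ((z + 2 * j : ℤ) : ℂ) := by
    intro j
    rw [LinearMap.add_apply, LinearMap.smul_apply, hz, RootTriple.root_coroot]
    push_cast
    ring
  have hsucc : ∀ j : ℕ, μ + (j : ℂ) • (D.roots h₀).root i + (D.roots h₀).root i =
      μ + ((j + 1 : ℕ) : ℂ) • (D.roots h₀).root i := by
    intro j
    push_cast
    module
  have step : ∀ j : ℕ, j ≤ T → shiftedWeight V wt (μ + (j : ℂ) • (D.roots h₀).root i)
      (s + r - j • expoZero n β) ≠ ⊥ := by
    intro j
    induction j with
    | zero => intro _; simpa using hne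
    | succ j ih =>
      intro hj
      have hj' : (j : ℝ) + 1 ≤ T := by exact_mod_cast hj
      have := shiftedWeight_add_root_ne_bot hV hL hh hΔ (ih (by omega)) t (hcoroot j)
        (expoZero_mem hβ) (by rw [expoZero_zero]; push_cast; linarith)
      rw [hsucc] at this
      convert this using 2
      rw [succ_nsmul]
      abel
  have top : shiftedWeight V wt (μ + ((T + 1 : ℕ) : ℂ) • (D.roots h₀).root i)
      (s + (T + 1) • expoZero n a) ≠ ⊥ := by
    have hr' : r - (T + 1) • expoZero n a - T • expoZero n β ∈ D.lattice :=
      sub_mem (sub_mem hr (nsmul_mem (expoZero_mem ha) _)) (nsmul_mem (expoZero_mem hβ) _)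
    have h0 : (β : ℝ) ≤ ((r - (T + 1) • expoZero n a - T • expoZero n β) 0 : ℤ) := by
      rw [Pi.sub_apply, Pi.sub_apply, Pi.smul_apply, Pi.smul_apply, expoZero_zero, expoZero_zero,
        nsmul_eq_mul, nsmul_eq_mul]
      push_cast
      have : (((T + 1) * a + (T + 1) * β : ℤ) : ℝ) ≤ r 0 := by exact_mod_cast hJ
      push_cast at this
      linarith
    have := shiftedWeight_add_root_ne_bot hV hL hh hΔ (step T le_rfl) t (hcoroot T) hr' (by
      push_cast
      have := mul_le_mul_of_nonneg_left h0 hκ.le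
      linarith)
    rw [hsucc] at this
    convert this using 2
    abel
  have down : ∀ j : ℕ, j ≤ T + 1 → ∃ v ∈ shiftedWeight V wt
      (μ + ((T + 1 - j : ℕ) : ℂ) • (D.roots h₀).root i) (s + (T + 1 - j) • expoZero n a),
      (t.opX V (expoZero_mem ha) ^ j) v ≠ 0 := by
    intro j
    induction j with
    | zero =>
      intro _
      obtain ⟨v, hv, hv0⟩ := Submodule.exists_mem_ne_zero_of_ne_bot top
      exact ⟨v, hv, by simpa using hv0⟩
    | succ j ih =>
      intro hj
      obtain ⟨v, hv, hv0⟩ := ih (by omega)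
      obtain ⟨k, hk⟩ : ∃ k, T + 1 - j = k + 1 := ⟨T - j, by omega⟩
      have hk' : T + 1 - (j + 1) = k := by omega
      rw [hk] at hv
      rw [hk']
      refine ⟨t.opY V (neg_mem (expoZero_mem ha)) v, ?_, ?_⟩
      · have := lie_loopEl_mem_shiftedWeight (t.Y_mem' (neg_mem (expoZero_mem ha))) hv
        convert this using 2
        · push_cast; module
        · rw [succ_nsmul]; abel
        · rfl
      · have hpos : (0 : ℝ) < (z + 2 * (k + 1 : ℕ) : ℤ) + t.level C₀ * a := by
          push_cast
          have : (0 : ℝ) ≤ k := by positivity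
          linarith
        refine (t.isSl2Ops hL hh hΔ (expoZero_mem ha)).pow_e_f_ne_zero (t.locNilp_opX hV _) hpos
          ?_ hv0
        rw [t.opH_apply C₀ _ hv, hcoroot, expoZero_zero]
        push_cast
        rfl
  obtain ⟨v, hv, hv0⟩ := down (T + 1) le_rfl
  refine hv0 (hT v ?_)
  simpa using hv

/-- The squared length of a weight with respect to the canonical form of the root system. -/
noncomputable def rootNorm (μ : Module.Dual ℂ h₀) : ℂ :=
  ∑ j : h₀.root, μ ((D.roots h₀).coroot j) ^ 2

lemma exists_nat_rootNorm {z : h₀.root → ℤ} (hz : ∀ j, μ ((D.roots h₀).coroot j) = z j) :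
    ∃ N : ℕ, rootNorm μ = N := by
  refine ⟨∑ j, (z j).natAbs ^ 2, ?_⟩
  rw [rootNorm]
  push_cast
  refine Finset.sum_congr rfl fun j _ => ?_
  rw [hz, Nat.cast_natAbs]
  exact_mod_cast (congrArg (Int.cast : ℤ → ℂ) (sq_abs (z j))).symm

lemma rootNorm_sub_root (μ : Module.Dual ℂ h₀) (i : h₀.root) :
    rootNorm (μ - (D.roots h₀).root i) = rootNorm μ -
      rootNorm ((D.roots h₀).root i) * (μ ((D.roots h₀).coroot i) - 1) := by
  have h1 : (D.roots h₀).RootForm ((D.roots h₀).root i) ((D.roots h₀).root i) =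
      rootNorm ((D.roots h₀).root i) := by
    rw [RootPairing.rootForm_apply_apply, rootNorm]
    refine Finset.sum_congr rfl fun j _ => ?_
    rw [sq]
    rfl
  have h2 := congrArg μ ((D.roots h₀).rootForm_self_smul_coroot i)
  have h3 : μ ((D.roots h₀).Polarization ((D.roots h₀).root i)) =
      ∑ j : h₀.root, (D.roots h₀).root i ((D.roots h₀).coroot j) *
        μ ((D.roots h₀).coroot j) := by
    refine ((D.roots h₀).toLinearMap_apply_apply_Polarization ((D.roots h₀).root i) μ).trans ?_
    exact RootPairing.rootForm_apply_apply _ _ _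
  rw [h1, map_smul, smul_eq_mul, map_nsmul, h3, nsmul_eq_mul] at h2
  have h4 : rootNorm (μ - (D.roots h₀).root i) = rootNorm μ + rootNorm ((D.roots h₀).root i) -
      2 * ∑ j : h₀.root, (D.roots h₀).root i ((D.roots h₀).coroot j) *
        μ ((D.roots h₀).coroot j) := by
    simp only [rootNorm, Finset.mul_sum, ← Finset.sum_add_distrib, ← Finset.sum_sub_distrib,
      LinearMap.sub_apply]
    exact Finset.sum_congr rfl fun j _ => by ring
  push_cast at h2
  rw [h4, ← h2]
  ring

lemma exists_pos_rootNorm (i : h₀.root) :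
    ∃ B : ℕ, 0 < B ∧ rootNorm ((D.roots h₀).root i) = B := by
  choose z hz using fun j => D.exists_int_root_coroot i j
  refine ⟨∑ j, (z j).natAbs ^ 2, ?_, ?_⟩
  · have h1 : z i = 2 := by
      have := hz i
      rw [RootTriple.root_coroot] at this
      exact_mod_cast this.symm
    refine lt_of_lt_of_le ?_ (Finset.single_le_sum (f := fun j => (z j).natAbs ^ 2)
      (fun _ _ => Nat.zero_le _) (Finset.mem_univ i))
    rw [h1]
    norm_num
  · rw [rootNorm]
    push_cast
    refine Finset.sum_congr rfl fun j _ => ?_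
    rw [hz, Nat.cast_natAbs]
    exact_mod_cast (congrArg (Int.cast : ℤ → ℂ) (sq_abs (z j))).symm

variable {b : (D.roots h₀).Base}

/-- Every weight can be moved, without lowering its height, to a weight with bounded values on
the coroots. -/
lemma exists_bounded_weight (H : D.HeightData b)
    (hV : D.IsIntegrable h₀ V) {C₀ : ℝ} (hL : D.HasLevel V C₀)
    (hh : ∀ x : h₀, ((x : D.fixed) : g) ∈ h) (hΔ : D.weightsOfG h₀ ⊆ D.enlargedRoots h₀)
    (t : ∀ i, D.RootTriple h₀ i) (wt : D.Weight h₀) (N : ℕ) :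
    ∀ (μ : Module.Dual ℂ h₀) (s : Expo n), rootNorm μ = N → shiftedWeight V wt μ s ≠ ⊥ →
    ∃ (μ' : Module.Dual ℂ h₀) (s' : Expo n) (k : ℕ), shiftedWeight V wt μ' s' ≠ ⊥ ∧
      μ' H.ρ + H.bound * s' 0 = μ H.ρ + H.bound * s 0 + k ∧
      ∀ i (z : ℤ), μ' ((D.roots h₀).coroot i) = z → (z : ℝ) ≤ (t i).level C₀ * D.m 0 + 1 := by
  induction N using Nat.strong_induction_on with
  | _ N ih =>
    intro μ s hN hs
    by_cases hF : ∀ i (z : ℤ), μ ((D.roots h₀).coroot i) = z →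
        (z : ℝ) ≤ (t i).level C₀ * D.m 0 + 1
    · exact ⟨μ, s, 0, hs, by simp, hF⟩
    push Not at hF
    obtain ⟨i, z, hz, hlt⟩ := hF
    have hlev := (t i).level_pos hL hh hΔ
    have hm : (1 : ℝ) ≤ D.m 0 := by exact_mod_cast D.m_pos 0
    have hs' := shiftedWeight_sub_root_ne_bot hV hL hh hΔ hs (t i) hz
      (expoZero_mem (D := D) (dvd_refl _)) (by
        rw [expoZero_zero]
        push_cast
        linarith)
    choose z' hz' using fun j => exists_int_coroot hV hL hh hΔ hs' j
    obtain ⟨N', hN'⟩ := exists_nat_rootNorm hz'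
    obtain ⟨B, hB, hB'⟩ := exists_pos_rootNorm (D := D) i
    have hlt' : N' < N := by
      have h1 := rootNorm_sub_root μ i
      rw [hN', hN, hB', hz] at h1
      have h2 : (N' : ℤ) = N - B * (z - 1) := by exact_mod_cast h1
      have h3 : 1 < z := by
        have : (1 : ℝ) < z := by nlinarith
        exact_mod_cast this
      have : (0 : ℤ) < B * (z - 1) := mul_pos (by exact_mod_cast hB) (by omega)
      omega
    obtain ⟨μ', s'', k, h1, h2, h3⟩ := ih N' hlt' _ _ hN' hs'
    obtain ⟨y, hy, hy'⟩ := H.lt_bound ((D.roots h₀).root i) (Or.inl (Or.inr ⟨i, rfl⟩))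
    have h4 : 0 ≤ H.bound * (D.m 0 : ℤ) - y := by
      have := le_abs_self y
      have h5 := D.m_pos 0
      nlinarith
    refine ⟨μ', s'', k + (H.bound * (D.m 0 : ℤ) - y).toNat, h1, ?_, h3⟩
    rw [h2, LinearMap.sub_apply, hy, Pi.add_apply, expoZero_zero]
    have h5 : (((H.bound * (D.m 0 : ℤ) - y).toNat : ℤ) : ℂ) =
        ((H.bound * (D.m 0 : ℤ) - y : ℤ) : ℂ) := by rw [Int.toNat_of_nonneg h4]
    push_cast at h5 ⊢
    rw [h5]
    ring

/-- There are only finitely many weights of `h(0)` with bounded integral values on the coroots. -/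
lemma finite_bounded_weights (B : ℤ) :
    {μ : Module.Dual ℂ h₀ | ∀ i, ∃ z : ℤ, μ ((D.roots h₀).coroot i) = z ∧ z ≤ B}.Finite := by
  have hfin : (Set.univ.pi fun _ : h₀.root => ((fun z : ℤ => (z : ℂ)) '' Set.Icc (-B) B)).Finite :=
    Set.Finite.pi fun _ => (Set.finite_Icc _ _).image _
  refine Set.Finite.of_finite_image (f := fun μ (i : h₀.root) => μ ((D.roots h₀).coroot i))
    (hfin.subset ?_) ?_
  · rintro _ ⟨μ, hμ, rfl⟩ i -
    obtain ⟨z, hz, hzB⟩ := hμ i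
    obtain ⟨z', hz', hzB'⟩ := hμ ((D.roots h₀).reflectionPerm i i)
    rw [(D.roots h₀).coroot_reflectionPerm, (D.roots h₀).coreflection_apply_self, map_neg, hz] at hz'
    have : -z = z' := by exact_mod_cast hz'
    exact ⟨z, ⟨by omega, hzB⟩, hz.symm⟩
  · intro μ _ μ' _ heq
    have h1 : Submodule.span ℂ (Set.range (D.roots h₀).coroot) = ⊤ :=
      RootPairing.IsRootSystem.span_coroot_eq_top
    refine LinearMap.ext_on h1 ?_
    rintro _ ⟨i, rfl⟩
    exact congrFun heq i

lemma exists_mem_lattice (D : TwistData n g) (s : Expo n) :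
    ∃ r ∈ D.lattice, ∀ i, 0 ≤ (s - r) i ∧ (s - r) i < D.m i := by
  refine ⟨fun i => D.m i * (s i / D.m i), fun i => dvd_mul_right _ _, fun i => ?_⟩
  have h1 : (0 : ℤ) < D.m i := by exact_mod_cast D.m_pos i
  have h2 := Int.emod_add_mul_ediv (s i) (D.m i)
  have h3 := Int.emod_nonneg (s i) h1.ne'
  have h4 := Int.emod_lt_of_pos (s i) h1
  simp only [Pi.sub_apply]
  constructor <;> omega

lemma exists_root (D : TwistData n g) (h₀ : LieSubalgebra ℂ D.fixed)
    [LieAlgebra.IsSimple ℂ D.fixed] [h₀.IsCartanSubalgebra] : Nonempty h₀.root := by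
  by_contra hne
  rw [not_nonempty_iff] at hne
  have h1 : Submodule.span ℂ (Set.range (D.roots h₀).coroot) = ⊤ :=
    RootPairing.IsRootSystem.span_coroot_eq_top
  rw [Set.range_eq_empty, Submodule.span_empty] at h1
  have h2 : h₀ = ⊥ := by
    rw [eq_bot_iff]
    intro x hx
    have : (⟨x, hx⟩ : h₀) ∈ (⊤ : Submodule ℂ h₀) := trivial
    rw [← h1, Submodule.mem_bot] at this
    exact congrArg Subtype.val this
  have h3 : (⊥ : LieSubalgebra ℂ D.fixed).normalizer = ⊥ := by
    rw [← h2]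
    exact LieSubalgebra.IsCartanSubalgebra.self_normalizing
  have h4 : ∀ x : D.fixed, x = 0 := by
    intro x
    have : x ∈ (⊥ : LieSubalgebra ℂ D.fixed).normalizer := by
      rw [LieSubalgebra.mem_normalizer_iff]
      intro y hy
      rw [LieSubalgebra.mem_bot] at hy ⊢
      rw [hy, lie_zero]
    rwa [h3, LieSubalgebra.mem_bot] at this
  have h5 := LieAlgebra.IsSimple.non_abelian ℂ (L := D.fixed)
  exact h5 ⟨fun x y => h4 _⟩

variable (b) in
/-- Existence of a highest weight vector. -/
theorem exists_mem_topSpace [Nontrivial V] (H : D.HeightData b) (hV : D.IsIntegrable h₀ V)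
    {C₀ : ℝ} (hL : D.HasLevel V C₀) (hh : ∀ x : h₀, ((x : D.fixed) : g) ∈ h)
    (hΔ : D.weightsOfG h₀ ⊆ D.enlargedRoots h₀) :
    ∃ v ∈ D.topSpace V b, v ≠ 0 ∧ ∃ wt : D.Weight h₀, v ∈ D.weightSpace V wt := by
  obtain ⟨wt, hwt⟩ : ∃ wt : D.Weight h₀, D.weightSpace V wt ≠ ⊥ := by
    by_contra hne
    push Not at hne
    have := hV.iSup_weightSpace
    simp only [hne, iSup_bot] at this
    exact bot_ne_top this
  have hwt0 : shiftedWeight V wt wt.onCartan 0 ≠ ⊥ := by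
    rw [shiftedWeight, toCoef_zero, add_zero]
    exact hwt
  let t : ∀ i, D.RootTriple h₀ i := fun i => (D.exists_rootTriple h₀ i).some
  obtain ⟨i₀⟩ := exists_root D h₀
  obtain ⟨B, hB⟩ : ∃ B : ℤ, ∀ i, (t i).level C₀ * D.m 0 + 1 ≤ B := by
    obtain ⟨x, hx⟩ := (Set.finite_range fun i => (t i).level C₀ * D.m 0 + 1).bddAbove
    exact ⟨⌈x⌉, fun i => (hx ⟨i, rfl⟩).trans (Int.le_ceil x)⟩
  have hFfin := finite_bounded_weights (D := D) (h₀ := h₀) B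
  set F := {μ : Module.Dual ℂ h₀ | ∀ i, ∃ z : ℤ, μ ((D.roots h₀).coroot i) = z ∧ z ≤ B}
  choose J hJ using exists_bound_shiftedWeight hV hL hh hΔ i₀ wt
  have hRfin : (Set.univ.pi fun i => Set.Ico (0 : ℤ) (D.m i)).Finite :=
    Set.Finite.pi fun i => Set.finite_Ico _ _
  obtain ⟨A, hA⟩ := ((hFfin.prod hRfin).image fun p => J p.1 p.2).bddAbove
  have hbound : ∀ μ ∈ F, ∀ s, shiftedWeight V wt μ s ≠ ⊥ → s 0 < A + D.m 0 := by
    intro μ hμ s hs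
    obtain ⟨r, hr, hr'⟩ := exists_mem_lattice D s
    by_contra hlt
    push Not at hlt
    refine hs ?_
    have h1 : J μ (s - r) ≤ A :=
      hA ⟨(μ, s - r), ⟨hμ, fun i _ => ⟨(hr' i).1, (hr' i).2⟩⟩, rfl⟩
    have h2 := (hr' 0).2
    rw [Pi.sub_apply] at h2
    have := hJ μ (s - r) r hr (by omega)
    rwa [sub_add_cancel] at this
  obtain ⟨Q, hQ⟩ := (hFfin.image fun μ => ‖μ H.ρ‖).bddAbove
  let P : ℤ → Prop := fun z => ∃ μ s, shiftedWeight V wt μ s ≠ ⊥ ∧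
    μ H.ρ + H.bound * s 0 = wt.onCartan H.ρ + z
  have hPbd : ∃ M : ℤ, ∀ z, P z → z ≤ M := by
    obtain ⟨M, hM⟩ := exists_int_ge (Q + H.bound * (A + D.m 0) + ‖wt.onCartan H.ρ‖)
    refine ⟨M, ?_⟩
    rintro z ⟨μ, s, hs, hz⟩
    choose z' hz' using fun j => exists_int_coroot hV hL hh hΔ hs j
    obtain ⟨N, hN⟩ := exists_nat_rootNorm hz'
    obtain ⟨μ', s', k, h1, h2, h3⟩ := exists_bounded_weight H hV hL hh hΔ t wt N μ s hN hs
    choose z'' hz'' using fun j => exists_int_coroot hV hL hh hΔ h1 j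
    have hμ' : μ' ∈ F := fun i => ⟨z'' i, hz'' i, by
      exact_mod_cast (h3 i _ (hz'' i)).trans (hB i)⟩
    have h4 := hbound μ' hμ' s' h1
    have h5 : ‖μ' H.ρ‖ ≤ Q := hQ ⟨μ', hμ', rfl⟩
    rw [hz] at h2
    have h6 := congrArg Complex.re h2
    simp only [Complex.add_re, Complex.mul_re, Complex.natCast_re, Complex.natCast_im,
      Complex.intCast_re, Complex.intCast_im] at h6
    have h7 := (Complex.re_le_norm (μ' H.ρ)).trans h5
    have h8 := (neg_le_abs _).trans (Complex.abs_re_le_norm (wt.onCartan H.ρ))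
    have h9 : ((H.bound : ℝ)) * (s' 0 : ℝ) ≤ H.bound * (A + D.m 0) := by
      refine mul_le_mul_of_nonneg_left ?_ (by positivity)
      exact_mod_cast h4.le
    have : (z : ℝ) ≤ M := by
      refine le_trans ?_ hM
      have : (0 : ℝ) ≤ k := by positivity
      linarith
    exact_mod_cast this
  obtain ⟨z, ⟨μ, s, hs, hz⟩, hmax⟩ := Int.exists_greatest_of_bdd hPbd
    ⟨0, wt.onCartan, 0, hwt0, by simp⟩
  obtain ⟨v, hv, hv0⟩ := Submodule.exists_mem_ne_zero_of_ne_bot hs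
  have hkill : ∀ (α : Module.Dual ℂ h₀) (k : Expo n) (w : V),
      (∃ i : ℕ, α H.ρ + H.bound * k 0 = i + 1) → w ∈ shiftedWeight V wt (μ + α) (s + k) → w = 0 := by
    rintro α k w ⟨i, hi⟩ hw
    by_contra hw0
    have := hmax (z + (i + 1)) ⟨μ + α, s + k, (Submodule.ne_bot_iff _).mpr ⟨w, hw, hw0⟩, by
      rw [LinearMap.add_apply, Pi.add_apply]
      push_cast
      linear_combination hz + hi⟩
    omega
  refine ⟨v, ?_, hv0, _, hv⟩
  change ∀ x ∈ D.tauPos b, ⁅x, v⁆ = 0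
  intro x hx
  refine D.rootPart_induction (p := fun x => ⁅x, v⁆ = 0) (zero_lie v)
    (fun x y hx hy => by rw [add_lie, hx, hy, add_zero])
    (fun a x hx => by rw [smul_lie, hx, smul_zero]) ?_ ?_ ?_ x hx
  · intro k α X hX hP
    by_cases h0 : X = 0
    · subst h0
      rw [D.loopEl_zero, zero_lie]
    exact hkill α k _ (H.height_of_isPos (HeightData.mem_enlargedRoots hΔ hX h0) hP)
      (lie_loopEl_mem_shiftedWeight hX hv)
  · intro k hk w hP
    refine hkill 0 k _ (H.height_of_isPos HeightData.zero_mem_enlargedRoots hP) ?_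
    rw [add_zero]
    exact lie_centerEl_mem_shiftedWeight hk w hv
  · intro k hk w hP
    refine hkill 0 k _ (H.height_of_isPos HeightData.zero_mem_enlargedRoots hP) ?_
    rw [add_zero]
    exact lie_derEl_mem_shiftedWeight hk w hv

end

end TwistData


/-! ### The operators on the highest weight space -/

namespace TwistData

variable {n : ℕ} {g : Type*} [LieRing g] [LieAlgebra ℂ g] (D : TwistData n g)

@[simp] lemma expo0_zero (l : Fin n → ℤ) : expo0 l 0 = 0 := rfl

@[simp] lemma expo0_succ (l : Fin n → ℤ) (i : Fin n) : expo0 l i.succ = l i := rfl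

lemma expo0_add (l k : Fin n → ℤ) : expo0 (l + k) = expo0 l + expo0 k := by
  funext i
  refine Fin.cases ?_ (fun j => ?_) i <;> simp [expo0]

lemma eq_expo0 {k : Expo n} (hk : k 0 = 0) : k = expo0 fun i => k i.succ := by
  funext i
  refine Fin.cases hk (fun j => rfl) i

lemma loopEl_congr {k k' : Expo n} {X X' : g} (hk : k = k') (hX : X = X') (h1 : X ∈ D.grad k) :
    D.loopEl k X h1 = D.loopEl k' X' (hk ▸ hX ▸ h1) := by
  subst hk hX; rfl

lemma centerEl_congr {k k' : Expo n} {w w' : Coef n} (hk : k = k') (hw : w = w')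
    (h1 : k ∈ D.lattice) : D.centerEl k h1 w = D.centerEl k' (hk ▸ h1) w' := by
  subst hk hw; rfl

lemma derEl_congr {k k' : Expo n} {w w' : Coef n} (hk : k = k') (hw : w = w')
    (h1 : k ∈ D.lattice) : D.derEl k h1 w = D.derEl k' (hk ▸ h1) w' := by
  subst hk hw; rfl

variable [FiniteDimensional ℂ g] [LieAlgebra.IsSimple ℂ D.fixed]
variable {h₀ : LieSubalgebra ℂ D.fixed} [h₀.IsCartanSubalgebra] (b : (D.roots h₀).Base)

/-- `∑ wᵢ t^r Kᵢ` in `τ⁰`. -/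
noncomputable def zeroC (r : Fin n → ℤ) (hr : r ∈ D.Γ) : Coef n →ₗ[ℂ] D.tauNonneg b where
  toFun w := ⟨D.centerEl (expo0 r) (D.expo0_mem hr) w,
    D.centerEl_mem_rootPart (P := D.IsNonneg b) (D.expo0_mem hr) w (Or.inl ⟨rfl, rfl⟩)⟩
  map_add' w w' := Subtype.ext (D.centerEl_add _ (D.expo0_mem hr) w w')
  map_smul' a w := Subtype.ext (D.centerEl_smul _ (D.expo0_mem hr) a w)

/-- `D(u, r)` as a linear function of `u`. -/
noncomputable def zeroDLin (r : Fin n → ℤ) (hr : r ∈ D.Γ) : (Fin n → ℂ) →ₗ[ℂ] D.tauNonneg b where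
  toFun u := D.zeroD b u r hr
  map_add' u v := Subtype.ext ((D.derEl_congr rfl (by
    funext i; refine Fin.cases ?_ (fun j => ?_) i <;> simp) (D.expo0_mem hr)).trans
      (D.derEl_add _ (D.expo0_mem hr) (Fin.cons 0 u) (Fin.cons 0 v)))
  map_smul' a v := Subtype.ext ((D.derEl_congr rfl (by
    funext i; refine Fin.cases ?_ (fun j => ?_) i <;> simp) (D.expo0_mem hr)).trans
      (D.derEl_smul _ (D.expo0_mem hr) a (Fin.cons 0 v)))

/-- `X(l)` as a linear function of `X`. -/
noncomputable def zeroLoopLin (l : Fin n → ℤ) : D.gCircGrad h₀ l →ₗ[ℂ] D.tauNonneg b where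
  toFun X := D.zeroLoop b l X X.2
  map_add' X Y := Subtype.ext (D.loopEl_add _ _ _ (D.gCircGrad_mem X.2).1 (D.gCircGrad_mem Y.2).1)
  map_smul' a X := Subtype.ext (D.loopEl_smul _ a _ (D.gCircGrad_mem X.2).1)

lemma cons_dot_expo0 (u : Fin n → ℂ) (a : ℂ) (l : Fin n → ℤ) :
    Coef.dot (Fin.cons a u : Coef n) (expo0 l).toCoef = ∑ i, u i * l i := by
  simp [Coef.dot, Fin.sum_univ_succ, Expo.toCoef]

lemma single_dot_expo0 (l : Fin n → ℤ) :
    Coef.dot (Pi.single 0 1 : Coef n) (expo0 l).toCoef = 0 := by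
  rw [single_dot]; simp [Expo.toCoef]

variable {b}

lemma lie_zeroD_zeroLoop (u : Fin n → ℂ) (r : Fin n → ℤ) (hr : r ∈ D.Γ) (l : Fin n → ℤ)
    (X : D.gCirc h₀) (hX : X ∈ D.gCircGrad h₀ l) (hX' : X ∈ D.gCircGrad h₀ (r + l)) :
    ⁅D.zeroD b u r hr, D.zeroLoop b l X hX⁆ = (∑ i, u i * l i) • D.zeroLoop b (r + l) X hX' := by
  refine Subtype.ext ((D.lie_derEl_loopEl _ _ (D.expo0_mem hr) _ _ (D.gCircGrad_mem hX).1).trans ?_)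
  rw [cons_dot_expo0]
  exact congrArg _ (D.loopEl_congr (expo0_add r l).symm rfl
    (D.mem_grad_add (D.expo0_mem hr) (D.gCircGrad_mem hX).1))

lemma lie_zeroD_zeroC (u : Fin n → ℂ) (r s : Fin n → ℤ) (hr : r ∈ D.Γ) (hs : s ∈ D.Γ)
    (w : Coef n) : ⁅D.zeroD b u r hr, D.zeroC b s hs w⁆ = D.zeroC b (r + s) (add_mem hr hs)
      ((∑ i, u i * s i) • w + (Coef.dot (Fin.cons 0 u) w) • (expo0 r).toCoef) := by
  refine Subtype.ext ((D.lie_derEl_centerEl _ _ (D.expo0_mem hr) (D.expo0_mem hs) _ _).trans ?_)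
  refine D.centerEl_congr (expo0_add r s).symm ?_ (add_mem (D.expo0_mem hr) (D.expo0_mem hs))
  rw [cons_dot_expo0]

lemma lie_zeroD_zeroD₀ (u : Fin n → ℂ) (r s : Fin n → ℤ) (hr : r ∈ D.Γ) (hs : s ∈ D.Γ) :
    ⁅D.zeroD b u r hr, D.zeroD₀ b s hs⁆ =
      (∑ i, u i * s i) • D.zeroD₀ b (r + s) (add_mem hr hs) := by
  refine Subtype.ext ((D.lie_derEl_derEl _ _ (D.expo0_mem hr) (D.expo0_mem hs) _ _).trans ?_)
  rw [cons_dot_expo0, single_dot_expo0, single_dot_expo0, zero_smul, sub_zero, mul_zero, mul_zero,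
    mul_zero, mul_zero, neg_zero, add_zero]
  rw [D.centerEl_smul, zero_smul, add_zero, D.derEl_smul]
  exact congrArg _ (D.derEl_congr (expo0_add r s).symm rfl
    (add_mem (D.expo0_mem hr) (D.expo0_mem hs)))

lemma lie_zeroD_zeroD (u v : Fin n → ℂ) (r s : Fin n → ℤ) (hr : r ∈ D.Γ) (hs : s ∈ D.Γ) :
    ⁅D.zeroD b u r hr, D.zeroD b v s hs⁆ =
      D.zeroD b ((∑ i, u i * s i) • v - (∑ i, v i * r i) • u) (r + s) (add_mem hr hs) +
      ((-(D.μ * ((∑ i, u i * s i) * (∑ i, v i * r i)))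
        + D.ν * ((∑ i, u i * r i) * (∑ i, v i * s i)))) •
        D.zeroC b (r + s) (add_mem hr hs) (expo0 r).toCoef := by
  refine Subtype.ext ((D.lie_derEl_derEl _ _ (D.expo0_mem hr) (D.expo0_mem hs) _ _).trans ?_)
  simp only [cons_dot_expo0]
  rw [D.centerEl_smul]
  refine congrArg₂ _ (D.derEl_congr (expo0_add r s).symm ?_
    (add_mem (D.expo0_mem hr) (D.expo0_mem hs)))
    (congrArg _ (D.centerEl_congr (expo0_add r s).symm rfl
    (add_mem (D.expo0_mem hr) (D.expo0_mem hs))))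
  funext i
  refine Fin.cases ?_ (fun j => ?_) i <;> simp

lemma lie_zeroD₀_zeroD₀ (r s : Fin n → ℤ) (hr : r ∈ D.Γ) (hs : s ∈ D.Γ) :
    ⁅D.zeroD₀ b r hr, D.zeroD₀ b s hs⁆ = 0 := by
  refine Subtype.ext ((D.lie_derEl_derEl _ _ (D.expo0_mem hr) (D.expo0_mem hs) _ _).trans ?_)
  simp only [single_dot_expo0, zero_smul, sub_zero, mul_zero, neg_zero, add_zero]
  rw [← zero_smul ℂ (0 : Coef n), D.derEl_smul, D.centerEl_smul, zero_smul, zero_smul, add_zero]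
  rfl

lemma lie_zeroD₀_zeroC (r s : Fin n → ℤ) (hr : r ∈ D.Γ) (hs : s ∈ D.Γ) (w : Coef n) :
    ⁅D.zeroD₀ b r hr, D.zeroC b s hs w⁆ =
      w 0 • D.zeroC b (r + s) (add_mem hr hs) (expo0 r).toCoef := by
  refine Subtype.ext ((D.lie_derEl_centerEl _ _ (D.expo0_mem hr) (D.expo0_mem hs) _ _).trans ?_)
  rw [single_dot_expo0, zero_smul, zero_add, single_dot, D.centerEl_smul]
  exact congrArg _ (D.centerEl_congr (expo0_add r s).symm rfl
    (add_mem (D.expo0_mem hr) (D.expo0_mem hs)))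

lemma lie_zeroD₀_zeroLoop (r : Fin n → ℤ) (hr : r ∈ D.Γ) (l : Fin n → ℤ)
    (X : D.gCirc h₀) (hX : X ∈ D.gCircGrad h₀ l) :
    ⁅D.zeroD₀ b r hr, D.zeroLoop b l X hX⁆ = 0 := by
  refine Subtype.ext ((D.lie_derEl_loopEl _ _ (D.expo0_mem hr) _ _ (D.gCircGrad_mem hX).1).trans ?_)
  rw [single_dot_expo0, zero_smul]
  rfl

lemma lie_zeroC_zeroC (r s : Fin n → ℤ) (hr : r ∈ D.Γ) (hs : s ∈ D.Γ) (w w' : Coef n) :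
    ⁅D.zeroC b r hr w, D.zeroC b s hs w'⁆ = 0 :=
  Subtype.ext (D.lie_centerEl_centerEl _ _ (D.expo0_mem hr) (D.expo0_mem hs) _ _)

lemma lie_zeroLoop_zeroC (l : Fin n → ℤ) (X : D.gCirc h₀) (hX : X ∈ D.gCircGrad h₀ l)
    (s : Fin n → ℤ) (hs : s ∈ D.Γ) (w : Coef n) :
    ⁅D.zeroLoop b l X hX, D.zeroC b s hs w⁆ = 0 :=
  Subtype.ext (D.lie_loopEl_centerEl _ _ _ (D.gCircGrad_mem hX).1 (D.expo0_mem hs) _)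

lemma lie_mem_gCircGrad {l k : Fin n → ℤ} {X Y : D.gCirc h₀} (hX : X ∈ D.gCircGrad h₀ l)
    (hY : Y ∈ D.gCircGrad h₀ k) : ⁅X, Y⁆ ∈ D.gCircGrad h₀ (l + k) := by
  intro i
  have := (D.lie_mem_grad (D.gCircGrad_mem hX).1 (D.gCircGrad_mem hY).1) i.succ
  simpa using this

lemma lie_zeroLoop_zeroLoop (l k : Fin n → ℤ) (X Y : D.gCirc h₀) (hX : X ∈ D.gCircGrad h₀ l)
    (hY : Y ∈ D.gCircGrad h₀ k) :
    ⁅D.zeroLoop b l X hX, D.zeroLoop b k Y hY⁆ =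
      D.zeroLoop b (l + k) ⁅X, Y⁆ (D.lie_mem_gCircGrad hX hY) ∨
    ∃ hlk : l + k ∈ D.Γ, ∃ a : ℂ, ⁅D.zeroLoop b l X hX, D.zeroLoop b k Y hY⁆ =
      D.zeroLoop b (l + k) ⁅X, Y⁆ (D.lie_mem_gCircGrad hX hY) +
        a • D.zeroC b (l + k) hlk (expo0 l).toCoef := by
  have key := D.coe_lie_loopEl_loopEl _ _ _ _ (D.gCircGrad_mem hX).1 (D.gCircGrad_mem hY).1
  by_cases h0 : killingForm ℂ g X Y = 0
  · left
    refine Subtype.ext (Subtype.ext (key.trans ?_))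
    rw [h0, mul_zero, zero_smul, ← expo0_add]
    have : (FullToroidal.centerEl (expo0 (l + k)) 0 : D.Full) = 0 := by
      apply FullToroidal.ext' <;> simp [FullToroidal.centerEl, kahler]
    rw [this, add_zero]
    rfl
  · right
    have hm := D.add_mem_lattice (D.gCircGrad_mem hX).1 (D.gCircGrad_mem hY).1 h0
    have hlk : l + k ∈ D.Γ := fun i => by simpa [← expo0_add] using hm i.succ
    refine ⟨hlk, D.c * killingForm ℂ g X Y, Subtype.ext (Subtype.ext (key.trans ?_))⟩
    rw [← expo0_add]
    have : (FullToroidal.centerEl (expo0 (l + k)) ((D.c * killingForm ℂ g X Y) •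
        (expo0 l).toCoef) : D.Full) = (D.c * killingForm ℂ g X Y) •
        FullToroidal.centerEl (expo0 (l + k)) (expo0 l).toCoef := by
      apply FullToroidal.ext' <;> simp [FullToroidal.centerEl, kahler_smul]
    rw [this]
    rfl

section Module

variable (V : Type*) [AddCommGroup V] [Module ℂ V] [LieRingModule D.tau V] [LieModule ℂ D.tau V]

variable {D V} in
/-- A subspace of `T` that is stable under the generators of `τ⁰` is trivial. -/
lemma eq_bot_or_eq_top_of_stable [LieModule.IsIrreducible ℂ (D.tauNonneg b) (D.topSpace V b)]
    (N : Submodule ℂ (D.topSpace V b))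
    (hloop : ∀ l X hX, ∀ v ∈ N, ⁅D.zeroLoop b l X hX, v⁆ ∈ N)
    (hC : ∀ r hr w, ∀ v ∈ N, ⁅D.zeroC b r hr w, v⁆ ∈ N)
    (hD₀ : ∀ r hr, ∀ v ∈ N, ⁅D.zeroD₀ b r hr, v⁆ ∈ N)
    (hD : ∀ u r hr, ∀ v ∈ N, ⁅D.zeroD b u r hr, v⁆ ∈ N) : N = ⊥ ∨ N = ⊤ := by
  have hpos : ∀ x (hx : x ∈ D.tauNonneg b), x ∈ D.tauPos b → ∀ v : D.topSpace V b,
      ⁅(⟨x, hx⟩ : D.tauNonneg b), v⁆ = 0 := fun x hx hp v => Subtype.ext (v.2 x hp)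
  have hΓ : ∀ {s : Expo n}, s ∈ D.lattice → (fun i : Fin n => s i.succ) ∈ D.Γ :=
    fun hs i => hs i.succ
  have key : ∀ x ∈ D.rootPart h₀ (D.IsNonneg b), ∃ hx : x ∈ D.tauNonneg b, ∀ v ∈ N,
      ⁅(⟨x, hx⟩ : D.tauNonneg b), v⁆ ∈ N := by
    intro x hx
    refine D.rootPart_induction (p := fun x => ∃ hx : x ∈ D.tauNonneg b, ∀ v ∈ N,
      ⁅(⟨x, hx⟩ : D.tauNonneg b), v⁆ ∈ N) ?_ ?_ ?_ ?_ ?_ ?_ x hx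
    · refine ⟨zero_mem _, fun v _ => ?_⟩
      have : ⁅(0 : D.tauNonneg b), v⁆ ∈ N := by rw [zero_lie]; exact zero_mem _
      exact this
    · rintro x y ⟨hx, hx'⟩ ⟨hy, hy'⟩
      refine ⟨add_mem hx hy, fun v hv => ?_⟩
      have : ⁅(⟨x, hx⟩ + ⟨y, hy⟩ : D.tauNonneg b), v⁆ ∈ N := by
        rw [add_lie]; exact add_mem (hx' v hv) (hy' v hv)
      exact this
    · rintro a x ⟨hx, hx'⟩
      refine ⟨(D.tauNonneg b).smul_mem a hx, fun v hv => ?_⟩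
      have : ⁅a • (⟨x, hx⟩ : D.tauNonneg b), v⁆ ∈ N := by
        rw [smul_lie]; exact Submodule.smul_mem _ a (hx' v hv)
      exact this
    · intro k α X hX hP
      have hm := D.loopEl_mem_rootPart (P := D.IsNonneg b) hX hP
      refine ⟨hm, fun v hv => ?_⟩
      rcases hP with ⟨hk, rfl⟩ | hP
      · have hX1 : X ∈ D.gCirc h₀ := by
          refine ⟨?_, fun x => ?_⟩
          · have := hX.1 0
            simpa [hk] using this
          · have := hX.2 x
            simpa using this
        have h2 := hloop (fun i => k i.succ) ⟨X, hX1⟩ (fun i => hX.1 i.succ) v hv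
        convert h2 using 1
        congr 1
        exact Subtype.ext (D.loopEl_congr (eq_expo0 hk) rfl hX.1)
      · rw [hpos _ hm (D.loopEl_mem_rootPart hX hP)]
        exact zero_mem _
    · intro s hs w hP
      have hm := D.centerEl_mem_rootPart (P := D.IsNonneg b) hs w hP
      refine ⟨hm, fun v hv => ?_⟩
      rcases hP with ⟨hk, -⟩ | hP
      · convert hC _ (hΓ hs) w v hv using 1
        congr 1
        exact Subtype.ext (D.centerEl_congr (eq_expo0 hk) rfl hs)
      · rw [hpos _ hm (D.centerEl_mem_rootPart hs w hP)]
        exact zero_mem _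
    · intro s hs w hP
      have hm := D.derEl_mem_rootPart (P := D.IsNonneg b) hs w hP
      refine ⟨hm, fun v hv => ?_⟩
      rcases hP with ⟨hk, -⟩ | hP
      · have h1 : (⟨_, hm⟩ : D.tauNonneg b) = w 0 • D.zeroD₀ b _ (hΓ hs) +
            D.zeroD b (fun i => w i.succ) _ (hΓ hs) := by
          refine Subtype.ext ?_
          change D.derEl s hs w = w 0 • D.derEl _ (D.expo0_mem (hΓ hs)) _ +
            D.derEl _ (D.expo0_mem (hΓ hs)) _
          rw [← D.derEl_smul, ← D.derEl_add]
          refine D.derEl_congr (eq_expo0 hk) ?_ hs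
          funext i
          refine Fin.cases ?_ (fun j => ?_) i <;> simp
        rw [h1, add_lie, smul_lie]
        exact add_mem (Submodule.smul_mem _ _ (hD₀ _ _ v hv)) (hD _ _ _ v hv)
      · rw [hpos _ hm (D.derEl_mem_rootPart hs w hP)]
        exact zero_mem _
  let N' : LieSubmodule ℂ (D.tauNonneg b) (D.topSpace V b) :=
    { N with lie_mem := fun {x v} hv => (key x.1 x.2).2 v hv }
  rcases eq_bot_or_eq_top N' with h1 | h1
  · left
    exact congrArg LieSubmodule.toSubmodule h1
  · right
    exact congrArg LieSubmodule.toSubmodule h1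

variable {V}

/-- The graded pieces of `T`. -/
noncomputable def topGrade (wt : D.Weight h₀) (k : Fin n → ℤ) : Submodule ℂ (D.topSpace V b) :=
  (shiftedWeight V wt wt.onCartan (expo0 k)).comap
    (D.topSpace V b : Submodule ℂ V).subtype

variable {D} {wt : D.Weight h₀} {k : Fin n → ℤ} {v : D.topSpace V b}

lemma mem_topGrade : v ∈ D.topGrade wt k ↔
    (v : V) ∈ shiftedWeight V wt wt.onCartan (expo0 k) := Iff.rfl

lemma zeroLoop_mem_topGrade (l : Fin n → ℤ) (X : D.gCirc h₀) (hX : X ∈ D.gCircGrad h₀ l)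
    (hv : v ∈ D.topGrade wt k) : ⁅D.zeroLoop b l X hX, v⁆ ∈ D.topGrade wt (k + l) := by
  have := lie_loopEl_mem_shiftedWeight (D.gCircGrad_mem hX) (mem_topGrade.mp hv)
  rw [add_zero, ← expo0_add] at this
  exact this

lemma zeroC_mem_topGrade (r : Fin n → ℤ) (hr : r ∈ D.Γ) (w : Coef n)
    (hv : v ∈ D.topGrade wt k) : ⁅D.zeroC b r hr w, v⁆ ∈ D.topGrade wt (k + r) := by
  have := lie_centerEl_mem_shiftedWeight (D.expo0_mem hr) w (mem_topGrade.mp hv)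
  rw [← expo0_add] at this
  exact this

lemma zeroD₀_mem_topGrade (r : Fin n → ℤ) (hr : r ∈ D.Γ)
    (hv : v ∈ D.topGrade wt k) : ⁅D.zeroD₀ b r hr, v⁆ ∈ D.topGrade wt (k + r) := by
  have := lie_derEl_mem_shiftedWeight (D.expo0_mem hr) (Pi.single 0 1) (mem_topGrade.mp hv)
  rw [← expo0_add] at this
  exact this

lemma zeroD_mem_topGrade (u : Fin n → ℂ) (r : Fin n → ℤ) (hr : r ∈ D.Γ)
    (hv : v ∈ D.topGrade wt k) : ⁅D.zeroD b u r hr, v⁆ ∈ D.topGrade wt (k + r) := by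
  have := lie_derEl_mem_shiftedWeight (D.expo0_mem hr) (Fin.cons 0 u) (mem_topGrade.mp hv)
  rw [← expo0_add] at this
  exact this

lemma iSup_topGrade [LieModule.IsIrreducible ℂ (D.tauNonneg b) (D.topSpace V b)]
    {v₀ : V} (h1 : v₀ ∈ D.topSpace V b) (h0 : v₀ ≠ 0) (hw : v₀ ∈ D.weightSpace V wt) :
    ⨆ k, (D.topGrade wt k : Submodule ℂ (D.topSpace V b)) = ⊤ := by
  have stab : ∀ (x : D.tauNonneg b) (r : Fin n → ℤ),
      (∀ k, ∀ v ∈ (D.topGrade wt k : Submodule ℂ (D.topSpace V b)), ⁅x, v⁆ ∈ D.topGrade wt (k + r)) →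
      ∀ v ∈ ⨆ k, (D.topGrade wt k : Submodule ℂ (D.topSpace V b)),
        ⁅x, v⁆ ∈ ⨆ k, (D.topGrade wt k : Submodule ℂ (D.topSpace V b)) := by
    intro x r hx v hv
    induction hv using Submodule.iSup_induction' with
    | zero => rw [lie_zero]; exact zero_mem _
    | add v w _ _ h2 h3 => rw [lie_add]; exact add_mem h2 h3
    | mem k v hv => exact Submodule.mem_iSup_of_mem _ (hx k v hv)
  refine (eq_bot_or_eq_top_of_stable _ (fun l X hX => stab _ l fun k v => zeroLoop_mem_topGrade l X hX)
    (fun r hr w => stab _ r fun k v => zeroC_mem_topGrade r hr w)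
    (fun r hr => stab _ r fun k v => zeroD₀_mem_topGrade r hr)
    (fun u r hr => stab _ r fun k v => zeroD_mem_topGrade u r hr)).resolve_left fun hb => h0 ?_
  have h2 : (⟨v₀, h1⟩ : D.topSpace V b) ∈ D.topGrade wt 0 := by
    rw [mem_topGrade, shiftedWeight]
    have : (expo0 (0 : Fin n → ℤ)).toCoef = 0 := by
      funext i
      refine Fin.cases ?_ (fun j => ?_) i <;> simp [Expo.toCoef]
    rw [this, add_zero]
    exact hw
  have h3 := Submodule.mem_iSup_of_mem (p := fun k => D.topGrade wt k) 0 h2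
  rw [hb, Submodule.mem_bot] at h3
  exact congrArg Subtype.val h3

lemma finiteDimensional_topGrade (hV : D.IsIntegrable h₀ V) (wt : D.Weight h₀) (k : Fin n → ℤ) :
    FiniteDimensional ℂ (D.topGrade wt k : Submodule ℂ (D.topSpace V b)) := by
  have := hV.finite_weightSpace ⟨wt.onCartan, wt.onK, wt.onD + (expo0 k).toCoef⟩
  let φ : (D.topGrade wt k : Submodule ℂ (D.topSpace V b)) →ₗ[ℂ]
      D.weightSpace V ⟨wt.onCartan, wt.onK, wt.onD + (expo0 k).toCoef⟩ :=
    LinearMap.codRestrict _ ((D.topSpace V b : Submodule ℂ V).subtype ∘ₗ Submodule.subtype _)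
      fun v => v.2
  refine FiniteDimensional.of_injective φ fun v w hvw => ?_
  exact Subtype.ext (Subtype.ext (congrArg
    (fun z : D.weightSpace V ⟨wt.onCartan, wt.onK, wt.onD + (expo0 k).toCoef⟩ => (z : V)) hvw))

end Module

end TwistData


/-! ### Products of root operators on highest weight vectors -/

section Ladder

variable {U : Type*} [AddCommGroup U] [Module ℂ U] {A : Type*} {e : Module.End ℂ U}
variable {f h : A → Module.End ℂ U} {φ : A → A → A} {T : Submodule ℂ U}

/-- Operators `f_a` whose commutators `h_a` with `e` normalize the `f_b` and preserve the subspace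
`T`, which is killed by `e`. -/
structure IsLadder (e : Module.End ℂ U) (f h : A → Module.End ℂ U) (φ : A → A → A)
    (T : Submodule ℂ U) : Prop where
  ef : ∀ a v, e (f a v) = f a (e v) + h a v
  hf : ∀ a b v, h b (f a v) = f a (h b v) - (2 : ℂ) • f (φ a b) v
  e_T : ∀ v ∈ T, e v = 0
  h_T : ∀ a, ∀ v ∈ T, h a v ∈ T

/-- The maps `f_{a₁} ⋯ f_{a_M} b` on `T`, with `b ∈ B`. -/
def ladderMaps (f : A → Module.End ℂ U) (B : Subalgebra ℂ (Module.End ℂ T)) :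
    ℕ → Submodule ℂ (T →ₗ[ℂ] U)
  | 0 => (Subalgebra.toSubmodule B).map (LinearMap.llcomp ℂ T T U T.subtype)
  | M + 1 => ⨆ a, (ladderMaps f B M).map (LinearMap.llcomp ℂ T U U (f a))

namespace IsLadder

variable (H : IsLadder e f h φ T) {B : Subalgebra ℂ (Module.End ℂ T)}
  (hB : ∀ a, (h a).restrict (H.h_T a) ∈ B)

include hB in
lemma h_comp_mem (M : ℕ) (b : A) :
    ∀ q ∈ ladderMaps f B M, (h b).comp q ∈ ladderMaps f B M := by
  induction M with
  | zero =>
    rintro _ ⟨c, hc, rfl⟩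
    exact ⟨(h b).restrict (H.h_T b) * c, B.mul_mem (hB b) hc, rfl⟩
  | succ M ih =>
    intro q hq
    induction hq using Submodule.iSup_induction' with
    | zero => rw [LinearMap.comp_zero]; exact zero_mem _
    | add x y _ _ hx hy => rw [LinearMap.comp_add]; exact add_mem hx hy
    | mem a q hq =>
      obtain ⟨q, hq, rfl⟩ := hq
      have : (h b).comp ((f a).comp q) = (f a).comp ((h b).comp q) -
          (2 : ℂ) • (f (φ a b)).comp q := by
        ext v
        simp [H.hf]
      rw [LinearMap.llcomp_apply', this]
      exact sub_mem (Submodule.mem_iSup_of_mem a ⟨_, ih q hq, rfl⟩)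
        (Submodule.smul_mem _ _ (Submodule.mem_iSup_of_mem (φ a b) ⟨_, hq, rfl⟩))

include H in
lemma e_comp_eq_zero : ∀ q ∈ ladderMaps f B 0, e.comp q = 0 := by
  rintro _ ⟨c, hc, rfl⟩
  ext v
  exact H.e_T _ (c v).2

include hB in
lemma e_comp_mem (M : ℕ) :
    ∀ q ∈ ladderMaps f B (M + 1), e.comp q ∈ ladderMaps f B M := by
  induction M with
  | zero =>
    intro q hq
    rw [ladderMaps] at hq
    induction hq using Submodule.iSup_induction' with
    | zero => rw [LinearMap.comp_zero]; exact zero_mem _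
    | add x y _ _ hx hy => rw [LinearMap.comp_add]; exact add_mem hx hy
    | mem a q hq =>
      obtain ⟨q, hq, rfl⟩ := hq
      have : e.comp ((f a).comp q) = (h a).comp q := by
        ext v
        have := DFunLike.congr_fun (H.e_comp_eq_zero q hq) v
        simp only [LinearMap.comp_apply, LinearMap.zero_apply] at this ⊢
        rw [H.ef, this, map_zero, zero_add]
      rw [LinearMap.llcomp_apply', this]
      exact H.h_comp_mem hB 0 a q hq
  | succ M ih =>
    intro q hq
    rw [ladderMaps] at hq
    induction hq using Submodule.iSup_induction' with
    | zero => rw [LinearMap.comp_zero]; exact zero_mem _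
    | add x y _ _ hx hy => rw [LinearMap.comp_add]; exact add_mem hx hy
    | mem a q hq =>
      obtain ⟨q, hq, rfl⟩ := hq
      have : e.comp ((f a).comp q) = (f a).comp (e.comp q) + (h a).comp q := by
        ext v
        simp [H.ef]
      rw [LinearMap.llcomp_apply', this]
      exact add_mem (Submodule.mem_iSup_of_mem a ⟨_, ih q hq, rfl⟩) (H.h_comp_mem hB _ a q hq)

include hB in
/-- `e^N f_a^N` acts on `T` as an element of the algebra generated by the `h_b`. -/
lemma exists_pow_e_pow_f (N : ℕ) (a : A) :
    ∃ b ∈ B, ∀ v : T, (e ^ N) ((f a ^ N) (v : U)) = (b v : T) := by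
  have h1 : ∀ N, (f a ^ N).comp T.subtype ∈ ladderMaps f B N := by
    intro N
    induction N with
    | zero => exact ⟨1, B.one_mem, rfl⟩
    | succ N ih =>
      rw [pow_succ']
      exact Submodule.mem_iSup_of_mem a ⟨_, ih, rfl⟩
  have h2 : ∀ j M, ∀ q ∈ ladderMaps f B (M + j), (e ^ j).comp q ∈ ladderMaps f B M := by
    intro j
    induction j with
    | zero => intro M q hq; exact hq
    | succ j ih =>
      intro M q hq
      rw [pow_succ]
      exact ih M _ (H.e_comp_mem hB _ q hq)
  obtain ⟨b, hb, hb'⟩ := h2 N 0 _ (by simpa using h1 N)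
  exact ⟨b, hb, fun v => (DFunLike.congr_fun hb' v).symm⟩

end IsLadder

end Ladder

section PolynomialLadder

variable {V : Type*} [AddCommGroup V] [Module ℂ V]

/-- A family of vectors that depends polynomially on an integer vanishes only if its leading
coefficient does. -/
lemma eq_zero_of_polynomial_eq_zero {M : ℕ} {w : V} {u : ℕ → V}
    (h : ∀ x : ℤ, (x : ℂ) ^ M • w + ∑ j ∈ Finset.range M, (x : ℂ) ^ j • u j = 0) : w = 0 := by
  rw [← Module.forall_dual_apply_eq_zero_iff ℂ]
  intro φ
  set p : Polynomial ℂ := Polynomial.C (φ w) * Polynomial.X ^ M +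
    ∑ j ∈ Finset.range M, Polynomial.C (φ (u j)) * Polynomial.X ^ j with hp
  have h0 : p = 0 := by
    refine Polynomial.eq_zero_of_infinite_isRoot p
      ((Set.infinite_range_of_injective (Int.cast_injective (α := ℂ))).mono ?_)
    rintro _ ⟨x, rfl⟩
    have := congrArg φ (h x)
    simp only [map_add, map_sum, map_smul, smul_eq_mul, map_zero] at this
    simp only [hp, Set.mem_ofPred_eq, Polynomial.IsRoot, Polynomial.eval_add, Polynomial.eval_mul,
      Polynomial.eval_C, Polynomial.eval_pow, Polynomial.eval_X, Polynomial.eval_finsetSum]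
    rw [← this, mul_comm]
    congr 1
    exact Finset.sum_congr rfl fun j _ => mul_comm _ _
  have h1 : p.coeff M = φ w := by
    rw [hp, Polynomial.coeff_add, Polynomial.coeff_C_mul_X_pow, if_pos rfl,
      Polynomial.finsetSum_coeff, Finset.sum_eq_zero, add_zero]
    intro j hj
    rw [Polynomial.coeff_C_mul_X_pow, if_neg]
    exact (Finset.mem_range.mp hj).ne'
  rw [← h1, h0, Polynomial.coeff_zero]

variable {A : Type*} {e : ℤ → Module.End ℂ V} {f : A → ℤ → Module.End ℂ V}
variable {h ω : A → Module.End ℂ V} {φ : A → A → A} {T : Submodule ℂ V}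

/-- A family of ladders in which the commutators `[e, f_a]` depend linearly on the parameter. -/
structure IsLinearLadder (e : ℤ → Module.End ℂ V) (f : A → ℤ → Module.End ℂ V)
    (h ω : A → Module.End ℂ V) (φ : A → A → A) (T : Submodule ℂ V) : Prop where
  ef : ∀ a x v, e x (f a x v) = f a x (e x v) + h a v + (x : ℂ) • ω a v
  hf : ∀ a b x v, h b (f a x v) = f a x (h b v) - (2 : ℂ) • f (φ a b) x v
  ωf : ∀ a b x v, ω b (f a x v) = f a x (ω b v)
  e_T : ∀ x, ∀ v ∈ T, e x v = 0
  h_T : ∀ a, ∀ v ∈ T, h a v ∈ T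
  ω_T : ∀ a, ∀ v ∈ T, ω a v ∈ T

/-- Pointwise application of a family of operators. -/
def pointwise (e : ℤ → Module.End ℂ V) : Module.End ℂ (ℤ → V) where
  toFun p x := e x (p x)
  map_add' p q := by ext x; simp
  map_smul' a p := by ext x; simp

@[simp] lemma pointwise_apply (e : ℤ → Module.End ℂ V) (p : ℤ → V) (x : ℤ) :
    pointwise e p x = e x (p x) := rfl

/-- Multiplication by the parameter. -/
noncomputable def mulParam (V : Type*) [AddCommGroup V] [Module ℂ V] : Module.End ℂ (ℤ → V) :=
  pointwise fun x => (x : ℂ) • LinearMap.id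

/-- The span of the families `x^j f_{a₁}(x) ⋯ f_{a_M}(x) u` with `j < d` and `u ∈ T`. -/
noncomputable def polyLadder (f : A → ℤ → Module.End ℂ V) (T : Submodule ℂ V) (d : ℕ) :
    ℕ → Submodule ℂ (ℤ → V)
  | 0 => Submodule.span ℂ {p | ∃ j < d, ∃ u ∈ T, p = fun x : ℤ => (x : ℂ) ^ j • u}
  | M + 1 => ⨆ a, (polyLadder f T d M).map (pointwise (f a))

lemma polyLadder_induction {d M : ℕ} {P : Submodule ℂ (ℤ → V)} (B : Module.End ℂ (ℤ → V))
    (h : ∀ a, ∀ p ∈ polyLadder f T d M, B (pointwise (f a) p) ∈ P) :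
    ∀ p ∈ polyLadder f T d (M + 1), B p ∈ P := by
  intro p hp
  rw [polyLadder] at hp
  induction hp using Submodule.iSup_induction' with
  | zero => rw [map_zero]; exact zero_mem _
  | add x y _ _ hx hy => rw [map_add]; exact add_mem hx hy
  | mem a q hq =>
    obtain ⟨q, hq, rfl⟩ := hq
    exact h a q hq

lemma polyLadder_zero_induction {d : ℕ} {P : Submodule ℂ (ℤ → V)} (B : Module.End ℂ (ℤ → V))
    (h : ∀ j < d, ∀ u ∈ T, B (fun x : ℤ => (x : ℂ) ^ j • u) ∈ P) :
    ∀ p ∈ polyLadder f T d 0, B p ∈ P := by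
  intro p hp
  rw [polyLadder] at hp
  induction hp using Submodule.span_induction with
  | zero => rw [map_zero]; exact zero_mem _
  | add x y _ _ hx hy => rw [map_add]; exact add_mem hx hy
  | smul a x _ hx => rw [map_smul]; exact Submodule.smul_mem _ a hx
  | mem p hp =>
    obtain ⟨j, hj, u, hu, rfl⟩ := hp
    exact h j hj u hu

lemma pointwise_mem_polyLadder {d M : ℕ} (a : A) {p : ℤ → V} (hp : p ∈ polyLadder f T d M) :
    pointwise (f a) p ∈ polyLadder f T d (M + 1) := by
  rw [polyLadder]
  exact Submodule.mem_iSup_of_mem a ⟨_, hp, rfl⟩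

lemma pow_smul_mem_polyLadder {d j : ℕ} (hj : j < d) {u : V} (hu : u ∈ T) :
    (fun x : ℤ => (x : ℂ) ^ j • u) ∈ polyLadder f T d 0 :=
  Submodule.subset_span ⟨j, hj, u, hu, rfl⟩

lemma polyLadder_mono {d d' : ℕ} (hd : d ≤ d') (M : ℕ) :
    polyLadder f T d M ≤ polyLadder f T d' M := by
  induction M with
  | zero =>
    refine Submodule.span_mono ?_
    rintro _ ⟨j, hj, u, hu, rfl⟩
    exact ⟨j, by omega, u, hu, rfl⟩
  | succ M ih =>
    rw [polyLadder, polyLadder]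
    exact iSup_mono fun a => Submodule.map_mono ih

lemma mulParam_mem_polyLadder {d : ℕ} (M : ℕ) :
    ∀ p ∈ polyLadder f T d M, mulParam V p ∈ polyLadder f T (d + 1) M := by
  induction M with
  | zero =>
    refine polyLadder_zero_induction _ fun j hj u hu => ?_
    have : mulParam V (fun x : ℤ => (x : ℂ) ^ j • u) = fun x : ℤ => (x : ℂ) ^ (j + 1) • u := by
      funext x
      simp [mulParam, smul_smul, pow_succ, mul_comm]
    rw [this]
    exact pow_smul_mem_polyLadder (by omega) hu
  | succ M ih =>
    refine polyLadder_induction _ fun a p hp => ?_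
    have : mulParam V (pointwise (f a) p) = pointwise (f a) (mulParam V p) := by
      funext x
      simp [mulParam]
    rw [this]
    exact pointwise_mem_polyLadder a (ih p hp)

namespace IsLinearLadder

variable (H : IsLinearLadder e f h ω φ T)

include H in
lemma h_mem {d : ℕ} (M : ℕ) (b : A) :
    ∀ p ∈ polyLadder f T d M, pointwise (fun _ => h b) p ∈ polyLadder f T d M := by
  induction M with
  | zero =>
    refine polyLadder_zero_induction _ fun j hj u hu => ?_
    have : pointwise (fun _ => h b) (fun x : ℤ => (x : ℂ) ^ j • u) =
        fun x : ℤ => (x : ℂ) ^ j • h b u := by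
      funext x; simp
    rw [this]
    exact pow_smul_mem_polyLadder hj (H.h_T b u hu)
  | succ M ih =>
    refine polyLadder_induction _ fun a p hp => ?_
    have : pointwise (fun _ => h b) (pointwise (f a) p) =
        pointwise (f a) (pointwise (fun _ => h b) p) - (2 : ℂ) • pointwise (f (φ a b)) p := by
      funext x
      simp [H.hf]
    rw [this]
    exact sub_mem (pointwise_mem_polyLadder a (ih p hp))
      (Submodule.smul_mem _ _ (pointwise_mem_polyLadder _ hp))

include H in
lemma ω_mem {d : ℕ} (M : ℕ) (b : A) :
    ∀ p ∈ polyLadder f T d M, pointwise (fun _ => ω b) p ∈ polyLadder f T d M := by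
  induction M with
  | zero =>
    refine polyLadder_zero_induction _ fun j hj u hu => ?_
    have : pointwise (fun _ => ω b) (fun x : ℤ => (x : ℂ) ^ j • u) =
        fun x : ℤ => (x : ℂ) ^ j • ω b u := by
      funext x; simp
    rw [this]
    exact pow_smul_mem_polyLadder hj (H.ω_T b u hu)
  | succ M ih =>
    refine polyLadder_induction _ fun a p hp => ?_
    have : pointwise (fun _ => ω b) (pointwise (f a) p) =
        pointwise (f a) (pointwise (fun _ => ω b) p) := by
      funext x
      simp [H.ωf]
    rw [this]
    exact pointwise_mem_polyLadder a (ih p hp)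

include H in
lemma e_pointwise (a : A) (p : ℤ → V) : pointwise e (pointwise (f a) p) =
    pointwise (f a) (pointwise e p) + pointwise (fun _ => h a) p +
      mulParam V (pointwise (fun _ => ω a) p) := by
  funext x
  simp [H.ef, mulParam]

include H in
lemma e_eq_zero {d : ℕ} : ∀ p ∈ polyLadder f T d 0, pointwise e p = 0 := by
  intro p hp
  rw [← Submodule.mem_bot ℂ]
  refine polyLadder_zero_induction _ (fun j hj u hu => ?_) p hp
  rw [Submodule.mem_bot]
  funext x
  simp [H.e_T x u hu]

include H in
lemma e_mem {d : ℕ} (M : ℕ) :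
    ∀ p ∈ polyLadder f T d (M + 1), pointwise e p ∈ polyLadder f T (d + 1) M := by
  have rest : ∀ (a : A) (M : ℕ) (p), p ∈ polyLadder f T d M →
      pointwise (fun _ => h a) p + mulParam V (pointwise (fun _ => ω a) p) ∈
        polyLadder f T (d + 1) M := fun a M p hp =>
    add_mem (polyLadder_mono (Nat.le_succ d) M (H.h_mem M a p hp))
      (mulParam_mem_polyLadder M _ (H.ω_mem M a p hp))
  induction M with
  | zero =>
    refine polyLadder_induction _ fun a p hp => ?_
    rw [H.e_pointwise, H.e_eq_zero p hp, map_zero, zero_add]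
    exact rest a 0 p hp
  | succ M ih =>
    refine polyLadder_induction _ fun a p hp => ?_
    rw [H.e_pointwise, add_assoc]
    exact add_mem (pointwise_mem_polyLadder a (ih p hp)) (rest a _ p hp)

/-- `x^d f_a(x)^M u`. -/
noncomputable def leading (f : A → ℤ → Module.End ℂ V) (a : A) (d M : ℕ) (u : V) : ℤ → V :=
  fun x => (x : ℂ) ^ d • (f a x ^ M) u

lemma leading_succ (a : A) (d M : ℕ) (u : V) :
    leading f a d (M + 1) u = pointwise (f a) (leading f a d M u) := by
  funext x
  simp [leading, pow_succ']

lemma leading_mem (a : A) (d M : ℕ) {u : V} (hu : u ∈ T) :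
    leading f a d M u ∈ polyLadder f T (d + 1) M := by
  induction M with
  | zero => exact pow_smul_mem_polyLadder (Nat.lt_succ_self d) hu
  | succ M ih =>
    rw [leading_succ]
    exact pointwise_mem_polyLadder a ih

include H in
lemma mulParam_ω_leading (a : A) (d M : ℕ) (u : V) :
    mulParam V (pointwise (fun _ => ω a) (leading f a d M u)) = leading f a (d + 1) M (ω a u) := by
  funext x
  have : ∀ M, ω a ((f a x ^ M) u) = (f a x ^ M) (ω a u) := by
    intro M
    induction M with
    | zero => rfl
    | succ M ih => rw [pow_succ_apply, pow_succ_apply, H.ωf, ih]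
  simp [leading, mulParam, this, smul_smul, pow_succ, mul_comm]

include H in
lemma e_leading (a : A) (d M : ℕ) {u : V} (hu : u ∈ T) :
    pointwise e (leading f a d (M + 1) u) - ((M + 1 : ℕ) : ℂ) • leading f a (d + 1) M (ω a u) ∈
      polyLadder f T (d + 1) M := by
  induction M with
  | zero =>
    have h0 : leading f a d 0 u ∈ polyLadder f T (d + 1) 0 := leading_mem a d 0 hu
    rw [leading_succ, H.e_pointwise, H.e_eq_zero _ h0, map_zero, zero_add, H.mulParam_ω_leading]
    simpa using H.h_mem 0 a _ h0
  | succ M ih =>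
    have h1 := pointwise_mem_polyLadder a ih
    rw [map_sub, map_smul, ← leading_succ] at h1
    have h2 := H.h_mem (M + 1) a _ (leading_mem a d (M + 1) hu)
    rw [leading_succ, H.e_pointwise, H.mulParam_ω_leading]
    convert add_mem h1 h2 using 1
    push_cast
    module

include H in
lemma pow_e_leading (a : A) {u : V} (hu : u ∈ T) (j M : ℕ) :
    (pointwise e ^ j) (leading f a 0 (M + j) u) -
      ((M + j).descFactorial j : ℂ) • leading f a j M ((ω a ^ j) u) ∈ polyLadder f T j M := by
  induction j generalizing M with
  | zero => simp
  | succ j ih =>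
    have h1 := H.e_mem M _ (ih (M + 1))
    have hω : ∀ j, (ω a ^ j) u ∈ T := by
      intro j
      induction j with
      | zero => exact hu
      | succ j ih => rw [pow_succ_apply]; exact H.ω_T a _ ih
    have h2 := Submodule.smul_mem _ (((M + 1 + j).descFactorial j : ℕ) : ℂ)
      (H.e_leading a j M (hω j))
    rw [map_sub, map_smul, ← pow_succ_apply] at h1
    rw [show M + (j + 1) = M + 1 + j by ring, pow_succ_apply (ω a)]
    convert add_mem h1 h2 using 1
    rw [Nat.descFactorial_succ, show M + 1 + j - j = M + 1 by omega]
    push_cast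
    module

include H in
/-- Nilpotency of the linear coefficient of `[e, f_a]`. -/
lemma pow_ω_eq_zero (a : A) (M : ℕ) {u : V} (hu : u ∈ T)
    (hM : ∀ x, (f a x ^ M) u = 0) : (ω a ^ M) u = 0 := by
  have h1 := H.pow_e_leading a hu M 0
  have h2 : leading f a 0 (0 + M) u = 0 := by
    funext x
    simp [leading, hM]
  rw [h2, map_zero, zero_sub, zero_add, Nat.descFactorial_self] at h1
  have h3 : ∀ p ∈ polyLadder f T M 0, ∃ w : ℕ → V,
      ∀ x : ℤ, p x = ∑ j ∈ Finset.range M, (x : ℂ) ^ j • w j := by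
    intro p hp
    rw [polyLadder] at hp
    induction hp using Submodule.span_induction with
    | zero => exact ⟨0, fun x => by simp⟩
    | add p q _ _ hp hq =>
      obtain ⟨w, hw⟩ := hp
      obtain ⟨w', hw'⟩ := hq
      exact ⟨w + w', fun x => by simp [hw, hw', Finset.sum_add_distrib]⟩
    | smul c p _ hp =>
      obtain ⟨w, hw⟩ := hp
      exact ⟨c • w, fun x => by simp [hw, Finset.smul_sum, smul_comm c]⟩
    | mem p hp =>
      obtain ⟨j, hj, u, hu, rfl⟩ := hp
      classical
      refine ⟨Pi.single j u, fun x => ?_⟩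
      rw [Finset.sum_eq_single j]
      · simp
      · intro i _ hij
        simp [Pi.single_eq_of_ne hij]
      · intro hj'
        exact absurd (Finset.mem_range.mpr hj) hj'
  obtain ⟨w, hw⟩ := h3 _ h1
  have h4 := eq_zero_of_polynomial_eq_zero (M := M) (w := (M.factorial : ℂ) • (ω a ^ M) u) (u := w)
    (fun x => by
      rw [← hw x]
      simp [leading, smul_smul, mul_comm])
  exact (smul_eq_zero.mp h4).resolve_left (Nat.cast_ne_zero.mpr M.factorial_ne_zero)

end IsLinearLadder

end PolynomialLadder

section CommonKernel

variable {I T : Type*} [AddCommGroup I] [AddCommGroup T] [Module ℂ T]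

/-- A family of commuting nilpotent homogeneous operators on a graded space with finite-dimensional
pieces has a common kernel, if finitely many pieces represent all of them. -/
lemma exists_mem_common_kernel {Tk : I → Submodule ℂ T} [∀ k, FiniteDimensional ℂ (Tk k)]
    {Φ : Set (Module.End ℂ T)} (hnil : ∀ φ ∈ Φ, IsNilpotent φ)
    (hdeg : ∀ φ ∈ Φ, ∃ d, ∀ k, ∀ v ∈ Tk k, φ v ∈ Tk (k + d))
    (hcomm : ∀ φ ∈ Φ, ∀ ψ ∈ Φ, Commute φ ψ) {R : Finset I}
    (hR : ∀ k, ∃ S : Module.End ℂ T, Function.Injective S ∧ (∀ φ ∈ Φ, Commute S φ) ∧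
      ∃ k' ∈ R, ∀ v ∈ Tk k, S v ∈ Tk k')
    {k₀ : I} (h0 : Tk k₀ ≠ ⊥) : ∃ k, ∃ v ∈ Tk k, v ≠ 0 ∧ ∀ φ ∈ Φ, φ v = 0 := by
  classical
  have step1 : ∀ F : Finset (Module.End ℂ T), (F : Set (Module.End ℂ T)) ⊆ Φ →
      ∃ k, ∃ v ∈ Tk k, v ≠ 0 ∧ ∀ φ ∈ F, φ v = 0 := by
    intro F
    induction F using Finset.induction_on with
    | empty =>
      intro _
      obtain ⟨v, hv, hv0⟩ := Submodule.exists_mem_ne_zero_of_ne_bot h0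
      exact ⟨k₀, v, hv, hv0, by simp⟩
    | insert φ F _ ih =>
      intro hF
      obtain ⟨k, v, hv, hv0, hvF⟩ := ih fun ψ hψ => hF (Finset.mem_insert_of_mem hψ)
      have hφ := hF (Finset.mem_insert_self φ F)
      obtain ⟨d, hd⟩ := hdeg φ hφ
      obtain ⟨N, hN⟩ := hnil φ hφ
      have hl : LocNilp φ := fun w => ⟨N, by rw [hN]; rfl⟩
      obtain ⟨t, -, h1, h2⟩ := hl.exists_max (v := v) (s := 0) (by simpa using hv0)
      have h3 : ∀ t, ∃ k', (φ ^ t) v ∈ Tk k' := by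
        intro t
        induction t with
        | zero => exact ⟨k, hv⟩
        | succ t ih =>
          obtain ⟨k', hk'⟩ := ih
          exact ⟨k' + d, by rw [pow_succ_apply]; exact hd k' _ hk'⟩
      obtain ⟨k', hk'⟩ := h3 t
      refine ⟨k', _, hk', h1, fun ψ hψ => ?_⟩
      rcases Finset.mem_insert.mp hψ with rfl | hψ
      · rw [← pow_succ_apply]; exact h2
      · have hc := (hcomm ψ (hF (Finset.mem_insert_of_mem hψ)) φ hφ).pow_right t
        have := DFunLike.congr_fun hc.eq v
        rw [Module.End.mul_apply, Module.End.mul_apply] at this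
        rw [this, hvF ψ hψ, map_zero]
  have step2 : ∀ F : Finset (Module.End ℂ T), (F : Set (Module.End ℂ T)) ⊆ Φ →
      ∃ k ∈ R, ∃ v ∈ Tk k, v ≠ 0 ∧ ∀ φ ∈ F, φ v = 0 := by
    intro F hF
    obtain ⟨k, v, hv, hv0, hvF⟩ := step1 F hF
    obtain ⟨S, hS, hSc, k', hk', hSk⟩ := hR k
    refine ⟨k', hk', S v, hSk v hv, fun h => hv0 (hS (by rw [h, map_zero])), fun φ hφ => ?_⟩
    have := DFunLike.congr_fun (hSc φ (hF hφ)).eq v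
    rw [Module.End.mul_apply, Module.End.mul_apply] at this
    rw [← this, hvF φ hφ, map_zero]
  let Kr : Finset (Module.End ℂ T) → I → Submodule ℂ T :=
    fun F k => Tk k ⊓ ⨅ φ ∈ F, LinearMap.ker φ
  have hKr : ∀ F k v, v ∈ Kr F k ↔ v ∈ Tk k ∧ ∀ φ ∈ F, φ v = 0 := by
    intro F k v
    simp [Kr, Submodule.mem_iInf]
  let dimF : {F : Finset (Module.End ℂ T) // (F : Set (Module.End ℂ T)) ⊆ Φ} → ℕ :=
    fun F => ∑ k ∈ R, Module.finrank ℂ (Kr F.1 k)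
  have hne : Nonempty {F : Finset (Module.End ℂ T) // (F : Set (Module.End ℂ T)) ⊆ Φ} :=
    ⟨⟨∅, by simp⟩⟩
  obtain ⟨F, hF⟩ : ∃ F, ∀ F', dimF F ≤ dimF F' :=
    ⟨Function.argmin dimF, fun F' => Function.argmin_le dimF F'⟩
  obtain ⟨k, hk, v, hv, hv0, hvF⟩ := step2 F.1 F.2
  refine ⟨k, v, hv, hv0, fun φ hφ => ?_⟩
  let F' : {F : Finset (Module.End ℂ T) // (F : Set (Module.End ℂ T)) ⊆ Φ} :=
    ⟨insert φ F.1, by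
      intro ψ hψ
      rcases Finset.mem_insert.mp hψ with rfl | hψ
      · exact hφ
      · exact F.2 hψ⟩
  have hfd : ∀ F k, FiniteDimensional ℂ (Kr F k) := fun F k =>
    Submodule.finiteDimensional_of_le (inf_le_left : Kr F k ≤ Tk k)
  have hle : ∀ k, Kr F'.1 k ≤ Kr F.1 k := by
    intro k w hw
    rw [hKr] at hw ⊢
    exact ⟨hw.1, fun ψ hψ => hw.2 ψ (Finset.mem_insert_of_mem hψ)⟩
  have hfr : ∀ k, Module.finrank ℂ (Kr F'.1 k) ≤ Module.finrank ℂ (Kr F.1 k) := fun k =>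
    Submodule.finrank_mono (hle k)
  have heq : Module.finrank ℂ (Kr F'.1 k) = Module.finrank ℂ (Kr F.1 k) := by
    refine le_antisymm (hfr k) ?_
    by_contra hlt
    have : dimF F' < dimF F := Finset.sum_lt_sum (fun k _ => hfr k) ⟨k, hk, not_le.mp hlt⟩
    exact absurd (hF F') (not_le.mpr this)
  have h5 : Kr F'.1 k = Kr F.1 k := Submodule.eq_of_le_of_finrank_eq (hle k) heq
  have h6 : v ∈ Kr F'.1 k := by
    rw [h5, hKr]
    exact ⟨hv, hvF⟩
  exact ((hKr _ _ _).mp h6).2 φ (Finset.mem_insert_self _ _)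

end CommonKernel

/-! ### Loop `sl₂`-triples acting on the highest weight space -/

namespace TwistData

variable {n : ℕ} {g : Type*} [LieRing g] [LieAlgebra ℂ g] {D : TwistData n g}
variable {h₀ : LieSubalgebra ℂ D.fixed}
variable (V : Type*) [AddCommGroup V] [Module ℂ V] [LieRingModule D.tau V] [LieModule ℂ D.tau V]

lemma cons_mem_lattice {a : ℤ} (ha : (D.m 0 : ℤ) ∣ a) (d : D.Γ) :
    (Fin.cons a (d : Fin n → ℤ) : Expo n) ∈ D.lattice := by
  intro i
  refine Fin.cases ?_ (fun j => ?_) i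
  · simpa using ha
  · simpa using d.2 j

lemma cons_add_cons_neg (a : ℤ) (d e : Fin n → ℤ) :
    (Fin.cons a d : Expo n) + Fin.cons (-a) e = expo0 (d + e) := by
  funext i
  refine Fin.cases ?_ (fun j => ?_) i <;> simp [expo0]

/-- The operator `∑ wᵢ t^d Kᵢ`. -/
noncomputable def centerOp (d : D.Γ) (w : Coef n) : Module.End ℂ V :=
  LieModule.toEnd ℂ D.tau V (D.centerEl (expo0 d) (D.expo0_mem d.2) w)

lemma loopEl_lie_centerEl {k s : Expo n} {X : g} (hX : X ∈ D.grad k) (hs : s ∈ D.lattice)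
    (w : Coef n) (v : V) :
    ⁅D.centerEl s hs w, ⁅D.loopEl k X hX, v⁆⁆ = ⁅D.loopEl k X hX, ⁅D.centerEl s hs w, v⁆⁆ := by
  rw [leibniz_lie, ← lie_skew, D.lie_loopEl_centerEl, neg_zero, zero_lie, zero_add]

variable [FiniteDimensional ℂ g] [LieAlgebra.IsSimple ℂ g]
variable [LieAlgebra.IsSimple ℂ D.fixed] [h₀.IsCartanSubalgebra]
variable {h : LieSubalgebra ℂ g} [h.IsCartanSubalgebra]
variable {i : h₀.root}

/-- The coroot as an element of `g°`. -/
noncomputable def corootCirc (i : h₀.root) : D.gCirc h₀ :=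
  ⟨(((D.roots h₀).coroot i : D.fixed) : g), ((D.roots h₀).coroot i : D.fixed).2 0, fun x => by
    have : ⁅x, (D.roots h₀).coroot i⁆ = 0 := trivial_lie_zero h₀ h₀ x _
    exact congrArg (fun y : h₀ => ((y : D.fixed) : g)) this⟩

lemma corootCirc_mem (i : h₀.root) (d : D.Γ) : corootCirc i ∈ D.gCircGrad h₀ (d : Fin n → ℤ) := by
  intro j
  obtain ⟨z, hz⟩ := d.2 j
  rw [hz, zpow_mul, zpow_natCast, (D.ξ_prim j.succ).pow_eq_one, one_zpow, one_smul]
  exact ((D.roots h₀).coroot i : D.fixed).2 j.succ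

variable (h₀) in
/-- The operator `α_i^∨ ⊗ t^d`. -/
noncomputable def corootOp (i : h₀.root) (d : D.Γ) : Module.End ℂ V :=
  LieModule.toEnd ℂ D.tau V
    (D.loopEl (expo0 d) (corootCirc i : D.gCirc h₀) (D.gCircGrad_mem (corootCirc_mem i d)).1)

namespace RootTriple

variable (t : D.RootTriple h₀ i) {a : ℤ} (ha : (D.m 0 : ℤ) ∣ a)

/-- The operator `X ⊗ t₀^a t^d`. -/
noncomputable def loopE (d : D.Γ) : Module.End ℂ V := t.opX V (cons_mem_lattice ha d)

/-- The operator `Y ⊗ t₀^(-a) t^d`. -/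
noncomputable def loopF (d : D.Γ) : Module.End ℂ V :=
  t.opY V (cons_mem_lattice ((dvd_neg).mpr ha) d)

variable {V}

lemma loopE_loopF (d e : D.Γ) (v : V) :
    t.loopE V ha d (t.loopF V ha e v) = t.loopF V ha e (t.loopE V ha d v) +
      (corootOp h₀ V i (d + e) + (D.c * killingForm ℂ g t.X t.Y) •
        centerOp V (d + e) (Expo.toCoef (Fin.cons a (d : Fin n → ℤ)))) v := by
  have h1 : ⁅D.loopEl _ t.X (t.X_mem' (cons_mem_lattice ha d)).1,
      D.loopEl _ t.Y (t.Y_mem' (cons_mem_lattice ((dvd_neg).mpr ha) e)).1⁆ =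
      D.loopEl (expo0 (d + e : D.Γ)) (corootCirc i : D.gCirc h₀)
        (D.gCircGrad_mem (corootCirc_mem i (d + e))).1 +
      (D.c * killingForm ℂ g t.X t.Y) • D.centerEl (expo0 (d + e : D.Γ)) (D.expo0_mem (d + e).2)
        (Expo.toCoef (Fin.cons a (d : Fin n → ℤ))) := by
    rw [← D.centerEl_smul]
    refine Subtype.ext ((D.coe_lie_loopEl_loopEl _ _ _ _ _ _).trans ?_)
    rw [t.lie_eq, cons_add_cons_neg]
    rfl
  simp only [loopE, loopF, opX, opY, corootOp, centerOp, LieModule.toEnd_apply_apply,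
    LinearMap.add_apply, LinearMap.smul_apply]
  rw [leibniz_lie, h1, add_lie, smul_lie, add_comm]

lemma corootOp_loopF (d e : D.Γ) (v : V) :
    corootOp h₀ V i d (t.loopF V ha e v) = t.loopF V ha e (corootOp h₀ V i d v) -
      (2 : ℂ) • t.loopF V ha (e + d) v := by
  have hY := t.Y_mem' (cons_mem_lattice ((dvd_neg).mpr ha) e)
  have hk : killingForm ℂ g (corootCirc i : D.gCirc h₀) t.Y = 0 := by
    by_contra hne
    have := D.add_eq_zero_of_killingForm (D.gCircGrad_mem (corootCirc_mem i d)).2 hY.2 hne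
    rw [zero_add] at this
    exact root_ne_zero i (neg_eq_zero.mp this)
  have h1 : ⁅D.loopEl (expo0 d) (corootCirc i : D.gCirc h₀)
        (D.gCircGrad_mem (corootCirc_mem i d)).1, D.loopEl _ t.Y hY.1⁆ =
      (-2 : ℂ) • D.loopEl _ t.Y (t.Y_mem' (cons_mem_lattice ((dvd_neg).mpr ha) (e + d))).1 := by
    rw [← D.loopEl_smul]
    refine Subtype.ext ((D.coe_lie_loopEl_loopEl _ _ _ _ _ _).trans ?_)
    have h2 : ⁅((corootCirc i : D.gCirc h₀) : g), t.Y⁆ = (-2 : ℂ) • t.Y := by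
      refine (t.Y_mem.2 ((D.roots h₀).coroot i)).trans ?_
      rw [LinearMap.neg_apply, root_coroot]
    have h3 : expo0 (d : Fin n → ℤ) + Fin.cons (-a) (e : Fin n → ℤ) =
        (Fin.cons (-a) ((e + d : D.Γ) : Fin n → ℤ) : Expo n) := by
      funext j
      refine Fin.cases ?_ (fun j => ?_) j <;> simp [expo0, add_comm]
    rw [hk, h2, h3, mul_zero, zero_smul]
    have h4 : (FullToroidal.centerEl (Fin.cons (-a) ((e + d : D.Γ) : Fin n → ℤ)) 0 : D.Full) = 0 := by
      apply FullToroidal.ext' <;> simp [FullToroidal.centerEl, kahler]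
    rw [h4, add_zero]
    rfl
  simp only [loopF, opY, corootOp, LieModule.toEnd_apply_apply]
  rw [leibniz_lie, h1, smul_lie]
  module

lemma loopF_comm (d e : D.Γ) (v : V) :
    t.loopF V ha d (t.loopF V ha e v) = t.loopF V ha e (t.loopF V ha d v) := by
  have hY := t.Y_mem' (cons_mem_lattice ((dvd_neg).mpr ha) d)
  have hk : killingForm ℂ g t.Y t.Y = 0 := by
    by_contra hne
    have := D.add_eq_zero_of_killingForm hY.2 hY.2 hne
    rw [← neg_add, neg_eq_zero, ← two_smul ℂ] at this
    exact root_ne_zero i ((smul_eq_zero.mp this).resolve_left two_ne_zero)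
  have h1 : ⁅D.loopEl _ t.Y hY.1,
      D.loopEl _ t.Y (t.Y_mem' (cons_mem_lattice ((dvd_neg).mpr ha) e)).1⁆ = 0 := by
    refine Subtype.ext ((D.coe_lie_loopEl_loopEl _ _ _ _ _ _).trans ?_)
    rw [hk, lie_self, mul_zero, zero_smul]
    apply FullToroidal.ext' <;> simp [FullToroidal.centerEl, FullToroidal.loopEl, kahler]
  simp only [loopF, opY, LieModule.toEnd_apply_apply]
  rw [leibniz_lie, h1, zero_lie, zero_add]

lemma isSl2Ops_loop {C₀ : ℝ} (hL : D.HasLevel V C₀)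
    (hh : ∀ x : h₀, ((x : D.fixed) : g) ∈ h) (hΔ : D.weightsOfG h₀ ⊆ D.enlargedRoots h₀) (d : D.Γ) :
    IsSl2Ops (t.loopE V ha (-d)) (t.loopF V ha d)
      (t.opH V C₀ (Fin.cons a ((-d : D.Γ) : Fin n → ℤ))) := by
  have h1 := t.isSl2Ops hL hh hΔ (cons_mem_lattice ha (-d))
  have h2 : t.loopF V ha d = t.opY V (neg_mem (cons_mem_lattice ha (-d))) := by
    simp only [loopF, opY]
    congr 1
    refine D.loopEl_congr ?_ rfl _
    funext j
    refine Fin.cases ?_ (fun j => ?_) j <;> simp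
  rw [h2]
  exact h1

end RootTriple

variable {V} {b : (D.roots h₀).Base}
variable {wt : D.Weight h₀}

variable (b V) in
/-- The operator `∑ wᵢ t^d Kᵢ` on `T`. -/
noncomputable def topC (d : D.Γ) (w : Coef n) : Module.End ℂ (D.topSpace V b) :=
  LieModule.toEnd ℂ (D.tauNonneg b) (D.topSpace V b) (D.zeroC b d d.2 w)

variable (b V) in
/-- The operator `α_i^∨ ⊗ t^d` on `T`. -/
noncomputable def topCoroot (i : h₀.root) (d : D.Γ) : Module.End ℂ (D.topSpace V b) :=
  LieModule.toEnd ℂ (D.tauNonneg b) (D.topSpace V b) (D.zeroLoop b d _ (corootCirc_mem i d))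

lemma coe_topC (d : D.Γ) (w : Coef n) (v : D.topSpace V b) :
    (topC V b d w v : V) = centerOp V d w (v : V) := rfl

lemma centerOp_mem (d : D.Γ) (w : Coef n) {v : V} (hv : v ∈ D.topSpace V b) :
    centerOp V d w v ∈ D.topSpace V b := (topC V b d w ⟨v, hv⟩).2

lemma corootOp_mem (i : h₀.root) (d : D.Γ) {v : V} (hv : v ∈ D.topSpace V b) :
    corootOp h₀ V i d v ∈ D.topSpace V b := (topCoroot V b i d ⟨v, hv⟩).2

lemma topC_mem_topGrade (d : D.Γ) (w : Coef n) {k : Fin n → ℤ} {v : D.topSpace V b}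
    (hv : v ∈ D.topGrade wt k) : topC V b d w v ∈ D.topGrade wt (k + (d : Fin n → ℤ)) :=
  zeroC_mem_topGrade _ d.2 w hv

lemma centerOp_add (d : D.Γ) (w w' : Coef n) :
    centerOp V d (w + w') = centerOp V d w + centerOp V d w' := by
  rw [centerOp, D.centerEl_add, map_add]; rfl

lemma centerOp_smul (d : D.Γ) (a : ℂ) (w : Coef n) :
    centerOp V d (a • w) = a • centerOp V d w := by
  rw [centerOp, D.centerEl_smul, map_smul]; rfl

lemma cartanEl_topSpace (hT : ⨆ k, (D.topGrade wt k : Submodule ℂ (D.topSpace V b)) = ⊤) (x : h₀)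
    {v : V} (hv : v ∈ D.topSpace V b) : ⁅D.cartanEl h₀ x, v⁆ = wt.onCartan x • v := by
  have h1 : (⟨v, hv⟩ : D.topSpace V b) ∈
      ⨆ k, (D.topGrade wt k : Submodule ℂ (D.topSpace V b)) := hT ▸ Submodule.mem_top
  suffices h : ∀ v : D.topSpace V b, v ∈ ⨆ k, (D.topGrade wt k : Submodule ℂ (D.topSpace V b)) →
      ⁅D.cartanEl h₀ x, (v : V)⁆ = wt.onCartan x • (v : V) from h _ h1
  intro v hv
  induction hv using Submodule.iSup_induction' with
  | zero => simp
  | add v w _ _ h2 h3 =>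
    rw [show ((v + w : D.topSpace V b) : V) = v + w from rfl, lie_add, h2, h3, smul_add]
  | mem k v hv => exact (mem_topGrade.mp hv).1 x

namespace RootTriple

variable {i : h₀.root} (t : D.RootTriple h₀ i) {a : ℤ} (ha : (D.m 0 : ℤ) ∣ a)

lemma loopE_eq_zero (ha0 : 0 < a) (d : D.Γ) {v : V} (hv : v ∈ D.topSpace V b) :
    t.loopE V ha d v = 0 :=
  hv _ (D.loopEl_mem_rootPart (P := D.IsPos b) (t.X_mem' (cons_mem_lattice ha d))
    (Or.inl (by simpa using ha0)))

/-- The commutator of `X ⊗ t₀^a t^(-j)` and `Y ⊗ t₀^(-a) t^d`. -/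
noncomputable def loopH (i : h₀.root) (t : D.RootTriple h₀ i) (a : ℤ) (j d : D.Γ) :
    Module.End ℂ V :=
  corootOp h₀ V i (-j + d) + (D.c * killingForm ℂ g t.X t.Y) •
    centerOp V (-j + d) (Expo.toCoef (Fin.cons a ((-j : D.Γ) : Fin n → ℤ)))

lemma centerOp_loopF (d e : D.Γ) (w : Coef n) (v : V) :
    centerOp V d w (t.loopF V ha e v) = t.loopF V ha e (centerOp V d w v) :=
  loopEl_lie_centerEl V (t.Y_mem' (cons_mem_lattice ((dvd_neg).mpr ha) e)).1 (D.expo0_mem d.2) w v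

lemma isLadder (ha0 : 0 < a) (j : D.Γ) :
    IsLadder (t.loopE V ha (-j)) (t.loopF V ha) (loopH i t a j) (fun d e => d + (-j + e))
      (D.topSpace V b : Submodule ℂ V) where
  ef d v := t.loopE_loopF ha (-j) d v
  hf d e v := by
    simp only [loopH, LinearMap.add_apply, LinearMap.smul_apply, map_add, map_smul,
      corootOp_loopF, centerOp_loopF]
    abel
  e_T v hv := t.loopE_eq_zero ha ha0 _ hv
  h_T d v hv := add_mem (corootOp_mem i _ hv) (Submodule.smul_mem _ _ (centerOp_mem _ _ hv))

lemma isLinearLadder (ha0 : 0 < a) (l : D.Γ) :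
    IsLinearLadder (fun x => t.loopE V ha (x • l)) (fun d x => t.loopF V ha (d - x • l))
      (fun d => corootOp h₀ V i d + (D.c * killingForm ℂ g t.X t.Y) •
        centerOp V d (Pi.single 0 (a : ℂ)))
      (fun d => (D.c * killingForm ℂ g t.X t.Y) • centerOp V d (expo0 (l : Fin n → ℤ)).toCoef)
      (fun d e => d + e) (D.topSpace V b : Submodule ℂ V) where
  ef d x v := by
    have h1 : Expo.toCoef (Fin.cons a ((x • l : D.Γ) : Fin n → ℤ)) =
        Pi.single 0 (a : ℂ) + (x : ℂ) • (expo0 (l : Fin n → ℤ)).toCoef := by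
      funext j
      refine Fin.cases ?_ (fun j => ?_) j <;> simp [Expo.toCoef]
    simp only [loopE_loopF, h1, add_sub_cancel, centerOp_add, centerOp_smul, LinearMap.add_apply,
      LinearMap.smul_apply, smul_add]
    rw [smul_comm (x : ℂ)]
    abel
  hf d e x v := by
    simp only [LinearMap.add_apply, LinearMap.smul_apply, map_add, map_smul,
      corootOp_loopF, centerOp_loopF]
    rw [show d + e - x • l = d - x • l + e by abel]
    abel
  ωf d e x v := by
    simp only [LinearMap.smul_apply, map_smul, centerOp_loopF]
  e_T x v hv := t.loopE_eq_zero ha ha0 _ hv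
  h_T d v hv := add_mem (corootOp_mem i _ hv) (Submodule.smul_mem _ _ (centerOp_mem _ _ hv))
  ω_T d v hv := Submodule.smul_mem _ _ (centerOp_mem _ _ hv)

end RootTriple

/-- The operators of the loop `sl₂` of a real root on `T` have positive weight and are nilpotent. -/
lemma exists_rootTriple_weight (hV : D.IsIntegrable h₀ V)
    {C₀ : ℝ} (hL : D.HasLevel V C₀) (hh : ∀ x : h₀, ((x : D.fixed) : g) ∈ h)
    (hΔ : D.weightsOfG h₀ ⊆ D.enlargedRoots h₀) {v₀ : V} (hv₀ : v₀ ∈ D.topSpace V b) (h0 : v₀ ≠ 0)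
    (hT : ⨆ k, (D.topGrade wt k : Submodule ℂ (D.topSpace V b)) = ⊤) :
    ∃ (i : h₀.root) (t : D.RootTriple h₀ i) (a : ℤ) (ha : (D.m 0 : ℤ) ∣ a) (N : ℕ),
      0 < a ∧ 0 < N ∧
      (∀ r : Fin n → ℤ, ∀ v ∈ D.topSpace V b, t.opH V C₀ (Fin.cons a r) v = (N : ℂ) • v) ∧
      ∀ d, ∀ v ∈ D.topSpace V b, (t.loopF V ha d ^ (N + 1)) v = 0 := by
  obtain ⟨i⟩ := D.exists_root h₀
  obtain ⟨t⟩ := D.exists_rootTriple h₀ i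
  have hH : ∀ (a : ℤ) (r : Fin n → ℤ), ∀ v ∈ D.topSpace V b, t.opH V C₀ (Fin.cons a r) v =
      (wt.onCartan ((D.roots h₀).coroot i) + t.level C₀ * a) • v := by
    intro a r v hv
    simp only [RootTriple.opH, LieModule.toEnd_apply_apply, LinearMap.add_apply,
      LinearMap.smul_apply, LinearMap.id_apply, Fin.cons_zero]
    rw [cartanEl_topSpace hT _ hv, add_smul]
  have hlev := t.level_pos hL hh hΔ
  obtain ⟨a, ha, -, hax⟩ := D.exists_multiple_gt hlev
    (max 0 (-(wt.onCartan ((D.roots h₀).coroot i)).re))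
  have ha0 : 0 < a := by
    have := (le_max_left _ _).trans_lt hax
    exact_mod_cast pos_of_mul_pos_right this hlev.le
  have key : ∀ (d : D.Γ) (v : V), v ∈ D.topSpace V b → v ≠ 0 →
      ∃ N : ℕ, wt.onCartan ((D.roots h₀).coroot i) + t.level C₀ * a = N ∧
        (t.loopF V ha d ^ (N + 1)) v = 0 := fun d v hv hne =>
    (t.isSl2Ops_loop ha hL hh hΔ d).exists_nat (t.locNilp_opY hV _) (hH a _ v hv)
      (t.loopE_eq_zero ha ha0 _ hv) hne
  obtain ⟨N, hN, -⟩ := key 0 v₀ hv₀ h0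
  have hNpos : 0 < N := by
    have h1 := (le_max_right _ _).trans_lt hax
    have h2 := congrArg Complex.re hN
    simp only [Complex.add_re, ← Complex.ofReal_intCast, ← Complex.ofReal_mul, Complex.ofReal_re,
      Complex.natCast_re] at h2
    have : (0 : ℝ) < N := by linarith
    exact_mod_cast this
  refine ⟨i, t, a, ha, N, ha0, hNpos, fun r v hv => by rw [hH a r v hv, hN], fun d v hv => ?_⟩
  rcases eq_or_ne v 0 with rfl | hne
  · simp
  · obtain ⟨N', hN', h2⟩ := key d v hv hne
    rw [hN] at hN'
    rwa [show N = N' by exact_mod_cast hN']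

section

variable {i : h₀.root} (t : D.RootTriple h₀ i) {a : ℤ} (ha : (D.m 0 : ℤ) ∣ a) {N : ℕ}

lemma RootTriple.loopF_loopF_pow (hN : ∀ d, ∀ v ∈ D.topSpace V b, (t.loopF V ha d ^ (N + 1)) v = 0)
    (d e : D.Γ) {v : V} (hv : v ∈ D.topSpace V b) : t.loopF V ha e ((t.loopF V ha d ^ N) v) = 0 := by
  have key : ∀ (M : ℕ) (v : V), corootOp h₀ V i (e - d) ((t.loopF V ha d ^ M) v) =
      (t.loopF V ha d ^ M) (corootOp h₀ V i (e - d) v) -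
        (2 * M : ℂ) • t.loopF V ha e ((t.loopF V ha d ^ (M - 1)) v) := by
    intro M
    induction M with
    | zero => simp
    | succ M ih =>
      intro v
      rw [pow_succ_apply, t.corootOp_loopF, ih, map_sub, map_smul, pow_succ_apply,
        show d + (e - d) = e by abel]
      rcases M with _ | M
      · simp
      · rw [Nat.add_sub_cancel, Nat.add_sub_cancel, t.loopF_comm ha d e]
        simp only [← pow_succ_apply]
        push_cast
        module
  have h1 := key (N + 1) v
  rw [hN d v hv, hN d _ (corootOp_mem i _ hv), map_zero, zero_sub, zero_eq_neg, Nat.add_sub_cancel,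
    smul_eq_zero] at h1
  refine h1.resolve_left ?_
  exact_mod_cast (by omega : 2 * (N + 1) ≠ 0)

end

variable (b V) in
/-- The algebra generated by the operators `∑ wᵢ t^d Kᵢ` and `α_i^∨ ⊗ t^d` on `T`. -/
noncomputable def topHeisenberg (i : h₀.root) : Subalgebra ℂ (Module.End ℂ (D.topSpace V b)) :=
  Algebra.adjoin ℂ (Set.range (topCoroot V b i) ∪ Set.range fun p : D.Γ × Coef n => topC V b p.1 p.2)

/-- Invertible operators of arbitrary degrees in `N Γ`. -/
lemma RootTriple.exists_shift {i : h₀.root} (t : D.RootTriple h₀ i) {a : ℤ}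
    (ha : (D.m 0 : ℤ) ∣ a) {N : ℕ} (ha0 : 0 < a)
    {C₀ : ℝ} (hL : D.HasLevel V C₀) (hh : ∀ x : h₀, ((x : D.fixed) : g) ∈ h)
    (hΔ : D.weightsOfG h₀ ⊆ D.enlargedRoots h₀)
    (hNw : ∀ r : Fin n → ℤ, ∀ v ∈ D.topSpace V b, t.opH V C₀ (Fin.cons a r) v = (N : ℂ) • v)
    (hN : ∀ d, ∀ v ∈ D.topSpace V b, (t.loopF V ha d ^ (N + 1)) v = 0) (wt : D.Weight h₀) (d : D.Γ) :
    ∃ S ∈ topHeisenberg V b i, ∃ S' ∈ topHeisenberg V b i, S * S' = 1 ∧ S' * S = 1 ∧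
      ∀ k, ∀ v ∈ D.topGrade wt k, S v ∈ D.topGrade wt (k + (N • d : D.Γ)) := by
  have hS : ∀ j d : D.Γ, ∃ S ∈ topHeisenberg V b i, ∀ v : D.topSpace V b,
      (t.loopE V ha (-j) ^ N) ((t.loopF V ha d ^ N) (v : V)) = (S v : D.topSpace V b) := by
    intro j d
    refine (t.isLadder ha ha0 j).exists_pow_e_pow_f (B := topHeisenberg V b i) (fun e => ?_) N d
    have : (RootTriple.loopH i t a j e).restrict ((t.isLadder ha ha0 j).h_T e) =
        topCoroot V b i (-j + e) + (D.c * killingForm ℂ g t.X t.Y) •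
          topC V b (-j + e) (Expo.toCoef (Fin.cons a ((-j : D.Γ) : Fin n → ℤ))) := rfl
    rw [this]
    have h1 : topCoroot V b i (-j + e) ∈ topHeisenberg V b i :=
      Algebra.subset_adjoin (Or.inl ⟨_, rfl⟩)
    have h2 : topC V b (-j + e) (Expo.toCoef (Fin.cons a ((-j : D.Γ) : Fin n → ℤ))) ∈
        topHeisenberg V b i := Algebra.subset_adjoin (Or.inr ⟨(_, _), rfl⟩)
    exact add_mem h1 (Subalgebra.smul_mem _ h2 _)
  choose S hSmem hS using hS
  have hSS : ∀ j k, S k j * S j k = ((N.factorial : ℂ) ^ 4) • (1 : Module.End ℂ (D.topSpace V b)) := by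
    intro j k
    ext v
    have hsl := fun d => t.isSl2Ops_loop ha hL hh hΔ d
    rw [Module.End.mul_apply, ← hS, ← hS]
    have hw : t.opH V C₀ (Fin.cons a ((-j : D.Γ) : Fin n → ℤ)) ((t.loopF V ha k ^ N) (v : V)) =
        (N - 2 * N : ℂ) • (t.loopF V ha k ^ N) (v : V) :=
      (hsl k).h_pow_f (hNw _ v v.2) N
    have h1 : (t.loopF V ha j ^ N) ((t.loopE V ha (-j) ^ N) ((t.loopF V ha k ^ N) (v : V))) =
        ((N.factorial : ℂ) ^ 2) • (t.loopF V ha k ^ N) (v : V) :=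
      (hsl j).symm.pow_e_pow_f (by rw [LinearMap.neg_apply, hw]; module)
        (t.loopF_loopF_pow ha hN k j v.2)
    rw [h1, map_smul, (hsl k).pow_e_pow_f (hNw _ v v.2) (t.loopE_eq_zero ha ha0 _ v.2), smul_smul,
      ← pow_add]
    rfl
  have hc : (N.factorial : ℂ) ^ 4 ≠ 0 := by
    exact_mod_cast pow_ne_zero 4 N.factorial_ne_zero
  refine ⟨S 0 d, hSmem _ _, ((N.factorial : ℂ) ^ 4)⁻¹ • S d 0, Subalgebra.smul_mem _ (hSmem _ _) _,
    ?_, ?_, fun k v hv => ?_⟩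
  · rw [mul_smul_comm, hSS, smul_smul, inv_mul_cancel₀ hc, one_smul]
  · rw [smul_mul_assoc, hSS, smul_smul, inv_mul_cancel₀ hc, one_smul]
  · rw [mem_topGrade, ← hS]
    have stepF : ∀ M : ℕ, (t.loopF V ha d ^ M) (v : V) ∈ shiftedWeight V wt
        (wt.onCartan + M • (-(D.roots h₀).root i))
        (expo0 k + M • Fin.cons (-a) (d : Fin n → ℤ)) := by
      intro M
      induction M with
      | zero => simpa using mem_topGrade.mp hv
      | succ M ih =>
        rw [pow_succ_apply, succ_nsmul, succ_nsmul, ← add_assoc, ← add_assoc]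
        exact lie_loopEl_mem_shiftedWeight
          (t.Y_mem' (cons_mem_lattice ((dvd_neg).mpr ha) d)) ih
    have stepE : ∀ M : ℕ, (t.loopE V ha (-0) ^ M) ((t.loopF V ha d ^ N) (v : V)) ∈ shiftedWeight V wt
        (wt.onCartan + N • (-(D.roots h₀).root i) + M • (D.roots h₀).root i)
        (expo0 k + N • Fin.cons (-a) (d : Fin n → ℤ) +
          M • Fin.cons a (((-0 : D.Γ)) : Fin n → ℤ)) := by
      intro M
      induction M with
      | zero => simpa using stepF N
      | succ M ih =>
        rw [pow_succ_apply, succ_nsmul, succ_nsmul, ← add_assoc, ← add_assoc]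
        exact lie_loopEl_mem_shiftedWeight (t.X_mem' (cons_mem_lattice ha (-0))) ih
    have h1 := stepE N
    have h2 : expo0 k + N • Fin.cons (-a) (d : Fin n → ℤ) +
        N • Fin.cons a (((-0 : D.Γ)) : Fin n → ℤ) =
        expo0 (k + ((N • d : D.Γ) : Fin n → ℤ)) := by
      funext j
      refine Fin.cases ?_ (fun j => ?_) j <;> simp [expo0]
    rw [h2, smul_neg, neg_add_cancel_right] at h1
    exact h1

/-- The operators `t^r K_p` with `p ≥ 1` are nilpotent on `T`. -/
lemma RootTriple.topC_pow_eq_zero {i : h₀.root} (t : D.RootTriple h₀ i) {a : ℤ}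
    (ha : (D.m 0 : ℤ) ∣ a) {N : ℕ} (ha0 : 0 < a)
    (hh : ∀ x : h₀, ((x : D.fixed) : g) ∈ h) (hΔ : D.weightsOfG h₀ ⊆ D.enlargedRoots h₀)
    (hN : ∀ d, ∀ v ∈ D.topSpace V b, (t.loopF V ha d ^ (N + 1)) v = 0) (d : D.Γ) (p : Fin n) :
    topC V b d (Pi.single p.succ 1) ^ (N + 1) = 0 := by
  have hl : (Pi.single p (D.m p.succ : ℤ) : Fin n → ℤ) ∈ D.Γ := by
    intro j
    rcases eq_or_ne j p with rfl | hj
    · simp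
    · simp [hj]
  obtain ⟨q, hq, hqk⟩ := t.exists_killingForm hh hΔ
  have hm : (D.m p.succ : ℂ) ≠ 0 := by exact_mod_cast (D.m_pos _).ne'
  have hc : (D.c * killingForm ℂ g t.X t.Y) * (D.m p.succ : ℂ) ≠ 0 := by
    rw [hqk]
    refine mul_ne_zero (mul_ne_zero ?_ ?_) hm
    · exact_mod_cast D.c_pos.ne'
    · exact_mod_cast hq.ne'
  have h1 : ∀ v : D.topSpace V b, ((((D.c * killingForm ℂ g t.X t.Y) * (D.m p.succ : ℂ)) •
      centerOp V d (Pi.single p.succ 1)) ^ (N + 1)) (v : V) = 0 := by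
    intro v
    have := (t.isLinearLadder ha ha0 ⟨_, hl⟩).pow_ω_eq_zero d (N + 1) v.2 fun x => hN _ v v.2
    rw [show (expo0 (Pi.single p (D.m p.succ : ℤ) : Fin n → ℤ)).toCoef =
      (D.m p.succ : ℂ) • (Pi.single p.succ 1 : Coef n) by
        funext j
        refine Fin.cases ?_ (fun j => ?_) j
        · simp [Expo.toCoef]
        · rcases eq_or_ne j p with rfl | hj
          · simp [Expo.toCoef]
          · simp [Expo.toCoef, hj], centerOp_smul, smul_smul] at this
    exact this
  ext v
  have h2 := h1 v
  rw [smul_pow, LinearMap.smul_apply, smul_eq_zero, or_iff_right (pow_ne_zero _ hc)] at h2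
  have h3 : ∀ M : ℕ, (((topC V b d (Pi.single p.succ 1) ^ M) v : D.topSpace V b) : V) =
      (centerOp V d (Pi.single p.succ 1) ^ M) (v : V) := by
    intro M
    induction M with
    | zero => rfl
    | succ M ih => rw [pow_succ_apply, pow_succ_apply, coe_topC, ih]
  rw [h3, h2]
  rfl

end TwistData

namespace TwistData

variable {n : ℕ} {g : Type*} [LieRing g] [LieAlgebra ℂ g] {D : TwistData n g}
variable {h₀ : LieSubalgebra ℂ D.fixed}
variable {V : Type*} [AddCommGroup V] [Module ℂ V] [LieRingModule D.tau V] [LieModule ℂ D.tau V]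

/-- A multiple of `Γ` contains a translate of any exponent to a given finite box. -/
lemma exists_mem_box (D : TwistData n g) {N : ℕ} (hN : 0 < N) (k : Fin n → ℤ) :
    ∃ d : D.Γ, k + ((N • d : D.Γ) : Fin n → ℤ) ∈
      Fintype.piFinset fun i : Fin n => Finset.Ico (0 : ℤ) (N * D.m i.succ) := by
  refine ⟨⟨fun i => -(D.m i.succ * (k i / (N * D.m i.succ))), fun i =>
    (dvd_neg).mpr (dvd_mul_right _ _)⟩, ?_⟩
  rw [Fintype.mem_piFinset]
  intro i
  have hpos : (0 : ℤ) < N * D.m i.succ := by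
    have := D.m_pos i.succ
    positivity
  have h1 : (k + ((N • (⟨fun i => -(D.m i.succ * (k i / (N * D.m i.succ))), fun i =>
    (dvd_neg).mpr (dvd_mul_right _ _)⟩ : D.Γ) : D.Γ) : Fin n → ℤ)) i = k i % (N * D.m i.succ) := by
    rw [Int.emod_def]
    simp
    ring
  rw [h1, Finset.mem_Ico]
  exact ⟨Int.emod_nonneg _ hpos.ne', Int.emod_lt_of_pos _ hpos⟩

variable [FiniteDimensional ℂ g] [LieAlgebra.IsSimple ℂ g]
variable [LieAlgebra.IsSimple ℂ D.fixed] [h₀.IsCartanSubalgebra]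
variable {b : (D.roots h₀).Base}
variable {wt : D.Weight h₀}

lemma commute_topC (d e : D.Γ) (w w' : Coef n) : Commute (topC V b d w) (topC V b e w') := by
  rw [commute_iff_lie_eq, topC, topC, ← LieHom.map_lie, lie_zeroC_zeroC, map_zero]

lemma commute_topCoroot_topC (i : h₀.root) (d e : D.Γ) (w : Coef n) :
    Commute (topCoroot V b i d) (topC V b e w) := by
  rw [commute_iff_lie_eq, topC, topCoroot, ← LieHom.map_lie, lie_zeroLoop_zeroC, map_zero]

lemma commute_topC_of_mem {i : h₀.root} {S : Module.End ℂ (D.topSpace V b)}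
    (hS : S ∈ topHeisenberg V b i) (e : D.Γ) (w : Coef n) : Commute S (topC V b e w) := by
  have : topHeisenberg V b i ≤ Subalgebra.centralizer ℂ {topC V b e w} := by
    refine Algebra.adjoin_le ?_
    rintro x (⟨d, rfl⟩ | ⟨⟨d, w'⟩, rfl⟩)
    · rw [SetLike.mem_coe, Subalgebra.mem_centralizer_iff]
      rintro _ rfl
      exact (commute_topCoroot_topC i d e w).symm.eq
    · rw [SetLike.mem_coe, Subalgebra.mem_centralizer_iff]
      rintro _ rfl
      exact (commute_topC d e w' w).symm.eq
  exact (Commute.symm ((Subalgebra.mem_centralizer_iff ℂ).mp (this hS) _ rfl))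

lemma topC_apply_eq_zero {d : D.Γ} {w : Coef n} (hw : w 0 = 0) {v : D.topSpace V b}
    (hv : ∀ p : Fin n, topC V b d (Pi.single p.succ 1) v = 0) : topC V b d w v = 0 := by
  have : w = ∑ p : Fin n, w p.succ • (Pi.single p.succ 1 : Coef n) := by
    funext j
    rw [Finset.sum_apply]
    refine Fin.cases ?_ (fun j => ?_) j
    · simpa using hw
    · simp [Pi.single_apply]
  rw [this, topC, map_sum, map_sum, LinearMap.sum_apply]
  refine Finset.sum_eq_zero fun p _ => ?_
  rw [map_smul, map_smul, LinearMap.smul_apply]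
  have := hv p
  rw [topC] at this
  rw [this, smul_zero]

/-- The common kernel of the operators `t^r K_p`, `p ≥ 1`. -/
noncomputable def centralKernel (V : Type*) [AddCommGroup V] [Module ℂ V] [LieRingModule D.tau V]
    [LieModule ℂ D.tau V] (b : (D.roots h₀).Base) : Submodule ℂ (D.topSpace V b) :=
  ⨅ p : D.Γ × Fin n, LinearMap.ker (topC V b p.1 (Pi.single p.2.succ 1))

lemma mem_centralKernel {v : D.topSpace V b} : v ∈ centralKernel V b ↔
    ∀ (d : D.Γ) (w : Coef n), w 0 = 0 → topC V b d w v = 0 := by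
  simp only [centralKernel, Submodule.mem_iInf, LinearMap.mem_ker, Prod.forall]
  exact ⟨fun hv d w hw => topC_apply_eq_zero hw (hv d), fun hv d p => hv d _ (by simp)⟩

lemma centralKernel_eq_bot_or_eq_top
    [LieModule.IsIrreducible ℂ (D.tauNonneg b) (D.topSpace V b)] :
    centralKernel V b = ⊥ ∨ centralKernel V b = ⊤ := by
  refine eq_bot_or_eq_top_of_stable (centralKernel V b) ?_ ?_ ?_ ?_
  · intro l X hX v hv
    rw [mem_centralKernel] at hv ⊢
    intro d w hw
    have h1 := hv d w hw
    rw [topC, LieModule.toEnd_apply_apply] at h1 ⊢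
    rw [leibniz_lie, ← lie_skew, lie_zeroLoop_zeroC, h1, neg_zero, zero_lie, lie_zero, add_zero]
  · intro r hr w' v hv
    rw [mem_centralKernel] at hv ⊢
    intro d w hw
    have h1 := hv d w hw
    rw [topC, LieModule.toEnd_apply_apply] at h1 ⊢
    rw [leibniz_lie, lie_zeroC_zeroC, h1, zero_lie, lie_zero, add_zero]
  · intro r hr v hv
    rw [mem_centralKernel] at hv ⊢
    intro d w hw
    have h1 := hv d w hw
    rw [topC, LieModule.toEnd_apply_apply] at h1 ⊢
    rw [leibniz_lie, ← lie_skew, lie_zeroD₀_zeroC, hw, h1, zero_smul, neg_zero, zero_lie,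
      lie_zero, add_zero]
  · intro u r hr v hv
    rw [mem_centralKernel] at hv ⊢
    intro d w hw
    have h1 := hv d w hw
    have h2 := hv (⟨r, hr⟩ + d) ((∑ i, u i * (d : Fin n → ℤ) i) • w +
      (Coef.dot (Fin.cons 0 u) w) • (expo0 r).toCoef) (by simp [hw, Expo.toCoef])
    rw [topC, LieModule.toEnd_apply_apply] at h1 h2 ⊢
    rw [leibniz_lie, ← lie_skew, lie_zeroD_zeroC, h1, lie_zero, add_zero, neg_lie]
    exact neg_eq_zero.mpr h2

variable {h : LieSubalgebra ℂ g} [h.IsCartanSubalgebra]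

/-- The operators `t^r K_p` with `p ≥ 1` vanish on `T`, and there are invertible operators
of arbitrary degrees in a multiple of `Γ`. -/
theorem topC_eq_zero_and_exists_shift [LieModule.IsIrreducible ℂ (D.tauNonneg b) (D.topSpace V b)]
    (hV : D.IsIntegrable h₀ V)
    {C₀ : ℝ} (hL : D.HasLevel V C₀) (hh : ∀ x : h₀, ((x : D.fixed) : g) ∈ h)
    (hΔ : D.weightsOfG h₀ ⊆ D.enlargedRoots h₀)
    {v₀ : V} (hv₀ : v₀ ∈ D.topSpace V b) (h0 : v₀ ≠ 0) (hw : v₀ ∈ D.weightSpace V wt) :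
    (∀ (d : D.Γ) (w : Coef n), w 0 = 0 → topC V b d w = 0) ∧
    ∃ (i : h₀.root) (N : ℕ), 0 < N ∧ ∀ d : D.Γ,
      ∃ S ∈ topHeisenberg V b i, ∃ S' ∈ topHeisenberg V b i, S * S' = 1 ∧ S' * S = 1 ∧
      ∀ k, ∀ v ∈ D.topGrade wt k, S v ∈ D.topGrade wt (k + (N • d : D.Γ)) := by
  have hT := iSup_topGrade (D := D) (b := b) (wt := wt) hv₀ h0 hw
  obtain ⟨i, t, a, ha, N, ha0, hN0, hNw, hN⟩ :=
    exists_rootTriple_weight (b := b) hV hL hh hΔ hv₀ h0 hT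
  have hS := t.exists_shift ha ha0 hL hh hΔ hNw hN wt
  refine ⟨?_, i, N, hN0, hS⟩
  have := fun k => finiteDimensional_topGrade (b := b) hV wt k
  obtain ⟨k₀, hk₀⟩ : ∃ k, (D.topGrade wt k : Submodule ℂ (D.topSpace V b)) ≠ ⊥ := by
    by_contra! hb
    have : (⟨v₀, hv₀⟩ : D.topSpace V b) ∈
        (⨆ k, D.topGrade wt k : Submodule ℂ (D.topSpace V b)) := hT ▸ Submodule.mem_top
    simp only [hb, iSup_bot, Submodule.mem_bot] at this
    exact h0 (congrArg Subtype.val this)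
  obtain ⟨k, v, hv, hv0, hker⟩ := exists_mem_common_kernel
    (Tk := fun k => (D.topGrade wt k : Submodule ℂ (D.topSpace V b)))
    (Φ := Set.range fun p : D.Γ × Fin n => topC V b p.1 (Pi.single p.2.succ 1))
    (R := Fintype.piFinset fun i : Fin n => Finset.Ico (0 : ℤ) (N * D.m i.succ))
    (by rintro _ ⟨⟨d, p⟩, rfl⟩
        exact ⟨N + 1, t.topC_pow_eq_zero ha ha0 hh hΔ hN d p⟩)
    (by rintro _ ⟨⟨d, p⟩, rfl⟩
        exact ⟨d, fun k v hv => topC_mem_topGrade d _ hv⟩)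
    (by rintro _ ⟨⟨d, p⟩, rfl⟩ _ ⟨⟨e, q⟩, rfl⟩
        exact commute_topC _ _ _ _)
    (fun k => by
      obtain ⟨d, hd⟩ := D.exists_mem_box hN0 k
      obtain ⟨S, hS1, S', -, -, hSS, hSk⟩ := hS d
      refine ⟨S, fun x y hxy => ?_, ?_, _, hd, hSk k⟩
      · rw [← Module.End.one_apply (R := ℂ) x, ← Module.End.one_apply (R := ℂ) y, ← hSS,
          Module.End.mul_apply, Module.End.mul_apply, hxy]
      · rintro _ ⟨⟨d, p⟩, rfl⟩
        exact commute_topC_of_mem hS1 _ _) hk₀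
  have htop : centralKernel V b = ⊤ := by
    refine centralKernel_eq_bot_or_eq_top.resolve_left fun hb => hv0 ?_
    have h1 : v ∈ centralKernel V b := by
      simp only [centralKernel, Submodule.mem_iInf, LinearMap.mem_ker]
      exact fun p => hker _ ⟨p, rfl⟩
    rwa [hb, Submodule.mem_bot] at h1
  intro d w hw
  ext1 v
  have : v ∈ centralKernel V b := htop ▸ Submodule.mem_top
  exact mem_centralKernel.mp this d w hw

end TwistData

/-! ### Commutative algebras of operators that are stable under derivations -/

section GradedOperators

variable {I : Type*} [AddCommGroup I] {T : Type*} [AddCommGroup T] [Module ℂ T]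
variable {Tk : I → Submodule ℂ T}

/-- Homogeneous operators on a graded space. -/
def HasDegree (Tk : I → Submodule ℂ T) (f : Module.End ℂ T) (d : I) : Prop :=
  ∀ k, ∀ v ∈ Tk k, f v ∈ Tk (k + d)

lemma HasDegree.mul {f g : Module.End ℂ T} {d e : I} (hf : HasDegree Tk f d)
    (hg : HasDegree Tk g e) : HasDegree Tk (f * g) (d + e) := fun k v hv => by
  have := hf _ _ (hg k v hv)
  rwa [add_assoc, add_comm e d] at this

lemma HasDegree.one : HasDegree Tk 1 0 := fun k v hv => by simpa using hv

lemma HasDegree.pow {f : Module.End ℂ T} {d : I} (hf : HasDegree Tk f d) (N : ℕ) :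
    HasDegree Tk (f ^ N) (N • d) := by
  induction N with
  | zero => simpa using HasDegree.one
  | succ N ih => rw [pow_succ, succ_nsmul]; exact ih.mul hf

lemma HasDegree.add {f g : Module.End ℂ T} {d : I} (hf : HasDegree Tk f d)
    (hg : HasDegree Tk g d) : HasDegree Tk (f + g) d :=
  fun k v hv => add_mem (hf k v hv) (hg k v hv)

lemma HasDegree.sub {f g : Module.End ℂ T} {d : I} (hf : HasDegree Tk f d)
    (hg : HasDegree Tk g d) : HasDegree Tk (f - g) d :=
  fun k v hv => sub_mem (hf k v hv) (hg k v hv)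

lemma HasDegree.smul {f : Module.End ℂ T} {d : I} (hf : HasDegree Tk f d) (a : ℂ) :
    HasDegree Tk (a • f) d := fun k v hv => Submodule.smul_mem _ a (hf k v hv)

lemma HasDegree.lie {f g : Module.End ℂ T} {d e : I} (hf : HasDegree Tk f d)
    (hg : HasDegree Tk g e) : HasDegree Tk ⁅f, g⁆ (d + e) := by
  rw [LieRing.of_associative_ring_bracket]
  exact (hf.mul hg).sub (add_comm e d ▸ hg.mul hf)

/-- The inverse of a homogeneous operator is homogeneous. -/
lemma HasDegree.of_mul_eq_one (hind : iSupIndep Tk) (htop : ⨆ k, Tk k = ⊤)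
    {f g : Module.End ℂ T} {d : I} (hf : HasDegree Tk f d) (hgf : g * f = 1) (hfg : f * g = 1) :
    HasDegree Tk g (-d) := by
  classical
  have hint : DirectSum.IsInternal Tk :=
    (DirectSum.isInternal_submodule_iff_iSupIndep_and_iSup_eq_top Tk).mpr ⟨hind, htop⟩
  let _ := hint.chooseDecomposition
  have hinj : ∀ v, f v = 0 → v = 0 := fun v hv => by
    rw [← Module.End.one_apply (R := ℂ) v, ← hgf, Module.End.mul_apply, hv, map_zero]
  have key : ∀ (k : I) (v : T), f v ∈ Tk (k + d) → v ∈ Tk k := by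
    intro k v hv
    have hcomp : ∀ j, j ≠ k → (DirectSum.decompose Tk v j : T) = 0 := by
      intro j hj
      refine hinj _ ?_
      have h1 : (DirectSum.decompose Tk (f v) (j + d) : T) = f (DirectSum.decompose Tk v j) := by
        conv_lhs => rw [← DirectSum.sum_support_decompose Tk v, map_sum, DirectSum.decompose_sum]
        rw [DFinsupp.finsetSum_apply, Submodule.coe_sum]
        by_cases hjs : j ∈ (DirectSum.decompose Tk v).support
        · rw [Finset.sum_eq_single_of_mem j hjs]
          · exact DirectSum.decompose_of_mem_same Tk (hf j _ (SetLike.coe_mem _))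
          · intro i _ hij
            exact DirectSum.decompose_of_mem_ne Tk (hf i _ (SetLike.coe_mem _))
              (fun he => hij (add_right_cancel he))
        · rw [DFinsupp.notMem_support_iff.mp hjs]
          simp only [ZeroMemClass.coe_zero, map_zero]
          refine Finset.sum_eq_zero fun i hi => ?_
          refine DirectSum.decompose_of_mem_ne Tk (hf i _ (SetLike.coe_mem _)) fun he => ?_
          rw [add_right_cancel he] at hi
          exact hjs hi
      rw [← h1]
      exact DirectSum.decompose_of_mem_ne Tk hv (fun he => hj (add_right_cancel he).symm)
    rw [← DirectSum.sum_support_decompose Tk v]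
    refine sum_mem fun j _ => ?_
    rcases eq_or_ne j k with rfl | hj
    · exact SetLike.coe_mem _
    · rw [hcomp j hj]
      exact zero_mem _
  intro k v hv
  refine key _ _ ?_
  rw [← Module.End.mul_apply, hfg]
  simpa using hv

variable {B : Subalgebra ℂ (Module.End ℂ T)} {𝒟 : Set (Module.End ℂ T)}

/-- The derivative of a nilpotent element is nilpotent. -/
lemma isNilpotent_lie {D b : Module.End ℂ T} (hb : IsNilpotent b) (h1 : Commute b ⁅D, b⁆) (h3 : Commute ⁅D, b⁆ ⁅D, ⁅D, b⁆⁆) : IsNilpotent ⁅D, b⁆ := by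
  set c := ⁅D, b⁆ with hc
  set e := ⁅D, c⁆ with he
  have hDb : ∀ i : ℕ, D * b ^ i = b ^ i * D + (i : ℂ) • (b ^ (i - 1) * c) := by
    intro i
    have hDb1 : D * b = b * D + c := by
      rw [hc, LieRing.of_associative_ring_bracket]; abel
    induction i with
    | zero => simp
    | succ i ih =>
      rw [pow_succ, ← mul_assoc, ih, add_mul, mul_assoc, hDb1, mul_add, smul_mul_assoc, mul_assoc,
        ← h1.eq]
      rcases i with _ | i
      · simp
      · simp only [Nat.add_sub_cancel, ← mul_assoc, ← pow_succ]
        push_cast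
        module
  have hDc : ∀ i : ℕ, D * c ^ i = c ^ i * D + (i : ℂ) • (c ^ (i - 1) * e) := by
    intro i
    have hDb1 : D * c = c * D + e := by
      rw [he, LieRing.of_associative_ring_bracket]; abel
    induction i with
    | zero => simp
    | succ i ih =>
      rw [pow_succ, ← mul_assoc, ih, add_mul, mul_assoc, hDb1, mul_add, smul_mul_assoc, mul_assoc,
        ← h3.eq]
      rcases i with _ | i
      · simp
      · simp only [Nat.add_sub_cancel, ← mul_assoc, ← pow_succ]
        push_cast
        module
  have step : ∀ i k : ℕ, b ^ (i + 1) * c ^ k = 0 → b ^ i * c ^ (k + 2) = 0 := by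
    intro i k h0
    have hbc := (h1.pow_left (i + 1)).pow_right k
    have e1 : D * (b ^ (i + 1) * c ^ k) * c = 0 := by rw [h0]; simp
    rw [← mul_assoc, hDb, add_mul, mul_assoc, hDc, mul_add, ← mul_assoc, h0, zero_mul, zero_add,
      add_mul, Nat.add_sub_cancel] at e1
    have e2 : b ^ (i + 1) * ((k : ℂ) • (c ^ (k - 1) * e)) * c = 0 := by
      rcases k with _ | k
      · simp
      · rw [Nat.add_sub_cancel, mul_smul_comm, smul_mul_assoc, mul_assoc, mul_assoc, ← h3.eq,
          ← mul_assoc (c ^ k), ← pow_succ, ← mul_assoc, h0, zero_mul, smul_zero]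
    rw [e2, zero_add, smul_mul_assoc, smul_mul_assoc, smul_eq_zero] at e1
    have e3 := e1.resolve_left (by exact_mod_cast Nat.succ_ne_zero i)
    rw [mul_assoc, mul_assoc, ← pow_succ, ← pow_succ'] at e3
    exact e3
  obtain ⟨M, hM⟩ := hb
  have desc : ∀ j ≤ M, b ^ (M - j) * c ^ (2 * j) = 0 := by
    intro j hj
    induction j with
    | zero => simp [hM]
    | succ j ih =>
      have h4 := step (M - (j + 1)) (2 * j) (by
        rw [show M - (j + 1) + 1 = M - j by omega]
        exact ih (by omega))
      rwa [show 2 * (j + 1) = 2 * j + 2 by ring]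
  exact ⟨2 * M, by simpa using desc M le_rfl⟩

/-- A commutative algebra `B` of operators on a graded space that is stable under the derivations
`[D, -]` for `D ∈ 𝒟`, such that no proper subspace is stable under `B`, `𝒟` and the centralizer
of `B`, and such that finitely many pieces represent all of them. -/
structure IsDiffIrreducible (Tk : I → Submodule ℂ T) (B : Subalgebra ℂ (Module.End ℂ T))
    (𝒟 : Set (Module.End ℂ T)) : Prop where
  finite : ∀ k, FiniteDimensional ℂ (Tk k)
  iSup_eq : ⨆ k, Tk k = ⊤
  exists_ne_bot : ∃ k, Tk k ≠ ⊥
  comm : ∀ b ∈ B, ∀ c ∈ B, Commute b c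
  degree : ∀ D ∈ 𝒟, ∃ d, HasDegree Tk D d
  lie_mem : ∀ D ∈ 𝒟, ∀ b ∈ B, ⁅D, b⁆ ∈ B
  eq_bot_or_eq_top : ∀ N : Submodule ℂ T, (∀ D ∈ 𝒟, ∀ v ∈ N, D v ∈ N) →
    (∀ x : Module.End ℂ T, (∀ b ∈ B, Commute b x) → ∀ v ∈ N, x v ∈ N) → N = ⊥ ∨ N = ⊤
  exists_shift : ∃ R : Finset I, ∀ k, ∃ S ∈ B, Function.Injective S ∧
    ∃ k' ∈ R, ∀ v ∈ Tk k, S v ∈ Tk k'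

namespace IsDiffIrreducible

variable (H : IsDiffIrreducible Tk B 𝒟)
include H

/-- Nilpotent homogeneous elements vanish. -/
lemma eq_zero_of_isNilpotent {b : Module.End ℂ T} (hb : b ∈ B) {d : I} (hd : HasDegree Tk b d)
    (hn : IsNilpotent b) : b = 0 := by
  have := H.finite
  obtain ⟨k₀, h0⟩ := H.exists_ne_bot
  obtain ⟨R, hR⟩ := H.exists_shift
  let Φ : Set (Module.End ℂ T) := {φ | φ ∈ B ∧ (∃ d, HasDegree Tk φ d) ∧ IsNilpotent φ}
  obtain ⟨k, v, -, hv0, hker⟩ := exists_mem_common_kernel (Tk := Tk) (Φ := Φ)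
    (fun φ hφ => hφ.2.2) (fun φ hφ => hφ.2.1) (fun φ hφ ψ hψ => H.comm φ hφ.1 ψ hψ.1) (R := R)
    (fun k => by
      obtain ⟨S, hS, hSi, hSk⟩ := hR k
      exact ⟨S, hSi, fun φ hφ => H.comm S hS φ hφ.1, hSk⟩) h0
  let N : Submodule ℂ T := ⨅ φ : Φ, LinearMap.ker (φ : Module.End ℂ T)
  have hN : ∀ {v}, v ∈ N ↔ ∀ φ ∈ Φ, φ v = 0 := by
    intro v
    simp only [N, Submodule.mem_iInf, LinearMap.mem_ker, Subtype.forall]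
  have htop : N = ⊤ := by
    refine (H.eq_bot_or_eq_top N ?_ ?_).resolve_left fun hb => hv0 ?_
    · intro D hD v hv
      rw [hN] at hv ⊢
      intro φ hφ
      obtain ⟨d, hd⟩ := H.degree D hD
      obtain ⟨e, he⟩ := hφ.2.1
      have hm := H.lie_mem D hD φ hφ.1
      have hmm := H.lie_mem D hD _ hm
      have h1 := hv ⁅D, φ⁆ ⟨hm, ⟨_, hd.lie he⟩, isNilpotent_lie hφ.2.2 (H.comm _ hφ.1 _ hm)
        (H.comm _ hm _ hmm)⟩
      rw [LieRing.of_associative_ring_bracket, LinearMap.sub_apply, Module.End.mul_apply,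
        Module.End.mul_apply, hv φ hφ, map_zero, zero_sub, neg_eq_zero] at h1
      exact h1
    · intro x hx v hv
      rw [hN] at hv ⊢
      intro φ hφ
      rw [← Module.End.mul_apply, (hx φ hφ.1).eq, Module.End.mul_apply, hv φ hφ, map_zero]
    · have h1 := hN.mpr hker
      rwa [hb, Submodule.mem_bot] at h1
  ext v
  have : v ∈ N := htop ▸ Submodule.mem_top
  exact hN.mp this b ⟨hb, ⟨d, hd⟩, hn⟩

/-- Elements of degree zero are scalars. -/
lemma exists_eq_smul_one {c : Module.End ℂ T} (hc : c ∈ B) (hd : HasDegree Tk c 0) :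
    ∃ a : ℂ, c = a • 1 := by
  have hfin := H.finite
  obtain ⟨k₀, h0⟩ := H.exists_ne_bot
  obtain ⟨R, hR⟩ := H.exists_shift
  have hst : ∀ k, ∀ v ∈ Tk k, c v ∈ Tk k := fun k v hv => by simpa using hd k v hv
  have : Nontrivial (Tk k₀) := Submodule.nontrivial_iff_ne_bot.mpr h0
  obtain ⟨a, ha⟩ := Module.End.exists_eigenvalue (c.restrict (hst k₀))
  obtain ⟨w, hw⟩ := ha.exists_hasEigenvector
  refine ⟨a, sub_eq_zero.mp ?_⟩
  set c' := c - a • (1 : Module.End ℂ T) with hc'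
  have hc'B : c' ∈ B := sub_mem hc (B.smul_mem (one_mem _) a)
  have hd' : HasDegree Tk c' 0 := hd.sub (HasDegree.one.smul a)
  let N : Submodule ℂ T := Module.End.maxGenEigenspace c' 0
  have hN : ∀ {v}, v ∈ N ↔ ∃ m : ℕ, (c' ^ m) v = 0 := by
    intro v
    simp [N, Module.End.mem_maxGenEigenspace]
  have htop : N = ⊤ := by
    refine (H.eq_bot_or_eq_top N ?_ ?_).resolve_left fun hb => hw.2 ?_
    · intro D hD v hv
      rw [hN] at hv ⊢
      obtain ⟨m, hm⟩ := hv
      have hcom := H.comm _ hc'B _ (H.lie_mem D hD _ hc'B)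
      have key : ∀ i : ℕ, c' ^ (i + 1) * D = D * c' ^ (i + 1) - (i + 1 : ℂ) • (⁅D, c'⁆ * c' ^ i) := by
        intro i
        have h1 : c' * D = D * c' - ⁅D, c'⁆ := by
          rw [LieRing.of_associative_ring_bracket]; abel
        induction i with
        | zero => simp [h1]
        | succ i ih =>
          rw [pow_succ' c' (i + 1), mul_assoc, ih, mul_sub, mul_smul_comm, ← mul_assoc, h1,
            ← mul_assoc c', hcom.eq, sub_mul, mul_assoc, mul_assoc, ← pow_succ', ← pow_succ']
          push_cast
          module
      refine ⟨m + 1, ?_⟩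
      rw [← Module.End.mul_apply, key, LinearMap.sub_apply, LinearMap.smul_apply,
        Module.End.mul_apply, Module.End.mul_apply, hm, pow_succ_apply, hm]
      simp
    · intro x hx v hv
      rw [hN] at hv ⊢
      obtain ⟨m, hm⟩ := hv
      refine ⟨m, ?_⟩
      rw [← Module.End.mul_apply, ((hx c' hc'B).pow_left m).eq, Module.End.mul_apply, hm, map_zero]
    · have h1 : (w : T) ∈ N := by
        refine hN.mpr ⟨1, ?_⟩
        have h2 := congrArg Subtype.val hw.apply_eq_smul
        rw [pow_one, hc', LinearMap.sub_apply, sub_eq_zero]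
        exact h2
      rw [hb, Submodule.mem_bot] at h1
      exact Subtype.ext h1
  have hloc : LocNilp c' := fun v => hN.mp (htop ▸ Submodule.mem_top)
  choose M hM using fun k => TwistData.exists_pow_eq_zero_of_finiteDimensional hloc (Tk k)
  refine H.eq_zero_of_isNilpotent hc'B hd' ⟨R.sup M, ?_⟩
  have h1 : ⨆ k, Tk k ≤ LinearMap.ker (c' ^ R.sup M) := by
    refine iSup_le fun k v hv => ?_
    obtain ⟨S, hS, hSi, k', hk', hSk⟩ := hR k
    refine hSi ?_
    rw [← Module.End.mul_apply, (H.comm _ hS _ (pow_mem hc'B _)).eq, Module.End.mul_apply, map_zero]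
    exact pow_apply_eq_zero_of_le (Finset.le_sup hk') (hM k' _ (hSk v hv))
  rw [H.iSup_eq, top_le_iff, LinearMap.ker_eq_top] at h1
  exact h1

/-- Homogeneous elements of a degree that has a multiple with an invertible element are invertible,
unless they vanish. -/
lemma exists_inverse {b : Module.End ℂ T} (hb : b ∈ B) {d : I} (hd : HasDegree Tk b d) (h0 : b ≠ 0)
    {N : ℕ} (hN : 0 < N) {S S' : Module.End ℂ T} (hS : S ∈ B) (hSS : S' * S = 1)
    (hSd : HasDegree Tk S (-(N • d))) : ∃ c ∈ B, HasDegree Tk c (-d) ∧ b * c = 1 := by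
  have h1 : HasDegree Tk (S * b ^ N) 0 := by
    have := hSd.mul (hd.pow N)
    rwa [neg_add_cancel] at this
  obtain ⟨a, ha⟩ := H.exists_eq_smul_one (B.mul_mem hS (pow_mem hb N)) h1
  have ha0 : a ≠ 0 := by
    rintro rfl
    refine h0 (H.eq_zero_of_isNilpotent hb hd ⟨N, ?_⟩)
    rw [zero_smul] at ha
    rw [← one_mul (b ^ N), ← hSS, mul_assoc, ha, mul_zero]
  have hc : a⁻¹ • (S * b ^ (N - 1)) ∈ B :=
    B.smul_mem (B.mul_mem hS (pow_mem hb _)) _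
  have h2 : a⁻¹ • (S * b ^ (N - 1)) * b = 1 := by
    rw [smul_mul_assoc, mul_assoc, ← pow_succ, Nat.sub_add_cancel hN, ha, smul_smul,
      inv_mul_cancel₀ ha0, one_smul]
  have h3 := (hSd.mul (hd.pow (N - 1))).smul a⁻¹
  have h4 : -(N • d) + (N - 1) • d = -d := by
    obtain ⟨M, rfl⟩ := Nat.exists_eq_succ_of_ne_zero hN.ne'
    rw [Nat.succ_sub_one, succ_nsmul]
    abel
  rw [h4] at h3
  exact ⟨_, hc, h3, (H.comm _ hb _ hc).eq.trans h2⟩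

section Torus

variable {Γ U : Type*} [AddCommGroup Γ] {ι : Γ →+ I} {pair : U → Γ →+ ℂ} {K δ : Γ → Module.End ℂ T}
  {Dop : Γ → U → Module.End ℂ T} {C : ℂ} {N : ℕ}

/-- A family of commuting homogeneous operators on which derivations act as on Laurent monomials. -/
theorem exists_torus [Nontrivial T] (hC : C ≠ 0) (hK : ∀ d, K d ∈ B) (hδ : ∀ d, δ d ∈ B)
    (hdegK : ∀ d, HasDegree Tk (K d) (ι d)) (hdegδ : ∀ d, HasDegree Tk (δ d) (ι d))
    (hDK : ∀ d e u, Dop d u * K e - K e * Dop d u = pair u e • K (d + e))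
    (hDδ : ∀ d e u, Dop d u * δ e - δ e * Dop d u = pair u e • δ (d + e))
    (hpair : ∀ e ≠ 0, ∃ u, pair u e ≠ 0) (hK0 : K 0 = C • 1) (hN : 0 < N)
    (hS : ∀ d, ∃ S ∈ B, ∃ S' : Module.End ℂ T, S' * S = 1 ∧ HasDegree Tk S (ι (N • d))) :
    (∀ d e, K d * K e = C • K (d + e)) ∧ ∀ r : Γ, r ≠ 0 → ∃ a : ℂ, ∀ d, δ d = a • K d := by
  have hKne : ∀ d, K d ≠ 0 := by
    intro d hd
    rcases eq_or_ne d 0 with rfl | hd0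
    · rw [hK0, smul_eq_zero] at hd
      exact hd.elim hC one_ne_zero
    · obtain ⟨u, hu⟩ := hpair d hd0
      have h1 := hDK (-d) d u
      rw [hd, mul_zero, zero_mul, sub_zero, neg_add_cancel, hK0, eq_comm, smul_eq_zero,
        smul_eq_zero] at h1
      exact h1.elim hu fun h => h.elim hC one_ne_zero
  have hmul : ∀ (d : Γ) (x : Module.End ℂ T), x ∈ B → HasDegree Tk x (ι d) →
      ∃ a : ℂ, x = a • K d := by
    intro d x hx hdx
    obtain ⟨S, hS1, S', h2, hSk⟩ := hS (-d)
    have hSd : HasDegree Tk S (-(N • ι d)) := by simpa using hSk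
    obtain ⟨c, hc, hcd, hc2⟩ := H.exists_inverse (hK d) (hdegK d) (hKne d) hN hS1 h2 hSd
    have hdeg0 := hcd.mul hdx
    rw [neg_add_cancel] at hdeg0
    obtain ⟨a, ha⟩ := H.exists_eq_smul_one (Subalgebra.mul_mem _ hc hx) hdeg0
    refine ⟨a, ?_⟩
    rw [← one_mul x, ← hc2, mul_assoc, ha, mul_smul_comm, mul_one]
  have hDmul : ∀ (d e e' : Γ) (u : U), Dop d u * (K e * K e') - K e * K e' * Dop d u =
      pair u e • (K (d + e) * K e') + pair u e' • (K e * K (d + e')) := by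
    intro d e e' u
    rw [← smul_mul_assoc, ← hDK, ← mul_smul_comm, ← hDK]
    simp only [sub_mul, mul_sub, mul_assoc]
    abel
  have hcommK : ∀ d e, K d * K e = K e * K d := fun d e => H.comm _ (hK d) _ (hK e)
  have hsq : ∀ d, K d * K d = C • K (d + d) := by
    intro d
    rcases eq_or_ne d 0 with rfl | hd
    · rw [add_zero, hK0, smul_mul_assoc, one_mul]
    obtain ⟨a, ha⟩ := hmul (d + d) _ (Subalgebra.mul_mem _ (hK d) (hK d))
      (by rw [map_add]; exact (hdegK d).mul (hdegK d))
    obtain ⟨u, hu⟩ := hpair d hd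
    have h1 := hDmul (-d) d d u
    rw [ha, mul_smul_comm, smul_mul_assoc, ← smul_sub, hDK, neg_add_cancel, hK0,
      show -d + (d + d) = d by abel, smul_mul_assoc, mul_smul_comm, one_mul, mul_one, ← add_smul,
      smul_smul, smul_smul] at h1
    have h3 := smul_left_injective ℂ (hKne d) h1
    rw [map_add] at h3
    have h4 : a = C := by
      have : (2 * pair u d) * a = (2 * pair u d) * C := by linear_combination h3
      exact mul_left_cancel₀ (mul_ne_zero two_ne_zero hu) this
    rw [ha, h4]
  refine ⟨fun d e => ?_, fun r hr0 => ?_⟩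
  · rcases eq_or_ne e 0 with rfl | he
    · rw [add_zero, hK0, mul_smul_comm, mul_one]
    obtain ⟨u, hu⟩ := hpair e he
    have h1 := hDmul (d - e) e e u
    rw [hsq, mul_smul_comm, smul_mul_assoc, ← smul_sub, hDK, sub_add_cancel,
      show d - e + (e + e) = d + e by abel, hcommK e d, ← add_smul, smul_comm, map_add] at h1
    exact (smul_right_injective _ (by rw [← two_mul]; exact mul_ne_zero two_ne_zero hu) h1).symm
  · obtain ⟨a, ha⟩ := hmul r _ (hδ r) (hdegδ r)
    obtain ⟨u, hu⟩ := hpair r hr0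
    refine ⟨a, fun d => ?_⟩
    have h2 := hDδ (d - r) r u
    rw [ha, mul_smul_comm, smul_mul_assoc, ← smul_sub, hDK, sub_add_cancel, smul_comm] at h2
    exact (smul_right_injective _ hu h2).symm

end Torus

end IsDiffIrreducible

end GradedOperators

lemma end_lie_eq {T : Type*} [AddCommGroup T] [Module ℂ T] (a b : Module.End ℂ T) :
    ⁅a, b⁆ = a * b - b * a := LieRing.of_associative_ring_bracket a b

lemma end_lie_mul {T : Type*} [AddCommGroup T] [Module ℂ T] (a b c : Module.End ℂ T) :
    ⁅a, b * c⁆ = ⁅a, b⁆ * c + b * ⁅a, c⁆ := by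
  simp only [end_lie_eq, mul_sub, sub_mul, mul_assoc]
  abel

/-- An algebra is stable under a derivation if its generators are mapped to it. -/
lemma lie_mem_adjoin {T : Type*} [AddCommGroup T] [Module ℂ T] {s : Set (Module.End ℂ T)}
    {D : Module.End ℂ T} (h : ∀ x ∈ s, ⁅D, x⁆ ∈ Algebra.adjoin ℂ s) {x : Module.End ℂ T}
    (hx : x ∈ Algebra.adjoin ℂ s) : ⁅D, x⁆ ∈ Algebra.adjoin ℂ s := by
  induction hx using Algebra.adjoin_induction with
  | mem x hx => exact h x hx
  | algebraMap r =>
    rw [end_lie_eq, Algebra.algebraMap_eq_smul_one, mul_smul_comm, smul_mul_assoc, mul_one, one_mul,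
      sub_self]
    exact zero_mem _
  | add x y _ _ h1 h2 =>
    rw [show ⁅D, x + y⁆ = ⁅D, x⁆ + ⁅D, y⁆ by simp only [end_lie_eq, mul_add, add_mul]; abel]
    exact add_mem h1 h2
  | mul x y hx hy h1 h2 =>
    rw [end_lie_mul]
    exact add_mem (Subalgebra.mul_mem _ h1 hy) (Subalgebra.mul_mem _ hx h2)

namespace TwistData

variable {n : ℕ} {g : Type*} [LieRing g] [LieAlgebra ℂ g] {D : TwistData n g}
variable {h₀ : LieSubalgebra ℂ D.fixed}
variable {V : Type*} [AddCommGroup V] [Module ℂ V] [LieRingModule D.tau V] [LieModule ℂ D.tau V]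
variable [FiniteDimensional ℂ g] [LieAlgebra.IsSimple ℂ g]
variable [LieAlgebra.IsSimple ℂ D.fixed] [h₀.IsCartanSubalgebra]
variable {b : (D.roots h₀).Base} {wt : D.Weight h₀}

variable (b V) in
/-- The operator `t^d K₀` on `T`. -/
noncomputable def topK (d : D.Γ) : Module.End ℂ (D.topSpace V b) := topC V b d (Pi.single 0 1)

variable (b V) in
/-- The operator `t^d d₀` on `T`. -/
noncomputable def topD₀ (d : D.Γ) : Module.End ℂ (D.topSpace V b) :=
  LieModule.toEnd ℂ (D.tauNonneg b) (D.topSpace V b) (D.zeroD₀ b d d.2)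

variable (b V) in
/-- The operator `D(u, d)` on `T`, linear in `u`. -/
noncomputable def topD (d : D.Γ) : (Fin n → ℂ) →ₗ[ℂ] Module.End ℂ (D.topSpace V b) :=
  (LieModule.toEnd ℂ (D.tauNonneg b) (D.topSpace V b) : D.tauNonneg b →ₗ[ℂ] _) ∘ₗ D.zeroDLin b d d.2

variable (b V) in
/-- The operator `X(l)` on `T`, linear in `X`. -/
noncomputable def topX (l : Fin n → ℤ) :
    D.gCircGrad h₀ l →ₗ[ℂ] Module.End ℂ (D.topSpace V b) :=
  (LieModule.toEnd ℂ (D.tauNonneg b) (D.topSpace V b) : D.tauNonneg b →ₗ[ℂ] _) ∘ₗ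
    D.zeroLoopLin b l

lemma topC_eq (h0 : ∀ (d : D.Γ) (w : Coef n), w 0 = 0 → topC V b d w = 0) (d : D.Γ) (w : Coef n) :
    topC V b d w = w 0 • topK V b d := by
  have h1 := h0 d (w - w 0 • Pi.single 0 1) (by simp)
  rw [topC, map_sub, map_sub, map_smul, map_smul, sub_eq_zero] at h1
  exact h1

/-- The action of `τ⁰ + τ⁺` on `T`. -/
noncomputable abbrev topRep (V : Type*) [AddCommGroup V] [Module ℂ V] [LieRingModule D.tau V]
    [LieModule ℂ D.tau V] (b : (D.roots h₀).Base) :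
    D.tauNonneg b →ₗ[ℂ] Module.End ℂ (D.topSpace V b) :=
  (LieModule.toEnd ℂ (D.tauNonneg b) (D.topSpace V b) : D.tauNonneg b →ₗ[ℂ] _)

lemma topRep_commutator (x y : D.tauNonneg b) :
    topRep V b x * topRep V b y - topRep V b y * topRep V b x = topRep V b ⁅x, y⁆ := by
  ext1 v
  exact (lie_lie x y v).symm

lemma topRep_zeroC_expo0 (h0 : ∀ (d : D.Γ) (w : Coef n), w 0 = 0 → topC V b d w = 0)
    (r l : Fin n → ℤ) (hr : r ∈ D.Γ) : topRep V b (D.zeroC b r hr (expo0 l).toCoef) = 0 :=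
  h0 ⟨r, hr⟩ _ (by simp [Expo.toCoef])

lemma commutator_topD_topC (d e : D.Γ) (u : Fin n → ℂ) (w : Coef n) :
    topD V b d u * topC V b e w - topC V b e w * topD V b d u = topC V b (d + e)
      ((∑ i, u i * (e : Fin n → ℤ) i) • w + (Coef.dot (Fin.cons 0 u) w) • (expo0 d).toCoef) :=
  (topRep_commutator (V := V) (D.zeroD b u d d.2) (D.zeroC b e e.2 w)).trans
    (congrArg (topRep V b) (lie_zeroD_zeroC D u _ _ d.2 e.2 w))

lemma commutator_topD_topK (d e : D.Γ) (u : Fin n → ℂ) :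
    topD V b d u * topK V b e - topK V b e * topD V b d u =
      (∑ i, u i * (e : Fin n → ℤ) i) • topK V b (d + e) := by
  rw [topK, commutator_topD_topC, topK, topC, topC, ← map_smul, ← map_smul]
  congr 2
  have : Coef.dot (Fin.cons 0 u) (Pi.single 0 1) = 0 := by
    simp [Coef.dot, Fin.sum_univ_succ]
  rw [this, zero_smul, add_zero]

lemma commutator_topD_topD₀ (d e : D.Γ) (u : Fin n → ℂ) :
    topD V b d u * topD₀ V b e - topD₀ V b e * topD V b d u =
      (∑ i, u i * (e : Fin n → ℤ) i) • topD₀ V b (d + e) :=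
  (topRep_commutator (V := V) (D.zeroD b u d d.2) (D.zeroD₀ b e e.2)).trans
    ((congrArg (topRep V b) (lie_zeroD_zeroD₀ D u _ _ d.2 e.2)).trans
      ((topRep V b).map_smul _ _))

lemma commutator_topD_topX (d : D.Γ) (u : Fin n → ℂ) (l : Fin n → ℤ) (X : D.gCirc h₀)
    (hX : X ∈ D.gCircGrad h₀ l) (hX' : X ∈ D.gCircGrad h₀ ((d : Fin n → ℤ) + l)) :
    topD V b d u * topX V b l ⟨X, hX⟩ - topX V b l ⟨X, hX⟩ * topD V b d u =
      (∑ i, u i * l i) • topX V b (d + l) ⟨X, hX'⟩ :=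
  (topRep_commutator (V := V) (D.zeroD b u d d.2) (D.zeroLoop b l X hX)).trans
    ((congrArg (topRep V b) (lie_zeroD_zeroLoop D u _ d.2 l X hX hX')).trans
      ((topRep V b).map_smul _ _))

lemma commutator_topD_topD (h0 : ∀ (d : D.Γ) (w : Coef n), w 0 = 0 → topC V b d w = 0) (d e : D.Γ)
    (u v : Fin n → ℂ) : topD V b d u * topD V b e v - topD V b e v * topD V b d u = topD V b (d + e)
      ((∑ i, u i * (e : Fin n → ℤ) i) • v - (∑ i, v i * (d : Fin n → ℤ) i) • u) := by
  refine (topRep_commutator (V := V) (D.zeroD b u d d.2) (D.zeroD b v e e.2)).trans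
    ((congrArg (topRep V b) (lie_zeroD_zeroD D u v _ _ d.2 e.2)).trans ?_)
  rw [map_add, map_smul, topRep_zeroC_expo0 h0, smul_zero, add_zero]
  rfl

lemma commutator_topX_topX (h0 : ∀ (d : D.Γ) (w : Coef n), w 0 = 0 → topC V b d w = 0)
    (l k : Fin n → ℤ) (X Y : D.gCirc h₀) (hX : X ∈ D.gCircGrad h₀ l) (hY : Y ∈ D.gCircGrad h₀ k) :
    topX V b l ⟨X, hX⟩ * topX V b k ⟨Y, hY⟩ - topX V b k ⟨Y, hY⟩ * topX V b l ⟨X, hX⟩ =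
      topX V b (l + k) ⟨⁅X, Y⁆, D.lie_mem_gCircGrad hX hY⟩ := by
  refine (topRep_commutator (V := V) (D.zeroLoop b l X hX) (D.zeroLoop b k Y hY)).trans ?_
  rcases D.lie_zeroLoop_zeroLoop (b := b) l k X Y hX hY with h1 | ⟨hlk, a, h1⟩
  · exact congrArg (topRep V b) h1
  · refine (congrArg (topRep V b) h1).trans ?_
    rw [map_add, map_smul, topRep_zeroC_expo0 h0, smul_zero, add_zero]
    rfl

lemma commute_of_lie_eq_zero {x y : D.tauNonneg b} (h : ⁅x, y⁆ = 0) :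
    Commute (topRep V b x) (topRep V b y) :=
  sub_eq_zero.mp ((topRep_commutator x y).trans (by rw [h, map_zero]))

lemma commute_topX_topC (l : Fin n → ℤ) (X : D.gCircGrad h₀ l) (e : D.Γ) (w : Coef n) :
    Commute (topX V b l X) (topC V b e w) :=
  commute_of_lie_eq_zero (V := V) (x := D.zeroLoop b l X.1 X.2) (y := D.zeroC b e e.2 w)
    (lie_zeroLoop_zeroC D l X.1 X.2 e e.2 w)

lemma commute_topD₀_topD₀ (d e : D.Γ) : Commute (topD₀ V b d) (topD₀ V b e) :=
  commute_of_lie_eq_zero (lie_zeroD₀_zeroD₀ D _ _ d.2 e.2)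

lemma commute_topD₀_topX (d : D.Γ) (l : Fin n → ℤ) (X : D.gCircGrad h₀ l) :
    Commute (topD₀ V b d) (topX V b l X) :=
  commute_of_lie_eq_zero (V := V) (x := D.zeroD₀ b d d.2) (y := D.zeroLoop b l X.1 X.2)
    (lie_zeroD₀_zeroLoop D _ d.2 l X.1 X.2)

lemma commute_topD₀_topC (h0 : ∀ (d : D.Γ) (w : Coef n), w 0 = 0 → topC V b d w = 0) (d e : D.Γ)
    (w : Coef n) : Commute (topD₀ V b d) (topC V b e w) := by
  refine sub_eq_zero.mp
    ((topRep_commutator (V := V) (D.zeroD₀ b d d.2) (D.zeroC b e e.2 w)).trans ?_)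
  rw [lie_zeroD₀_zeroC D _ _ d.2 e.2 w, map_smul, topRep_zeroC_expo0 h0, smul_zero]

lemma lie_corootCirc (i : h₀.root) (X : D.gCirc h₀) : ⁅corootCirc i, X⁆ = 0 :=
  Subtype.ext (X.2.2 _)

lemma commute_topCoroot_topX (h0 : ∀ (d : D.Γ) (w : Coef n), w 0 = 0 → topC V b d w = 0)
    (i : h₀.root) (d : D.Γ) (l : Fin n → ℤ) (X : D.gCircGrad h₀ l) :
    Commute (topCoroot V b i d) (topX V b l X) := by
  refine sub_eq_zero.mp ((commutator_topX_topX (V := V) (b := b) h0 d l _ _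
    (corootCirc_mem i d) X.2).trans ?_)
  rw [show (⟨⁅corootCirc i, (X : D.gCirc h₀)⁆, D.lie_mem_gCircGrad (corootCirc_mem i d) X.2⟩ :
    D.gCircGrad h₀ (d + l)) = 0 from Subtype.ext (lie_corootCirc i _), map_zero]

lemma commutator_topD_topCoroot (i : h₀.root) (d e : D.Γ) (u : Fin n → ℂ) :
    topD V b d u * topCoroot V b i e - topCoroot V b i e * topD V b d u =
      (∑ i, u i * (e : Fin n → ℤ) i) • topCoroot V b i (d + e) :=
  commutator_topD_topX d u _ _ (corootCirc_mem i e) (corootCirc_mem i (d + e))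

lemma hasDegree_topC (d : D.Γ) (w : Coef n) :
    HasDegree (fun k => (D.topGrade wt k : Submodule ℂ (D.topSpace V b))) (topC V b d w) d :=
  fun _ _ hv => topC_mem_topGrade d w hv

lemma hasDegree_topD₀ (d : D.Γ) :
    HasDegree (fun k => (D.topGrade wt k : Submodule ℂ (D.topSpace V b))) (topD₀ V b d) d :=
  fun _ _ hv => zeroD₀_mem_topGrade _ d.2 hv

lemma hasDegree_topD (d : D.Γ) (u : Fin n → ℂ) :
    HasDegree (fun k => (D.topGrade wt k : Submodule ℂ (D.topSpace V b))) (topD V b d u) d :=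
  fun _ _ hv => zeroD_mem_topGrade u _ d.2 hv

lemma hasDegree_topX (l : Fin n → ℤ) (X : D.gCircGrad h₀ l) :
    HasDegree (fun k => (D.topGrade wt k : Submodule ℂ (D.topSpace V b))) (topX V b l X) l :=
  fun _ _ hv => zeroLoop_mem_topGrade l X.1 X.2 hv

variable (V b) in
/-- The generators of the commutative algebra of operators `t^r K₀`, `t^r d₀`, `α_i^∨ ⊗ t^r`. -/
def torusGenerators (i : h₀.root) : Set (Module.End ℂ (D.topSpace V b)) :=
  Set.range (topK V b) ∪ Set.range (topD₀ V b) ∪ Set.range (topCoroot V b i)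

variable (V b) in
/-- The algebra generated by the operators `t^r K₀`, `t^r d₀`, `α_i^∨ ⊗ t^r`. -/
noncomputable def torusAlgebra (i : h₀.root) : Subalgebra ℂ (Module.End ℂ (D.topSpace V b)) :=
  Algebra.adjoin ℂ (torusGenerators V b i)

variable {i : h₀.root}

lemma topK_mem (d : D.Γ) : topK V b d ∈ torusAlgebra V b i :=
  Algebra.subset_adjoin (Or.inl (Or.inl ⟨d, rfl⟩))

lemma topD₀_mem (d : D.Γ) : topD₀ V b d ∈ torusAlgebra V b i :=
  Algebra.subset_adjoin (Or.inl (Or.inr ⟨d, rfl⟩))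

lemma topCoroot_mem (d : D.Γ) : topCoroot V b i d ∈ torusAlgebra V b i :=
  Algebra.subset_adjoin (Or.inr ⟨d, rfl⟩)

lemma topHeisenberg_le (h0 : ∀ (d : D.Γ) (w : Coef n), w 0 = 0 → topC V b d w = 0) :
    topHeisenberg V b i ≤ torusAlgebra V b i := by
  refine Algebra.adjoin_le ?_
  rintro _ (⟨d, rfl⟩ | ⟨⟨d, w⟩, rfl⟩)
  · exact topCoroot_mem d
  · change topC V b d w ∈ torusAlgebra V b i
    rw [topC_eq h0]
    exact Subalgebra.smul_mem _ (topK_mem d) _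

lemma commute_torusGenerators (h0 : ∀ (d : D.Γ) (w : Coef n), w 0 = 0 → topC V b d w = 0)
    {x y : Module.End ℂ (D.topSpace V b)} (hx : x ∈ torusGenerators V b i)
    (hy : y ∈ torusGenerators V b i) : Commute x y := by
  have hc : ∀ d e, Commute (topCoroot V b i d) (topCoroot V b i e) := fun d e =>
    commute_topCoroot_topX h0 i d e ⟨_, corootCirc_mem i e⟩
  have hd : ∀ d e, Commute (topD₀ V b d) (topCoroot V b i e) := fun d e =>
    commute_topD₀_topX d e ⟨_, corootCirc_mem i e⟩
  rcases hx with (⟨d, rfl⟩ | ⟨d, rfl⟩) | ⟨d, rfl⟩ <;> rcases hy with (⟨e, rfl⟩ | ⟨e, rfl⟩) | ⟨e, rfl⟩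
  · exact commute_topC _ _ _ _
  · exact (commute_topD₀_topC h0 _ _ _).symm
  · exact (commute_topCoroot_topC _ _ _ _).symm
  · exact commute_topD₀_topC h0 _ _ _
  · exact commute_topD₀_topD₀ _ _
  · exact hd _ _
  · exact commute_topCoroot_topC _ _ _ _
  · exact (hd _ _).symm
  · exact hc _ _

lemma commute_torusAlgebra (h0 : ∀ (d : D.Γ) (w : Coef n), w 0 = 0 → topC V b d w = 0)
    {x y : Module.End ℂ (D.topSpace V b)} (hx : x ∈ torusAlgebra V b i)
    (hy : y ∈ torusAlgebra V b i) : Commute x y :=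
  Algebra.commute_of_mem_adjoin_of_forall_mem_commute hy fun _ hz =>
    (Algebra.commute_of_mem_adjoin_of_forall_mem_commute hx fun _ hw =>
      (commute_torusGenerators h0 hw hz).symm).symm

lemma commute_torusAlgebra_topX (h0 : ∀ (d : D.Γ) (w : Coef n), w 0 = 0 → topC V b d w = 0)
    {x : Module.End ℂ (D.topSpace V b)} (hx : x ∈ torusAlgebra V b i) (l : Fin n → ℤ)
    (X : D.gCircGrad h₀ l) : Commute x (topX V b l X) := by
  refine (Algebra.commute_of_mem_adjoin_of_forall_mem_commute hx fun w hw => ?_).symm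
  rcases hw with (⟨d, rfl⟩ | ⟨d, rfl⟩) | ⟨d, rfl⟩
  · exact commute_topX_topC l X d _
  · exact (commute_topD₀_topX d l X).symm
  · exact (commute_topCoroot_topX h0 i d l X).symm

lemma lie_topD_mem (d : D.Γ) (u : Fin n → ℂ) {x : Module.End ℂ (D.topSpace V b)}
    (hx : x ∈ torusAlgebra V b i) : ⁅topD V b d u, x⁆ ∈ torusAlgebra V b i := by
  refine lie_mem_adjoin (fun x hx => ?_) hx
  rw [end_lie_eq]
  rcases hx with (⟨e, rfl⟩ | ⟨e, rfl⟩) | ⟨e, rfl⟩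
  · rw [commutator_topD_topK]
    exact Subalgebra.smul_mem _ (topK_mem _) _
  · rw [commutator_topD_topD₀]
    exact Subalgebra.smul_mem _ (topD₀_mem _) _
  · rw [commutator_topD_topCoroot]
    exact Subalgebra.smul_mem _ (topCoroot_mem _) _

/-- A subspace of `T` that is stable under the operators `X(l)`, `t^r K₀`, `t^r d₀`, `D(u, r)`
is trivial. -/
lemma eq_bot_or_eq_top_of_op_stable [LieModule.IsIrreducible ℂ (D.tauNonneg b) (D.topSpace V b)]
    (h0 : ∀ (d : D.Γ) (w : Coef n), w 0 = 0 → topC V b d w = 0)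
    (N : Submodule ℂ (D.topSpace V b))
    (hX : ∀ l X, ∀ v ∈ N, topX V b l X v ∈ N) (hK : ∀ d, ∀ v ∈ N, topK V b d v ∈ N)
    (hD₀ : ∀ d, ∀ v ∈ N, topD₀ V b d v ∈ N) (hD : ∀ d u, ∀ v ∈ N, topD V b d u v ∈ N) :
    N = ⊥ ∨ N = ⊤ := by
  refine eq_bot_or_eq_top_of_stable N (fun l X hX' v hv => hX l ⟨X, hX'⟩ v hv)
    (fun r hr w v hv => ?_) (fun r hr v hv => hD₀ ⟨r, hr⟩ v hv)
    (fun u r hr v hv => hD ⟨r, hr⟩ u v hv)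
  change topC V b ⟨r, hr⟩ w v ∈ N
  rw [topC_eq h0]
  exact Submodule.smul_mem _ _ (hK _ v hv)

/-- The form of the operators `t^r K₀` and `t^r d₀` on `T`. -/
structure HasTorus (b : (D.roots h₀).Base) (V : Type*) [AddCommGroup V] [Module ℂ V]
    [LieRingModule D.tau V] [LieModule ℂ D.tau V] (C₀ : ℝ) (a₀ : ℂ) : Prop where
  topC_eq_zero : ∀ (d : D.Γ) (w : Coef n), w 0 = 0 → topC V b d w = 0
  topK_zero : topK V b 0 = (C₀ : ℂ) • 1
  topK_mul : ∀ d e, topK V b d * topK V b e = (C₀ : ℂ) • topK V b (d + e)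
  topD₀_eq : ∀ d, (C₀ : ℂ) • topD₀ V b d = a₀ • topK V b d

/-- The pairing `u ↦ (u, d)` of `ℂⁿ` with `Γ`. -/
noncomputable def latticePair (D : TwistData n g) (u : Fin n → ℂ) : D.Γ →+ ℂ where
  toFun d := ∑ i, u i * (d : Fin n → ℤ) i
  map_zero' := by simp
  map_add' d e := by simp [mul_add, Finset.sum_add_distrib]

lemma exists_latticePair_ne_zero {e : D.Γ} (he : e ≠ 0) :
    ∃ u : Fin n → ℂ, D.latticePair u e ≠ 0 := by
  obtain ⟨j, hj⟩ : ∃ j, (e : Fin n → ℤ) j ≠ 0 := by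
    by_contra! hc
    exact he (Subtype.ext (funext hc))
  refine ⟨Pi.single j 1, ?_⟩
  simpa [latticePair, Pi.single_apply] using hj

variable {h : LieSubalgebra ℂ g} [h.IsCartanSubalgebra]

lemma isDiffIrreducible [LieModule.IsIrreducible ℂ (D.tauNonneg b) (D.topSpace V b)]
    (hV : D.IsIntegrable h₀ V) (h0 : ∀ (d : D.Γ) (w : Coef n), w 0 = 0 → topC V b d w = 0)
    {v₀ : V} (hv₀ : v₀ ∈ D.topSpace V b) (hne : v₀ ≠ 0) (hw : v₀ ∈ D.weightSpace V wt)
    {N : ℕ} (hN : 0 < N)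
    (hS : ∀ d : D.Γ, ∃ S ∈ topHeisenberg V b i, ∃ S' ∈ topHeisenberg V b i, S * S' = 1 ∧
      S' * S = 1 ∧ ∀ k, ∀ v ∈ D.topGrade wt k, S v ∈ D.topGrade wt (k + (N • d : D.Γ))) :
    IsDiffIrreducible (fun k => (D.topGrade wt k : Submodule ℂ (D.topSpace V b)))
      (torusAlgebra V b i) (Set.range fun p : D.Γ × (Fin n → ℂ) => topD V b p.1 p.2) where
  finite k := finiteDimensional_topGrade hV wt k
  iSup_eq := iSup_topGrade (D := D) (b := b) (wt := wt) hv₀ hne hw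
  exists_ne_bot := by
    by_contra! hb
    have hT := iSup_topGrade (D := D) (b := b) (wt := wt) hv₀ hne hw
    rw [funext hb, iSup_const] at hT
    have : Nontrivial (D.topSpace V b) := ⟨⟨v₀, hv₀⟩, 0, fun h => hne (congrArg Subtype.val h)⟩
    exact bot_ne_top hT
  comm x hx y hy := commute_torusAlgebra h0 hx hy
  degree := by
    rintro _ ⟨⟨d, u⟩, rfl⟩
    exact ⟨d, hasDegree_topD d u⟩
  lie_mem := by
    rintro _ ⟨⟨d, u⟩, rfl⟩ x hx
    exact lie_topD_mem d u hx
  eq_bot_or_eq_top N h1 h2 := eq_bot_or_eq_top_of_op_stable h0 N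
    (fun l X => h2 _ fun x hx => commute_torusAlgebra_topX h0 hx l X)
    (fun d => h2 _ fun x hx => commute_torusAlgebra h0 hx (topK_mem d))
    (fun d => h2 _ fun x hx => commute_torusAlgebra h0 hx (topD₀_mem d))
    (fun d u => h1 _ ⟨(d, u), rfl⟩)
  exists_shift := ⟨Fintype.piFinset fun i : Fin n => Finset.Ico (0 : ℤ) (N * D.m i.succ), fun k => by
    obtain ⟨d, hd⟩ := D.exists_mem_box hN k
    obtain ⟨S, hS1, S', -, -, hSS, hSk⟩ := hS d
    refine ⟨S, topHeisenberg_le h0 hS1, fun x y hxy => ?_, _, hd, hSk k⟩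
    rw [← Module.End.one_apply (R := ℂ) x, ← Module.End.one_apply (R := ℂ) y, ← hSS,
      Module.End.mul_apply, Module.End.mul_apply, hxy]⟩

lemma topK_zero_eq {C₀ : ℝ} (hL : D.HasLevel V C₀) : topK V b 0 = (C₀ : ℂ) • 1 := by
  ext1 v
  refine Subtype.ext ?_
  refine (congrArg (fun x : D.tau => ⁅x, (v : V)⁆) ?_).trans (hL.K_zero v)
  refine D.centerEl_congr ?_ rfl (D.expo0_mem (0 : D.Γ).2)
  funext j
  refine Fin.cases ?_ (fun j => ?_) j <;> simp

lemma topD₀_zero_apply {v₀ : V} (hv₀ : v₀ ∈ D.topSpace V b) (hw : v₀ ∈ D.weightSpace V wt) :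
    topD₀ V b 0 (⟨v₀, hv₀⟩ : D.topSpace V b) = wt.onD 0 • ⟨v₀, hv₀⟩ := by
  refine Subtype.ext ?_
  refine (congrArg (fun x : D.tau => ⁅x, (v₀ : V)⁆) ?_).trans (hw.2.2 0)
  refine D.derEl_congr ?_ rfl (D.expo0_mem (0 : D.Γ).2)
  funext j
  refine Fin.cases ?_ (fun j => ?_) j <;> simp

lemma exists_ne_zero_lattice (hn : 0 < n) : ∃ r : D.Γ, r ≠ 0 := by
  refine ⟨⟨fun i => D.m i.succ, fun i => dvd_rfl⟩, fun h => ?_⟩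
  have := congrFun (congrArg Subtype.val h) ⟨0, hn⟩
  simp only [ZeroMemClass.coe_zero, Pi.zero_apply, Nat.cast_eq_zero] at this
  exact (D.m_pos _).ne' this

theorem hasTorus (hn : 0 < n) [LieModule.IsIrreducible ℂ (D.tauNonneg b) (D.topSpace V b)]
    (hV : D.IsIntegrable h₀ V)
    {C₀ : ℝ} (hL : D.HasLevel V C₀) (hh : ∀ x : h₀, ((x : D.fixed) : g) ∈ h)
    (hΔ : D.weightsOfG h₀ ⊆ D.enlargedRoots h₀)
    {v₀ : V} (hv₀ : v₀ ∈ D.topSpace V b) (hne : v₀ ≠ 0) (hw : v₀ ∈ D.weightSpace V wt) :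
    HasTorus b V C₀ (wt.onD 0) := by
  obtain ⟨h0, i, N, hN, hS⟩ := topC_eq_zero_and_exists_shift (b := b) hV hL hh hΔ hv₀ hne hw
  have H := isDiffIrreducible hV h0 hv₀ hne hw hN hS
  have hC : (C₀ : ℂ) ≠ 0 := by exact_mod_cast hL.pos.ne'
  have : Nontrivial (D.topSpace V b) := ⟨⟨v₀, hv₀⟩, 0, fun h => hne (congrArg Subtype.val h)⟩
  have hK0 : topK V b 0 = (C₀ : ℂ) • 1 := topK_zero_eq hL
  obtain ⟨h1, h2⟩ := H.exists_torus (ι := D.Γ.subtype) (pair := D.latticePair) (K := topK V b)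
    (δ := topD₀ V b) (Dop := fun d u => topD V b d u) (N := N) hC topK_mem topD₀_mem
    (fun d => hasDegree_topC d _) hasDegree_topD₀ commutator_topD_topK commutator_topD_topD₀
    (fun e he => exists_latticePair_ne_zero he) hK0 hN
    (fun d => by
      obtain ⟨S, hS1, S', -, -, hSS, hSk⟩ := hS d
      exact ⟨S, topHeisenberg_le h0 hS1, S', hSS, hSk⟩)
  obtain ⟨r, hr⟩ := exists_ne_zero_lattice (D := D) hn
  obtain ⟨a, ha⟩ := h2 r hr
  refine ⟨h0, hK0, h1, fun d => ?_⟩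
  have h3 := topD₀_zero_apply hv₀ hw
  rw [ha, hK0, smul_smul, LinearMap.smul_apply, Module.End.one_apply] at h3
  have h4 : a * C₀ = wt.onD 0 :=
    smul_left_injective ℂ (m := (⟨v₀, hv₀⟩ : D.topSpace V b))
      (fun h => hne (congrArg Subtype.val h)) h3
  rw [ha, smul_smul, ← h4, mul_comm]

end TwistData

/-! ### Laurent polynomials and the augmentation ideal -/

section Laurent

variable {n : ℕ}

/-- The ring of Laurent polynomials. -/
abbrev Laurent (n : ℕ) : Type := AddMonoidAlgebra ℂ (Fin n → ℤ)

/-- The monomial `T^a`. -/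
noncomputable def mono (a : Fin n → ℤ) : Laurent n := AddMonoidAlgebra.single a 1

lemma mono_add (a c : Fin n → ℤ) : mono (a + c) = mono a * mono c := by
  simp [mono, AddMonoidAlgebra.single_mul_single]

lemma mono_zero : mono (0 : Fin n → ℤ) = 1 := rfl

lemma mono_neg_mul (a : Fin n → ℤ) : mono (-a) * mono a = 1 := by
  rw [← mono_add, neg_add_cancel, mono_zero]

lemma laurent_induction {P : Laurent n → Prop} (f : Laurent n)
    (add : ∀ f g, P f → P g → P (f + g)) (smul : ∀ (r : ℂ) f, P f → P (r • f))
    (mon : ∀ a, P (mono a)) : P f := by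
  induction f using AddMonoidAlgebra.induction_linear with
  | zero => simpa using smul 0 _ (mon 0)
  | add f g hf hg => exact add f g hf hg
  | single a r =>
    have := smul r _ (mon a)
    rwa [mono, AddMonoidAlgebra.smul_single, smul_eq_mul, mul_one] at this

variable {M : Type*} [AddCommGroup M] [Module ℂ M]

/-- The linear map with given values on the monomials. -/
noncomputable def onMono (F : (Fin n → ℤ) → M) : Laurent n →ₗ[ℂ] M :=
  Finsupp.linearCombination ℂ F ∘ₗ (AddMonoidAlgebra.coeffLinearEquiv ℂ).toLinearMap

@[simp] lemma onMono_mono (F : (Fin n → ℤ) → M) (a : Fin n → ℤ) : onMono F (mono a) = F a := by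
  simp [onMono, mono]

/-- The augmentation `T^a ↦ 1`. -/
noncomputable def aug (n : ℕ) : Laurent n →ₗ[ℂ] ℂ := onMono fun _ => 1

@[simp] lemma aug_mono (a : Fin n → ℤ) : aug n (mono a) = 1 := onMono_mono _ _

lemma aug_mul (f g : Laurent n) : aug n (f * g) = aug n f * aug n g := by
  induction f using laurent_induction with
  | add f f' h h' => rw [add_mul, map_add, h, h', map_add, add_mul]
  | smul r f h => rw [smul_mul_assoc, map_smul, h, map_smul, smul_eq_mul, smul_eq_mul, mul_assoc]
  | mon a =>
    induction g using laurent_induction with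
    | add f f' h h' => rw [mul_add, map_add, h, h', map_add, mul_add]
    | smul r f h => rw [mul_smul_comm, map_smul, h, map_smul, smul_eq_mul, smul_eq_mul]; ring
    | mon c => simp [← mono_add]

/-- The derivation `T^a ↦ (u, a) T^a`. -/
noncomputable def dLog (u : Fin n → ℂ) : Laurent n →ₗ[ℂ] Laurent n :=
  onMono fun a => (∑ i, u i * a i) • mono a

@[simp] lemma dLog_mono (u : Fin n → ℂ) (a : Fin n → ℤ) :
    dLog u (mono a) = (∑ i, u i * a i) • mono a := onMono_mono _ _

lemma dLog_mul (u : Fin n → ℂ) (f g : Laurent n) :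
    dLog u (f * g) = f * dLog u g + g * dLog u f := by
  induction f using laurent_induction with
  | add f f' h h' => simp only [add_mul, map_add, h, h', mul_add]; abel
  | smul r f h => simp only [smul_mul_assoc, map_smul, h, mul_smul_comm, smul_add]
  | mon a =>
    induction g using laurent_induction with
    | add f f' h h' => simp only [add_mul, map_add, h, h', mul_add]; abel
    | smul r f h => simp only [smul_mul_assoc, map_smul, h, mul_smul_comm, smul_add]
    | mon c =>
      rw [← mono_add, dLog_mono, dLog_mono, dLog_mono, mul_smul_comm, mul_smul_comm, mul_comm (mono c),
        ← mono_add, ← add_smul]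
      congr 1
      rw [← Finset.sum_add_distrib]
      refine Finset.sum_congr rfl fun i _ => ?_
      push_cast [Pi.add_apply]
      ring

@[simp] lemma dLog_one (u : Fin n → ℂ) : dLog u 1 = 0 := by
  rw [← mono_zero, dLog_mono]; simp

/-- The coordinate `T_i - 1`. -/
noncomputable def coordX (i : Fin n) : Laurent n := mono (Pi.single i 1) - 1

lemma sum_single_mul_single (i j : Fin n) (c : ℤ) :
    (∑ k, (Pi.single i 1 : Fin n → ℂ) k * ((Pi.single j c : Fin n → ℤ) k : ℂ)) =
      if i = j then (c : ℂ) else 0 := by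
  simp only [Pi.single_apply, ite_mul, one_mul, zero_mul]
  simp

lemma dLog_mono_single (i j : Fin n) (c : ℤ) : dLog (Pi.single i 1) (mono (Pi.single j c)) =
    (if i = j then (c : ℂ) else 0) • mono (Pi.single j c) := by
  rw [dLog_mono, sum_single_mul_single]

lemma dLog_coordX (i j : Fin n) : dLog (Pi.single i 1) (coordX j) =
    if i = j then mono (Pi.single j 1) else 0 := by
  rw [coordX, map_sub, dLog_mono_single, dLog_one, sub_zero]
  split_ifs <;> simp

/-- The augmentation ideal. -/
noncomputable def augIdeal (n : ℕ) : Ideal (Laurent n) := Ideal.span (Set.range coordX)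

lemma coordX_mem (i : Fin n) : coordX i ∈ augIdeal n := Ideal.subset_span ⟨i, rfl⟩

lemma aug_eq_zero {f : Laurent n} (hf : f ∈ augIdeal n) : aug n f = 0 := by
  induction hf using Submodule.span_induction with
  | mem x hx =>
    obtain ⟨i, rfl⟩ := hx
    rw [coordX, map_sub, ← mono_zero, aug_mono, aug_mono, sub_self]
  | zero => simp
  | add x y _ _ hx hy => rw [map_add, hx, hy, add_zero]
  | smul a x _ hx => rw [smul_eq_mul, aug_mul, hx, mul_zero]

/-- The logarithm of a monomial, to first order. -/
noncomputable def linPart (a : Fin n → ℤ) : Laurent n := ∑ i, (a i : ℂ) • coordX i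

lemma linPart_mem (a : Fin n → ℤ) : linPart a ∈ augIdeal n :=
  sum_mem fun i _ => Submodule.smul_of_tower_mem _ _ (coordX_mem i)

lemma linPart_add (a c : Fin n → ℤ) : linPart (a + c) = linPart a + linPart c := by
  simp [linPart, add_smul, Finset.sum_add_distrib]

lemma augIdeal_sq_le : augIdeal n ^ 2 ≤ augIdeal n := Ideal.pow_le_self two_ne_zero

/-- The first order expansion of a monomial. -/
lemma mono_sub_linPart_mem (a : Fin n → ℤ) : mono a - 1 - linPart a ∈ augIdeal n ^ 2 := by
  let S : AddSubgroup (Fin n → ℤ) :=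
    { carrier := {a | mono a - 1 - linPart a ∈ augIdeal n ^ 2}
      zero_mem' := by simp [mono_zero, linPart]
      add_mem' := by
        intro a c ha hc
        rw [Set.mem_ofPred_eq] at *
        have h1 : mono a - 1 ∈ augIdeal n := by
          have := add_mem (augIdeal_sq_le ha) (linPart_mem a)
          rwa [sub_add_cancel] at this
        have h2 : mono c - 1 ∈ augIdeal n := by
          have := add_mem (augIdeal_sq_le hc) (linPart_mem c)
          rwa [sub_add_cancel] at this
        have h3 : (mono a - 1) * (mono c - 1) ∈ augIdeal n ^ 2 := by
          rw [pow_two]; exact Ideal.mul_mem_mul h1 h2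
        have := add_mem (add_mem h3 ha) hc
        rw [mono_add, linPart_add]
        convert this using 1
        ring
      neg_mem' := by
        intro a ha
        rw [Set.mem_ofPred_eq] at *
        have h1 : mono a - 1 ∈ augIdeal n := by
          have := add_mem (augIdeal_sq_le ha) (linPart_mem a)
          rwa [sub_add_cancel] at this
        have h3 : mono (-a) * ((mono a - 1) * (mono a - 1)) ∈ augIdeal n ^ 2 := by
          rw [pow_two]; exact Ideal.mul_mem_left _ _ (Ideal.mul_mem_mul h1 h1)
        have := sub_mem h3 ha
        have h4 : linPart (-a) = -linPart a := by simp [linPart]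
        rw [h4]
        convert this using 1
        linear_combination (2 - mono a) * mono_neg_mul a }
  have hS : ∀ i, Pi.single i (1 : ℤ) ∈ S := by
    intro i
    change mono (Pi.single i 1) - 1 - linPart (Pi.single i 1) ∈ augIdeal n ^ 2
    have : linPart (Pi.single i 1) = coordX i := by
      rw [linPart, Finset.sum_eq_single i]
      · simp
      · intro j _ hj
        simp [Pi.single_eq_of_ne hj]
      · simp
    rw [this, coordX, sub_self]
    exact zero_mem _
  have h1 : a = ∑ i, a i • Pi.single i (1 : ℤ) := by
    funext j
    simp [Finset.sum_apply, Pi.single_apply]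
  change a ∈ S
  rw [h1]
  exact sum_mem fun i _ => zsmul_mem (hS i) _

lemma mono_sub_one_mem (a : Fin n → ℤ) : mono a - 1 ∈ augIdeal n := by
  have := add_mem (augIdeal_sq_le (mono_sub_linPart_mem a)) (linPart_mem a)
  rwa [sub_add_cancel] at this

lemma dLog_mem {u : Fin n → ℂ} {f : Laurent n} (hf : f ∈ augIdeal n ^ 2) :
    dLog u f ∈ augIdeal n := by
  rw [pow_two] at hf
  induction hf using Submodule.mul_induction_on' with
  | mem_mul_mem f hf g hg =>
    rw [dLog_mul]
    exact add_mem (Ideal.mul_mem_right _ _ hf) (Ideal.mul_mem_right _ _ hg)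
  | add x _ y _ hx hy => rw [map_add]; exact add_mem hx hy

/-- The Euler field `∑ (1 - T_i⁻¹) T_i ∂_i`. -/
noncomputable def euler (n : ℕ) : Laurent n →ₗ[ℂ] Laurent n :=
  ∑ i : Fin n, LinearMap.mulLeft ℂ (1 - mono (Pi.single i (-1))) ∘ₗ dLog (Pi.single i 1)

lemma euler_apply (f : Laurent n) :
    euler n f = ∑ i, (1 - mono (Pi.single i (-1))) * dLog (Pi.single i 1) f := by
  simp [euler]

lemma euler_mul (f g : Laurent n) : euler n (f * g) = f * euler n g + g * euler n f := by
  simp only [euler_apply, Finset.mul_sum, ← Finset.sum_add_distrib, dLog_mul]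
  exact Finset.sum_congr rfl fun i _ => by ring

lemma euler_mem (f : Laurent n) : euler n f ∈ augIdeal n := by
  rw [euler_apply]
  refine sum_mem fun i _ => Ideal.mul_mem_right _ _ ?_
  rw [← neg_sub]
  exact neg_mem (mono_sub_one_mem _)

lemma euler_mono_single (j : Fin n) (c : ℤ) : euler n (mono (Pi.single j c)) =
    (c : ℂ) • (mono (Pi.single j c) - mono (Pi.single j (c - 1))) := by
  rw [euler_apply, Finset.sum_eq_single j]
  · rw [dLog_mono_single, if_pos rfl, mul_smul_comm, sub_mul, one_mul, ← mono_add, ← Pi.single_add,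
      neg_add_eq_sub]
  · intro i _ hij
    rw [dLog_mono_single, if_neg hij, zero_smul, mul_zero]
  · simp

lemma euler_one : euler n 1 = 0 := by
  rw [euler_apply]; simp

lemma euler_coordX (j : Fin n) : euler n (coordX j) = coordX j := by
  rw [coordX, map_sub, euler_mono_single, euler_one, sub_self, Pi.single_zero, mono_zero]
  simp

open scoped Pointwise in
/-- Monomials in the coordinates are eigenvectors of the Euler field. -/
lemma euler_of_mem_pow (k : ℕ) : ∀ p ∈ (Set.range coordX : Set (Laurent n)) ^ k,
    euler n p = (k : ℂ) • p := by
  induction k with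
  | zero =>
    intro p hp
    rw [pow_zero, Set.mem_one] at hp
    rw [hp, euler_one]; simp
  | succ k ih =>
    intro p hp
    rw [pow_succ] at hp
    obtain ⟨f, hf, _, ⟨j, rfl⟩, rfl⟩ := Set.mem_mul.mp hp
    rw [euler_mul, euler_coordX, ih f hf, mul_smul_comm]
    push_cast
    rw [add_smul, one_smul, mul_comm (coordX j), add_comm]

open scoped Pointwise in
lemma mem_augIdeal_pow {k : ℕ} {p : Laurent n} (hp : p ∈ (Set.range coordX : Set (Laurent n)) ^ k) :
    p ∈ augIdeal n ^ k := by
  rw [augIdeal, Ideal.span, Submodule.span_pow]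
  exact Submodule.subset_span hp

open scoped Pointwise in
lemma augIdeal_pow_eq (k : ℕ) :
    augIdeal n ^ k = Ideal.span ((Set.range coordX : Set (Laurent n)) ^ k) := by
  rw [augIdeal, Ideal.span, Submodule.span_pow]

lemma euler_sub_mem_one {f : Laurent n} (hf : f ∈ augIdeal n) : euler n f - f ∈ augIdeal n ^ 2 := by
  induction hf using Submodule.span_induction with
  | mem x hx =>
    obtain ⟨i, rfl⟩ := hx
    rw [euler_coordX, sub_self]
    exact zero_mem _
  | zero => simp
  | add x y _ _ hx hy =>
    rw [map_add, show euler n x + euler n y - (x + y) = (euler n x - x) + (euler n y - y) by ring]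
    exact add_mem hx hy
  | smul a x hx' hx =>
    rw [smul_eq_mul, euler_mul,
      show a * euler n x + x * euler n a - a * x = a * (euler n x - x) + x * euler n a by ring]
    refine add_mem (Ideal.mul_mem_left _ _ hx) ?_
    rw [pow_two]
    exact Ideal.mul_mem_mul hx' (euler_mem a)

/-- The Euler field acts on `𝔪^k / 𝔪^(k + 1)` as multiplication by `k`. -/
lemma euler_sub_mem (k : ℕ) {f : Laurent n} (hf : f ∈ augIdeal n ^ k) :
    euler n f - (k : ℂ) • f ∈ augIdeal n ^ (k + 1) := by
  induction k generalizing f with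
  | zero => simpa using euler_mem f
  | succ k ih =>
    rw [pow_succ] at hf
    induction hf using Submodule.mul_induction_on' with
    | mem_mul_mem f hf g hg =>
      have e : euler n (f * g) - ((k + 1 : ℕ) : ℂ) • (f * g) =
          f * (euler n g - g) + g * (euler n f - (k : ℂ) • f) := by
        rw [euler_mul, mul_sub, mul_sub, mul_smul_comm, mul_comm g f]
        push_cast
        module
      rw [e]
      refine add_mem ?_ ?_
      · rw [show k + 1 + 1 = k + 2 by ring, pow_add]
        exact Ideal.mul_mem_mul hf (euler_sub_mem_one hg)
      · rw [pow_succ', pow_succ']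
        rw [← pow_succ']
        exact Ideal.mul_mem_mul hg (ih hf)
    | add x _ y _ hx hy =>
      rw [map_add, smul_add, add_sub_add_comm]
      exact add_mem hx hy

end Laurent

/-! ### Modules for the current algebra of vector fields -/

/-- The element of `m₁ ℤ ⊕ … ⊕ mₙ ℤ` with coordinates `a`. -/
def scaleLat {n : ℕ} (m : Fin n → ℕ) (a : Fin n → ℤ) : Fin n → ℤ := fun i => m i * a i

lemma scaleLat_add {n : ℕ} (m : Fin n → ℕ) (a c : Fin n → ℤ) :
    scaleLat m (a + c) = scaleLat m a + scaleLat m c := by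
  funext i; simp [scaleLat, mul_add]

lemma scaleLat_zero {n : ℕ} (m : Fin n → ℕ) : scaleLat m 0 = 0 := by
  funext i; simp [scaleLat]

lemma scaleLat_neg {n : ℕ} (m : Fin n → ℕ) (a : Fin n → ℤ) : scaleLat m (-a) = -scaleLat m a := by
  funext i; simp [scaleLat]

/-- An irreducible graded module for the semidirect product of vector fields `D a u` on a torus with
the Laurent polynomials `t a` and a current algebra `x l X`. The coordinates `a` describe the
lattice `m₁ ℤ ⊕ … ⊕ mₙ ℤ`. -/
structure CurrentRep (n : ℕ) (G : Type*) [LieRing G] [LieAlgebra ℂ G] (T : Type*) [AddCommGroup T]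
    [Module ℂ T] where
  m : Fin n → ℕ
  m_pos : ∀ i, 0 < m i
  gr : (Fin n → ℤ) → Submodule ℂ G
  gr_add : ∀ l a, gr (l + scaleLat m a) = gr l
  lie_mem : ∀ l k X Y, X ∈ gr l → Y ∈ gr k → ⁅X, Y⁆ ∈ gr (l + k)
  α : Fin n → ℂ
  Tk : (Fin n → ℤ) → Submodule ℂ T
  finite : ∀ k, FiniteDimensional ℂ (Tk k)
  indep : iSupIndep Tk
  iSup_eq : ⨆ k, Tk k = ⊤
  t : (Fin n → ℤ) → Module.End ℂ T
  D : (Fin n → ℤ) → (Fin n → ℂ) →ₗ[ℂ] Module.End ℂ T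
  x : (Fin n → ℤ) → G → Module.End ℂ T
  t_mem : ∀ a, HasDegree Tk (t a) (scaleLat m a)
  D_mem : ∀ a u, HasDegree Tk (D a u) (scaleLat m a)
  x_mem : ∀ l, ∀ X ∈ gr l, HasDegree Tk (x l X) l
  t_zero : t 0 = 1
  t_add : ∀ a c, t (a + c) = t a * t c
  D_zero : ∀ k, ∀ v ∈ Tk k, ∀ u, D 0 u v = (∑ i, u i * ((k i + α i) / m i)) • v
  x_add : ∀ l, ∀ X ∈ gr l, ∀ Y ∈ gr l, x l (X + Y) = x l X + x l Y
  x_smul : ∀ l (c : ℂ), ∀ X ∈ gr l, x l (c • X) = c • x l X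
  D_t : ∀ a u c, D a u * t c = t c * D a u + (∑ i, u i * c i) • t (a + c)
  D_D : ∀ a u c v, D a u * D c v = D c v * D a u +
    D (a + c) ((∑ i, u i * c i) • v - (∑ i, v i * a i) • u)
  D_x : ∀ a u l, ∀ X ∈ gr l,
    D a u * x l X = x l X * D a u + (∑ i, u i * (l i / m i)) • x (l + scaleLat m a) X
  x_t : ∀ l, ∀ X ∈ gr l, ∀ a, x l X * t a = t a * x l X
  x_x : ∀ l k, ∀ X ∈ gr l, ∀ Y ∈ gr k, x l X * x k Y = x k Y * x l X + x (l + k) ⁅X, Y⁆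
  eq_bot_or_eq_top : ∀ N : Submodule ℂ T, (∀ a, ∀ v ∈ N, t a v ∈ N) →
    (∀ a u, ∀ v ∈ N, D a u v ∈ N) → (∀ l, ∀ X ∈ gr l, ∀ v ∈ N, x l X v ∈ N) → N = ⊥ ∨ N = ⊤

namespace CurrentRep

variable {n : ℕ} {G : Type*} [LieRing G] [LieAlgebra ℂ G] {T : Type*} [AddCommGroup T]
  [Module ℂ T] (R : CurrentRep n G T)

lemma t_comm (a c : Fin n → ℤ) : R.t a * R.t c = R.t c * R.t a := by
  rw [← R.t_add, ← R.t_add, add_comm]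

lemma t_neg_mul (a : Fin n → ℤ) : R.t (-a) * R.t a = 1 := by
  rw [← R.t_add, neg_add_cancel, R.t_zero]

lemma t_mul_neg (a : Fin n → ℤ) : R.t a * R.t (-a) = 1 := by
  rw [← R.t_add, add_neg_cancel, R.t_zero]

lemma mem_gr_add {l : Fin n → ℤ} {X : G} (hX : X ∈ R.gr l) (a : Fin n → ℤ) :
    X ∈ R.gr (l + scaleLat R.m a) := by rwa [R.gr_add]

/-- The operators `T^a ↦ t^(-a) D(u, a)`. -/
noncomputable def jetD (u : Fin n → ℂ) : Laurent n →ₗ[ℂ] Module.End ℂ T :=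
  onMono fun a => R.t (-a) * R.D a u

/-- The operators `T^a ↦ t^(-a) X(l + a)`. -/
noncomputable def jetX (l : Fin n → ℤ) (X : G) : Laurent n →ₗ[ℂ] Module.End ℂ T :=
  onMono fun a => R.t (-a) * R.x (l + scaleLat R.m a) X

@[simp] lemma jetD_mono (u : Fin n → ℂ) (a : Fin n → ℤ) :
    R.jetD u (mono a) = R.t (-a) * R.D a u := onMono_mono _ _

@[simp] lemma jetX_mono (l : Fin n → ℤ) (X : G) (a : Fin n → ℤ) :
    R.jetX l X (mono a) = R.t (-a) * R.x (l + scaleLat R.m a) X := onMono_mono _ _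

lemma jetD_one (u : Fin n → ℂ) : R.jetD u 1 = R.D 0 u := by
  rw [← mono_zero, jetD_mono, neg_zero, R.t_zero, one_mul]

lemma jetX_one (l : Fin n → ℤ) (X : G) : R.jetX l X 1 = R.x l X := by
  rw [← mono_zero, jetX_mono, neg_zero, R.t_zero, one_mul, scaleLat_zero, add_zero]

lemma jetD_hasDegree (u : Fin n → ℂ) (f : Laurent n) : HasDegree R.Tk (R.jetD u f) 0 := by
  induction f using laurent_induction with
  | add f g hf hg => rw [map_add]; exact hf.add hg
  | smul r f hf => rw [map_smul]; exact hf.smul r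
  | mon a =>
    rw [jetD_mono]
    have := (R.t_mem (-a)).mul (R.D_mem a u)
    rwa [scaleLat_neg, neg_add_cancel] at this

lemma jetX_hasDegree (l : Fin n → ℤ) {X : G} (hX : X ∈ R.gr l) (f : Laurent n) :
    HasDegree R.Tk (R.jetX l X f) l := by
  induction f using laurent_induction with
  | add f g hf hg => rw [map_add]; exact hf.add hg
  | smul r f hf => rw [map_smul]; exact hf.smul r
  | mon a =>
    rw [jetX_mono]
    have := (R.t_mem (-a)).mul (R.x_mem _ X (R.mem_gr_add hX a))
    rwa [scaleLat_neg, neg_add_eq_sub, add_sub_cancel_right] at this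

lemma jetD_t (u : Fin n → ℂ) (f : Laurent n) (c : Fin n → ℤ) :
    R.jetD u f * R.t c = R.t c * R.jetD u f + (aug n f * ∑ i, u i * c i) • R.t c := by
  induction f using laurent_induction with
  | add f g hf hg => simp only [map_add, add_mul, mul_add, hf, hg, add_smul]; abel
  | smul r f hf =>
    simp only [map_smul, smul_mul_assoc, mul_smul_comm, hf, smul_add, smul_smul, smul_eq_mul,
      mul_assoc]
  | mon a =>
    rw [jetD_mono, mul_assoc, R.D_t, mul_add, mul_smul_comm, ← R.t_add, neg_add_cancel_left, ← mul_assoc,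
      R.t_comm, mul_assoc, aug_mono, one_mul]

lemma jetX_t (l : Fin n → ℤ) {X : G} (hX : X ∈ R.gr l) (f : Laurent n) (c : Fin n → ℤ) :
    R.jetX l X f * R.t c = R.t c * R.jetX l X f := by
  induction f using laurent_induction with
  | add f g hf hg => simp only [map_add, add_mul, mul_add, hf, hg]
  | smul r f hf => simp only [map_smul, smul_mul_assoc, mul_smul_comm, hf]
  | mon a =>
    rw [jetX_mono, mul_assoc, R.x_t _ _ (R.mem_gr_add hX a), ← mul_assoc, R.t_comm, mul_assoc]

lemma jetD_jetD (u v : Fin n → ℂ) (f g : Laurent n) :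
    R.jetD u f * R.jetD v g = R.jetD v g * R.jetD u f + R.jetD v (f * dLog u g) -
      R.jetD u (g * dLog v f) - aug n f • R.jetD v (dLog u g) + aug n g • R.jetD u (dLog v f) := by
  induction f using laurent_induction with
  | add f f' h h' =>
    simp only [map_add, add_mul, mul_add, h, h', add_smul, smul_add]; abel
  | smul r f h =>
    simp only [map_smul, smul_mul_assoc, mul_smul_comm, h, smul_eq_mul]
    module
  | mon a =>
    induction g using laurent_induction with
    | add f f' h h' =>
      simp only [map_add, add_mul, mul_add, h, h', add_smul, smul_add]; abel
    | smul r f h =>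
      simp only [map_smul, smul_mul_assoc, mul_smul_comm, h, smul_eq_mul]
      module
    | mon c =>
      have key : ∀ (u v : Fin n → ℂ) (a c : Fin n → ℤ), R.t (-a) * R.D a u * (R.t (-c) * R.D c v) =
          R.t (-(a + c)) * (R.D a u * R.D c v) - (∑ i, u i * c i) • (R.t (-c) * R.D c v) := by
        intro u v a c
        have e1 : (∑ i, u i * ((-c) i : ℤ)) = -∑ i, u i * c i := by
          rw [← Finset.sum_neg_distrib]
          refine Finset.sum_congr rfl fun i _ => ?_
          push_cast [Pi.neg_apply]
          ring
        rw [mul_assoc, ← mul_assoc (R.D a u), R.D_t, e1, add_mul, mul_add, smul_mul_assoc,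
          mul_smul_comm, ← mul_assoc (R.t (-a)) (R.t (a + -c)), ← R.t_add, neg_add_cancel_left,
          neg_add, R.t_add]
        simp only [mul_assoc]
        module
      simp only [jetD_mono, dLog_mono, aug_mono, one_smul, map_smul, mul_smul_comm, ← mono_add]
      rw [key u v a c, key v u c a, R.D_D, mul_add, map_sub, map_smul, map_smul, mul_sub,
        mul_smul_comm, mul_smul_comm, add_comm c a]
      abel

lemma jetD_jetX (u : Fin n → ℂ) (l : Fin n → ℤ) {X : G} (hX : X ∈ R.gr l) (f g : Laurent n) :
    R.jetD u f * R.jetX l X g = R.jetX l X g * R.jetD u f +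
      R.jetX l X (f * (dLog u g + (∑ i, u i * (l i / R.m i)) • g)) -
      aug n f • R.jetX l X (dLog u g) := by
  induction f using laurent_induction with
  | add f f' h h' =>
    simp only [map_add, add_mul, mul_add, h, h', add_smul, smul_add]; abel
  | smul r f h =>
    simp only [map_smul, smul_mul_assoc, mul_smul_comm, h, smul_eq_mul]
    module
  | mon a =>
    induction g using laurent_induction with
    | add f f' h h' =>
      simp only [map_add, add_mul, mul_add, h, h', add_smul, smul_add]; abel
    | smul r f h =>
      simp only [map_add, map_smul, smul_mul_assoc, mul_smul_comm, h, smul_eq_mul, mul_add]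
      module
    | mon c =>
      have e1 : (∑ i, u i * ((-c) i : ℤ)) = -∑ i, u i * c i := by
        rw [← Finset.sum_neg_distrib]
        refine Finset.sum_congr rfl fun i _ => ?_
        push_cast [Pi.neg_apply]
        ring
      have e2 : (∑ i, u i * (((l + scaleLat R.m c) i : ℤ) / R.m i)) =
          (∑ i, u i * c i) + ∑ i, u i * (l i / R.m i) := by
        rw [← Finset.sum_add_distrib]
        refine Finset.sum_congr rfl fun i _ => ?_
        have : (R.m i : ℂ) ≠ 0 := by exact_mod_cast (R.m_pos i).ne'
        simp only [Pi.add_apply, scaleLat]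
        push_cast
        field_simp
        ring
      have hXc := R.mem_gr_add hX c
      simp only [jetD_mono, jetX_mono, dLog_mono, aug_mono, one_smul, map_smul, mul_smul_comm,
        ← mono_add, map_add, mul_add]
      rw [mul_assoc (R.t (-a)), ← mul_assoc (R.D a u), R.D_t, e1, add_mul, mul_assoc, R.D_x _ _ _ _ hXc,
        e2, ← mul_assoc (R.t (-c) * _), mul_assoc (R.t (-c)), R.x_t _ _ hXc, smul_mul_assoc, mul_add,
        mul_add, mul_add, mul_smul_comm, mul_smul_comm, mul_smul_comm, ← mul_assoc (R.t (-a)) (R.t (a + -c)),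
        ← R.t_add, neg_add_cancel_left, add_assoc l, ← scaleLat_add, add_comm c a, neg_add, R.t_add]
      simp only [mul_assoc]
      rw [← mul_assoc (R.t (-c)) (R.t (-a)), R.t_comm, mul_assoc]
      module

lemma jetX_jetX (l k : Fin n → ℤ) {X Y : G} (hX : X ∈ R.gr l) (hY : Y ∈ R.gr k) (f g : Laurent n) :
    R.jetX l X f * R.jetX k Y g = R.jetX k Y g * R.jetX l X f + R.jetX (l + k) ⁅X, Y⁆ (f * g) := by
  induction f using laurent_induction with
  | add f f' h h' => simp only [map_add, add_mul, mul_add, h, h']; abel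
  | smul r f h => simp only [map_smul, smul_mul_assoc, mul_smul_comm, h, smul_add]
  | mon a =>
    induction g using laurent_induction with
    | add f f' h h' => simp only [map_add, add_mul, mul_add, h, h']; abel
    | smul r f h => simp only [map_smul, smul_mul_assoc, mul_smul_comm, h, smul_add]
    | mon c =>
      have hXa := R.mem_gr_add hX a
      have hYc := R.mem_gr_add hY c
      rw [← mono_add]
      simp only [jetX_mono]
      rw [mul_assoc (R.t (-a)), ← mul_assoc (R.x _ X), R.x_t _ _ hXa, mul_assoc, R.x_x _ _ _ hXa _ hYc,
        mul_assoc (R.t (-c)), ← mul_assoc (R.x _ Y) (R.t (-a)), R.x_t _ _ hYc, scaleLat_add, neg_add,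
        R.t_add, mul_add, mul_add, add_add_add_comm l k]
      simp only [mul_assoc]
      rw [← mul_assoc (R.t (-a)), R.t_comm, mul_assoc]

end CurrentRep

/-! ### Vanishing of higher jets -/

section Jets

/-- A finite-dimensional endomorphism algebra has only finitely many adjoint eigenvalues. -/
lemma exists_forall_ad_eigen_eq_zero {W : Type*} [AddCommGroup W] [Module ℂ W]
    [FiniteDimensional ℂ W] (E : Module.End ℂ W) :
    ∃ K : ℕ, ∀ k : ℕ, K ≤ k → ∀ A : Module.End ℂ W, E * A - A * E = (k : ℂ) • A → A = 0 := by
  let F : Module.End ℂ (Module.End ℂ W) := LinearMap.mulLeft ℂ E - LinearMap.mulRight ℂ E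
  have hfin : Set.Finite {k : ℕ | F.HasEigenvalue (k : ℂ)} :=
    Set.Finite.preimage (Nat.cast_injective.injOn) (Module.End.finite_hasEigenvalue F)
  obtain ⟨K, hK⟩ := hfin.bddAbove
  refine ⟨K + 1, fun k hk A hA => ?_⟩
  by_contra h0
  have : k ∈ {k : ℕ | F.HasEigenvalue (k : ℂ)} := by
    refine Module.End.hasEigenvalue_of_hasEigenvector (x := A) ⟨?_, h0⟩
    rw [Module.End.mem_eigenspace_iff]
    simpa [F] using hA
  have := hK this
  omega

variable {n : ℕ}

lemma sub_aug_mem (f : Laurent n) : f - aug n f • 1 ∈ augIdeal n := by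
  induction f using laurent_induction with
  | add f g hf hg =>
    rw [map_add, add_smul, add_sub_add_comm]
    exact add_mem hf hg
  | smul r f hf =>
    rw [map_smul, smul_assoc, ← smul_sub]
    exact Submodule.smul_of_tower_mem _ _ hf
  | mon a => simpa using mono_sub_one_mem a

namespace CurrentRep

variable {G : Type*} [LieRing G] [LieAlgebra ℂ G] {T : Type*} [AddCommGroup T]
  [Module ℂ T] (R : CurrentRep n G T)

/-- The Euler operator. -/
noncomputable def E : Module.End ℂ T :=
  ∑ i, R.jetD (Pi.single i 1) (1 - mono (Pi.single i (-1)))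

lemma one_sub_mono_mem (i : Fin n) : (1 - mono (Pi.single i (-1)) : Laurent n) ∈ augIdeal n := by
  rw [← neg_sub]
  exact neg_mem (mono_sub_one_mem _)

lemma jetD_jetD_of_mem (u v : Fin n → ℂ) {f g : Laurent n} (hf : f ∈ augIdeal n)
    (hg : g ∈ augIdeal n) : R.jetD u f * R.jetD v g = R.jetD v g * R.jetD u f +
      R.jetD v (f * dLog u g) - R.jetD u (g * dLog v f) := by
  rw [R.jetD_jetD, aug_eq_zero hf, aug_eq_zero hg, zero_smul, zero_smul, sub_zero, add_zero]

lemma E_hasDegree : HasDegree R.Tk R.E 0 := fun k v hv => by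
  rw [E, LinearMap.sum_apply]
  exact sum_mem fun i _ => R.jetD_hasDegree _ _ _ _ hv

lemma E_t (c : Fin n → ℤ) : R.E * R.t c = R.t c * R.E := by
  rw [E, Finset.sum_mul, Finset.mul_sum]
  refine Finset.sum_congr rfl fun i _ => ?_
  rw [R.jetD_t, aug_eq_zero (one_sub_mono_mem i), zero_mul, zero_smul, add_zero]

lemma dLog_one_sub (i j : Fin n) : dLog (Pi.single j 1) (1 - mono (Pi.single i (-1)) : Laurent n) =
    if j = i then mono (Pi.single i (-1)) else 0 := by
  rw [map_sub, dLog_one, dLog_mono_single]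
  split_ifs <;> simp

lemma E_jetD (j : Fin n) {q : Laurent n} (hq : q ∈ augIdeal n) :
    R.E * R.jetD (Pi.single j 1) q = R.jetD (Pi.single j 1) q * R.E +
      R.jetD (Pi.single j 1) (euler n q - q * mono (Pi.single j (-1))) := by
  rw [E, Finset.sum_mul, Finset.mul_sum]
  simp_rw [R.jetD_jetD_of_mem _ _ (one_sub_mono_mem _) hq, dLog_one_sub]
  rw [Finset.sum_sub_distrib, Finset.sum_add_distrib, map_sub, euler_apply, map_sum, add_sub_assoc]
  congr 2
  rw [Finset.sum_eq_single j]
  · rw [if_pos rfl]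
  · intro i _ hij
    rw [if_neg hij.symm, mul_zero, map_zero]
  · simp

lemma E_jetX (l : Fin n → ℤ) {X : G} (hX : X ∈ R.gr l) (g : Laurent n) :
    R.E * R.jetX l X g = R.jetX l X g * R.E + R.jetX l X (euler n g +
      (∑ i, ((l i : ℂ) / R.m i) • (1 - mono (Pi.single i (-1)))) * g) := by
  rw [E, Finset.sum_mul, Finset.mul_sum]
  simp_rw [R.jetD_jetX _ _ hX, aug_eq_zero (one_sub_mono_mem _), zero_smul, sub_zero]
  rw [Finset.sum_add_distrib, ← map_sum, euler_apply, Finset.sum_mul, ← Finset.sum_add_distrib]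
  congr 2
  refine Finset.sum_congr rfl fun i _ => ?_
  rw [mul_add, mul_smul_comm, smul_mul_assoc]
  congr 2
  rw [Finset.sum_eq_single i]
  · simp
  · intro j _ hj
    simp [Pi.single_eq_of_ne hj]
  · simp

open scoped Pointwise in
lemma euler_mul_mono {j : Fin n} {k : ℕ} {p : Laurent n}
    (hp : p ∈ (Set.range coordX : Set (Laurent n)) ^ (k + 1)) :
    euler n (p * mono (Pi.single j (-1))) - p * mono (Pi.single j (-1)) * mono (Pi.single j (-1)) =
      (k : ℂ) • (p * mono (Pi.single j (-1))) := by
  rw [euler_mul, euler_mono_single, euler_of_mem_pow _ _ hp, mul_assoc p, ← mono_add, ← Pi.single_add]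
  have : (-1 : ℤ) - 1 = -1 + -1 := rfl
  rw [this, mul_smul_comm, mul_smul_comm, mul_comm (mono _) p, mul_sub]
  push_cast
  module

/-- The restriction of `jetD` to a graded piece vanishes on eigenvectors of large weight. -/
lemma exists_jetD_eq_zero (κ : Fin n → ℤ) :
    ∃ K : ℕ, ∀ k : ℕ, K ≤ k → ∀ j, ∀ q ∈ augIdeal n,
      euler n q - q * mono (Pi.single j (-1)) = (k : ℂ) • q →
      ∀ v ∈ R.Tk κ, R.jetD (Pi.single j 1) q v = 0 := by
  have := R.finite κ
  have hE : ∀ v ∈ R.Tk κ, R.E v ∈ R.Tk κ := fun v hv => by simpa using R.E_hasDegree κ v hv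
  obtain ⟨K, hK⟩ := exists_forall_ad_eigen_eq_zero (R.E.restrict hE)
  refine ⟨K, fun k hk j q hq hqk v hv => ?_⟩
  have hA : ∀ v ∈ R.Tk κ, R.jetD (Pi.single j 1) q v ∈ R.Tk κ := fun v hv => by
    simpa using R.jetD_hasDegree (Pi.single j 1) q κ v hv
  have h0 := hK k hk ((R.jetD (Pi.single j 1) q).restrict hA) (by
    ext w
    have := LinearMap.congr_fun (R.E_jetD j hq) (w : T)
    rw [hqk, map_smul] at this
    simp only [LinearMap.sub_apply, Module.End.mul_apply, LinearMap.smul_apply,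
      AddSubgroupClass.coe_sub, LinearMap.coe_restrict_apply, Submodule.coe_smul]
    rw [LinearMap.add_apply, Module.End.mul_apply, Module.End.mul_apply, LinearMap.smul_apply] at this
    rw [this, add_sub_cancel_left])
  have := congrArg Subtype.val (LinearMap.congr_fun h0 ⟨v, hv⟩)
  simpa using this

open scoped Pointwise in
/-- High jets vanish on each graded piece. -/
lemma exists_pow_jetD_single_eq_zero (κ : Fin n → ℤ) :
    ∃ K : ℕ, ∀ j, ∀ f ∈ augIdeal n ^ K, ∀ v ∈ R.Tk κ, R.jetD (Pi.single j 1) f v = 0 := by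
  obtain ⟨K, hK⟩ := R.exists_jetD_eq_zero κ
  have hp : ∀ k, K ≤ k → ∀ j, ∀ p ∈ (Set.range coordX : Set (Laurent n)) ^ (k + 1),
      ∀ v ∈ R.Tk κ, R.jetD (Pi.single j 1) (p * mono (Pi.single j (-1))) v = 0 :=
    fun k hk j p hp v hv => hK k hk j _ (Ideal.mul_mem_right _ _ (Ideal.pow_le_self
      (Nat.succ_ne_zero k) (mem_augIdeal_pow hp))) (euler_mul_mono hp) v hv
  have h2 : ∀ j, ∀ p ∈ (Set.range coordX : Set (Laurent n)) ^ (K + 1), ∀ f ∈ augIdeal n,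
      ∀ v ∈ R.Tk κ, R.jetD (Pi.single j 1) (p * f) v = 0 := by
    intro j p hp' f hf v hv
    set q := p * mono (Pi.single j (-1)) with hq
    have hqm : q ∈ augIdeal n :=
      Ideal.mul_mem_right _ _ (Ideal.pow_le_self (Nat.succ_ne_zero K) (mem_augIdeal_pow hp'))
    have hz1 : ∀ v ∈ R.Tk κ, R.jetD (Pi.single j 1) q v = 0 := hp K le_rfl j p hp'
    have hz2 : ∀ v ∈ R.Tk κ, R.jetD (Pi.single j 1) (coordX j * q) v = 0 := by
      intro v hv
      have := hp (K + 1) (Nat.le_succ K) j (p * coordX j)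
        (by rw [pow_succ]; exact Set.mul_mem_mul hp' ⟨j, rfl⟩) v hv
      rwa [show coordX j * q = p * coordX j * mono (Pi.single j (-1)) by rw [hq]; ring]
    have hst : ∀ g, ∀ v ∈ R.Tk κ, R.jetD (Pi.single j 1) g v ∈ R.Tk κ := fun g v hv => by
      simpa using R.jetD_hasDegree (Pi.single j 1) g κ v hv
    have e1 := LinearMap.congr_fun (R.jetD_jetD_of_mem (Pi.single j 1) (Pi.single j 1)
      (Ideal.mul_mem_left _ (coordX j) hqm) hf) v
    have e2 := LinearMap.congr_fun (R.jetD_jetD_of_mem (Pi.single j 1) (Pi.single j 1)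
      hqm (Ideal.mul_mem_left _ (coordX j) hf)) v
    simp only [LinearMap.add_apply, LinearMap.sub_apply, Module.End.mul_apply] at e1 e2
    rw [hz2 _ (hst _ v hv), hz2 v hv, map_zero, zero_add] at e1
    rw [hz1 _ (hst _ v hv), hz1 v hv, map_zero, zero_add] at e2
    rw [eq_comm, sub_eq_zero, ← sub_eq_zero, ← LinearMap.sub_apply, ← map_sub] at e1 e2
    have e3 := congrArg₂ (· - ·) e1 e2
    simp only [← LinearMap.sub_apply, ← map_sub, sub_zero] at e3
    have hT : mono (Pi.single j (-1)) * mono (Pi.single j 1) = (1 : Laurent n) := by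
      rw [← mono_add, ← Pi.single_add]; simp [mono_zero]
    have e4 : coordX j * q * dLog (Pi.single j 1) f - f * dLog (Pi.single j 1) (coordX j * q) -
        (q * dLog (Pi.single j 1) (coordX j * f) - coordX j * f * dLog (Pi.single j 1) q) =
        (-2 : ℂ) • (p * f) := by
      rw [dLog_mul (f := coordX j) (g := q), dLog_mul (f := coordX j) (g := f), dLog_coordX, if_pos rfl, hq]
      have : (-2 : ℂ) • (p * f) = -2 * (p * f) := by
        rw [neg_smul, two_smul]; ring
      rw [this]
      linear_combination (-2 * p * f) * hT
    rw [e4, map_smul, LinearMap.smul_apply] at e3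
    exact (smul_eq_zero.mp e3).resolve_left (by norm_num)
  refine ⟨K + 1 + 1, fun j f hf v hv => ?_⟩
  rw [pow_succ, augIdeal_pow_eq] at hf
  induction hf using Submodule.mul_induction_on' with
  | mem_mul_mem a ha f hf =>
    induction ha using Submodule.span_induction generalizing f with
    | mem x hx => exact h2 j x hx f hf v hv
    | zero => simp
    | add x y _ _ hx hy =>
      rw [add_mul, map_add, LinearMap.add_apply, hx f hf, hy f hf, add_zero]
    | smul a x _ hx =>
      rw [smul_eq_mul, mul_comm a, mul_assoc]
      exact hx _ (Ideal.mul_mem_left _ _ hf)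
  | add x _ y _ hx hy => rw [map_add, LinearMap.add_apply, hx, hy, add_zero]

lemma jetD_eq_sum (u : Fin n → ℂ) (f : Laurent n) :
    R.jetD u f = ∑ j, u j • R.jetD (Pi.single j 1) f := by
  induction f using laurent_induction with
  | add f g hf hg => simp only [map_add, hf, hg, smul_add, Finset.sum_add_distrib]
  | smul r f hf => 
    simp only [map_smul, hf, Finset.smul_sum]
    exact Finset.sum_congr rfl fun i _ => smul_comm _ _ _
  | mon a =>
    simp only [jetD_mono]
    have : u = ∑ j, u j • (Pi.single j 1 : Fin n → ℂ) := by
      funext i; simp [Finset.sum_apply, Pi.single_apply]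
    conv_lhs => rw [this]
    rw [map_sum, Finset.mul_sum]
    simp only [map_smul, mul_smul_comm]

lemma exists_pow_jetX_eq_zero (hn : 0 < n) (l : Fin n → ℤ) {X : G} (hX : X ∈ R.gr l)
    (κ : Fin n → ℤ) :
    ∃ K : ℕ, ∀ f ∈ augIdeal n ^ K, ∀ v ∈ R.Tk κ, R.jetX l X f v = 0 := by
  obtain ⟨K₁, h1⟩ := R.exists_pow_jetD_single_eq_zero κ
  obtain ⟨K₂, h2⟩ := R.exists_pow_jetD_single_eq_zero (κ + l)
  let j : Fin n := ⟨0, hn⟩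
  obtain ⟨c, hc⟩ : ∃ c : ℤ, (c : ℂ) + (l j : ℂ) / R.m j ≠ 0 := by
    by_cases h : (l j : ℂ) / R.m j = 0
    · exact ⟨1, by rw [h]; norm_num⟩
    · exact ⟨0, by simpa using h⟩
  refine ⟨K₁ + K₂ + 1, fun f hf v hv => ?_⟩
  set f' := f * mono (Pi.single j (-c)) with hf'
  have hfm : ∀ K, K ≤ K₁ + K₂ + 1 → f' ∈ augIdeal n ^ K := fun K hK =>
    Ideal.mul_mem_right _ _ (Ideal.pow_le_pow_right hK hf)
  have e := LinearMap.congr_fun (R.jetD_jetX (Pi.single j 1) l hX f' (mono (Pi.single j c))) v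
  have hm : f' ∈ augIdeal n := by simpa using hfm 1 (by omega)
  rw [aug_eq_zero hm, zero_smul, sub_zero, LinearMap.add_apply,
    Module.End.mul_apply, Module.End.mul_apply, h1 j f' (hfm _ (by omega)) v hv, map_zero, zero_add,
    h2 j f' (hfm _ (by omega)) _ (R.jetX_hasDegree l hX _ κ v hv), dLog_mono_single, if_pos rfl,
    ← add_smul, mul_smul_comm, map_smul, LinearMap.smul_apply, hf', mul_assoc, ← mono_add,
    ← Pi.single_add, neg_add_cancel, Pi.single_zero, mono_zero, mul_one] at e
  refine (smul_eq_zero.mp e.symm).resolve_left ?_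
  convert hc using 2
  rw [Finset.sum_eq_single j]
  · simp
  · intro i _ hi
    simp [Pi.single_eq_of_ne hi]
  · simp

lemma mem_of_hasEigen_scale {κ a : Fin n → ℤ} {v : T} {ε : ℂ} (hv : v ∈ R.Tk κ) (h0 : v ≠ 0)
    (he : R.E v = ε • v) : R.t a v ∈ R.Tk (κ + scaleLat R.m a) ∧ R.t a v ≠ 0 ∧
      R.E (R.t a v) = ε • R.t a v := by
  refine ⟨R.t_mem a κ v hv, fun h => h0 ?_, ?_⟩
  · have := LinearMap.congr_fun (R.t_neg_mul a) v
    rw [Module.End.mul_apply, h, map_zero] at this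
    exact this.symm
  · have := LinearMap.congr_fun (R.E_t a) v
    rw [Module.End.mul_apply, Module.End.mul_apply, he, map_smul] at this
    exact this

/-- A homogeneous eigenvector of the Euler operator with eigenvalue of maximal real part. -/
lemma exists_max_eigenvector [Nontrivial T] : ∃ (ε : ℂ) (κ : Fin n → ℤ) (w : T), w ∈ R.Tk κ ∧ w ≠ 0 ∧
    R.E w = ε • w ∧ ∀ (ε' : ℂ) (κ' : Fin n → ℤ), ε.re < ε'.re → ∀ v ∈ R.Tk κ', R.E v = ε' • v →
      v = 0 := by
  classical
  have hE : ∀ κ, ∀ v ∈ R.Tk κ, R.E v ∈ R.Tk κ := fun κ v hv => by simpa using R.E_hasDegree κ v hv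
  let box : Finset (Fin n → ℤ) := Fintype.piFinset fun i => Finset.Ico 0 (R.m i : ℤ)
  let ev : (Fin n → ℤ) → Set ℂ := fun κ => {ε | ∃ v ∈ R.Tk κ, v ≠ 0 ∧ R.E v = ε • v}
  have hfin : ∀ κ, (ev κ).Finite := by
    intro κ
    have := R.finite κ
    refine (Module.End.finite_hasEigenvalue (R.E.restrict (hE κ))).subset ?_
    rintro ε ⟨v, hv, h0, he⟩
    refine Module.End.hasEigenvalue_of_hasEigenvector (x := ⟨v, hv⟩) ⟨?_, ?_⟩
    · rw [Module.End.mem_eigenspace_iff]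
      exact Subtype.ext he
    · intro h
      exact h0 (congrArg Subtype.val h)
  have hbox : ∀ κ, ∃ κ' ∈ box, ev κ ⊆ ev κ' := by
    intro κ
    refine ⟨fun i => κ i % R.m i, ?_, ?_⟩
    · rw [Fintype.mem_piFinset]
      intro i
      have := R.m_pos i
      rw [Finset.mem_Ico]
      exact ⟨Int.emod_nonneg _ (by omega), Int.emod_lt_of_pos _ (by exact_mod_cast this)⟩
    · rintro ε ⟨v, hv, h0, he⟩
      obtain ⟨h1, h2, h3⟩ := R.mem_of_hasEigen_scale (a := fun i => -(κ i / R.m i)) hv h0 he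
      refine ⟨_, ?_, h2, h3⟩
      convert h1 using 2
      funext i
      have := Int.emod_add_mul_ediv (κ i) (R.m i)
      simp only [Pi.add_apply, scaleLat]
      linarith
  have hSfin : (⋃ κ ∈ box, ev κ).Finite := Set.Finite.biUnion box.finite_toSet fun κ _ => hfin κ
  have hne : (⋃ κ ∈ box, ev κ).Nonempty := by
    obtain ⟨κ, hκ⟩ : ∃ κ, R.Tk κ ≠ ⊥ := by
      by_contra! h
      have := R.iSup_eq
      simp only [h, iSup_bot] at this
      exact bot_ne_top this
    have := R.finite κ
    have := Submodule.nontrivial_iff_ne_bot.mpr hκ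
    obtain ⟨ε, hε⟩ := Module.End.exists_eigenvalue (R.E.restrict (hE κ))
    obtain ⟨v, hv⟩ := hε.exists_hasEigenvector
    obtain ⟨κ', hκ', hs⟩ := hbox κ
    refine ⟨ε, Set.mem_biUnion hκ' (hs ⟨v, v.2, ?_, ?_⟩)⟩
    · intro h
      exact hv.2 (Subtype.ext h)
    · exact congrArg Subtype.val hv.apply_eq_smul
  obtain ⟨ε, hε, hmax⟩ := Set.exists_max_image _ Complex.re hSfin hne
  obtain ⟨κ, hκ, w, hw, hw0, hwe⟩ := Set.mem_iUnion₂.mp hε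
  refine ⟨ε, κ, w, hw, hw0, hwe, fun ε' κ' hlt v hv he => ?_⟩
  by_contra h0
  obtain ⟨κ'', hκ'', hs⟩ := hbox κ'
  have := hmax ε' (Set.mem_biUnion hκ'' (hs ⟨v, hv, h0, he⟩))
  exact absurd hlt (not_lt.mpr this)

/-- A nonzero vector killed by all higher jets. -/
lemma exists_ne_zero_jet_eq_zero [Nontrivial T] (hn : 0 < n) : ∃ w : T, w ≠ 0 ∧
    (∀ j, ∀ f ∈ augIdeal n ^ 2, R.jetD (Pi.single j 1) f w = 0) ∧
    ∀ l, ∀ X ∈ R.gr l, ∀ f ∈ augIdeal n, R.jetX l X f w = 0 := by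
  obtain ⟨ε, κ, w, hw, hw0, hwe, hmax⟩ := R.exists_max_eigenvector
  have hsucc : ∀ (k : ℕ) (f : Laurent n), f ∈ augIdeal n ^ k → ∀ h ∈ augIdeal n,
      h * f ∈ augIdeal n ^ (k + 1) := fun k f hf h hh => by
    rw [pow_succ']; exact Ideal.mul_mem_mul hh hf
  refine ⟨w, hw0, fun j => ?_, fun l X hX => ?_⟩
  · obtain ⟨K, hK⟩ := R.exists_pow_jetD_single_eq_zero κ
    have key : ∀ d : ℕ, ∀ k, 2 ≤ k → K ≤ k + d → ∀ f ∈ augIdeal n ^ k,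
        R.jetD (Pi.single j 1) f w = 0 := by
      intro d
      induction d with
      | zero => exact fun k _ hk f hf => hK j f (Ideal.pow_le_pow_right hk hf) w hw
      | succ d ih =>
        intro k hk2 hk f hf
        have hfm : f ∈ augIdeal n := Ideal.pow_le_self (by omega) hf
        have h1 := ih (k + 1) (by omega) (by omega) _ (euler_sub_mem k hf)
        have h2 := ih (k + 1) (by omega) (by omega) _
          (hsucc k f hf _ (mono_sub_one_mem (Pi.single j (-1))))
        have e := LinearMap.congr_fun (R.E_jetD j hfm) w
        rw [LinearMap.add_apply, Module.End.mul_apply, Module.End.mul_apply, hwe, map_smul] at e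
        have e3 : euler n f - f * mono (Pi.single j (-1)) = (euler n f - (k : ℂ) • f) -
            (mono (Pi.single j (-1)) - 1) * f + ((k : ℂ) - 1) • f := by
          rw [sub_smul, one_smul]; ring
        rw [e3, map_add, map_sub, LinearMap.add_apply, LinearMap.sub_apply, h1, h2, sub_zero,
          zero_add, map_smul, LinearMap.smul_apply, ← add_smul] at e
        refine hmax _ κ ?_ _ (by simpa using R.jetD_hasDegree (Pi.single j 1) f κ w hw) e
        have : (2 : ℝ) ≤ k := by exact_mod_cast hk2
        simp
        linarith
    intro f hf
    exact key K 2 le_rfl (by omega) f hf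
  · obtain ⟨K, hK⟩ := R.exists_pow_jetX_eq_zero hn l hX κ
    have key : ∀ d : ℕ, ∀ k, 1 ≤ k → K ≤ k + d → ∀ f ∈ augIdeal n ^ k, R.jetX l X f w = 0 := by
      intro d
      induction d with
      | zero => exact fun k _ hk f hf => hK f (Ideal.pow_le_pow_right hk hf) w hw
      | succ d ih =>
        intro k hk1 hk f hf
        have h1 := ih (k + 1) (by omega) (by omega) _ (euler_sub_mem k hf)
        have h2 := ih (k + 1) (by omega) (by omega) _ (hsucc k f hf
          (∑ i, ((l i : ℂ) / R.m i) • (1 - mono (Pi.single i (-1))))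
          (sum_mem fun i _ => Submodule.smul_of_tower_mem _ _ (one_sub_mono_mem i)))
        have e := LinearMap.congr_fun (R.E_jetX l hX f) w
        rw [LinearMap.add_apply, Module.End.mul_apply, Module.End.mul_apply, hwe, map_smul] at e
        rw [map_add, LinearMap.add_apply, h2, add_zero,
          show euler n f = (euler n f - (k : ℂ) • f) + (k : ℂ) • f by ring, map_add,
          LinearMap.add_apply, h1, zero_add, map_smul, LinearMap.smul_apply, ← add_smul] at e
        refine hmax _ (κ + l) ?_ _ (R.jetX_hasDegree l hX f κ w hw) e
        have : (1 : ℝ) ≤ k := by exact_mod_cast hk1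
        simp
        linarith
    intro f hf
    exact key K 1 le_rfl (by omega) f (by simpa using hf)

/-- All jets of order at least two of vector fields and of order at least one of currents vanish. -/
lemma jet_eq_zero [Nontrivial T] (hn : 0 < n) :
    (∀ u, ∀ f ∈ augIdeal n ^ 2, R.jetD u f = 0) ∧
    ∀ l, ∀ X ∈ R.gr l, ∀ f ∈ augIdeal n, R.jetX l X f = 0 := by
  obtain ⟨w, hw0, hw1, hw2⟩ := R.exists_ne_zero_jet_eq_zero hn
  let N : Submodule ℂ T :=
    { carrier := {v | (∀ u, ∀ f ∈ augIdeal n ^ 2, R.jetD u f v = 0) ∧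
        ∀ l, ∀ X ∈ R.gr l, ∀ f ∈ augIdeal n, R.jetX l X f v = 0}
      zero_mem' := ⟨fun u f _ => map_zero _, fun l X _ f _ => map_zero _⟩
      add_mem' := fun ha hb => ⟨fun u f hf => by rw [map_add, ha.1 u f hf, hb.1 u f hf, add_zero],
        fun l X hX f hf => by rw [map_add, ha.2 l X hX f hf, hb.2 l X hX f hf, add_zero]⟩
      smul_mem' := fun c v hv => ⟨fun u f hf => by rw [map_smul, hv.1 u f hf, smul_zero],
        fun l X hX f hf => by rw [map_smul, hv.2 l X hX f hf, smul_zero]⟩ }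
  have ht : ∀ a, ∀ v ∈ N, R.t a v ∈ N := by
    intro a v hv
    refine ⟨fun u f hf => ?_, fun l X hX f hf => ?_⟩
    · have := LinearMap.congr_fun (R.jetD_t u f a) v
      rw [aug_eq_zero (augIdeal_sq_le hf), zero_mul, zero_smul, add_zero, Module.End.mul_apply,
        Module.End.mul_apply, hv.1 u f hf, map_zero] at this
      exact this
    · have := LinearMap.congr_fun (R.jetX_t l hX f a) v
      rw [Module.End.mul_apply, Module.End.mul_apply, hv.2 l X hX f hf, map_zero] at this
      exact this
  have hD : ∀ u h, ∀ v ∈ N, R.jetD u h v ∈ N := by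
    intro u h v hv
    refine ⟨fun u' f hf => ?_, fun l X hX f hf => ?_⟩
    · have hfm := augIdeal_sq_le hf
      have := R.jetD_jetD u' u f h
      rw [aug_eq_zero hfm, zero_smul, sub_zero] at this
      have e : R.jetD u' (h * dLog u f) = R.jetD u' ((h - aug n h • 1) * dLog u f) +
          aug n h • R.jetD u' (dLog u f) := by
        rw [← map_smul, ← map_add]
        congr 1
        rw [sub_mul, smul_mul_assoc, one_mul, sub_add_cancel]
      rw [e, add_sub_assoc, add_assoc, sub_add_eq_add_sub, add_sub_add_right_eq_sub] at this
      have := LinearMap.congr_fun this v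
      rw [Module.End.mul_apply, LinearMap.add_apply, Module.End.mul_apply, hv.1 u' f hf, map_zero,
        zero_add, LinearMap.sub_apply, hv.1 u _ (Ideal.mul_mem_right _ _ hf), hv.1 u', sub_zero] at this
      · exact this
      · rw [pow_two]
        exact Ideal.mul_mem_mul (sub_aug_mem h) (dLog_mem hf)
    · have := R.jetD_jetX u l hX h f
      have e : aug n h • R.jetX l X (dLog u f) = R.jetX l X (aug n h • dLog u f) := by rw [map_smul]
      have e2 : h * (dLog u f + (∑ i, u i * (l i / R.m i)) • f) - aug n h • dLog u f =
          (h - aug n h • 1) * dLog u f + h * ((∑ i, u i * (l i / R.m i)) • f) := by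
        rw [sub_mul, smul_mul_assoc, one_mul]; ring
      rw [e, add_sub_assoc, ← map_sub, e2] at this
      have := LinearMap.congr_fun this v
      rw [Module.End.mul_apply, LinearMap.add_apply, Module.End.mul_apply, hv.2 l X hX f hf, map_zero,
        hv.2 l X hX _ (add_mem (Ideal.mul_mem_right _ _ (sub_aug_mem h)) (Ideal.mul_mem_left _ _
          (Submodule.smul_of_tower_mem _ _ hf))), add_zero] at this
      exact this.symm
  have hx : ∀ k, ∀ Y ∈ R.gr k, ∀ v ∈ N, R.x k Y v ∈ N := by
    intro k Y hY v hv
    rw [← R.jetX_one]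
    refine ⟨fun u f hf => ?_, fun l X hX f hf => ?_⟩
    · have hfm := augIdeal_sq_le hf
      have := R.jetD_jetX u k hY f 1
      rw [aug_eq_zero hfm, zero_smul, sub_zero] at this
      have := LinearMap.congr_fun this v
      rw [Module.End.mul_apply, LinearMap.add_apply, Module.End.mul_apply, hv.1 u f hf, map_zero,
        zero_add, hv.2 k Y hY _ (Ideal.mul_mem_right _ _ hfm)] at this
      exact this
    · have := LinearMap.congr_fun (R.jetX_jetX l k hX hY f 1) v
      rw [Module.End.mul_apply, LinearMap.add_apply, Module.End.mul_apply, hv.2 l X hX f hf, map_zero,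
        zero_add, hv.2 _ _ (R.lie_mem l k X Y hX hY) _ (Ideal.mul_mem_right _ _ hf)] at this
      exact this
  have hDa : ∀ a u, ∀ v ∈ N, R.D a u v ∈ N := by
    intro a u v hv
    have : R.D a u = R.t a * R.jetD u (mono a) := by
      rw [jetD_mono, ← mul_assoc, R.t_mul_neg, one_mul]
    rw [this]
    exact ht a _ (hD u _ v hv)
  have hwN : w ∈ N := ⟨fun u f hf => by
    rw [R.jetD_eq_sum, LinearMap.sum_apply]
    exact Finset.sum_eq_zero fun j _ => by rw [LinearMap.smul_apply, hw1 j f hf, smul_zero], hw2⟩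
  have htop : N = ⊤ := (R.eq_bot_or_eq_top N ht hDa hx).resolve_left fun h => by
    rw [h, Submodule.mem_bot] at hwN
    exact hw0 hwN
  have hall : ∀ v, v ∈ N := fun v => htop ▸ Submodule.mem_top
  exact ⟨fun u f hf => LinearMap.ext fun v => (hall v).1 u f hf,
    fun l X hX f hf => LinearMap.ext fun v => (hall v).2 l X hX f hf⟩

variable [Nontrivial T] (hn : 0 < n)

include hn in
/-- Currents are determined by their values in one fundamental domain. -/
lemma x_add_scaleLat (l a : Fin n → ℤ) {X : G} (hX : X ∈ R.gr l) :
    R.x (l + scaleLat R.m a) X = R.t a * R.x l X := by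
  have := (R.jet_eq_zero hn).2 l X hX _ (mono_sub_one_mem a)
  rw [map_sub, jetX_mono, jetX_one, sub_eq_zero] at this
  rw [← this, ← mul_assoc, R.t_mul_neg, one_mul]

/-- The operators of the `gl_n`-action: `glOp j i` is the action of `E_{ji}`. -/
noncomputable def glOp (j i : Fin n) : Module.End ℂ T := R.jetD (Pi.single i 1) (coordX j)

include hn in
/-- Vector fields act through their first jets. -/
lemma D_eq (a : Fin n → ℤ) (u : Fin n → ℂ) :
    R.D a u = R.t a * (R.D 0 u + ∑ i, ∑ j, (u i * a j) • R.glOp j i) := by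
  have := (R.jet_eq_zero hn).1 u _ (mono_sub_linPart_mem a)
  rw [map_sub, map_sub, jetD_mono, jetD_one, sub_sub, sub_eq_zero] at this
  have e : R.jetD u (linPart a) = ∑ i, ∑ j, (u i * a j) • R.glOp j i := by
    rw [R.jetD_eq_sum, linPart]
    refine Finset.sum_congr rfl fun i _ => ?_
    rw [map_sum, Finset.smul_sum]
    exact Finset.sum_congr rfl fun j _ => by rw [map_smul, smul_smul, glOp]
  rw [← e, ← this, ← mul_assoc, R.t_mul_neg, one_mul]

lemma glOp_hasDegree (j i : Fin n) : HasDegree R.Tk (R.glOp j i) 0 := R.jetD_hasDegree _ _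

lemma glOp_t (j i : Fin n) (c : Fin n → ℤ) : R.glOp j i * R.t c = R.t c * R.glOp j i := by
  rw [glOp, R.jetD_t, aug_eq_zero (coordX_mem j), zero_mul, zero_smul, add_zero]

include hn in
lemma glOp_x (j i : Fin n) (l : Fin n → ℤ) {X : G} (hX : X ∈ R.gr l) :
    R.glOp j i * R.x l X = R.x l X * R.glOp j i := by
  have := R.jetD_jetX (Pi.single i 1) l hX (coordX j) 1
  rw [aug_eq_zero (coordX_mem j), zero_smul, sub_zero, (R.jet_eq_zero hn).2 l X hX _
    (Ideal.mul_mem_right _ _ (coordX_mem j)), add_zero, jetX_one] at this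
  exact this

include hn in
lemma glOp_glOp (j i l k : Fin n) : R.glOp j i * R.glOp l k = R.glOp l k * R.glOp j i +
    (if i = l then R.glOp j k else 0) - (if k = j then R.glOp l i else 0) := by
  have key : ∀ (p q r s : Fin n), R.jetD (Pi.single s 1) (coordX p * dLog (Pi.single r 1) (coordX q)) =
      if r = q then R.glOp p s else 0 := by
    intro p q r s
    rw [dLog_coordX]
    split_ifs
    · have : coordX p * mono (Pi.single q 1) = coordX p * coordX q + coordX p := by
        rw [coordX, coordX]; ring
      rw [this, map_add, (R.jet_eq_zero hn).1, zero_add, glOp]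
      rw [pow_two]
      exact Ideal.mul_mem_mul (coordX_mem p) (coordX_mem q)
    · rw [mul_zero, map_zero]
  rw [glOp, glOp, R.jetD_jetD_of_mem _ _ (coordX_mem _) (coordX_mem _), key, key]

end CurrentRep

end Jets

/-! ### Graded vector spaces and their homogeneous operators -/

section Graded

variable {I : Type*} [AddCommGroup I] {T : Type*} [AddCommGroup T] [Module ℂ T]
  {Tk : I → Submodule ℂ T}

/-- The subspaces `Tk` are the homogeneous components of a grading. -/
structure IsGrading {I : Type*} (Tk : I → Submodule ℂ T) : Prop where
  indep : iSupIndep Tk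
  iSup_eq : ⨆ k, Tk k = ⊤

namespace IsGrading

lemma ext_hom {X : Type*} [AddCommGroup X] [Module ℂ X] (h : IsGrading Tk) {f g : T →ₗ[ℂ] X}
    (hfg : ∀ k, ∀ v ∈ Tk k, f v = g v) : f = g := by
  ext v
  have hv : v ∈ ⨆ k, Tk k := h.iSup_eq ▸ Submodule.mem_top
  induction hv using Submodule.iSup_induction' with
  | mem k v hv => exact hfg k v hv
  | zero => simp
  | add v w _ _ hv hw => rw [map_add, map_add, hv, hw]

/-- The linear map with given restrictions to the homogeneous components. -/
lemma exists_lift {X : Type*} [AddCommGroup X] [Module ℂ X] (h : IsGrading Tk)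
    (F : ∀ k, Tk k →ₗ[ℂ] X) : ∃ f : T →ₗ[ℂ] X, ∀ k (v : Tk k), f v = F k v := by
  classical
  have hint : DirectSum.IsInternal Tk :=
    (DirectSum.isInternal_submodule_iff_iSupIndep_and_iSup_eq_top Tk).mpr ⟨h.indep, h.iSup_eq⟩
  let e := LinearEquiv.ofBijective (DirectSum.coeLinearMap Tk) hint
  refine ⟨DirectSum.toModule ℂ I X F ∘ₗ e.symm.toLinearMap, fun k v => ?_⟩
  have : e.symm (v : T) = DirectSum.lof ℂ I (fun k => Tk k) k v := by
    rw [LinearEquiv.symm_apply_eq]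
    exact (DirectSum.coeLinearMap_lof Tk k v).symm
  rw [LinearMap.comp_apply, LinearEquiv.coe_coe, this, DirectSum.toModule_lof]

noncomputable def lift {X : Type*} [AddCommGroup X] [Module ℂ X] (h : IsGrading Tk)
    (F : ∀ k, Tk k →ₗ[ℂ] X) : T →ₗ[ℂ] X := (h.exists_lift F).choose

lemma lift_apply {X : Type*} [AddCommGroup X] [Module ℂ X] (h : IsGrading Tk)
    (F : ∀ k, Tk k →ₗ[ℂ] X) {k : I} {v : T} (hv : v ∈ Tk k) : h.lift F v = F k ⟨v, hv⟩ :=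
  (h.exists_lift F).choose_spec k ⟨v, hv⟩

open Classical in
/-- The projection to a homogeneous component. -/
noncomputable def comp (h : IsGrading Tk) (k : I) : Module.End ℂ T :=
  h.lift fun j => if j = k then (Tk j).subtype else 0

variable (h : IsGrading Tk)
include h

lemma comp_same {k : I} {v : T} (hv : v ∈ Tk k) : h.comp k v = v := by
  rw [comp, h.lift_apply _ hv, if_pos rfl]; rfl

lemma comp_ne {j k : I} (hjk : j ≠ k) {v : T} (hv : v ∈ Tk j) : h.comp k v = 0 := by
  rw [comp, h.lift_apply _ hv, if_neg hjk]; rfl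

lemma comp_mem (k : I) (v : T) : h.comp k v ∈ Tk k := by
  have hv : v ∈ ⨆ k, Tk k := h.iSup_eq ▸ Submodule.mem_top
  induction hv using Submodule.iSup_induction' with
  | mem j v hv =>
    by_cases hjk : j = k
    · subst hjk; rwa [h.comp_same hv]
    · rw [h.comp_ne hjk hv]; exact zero_mem _
  | zero => simp
  | add v w _ _ hv hw => rw [map_add]; exact add_mem hv hw

lemma exists_finset (v : T) : ∃ F : Finset I, ∀ k ∉ F, h.comp k v = 0 := by
  classical
  have hv : v ∈ ⨆ k, Tk k := h.iSup_eq ▸ Submodule.mem_top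
  induction hv using Submodule.iSup_induction' with
  | mem j v hv =>
    refine ⟨{j}, fun k hk => h.comp_ne (fun e => hk (by simp [e])) hv⟩
  | zero => exact ⟨∅, fun k _ => map_zero _⟩
  | add v w _ _ hv hw =>
    obtain ⟨F, hF⟩ := hv
    obtain ⟨F', hF'⟩ := hw
    refine ⟨F ∪ F', fun k hk => ?_⟩
    rw [Finset.mem_union, not_or] at hk
    rw [map_add, hF k hk.1, hF' k hk.2, add_zero]

lemma eq_sum {v : T} {F : Finset I} (hF : ∀ k ∉ F, h.comp k v = 0) : v = ∑ k ∈ F, h.comp k v := by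
  classical
  have key : ∀ v : T, ∃ F : Finset I, ∀ F', F ⊆ F' → v = ∑ k ∈ F', h.comp k v := by
    intro v
    have hv : v ∈ ⨆ k, Tk k := h.iSup_eq ▸ Submodule.mem_top
    induction hv using Submodule.iSup_induction' with
    | mem j v hv =>
      refine ⟨{j}, fun F' hF' => ?_⟩
      rw [Finset.sum_eq_single j, h.comp_same hv]
      · exact fun k _ hk => h.comp_ne hk.symm hv
      · intro hj; exact absurd (hF' (Finset.mem_singleton_self j)) hj
    | zero => exact ⟨∅, fun k _ => by simp⟩
    | add v w _ _ hv hw =>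
      obtain ⟨F, hF⟩ := hv
      obtain ⟨F', hF'⟩ := hw
      refine ⟨F ∪ F', fun F'' hF'' => ?_⟩
      simp only [map_add, Finset.sum_add_distrib]
      rw [← hF _ (Finset.union_subset_left hF''), ← hF' _ (Finset.union_subset_right hF'')]
  obtain ⟨F₀, h0⟩ := key v
  rw [Finset.sum_subset (Finset.subset_union_left (s₁ := F) (s₂ := F₀)) fun k _ hk => hF k hk]
  exact h0 _ Finset.subset_union_right

lemma ext_comp {v w : T} (hvw : ∀ k, h.comp k v = h.comp k w) : v = w := by
  obtain ⟨F, hF⟩ := h.exists_finset v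
  rw [h.eq_sum hF, h.eq_sum (v := w) (F := F) fun k hk => by rw [← hvw, hF k hk]]
  exact Finset.sum_congr rfl fun k _ => hvw k

lemma apply_comp {y : Module.End ℂ T} {d : I} (hy : HasDegree Tk y d) (k : I) (v : T) :
    y (h.comp k v) = h.comp (k + d) (y v) := by
  have : y ∘ₗ h.comp k = h.comp (k + d) ∘ₗ y := by
    refine h.ext_hom fun j v hv => ?_
    rw [LinearMap.comp_apply, LinearMap.comp_apply]
    by_cases hjk : j = k
    · subst hjk; rw [h.comp_same hv, h.comp_same (hy _ _ hv)]
    · rw [h.comp_ne hjk hv, h.comp_ne (fun e => hjk (add_right_cancel e)) (hy _ _ hv), map_zero]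
  exact LinearMap.congr_fun this v

lemma degree_unique {y : Module.End ℂ T} {d d' : I} (hy : HasDegree Tk y d) (hy' : HasDegree Tk y d')
    (h0 : y ≠ 0) : d = d' := by
  by_contra hd
  refine h0 (h.ext_hom fun k v hv => ?_)
  have := h.comp_ne (k := k + d') (fun e => hd (add_left_cancel e)) (hy k v hv)
  rw [h.comp_same (hy' k v hv)] at this
  exact this

lemma exists_ne_bot [Nontrivial T] : ∃ k, Tk k ≠ ⊥ := by
  by_contra! hk
  have := h.iSup_eq
  simp only [hk, iSup_bot] at this
  exact bot_ne_top this

end IsGrading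

/-- A graded vector space without proper graded subspaces stable under a set of homogeneous
operators. -/
structure IsGradedSimple (Tk : I → Submodule ℂ T) (S : Set (Module.End ℂ T)) : Prop
    extends IsGrading Tk where
  finite : ∀ k, FiniteDimensional ℂ (Tk k)
  degree : ∀ y ∈ S, ∃ d, HasDegree Tk y d
  eq_bot_or_eq_top : ∀ N : Submodule ℂ T, (∀ y ∈ S, ∀ v ∈ N, y v ∈ N) →
    (∀ k, ∀ v ∈ N, toIsGrading.comp k v ∈ N) → N = ⊥ ∨ N = ⊤

namespace IsGradedSimple

variable {S : Set (Module.End ℂ T)} (h : IsGradedSimple Tk S)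
include h

lemma isUnit_of_commute {y : Module.End ℂ T} {d : I} (hd : HasDegree Tk y d)
    (hc : ∀ s ∈ S, Commute y s) (h0 : y ≠ 0) : IsUnit y := by
  rw [Module.End.isUnit_iff]
  have hc' : ∀ s ∈ S, ∀ v, y (s v) = s (y v) := fun s hs v => LinearMap.congr_fun (hc s hs) v
  constructor
  · rw [← LinearMap.ker_eq_bot]
    refine (h.eq_bot_or_eq_top (LinearMap.ker y) (fun s hs v hv => ?_) fun k v hv => ?_).resolve_right
      fun ht => h0 (LinearMap.ker_eq_top.mp ht)
    · rw [LinearMap.mem_ker] at *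
      rw [hc' s hs, hv, map_zero]
    · rw [LinearMap.mem_ker] at *
      rw [h.apply_comp hd, hv, map_zero]
  · rw [← LinearMap.range_eq_top]
    refine (h.eq_bot_or_eq_top (LinearMap.range y) (fun s hs v hv => ?_)
      fun k v hv => ?_).resolve_left fun ht => h0 (LinearMap.range_eq_bot.mp ht)
    · obtain ⟨w, rfl⟩ := hv
      exact ⟨s w, hc' s hs w⟩
    · obtain ⟨w, rfl⟩ := hv
      refine ⟨h.comp (k - d) w, ?_⟩
      rw [h.apply_comp hd, sub_add_cancel]

lemma exists_eq_smul_one [Nontrivial T] {y : Module.End ℂ T} (hd : HasDegree Tk y 0)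
    (hc : ∀ s ∈ S, Commute y s) : ∃ a : ℂ, y = a • 1 := by
  obtain ⟨k, hk⟩ := h.exists_ne_bot
  have := h.finite k
  have := Submodule.nontrivial_iff_ne_bot.mpr hk
  have hy : ∀ v ∈ Tk k, y v ∈ Tk k := fun v hv => by simpa using hd k v hv
  obtain ⟨a, ha⟩ := Module.End.exists_eigenvalue (y.restrict hy)
  obtain ⟨v, hv⟩ := ha.exists_hasEigenvector
  refine ⟨a, ?_⟩
  by_contra hne
  have hu := h.isUnit_of_commute (y := y - a • 1) (d := 0) (hd.sub (HasDegree.one.smul a))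
    (fun s hs => (hc s hs).sub_left ((Commute.one_left s).smul_left a)) (sub_ne_zero.mpr hne)
  rw [Module.End.isUnit_iff] at hu
  have h1 : (y - a • 1) (v : T) = 0 := by
    have := congrArg Subtype.val hv.apply_eq_smul
    rw [LinearMap.sub_apply, sub_eq_zero]
    exact this
  exact hv.2 (Subtype.ext (hu.1 (h1.trans (map_zero _).symm)))

end IsGradedSimple

/-- The group of homogeneous invertible operators commuting with `S`. -/
def homUnits (h : IsGrading Tk) (S : Set (Module.End ℂ T)) : Subgroup (Module.End ℂ T)ˣ where
  carrier := {u | (∃ d, HasDegree Tk (u : Module.End ℂ T) d) ∧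
    ∀ s ∈ S, Commute (u : Module.End ℂ T) s}
  one_mem' := ⟨⟨0, HasDegree.one⟩, fun s _ => Commute.one_left s⟩
  mul_mem' := fun {a b} ha hb => by
    obtain ⟨⟨d, hd⟩, h1⟩ := ha
    obtain ⟨⟨e, he⟩, h2⟩ := hb
    exact ⟨⟨d + e, hd.mul he⟩, fun s hs => (h1 s hs).mul_left (h2 s hs)⟩
  inv_mem' := fun {a} ha => by
    obtain ⟨⟨d, hd⟩, h1⟩ := ha
    exact ⟨⟨-d, hd.of_mul_eq_one h.indep h.iSup_eq (Units.inv_mul a) (Units.mul_inv a)⟩,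
      fun s hs => (h1 s hs).units_inv_left⟩

/-- A set of pairwise commuting elements of a group, all in a subgroup, is contained in a subgroup
which is its own centralizer. -/
lemma exists_maximal_commutative {U : Type*} [Group U] (U₀ : Subgroup U) : ∃ M : Subgroup U, M ≤ U₀ ∧
    (∀ a ∈ M, ∀ b ∈ M, Commute a b) ∧ ∀ a ∈ U₀, (∀ b ∈ M, Commute a b) → a ∈ M := by
  obtain ⟨s, hs⟩ := zorn_subset {s : Set U | s ⊆ U₀ ∧ ∀ a ∈ s, ∀ b ∈ s, Commute a b} (by
    intro c hc hchain
    refine ⟨⋃₀ c, ⟨Set.sUnion_subset fun s hs => (hc hs).1, ?_⟩, fun s hs => Set.subset_sUnion_of_mem hs⟩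
    rintro a ⟨s, hs, ha⟩ b ⟨s', hs', hb⟩
    rcases hchain.total hs hs' with h | h
    · exact (hc hs').2 a (h ha) b hb
    · exact (hc hs).2 a ha b (h hb))
  have hmem : ∀ a ∈ U₀, (∀ b ∈ s, Commute a b) → a ∈ s := by
    intro a ha hab
    refine hs.2 (y := insert a s) ⟨Set.insert_subset ha hs.1.1, ?_⟩ (Set.subset_insert a s)
      (Set.mem_insert a s)
    rintro x (rfl | hx) y (rfl | hy)
    · exact Commute.refl _
    · exact hab y hy
    · exact (hab x hx).symm
    · exact hs.1.2 x hx y hy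
  refine ⟨U₀ ⊓ Subgroup.centralizer s, inf_le_left, ?_, ?_⟩
  · intro a ha b hb
    rw [Subgroup.mem_inf, Subgroup.mem_centralizer_iff] at ha hb
    exact (ha.2 b (hmem b hb.1 fun c hc => (hb.2 c hc).symm)).symm
  · intro a ha hab
    rw [Subgroup.mem_inf, Subgroup.mem_centralizer_iff]
    refine ⟨ha, fun b hb => (hab b ?_).symm⟩
    rw [Subgroup.mem_inf, Subgroup.mem_centralizer_iff]
    exact ⟨hs.1.1 hb, fun c hc => hs.1.2 c hc b hb⟩

lemma baer_complexUnits : Module.Baer ℤ (Additive ℂˣ) := by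
  let _ : DivisibleBy (Additive ℂˣ) ℤ := AddCommGroup.divisibleByIntOfSMulTopEqTop _ fun {k} hk => by
    rw [eq_top_iff]
    intro x _
    obtain ⟨z, hz⟩ := IsAlgClosed.exists_pow_nat_eq ((x.toMul : ℂˣ) : ℂ) (Int.natAbs_pos.mpr hk)
    have hz0 : z ≠ 0 := by
      rintro rfl
      rw [zero_pow (Int.natAbs_pos.mpr hk).ne'] at hz
      exact x.toMul.ne_zero hz.symm
    have hz' : Units.mk0 z hz0 ^ k.natAbs = x.toMul := Units.ext (by simpa using hz)
    rw [AddSubgroup.mem_smul_pointwise_iff_exists]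
    rcases Int.natAbs_eq k with h | h
    · refine ⟨Additive.ofMul (Units.mk0 z hz0), trivial, ?_⟩
      rw [h, natCast_zsmul, ← ofMul_pow, hz']
      rfl
    · refine ⟨Additive.ofMul (Units.mk0 z hz0)⁻¹, trivial, ?_⟩
      rw [h, neg_smul, natCast_zsmul, ← ofMul_pow, inv_pow, hz', ofMul_inv, neg_neg]
      rfl
  exact Module.Baer.of_divisible _

/-- A character of a subgroup of a commutative group with values in `ℂˣ` extends. -/
lemma exists_extend_character {A B : Type*} [AddCommGroup A] [AddCommGroup B] (f : A →+ B)
    (hf : Function.Injective f) (g : A →+ Additive ℂˣ) : ∃ χ : B →+ Additive ℂˣ, ∀ a, χ (f a) = g a := by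
  obtain ⟨χ, hχ⟩ := baer_complexUnits.extension_property f.toIntLinearMap hf g.toIntLinearMap
  exact ⟨χ.toAddMonoidHom, fun a => LinearMap.congr_fun hχ a⟩

end Graded

/-! ### Simple quotients of graded simple modules -/

section LoopData

/-- A character of a subgroup of a commutative group with values in `ℂˣ` extends. -/
lemma exists_extend_hom {A B : Type*} [CommGroup A] [CommGroup B] (f : A →* B)
    (hf : Function.Injective f) (g : A →* ℂˣ) : ∃ χ : B →* ℂˣ, ∀ a, χ (f a) = g a := by
  obtain ⟨χ, hχ⟩ := exists_extend_character (MonoidHom.toAdditive f) hf (MonoidHom.toAdditive g)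
  exact ⟨MonoidHom.toAdditive.symm χ, hχ⟩

lemma exists_character {U A : Type*} [Group U] [CommGroup A] (M : Subgroup U)
    (hM : ∀ a ∈ M, ∀ b ∈ M, Commute a b) (z : ℂˣ →* U) (t : A →* U) (hz : ∀ x, z x ∈ M)
    (ht : ∀ a, t a ∈ M) (hinj : ∀ x a, z x * t a = 1 → x = 1 ∧ a = 1) :
    ∃ χ : M →* ℂˣ, (∀ x, χ ⟨z x, hz x⟩ = x) ∧ ∀ a, χ ⟨t a, ht a⟩ = 1 := by
  let _ : CommGroup M :=
    { (inferInstance : Group M) with mul_comm := fun a b => Subtype.ext (hM a a.2 b b.2) }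
  let f : ℂˣ × A →* M := (z.codRestrict M hz).coprod (t.codRestrict M ht)
  have hf : Function.Injective f := by
    rw [injective_iff_map_eq_one]
    rintro ⟨x, a⟩ h
    obtain ⟨h1, h2⟩ := hinj x a (congrArg Subtype.val h)
    rw [h1, h2]; rfl
  obtain ⟨χ, hχ⟩ := exists_extend_hom f hf (MonoidHom.fst ℂˣ A)
  refine ⟨χ, fun x => ?_, fun a => ?_⟩
  · have := hχ (x, 1)
    simpa [f] using this
  · have := hχ (1, a)
    simpa [f] using this

variable {I : Type*} [AddCommGroup I] {T : Type*} [AddCommGroup T] [Module ℂ T]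
  {Tk : I → Submodule ℂ T} {S : Set (Module.End ℂ T)}

/-- A maximal torus of homogeneous operators commuting with `S`. -/
structure LoopData (Tk : I → Submodule ℂ T) (S : Set (Module.End ℂ T)) where
  /-- the degrees of the operators -/
  Γ' : AddSubgroup I
  /-- the operators -/
  c : I → Module.End ℂ T
  c_zero : c 0 = 1
  c_add : ∀ a ∈ Γ', ∀ b ∈ Γ', c (a + b) = c a * c b
  c_degree : ∀ a ∈ Γ', HasDegree Tk (c a) a
  c_comm : ∀ a ∈ Γ', ∀ s ∈ S, Commute (c a) s
  mem_of_commute : ∀ (b : Module.End ℂ T) (d : I), HasDegree Tk b d → (∀ s ∈ S, Commute b s) →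
    (∀ a ∈ Γ', Commute b (c a)) → b ≠ 0 → d ∈ Γ'

lemma IsGradedSimple.exists_loopData [Nontrivial T] (h : IsGradedSimple Tk S) {A : Type*}
    [AddCommGroup A] (ι : A →+ I) (hι : Function.Injective ι) (t : A → Module.End ℂ T)
    (t_zero : t 0 = 1) (t_add : ∀ a b, t (a + b) = t a * t b)
    (ht : ∀ a, HasDegree Tk (t a) (ι a)) (htS : ∀ a, t a ∈ S)
    (htc : ∀ a, ∀ s ∈ S, Commute (t a) s) :
    ∃ L : LoopData Tk S, ∀ a, ι a ∈ L.Γ' ∧ L.c (ι a) = t a := by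
  classical
  let U₀ := homUnits h.toIsGrading S
  obtain ⟨M, hMU, hMc, hMmax⟩ := exists_maximal_commutative U₀
  let z : ℂˣ →* (Module.End ℂ T)ˣ := Units.map (algebraMap ℂ (Module.End ℂ T)).toMonoidHom
  have hzv : ∀ x : ℂˣ, (z x : Module.End ℂ T) = (x : ℂ) • 1 := fun x =>
    Algebra.algebraMap_eq_smul_one _
  let tU : Multiplicative A →* (Module.End ℂ T)ˣ :=
    MonoidHom.toHomUnits
      { toFun := fun a => t a.toAdd
        map_one' := t_zero
        map_mul' := fun a b => t_add _ _ }
  have htv : ∀ a, (tU a : Module.End ℂ T) = t a.toAdd := fun a => rfl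
  have hscal : ∀ (x : ℂ) (y : Module.End ℂ T), Commute (x • 1) y := fun x y =>
    (Commute.one_left y).smul_left x
  have hz : ∀ x, z x ∈ M := by
    intro x
    refine hMmax _ ⟨⟨0, ?_⟩, fun s _ => ?_⟩ fun b _ => Units.ext ?_
    · rw [hzv]; exact HasDegree.one.smul _
    · rw [hzv]; exact hscal _ _
    · rw [Units.val_mul, Units.val_mul, hzv]; exact hscal _ _
  have htM : ∀ a, tU a ∈ M := fun a => hMmax _ ⟨⟨ι a.toAdd, ht _⟩, htc _⟩ fun b hb =>
    Units.ext ((hMU hb).2 _ (htS a.toAdd)).symm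
  have hinj : ∀ x a, z x * tU a = 1 → x = 1 ∧ a = 1 := by
    intro x a hxa
    have h1 : (x : ℂ) • t a.toAdd = 1 := by
      have := congrArg Units.val hxa
      rwa [Units.val_mul, hzv, htv, smul_mul_assoc, one_mul] at this
    have h2 : HasDegree Tk (1 : Module.End ℂ T) (ι a.toAdd) := h1 ▸ (ht a.toAdd).smul (x : ℂ)
    have h3 := h.degree_unique h2 HasDegree.one one_ne_zero
    have ha : a = 1 := by
      rw [← map_zero ι] at h3
      exact hι h3
    refine ⟨?_, ha⟩
    rw [ha, toAdd_one, t_zero] at h1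
    have : ((x : ℂ) - 1) • (1 : Module.End ℂ T) = 0 := by rw [sub_smul, h1, one_smul, sub_self]
    have := (smul_eq_zero.mp this).resolve_right one_ne_zero
    exact Units.ext (sub_eq_zero.mp this)
  obtain ⟨χ, hχz, hχt⟩ := exists_character M hMc z tU hz htM hinj
  let Γ' : AddSubgroup I :=
    { carrier := {d | ∃ u ∈ M, HasDegree Tk (u : Module.End ℂ T) d}
      zero_mem' := ⟨1, one_mem _, HasDegree.one⟩
      add_mem' := fun {a b} ⟨u, hu, hu'⟩ ⟨v, hv, hv'⟩ => ⟨u * v, mul_mem hu hv, hu'.mul hv'⟩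
      neg_mem' := fun {a} ⟨u, hu, hu'⟩ => ⟨u⁻¹, inv_mem hu,
        hu'.of_mul_eq_one h.indep h.iSup_eq (Units.inv_mul u) (Units.mul_inv u)⟩ }
  let c : I → Module.End ℂ T := fun d => if hd : d ∈ Γ' then
    ((χ ⟨hd.choose, hd.choose_spec.1⟩)⁻¹ : ℂˣ).val • (hd.choose : Module.End ℂ T) else 0
  have huniq : ∀ (d : I) (u w : (Module.End ℂ T)ˣ) (hu : u ∈ M) (hw : w ∈ M),
      HasDegree Tk (u : Module.End ℂ T) d → HasDegree Tk (w : Module.End ℂ T) d →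
      ((χ ⟨w, hw⟩)⁻¹ : ℂˣ).val • (w : Module.End ℂ T) =
        ((χ ⟨u, hu⟩)⁻¹ : ℂˣ).val • (u : Module.End ℂ T) := by
    intro d u w hu hw hud hwd
    obtain ⟨a, ha⟩ := h.exists_eq_smul_one (y := ((w * u⁻¹ : (Module.End ℂ T)ˣ) : Module.End ℂ T)) (by
        have := hwd.mul (hud.of_mul_eq_one h.indep h.iSup_eq (Units.inv_mul u) (Units.mul_inv u))
        rwa [add_neg_cancel] at this) (hMU (mul_mem hw (inv_mem hu))).2
    have ha0 : a ≠ 0 := by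
      rintro rfl
      rw [zero_smul] at ha
      exact (w * u⁻¹).ne_zero ha
    have hwu : w = z (Units.mk0 a ha0) * u := by
      rw [← mul_inv_eq_iff_eq_mul]
      exact Units.ext (by rw [ha, hzv]; rfl)
    subst hwu
    have h1 : χ ⟨z (Units.mk0 a ha0) * u, hw⟩ = Units.mk0 a ha0 * χ ⟨u, hu⟩ := by
      conv_rhs => rw [← hχz (Units.mk0 a ha0), ← map_mul]
      rfl
    rw [h1, mul_inv, Units.val_mul, Units.val_mul, hzv, smul_mul_assoc, one_mul, smul_smul]
    congr 1
    rw [Units.val_inv_eq_inv_val, Units.val_mk0]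
    field_simp
  have hc : ∀ (d : I) (u : (Module.End ℂ T)ˣ) (hu : u ∈ M), HasDegree Tk (u : Module.End ℂ T) d →
      c d = ((χ ⟨u, hu⟩)⁻¹ : ℂˣ).val • (u : Module.End ℂ T) := by
    intro d u hu hud
    have hd : d ∈ Γ' := ⟨u, hu, hud⟩
    simp only [c]
    rw [dif_pos hd]
    exact huniq d u _ hu hd.choose_spec.1 hud hd.choose_spec.2
  refine ⟨⟨Γ', c, ?_, ?_, ?_, ?_, ?_⟩, fun a => ⟨⟨tU (Multiplicative.ofAdd a), htM _, ht a⟩, ?_⟩⟩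
  · rw [hc 0 1 (one_mem _) HasDegree.one]
    have : χ ⟨1, one_mem _⟩ = 1 := map_one χ
    rw [this]; simp
  · rintro a ⟨u, hu, hua⟩ b ⟨v, hv, hvb⟩
    rw [hc a u hu hua, hc b v hv hvb, hc (a + b) (u * v) (mul_mem hu hv) (hua.mul hvb)]
    have : χ ⟨u * v, mul_mem hu hv⟩ = χ ⟨u, hu⟩ * χ ⟨v, hv⟩ := map_mul χ ⟨u, hu⟩ ⟨v, hv⟩
    rw [this, mul_inv, Units.val_mul, Units.val_mul, smul_mul_smul_comm]
  · rintro a ⟨u, hu, hua⟩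
    rw [hc a u hu hua]
    exact hua.smul _
  · rintro a ⟨u, hu, hua⟩ s hs
    rw [hc a u hu hua]
    exact ((hMU hu).2 s hs).smul_left _
  · intro b d hbd hbS hbc hb0
    obtain ⟨u, rfl⟩ := h.isUnit_of_commute hbd hbS hb0
    refine ⟨u, hMmax u ⟨⟨d, hbd⟩, hbS⟩ fun m hm => ?_, hbd⟩
    obtain ⟨e, he⟩ := (hMU hm).1
    have := hbc e ⟨m, hm, he⟩
    rw [hc e m hm he] at this
    have h2 := this.smul_right ((χ ⟨m, hm⟩ : ℂˣ) : ℂ)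
    rw [smul_smul, Units.mul_inv, one_smul] at h2
    exact Units.ext h2
  · change c (ι a) = t a
    rw [hc (ι a) (tU (Multiplicative.ofAdd a)) (htM _) (ht a), hχt, inv_one, Units.val_one, one_smul]
    rfl

namespace LoopData

variable (h : IsGradedSimple Tk S) (L : LoopData Tk S)

/-- A representative of the class modulo `Γ'`. -/
noncomputable def rep (k : I) : I := Quotient.out (k : I ⧸ L.Γ')

lemma rep_coe (k : I) : (L.rep k : I ⧸ L.Γ') = k := QuotientAddGroup.out_eq' _

lemma rep_eq {k l : I} (hkl : (k : I ⧸ L.Γ') = l) : L.rep k = L.rep l := by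
  rw [rep, hkl]; rfl

lemma rep_eq_iff {k l : I} : L.rep k = L.rep l ↔ (k : I ⧸ L.Γ') = l :=
  ⟨fun h => by rw [← L.rep_coe k, h, L.rep_coe], L.rep_eq⟩

lemma rep_rep (k : I) : L.rep (L.rep k) = L.rep k := L.rep_eq (L.rep_coe k)

lemma rep_sub_mem (k : I) : L.rep k - k ∈ L.Γ' := by
  rw [sub_eq_neg_add, ← QuotientAddGroup.eq, L.rep_coe]

lemma c_neg_mul {a : I} (ha : a ∈ L.Γ') : L.c (-a) * L.c a = 1 := by
  rw [← L.c_add _ (neg_mem ha) _ ha, neg_add_cancel, L.c_zero]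

lemma c_commute {a b : I} (ha : a ∈ L.Γ') (hb : b ∈ L.Γ') : Commute (L.c a) (L.c b) := by
  rw [Commute, SemiconjBy, ← L.c_add _ ha _ hb, ← L.c_add _ hb _ ha, add_comm]

include h

/-- The projection to a fundamental domain. -/
noncomputable def proj : Module.End ℂ T :=
  h.lift fun k => L.c (L.rep k - k) ∘ₗ (Tk k).subtype

lemma proj_apply {k : I} {v : T} (hv : v ∈ Tk k) : L.proj h v = L.c (L.rep k - k) v :=
  h.lift_apply _ hv

lemma proj_mem {k : I} {v : T} (hv : v ∈ Tk k) : L.proj h v ∈ Tk (L.rep k) := by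
  rw [L.proj_apply h hv]
  simpa using L.c_degree _ (L.rep_sub_mem k) k v hv

lemma proj_eq_self {k : I} (hk : L.rep k = k) {v : T} (hv : v ∈ Tk k) : L.proj h v = v := by
  rw [L.proj_apply h hv, hk, sub_self, L.c_zero]; rfl

lemma proj_proj (v : T) : L.proj h (L.proj h v) = L.proj h v := by
  have : L.proj h ∘ₗ L.proj h = L.proj h := h.ext_hom fun k v hv => by
    rw [LinearMap.comp_apply, L.proj_eq_self h (L.rep_rep k) (L.proj_mem h hv)]
  exact LinearMap.congr_fun this v

lemma eq_zero_of_proj {k : I} {v : T} (hv : v ∈ Tk k) (h0 : L.proj h v = 0) : v = 0 := by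
  rw [L.proj_apply h hv] at h0
  have := LinearMap.congr_fun (L.c_neg_mul (L.rep_sub_mem k)) v
  rw [Module.End.mul_apply, h0, map_zero] at this
  exact this.symm

lemma proj_c {a : I} (ha : a ∈ L.Γ') (v : T) : L.proj h (L.c a v) = L.proj h v := by
  have : L.proj h ∘ₗ L.c a = L.proj h := h.ext_hom fun k v hv => by
    have hr : L.rep (k + a) = L.rep k := L.rep_eq (by
      rw [QuotientAddGroup.eq]; simpa using ha)
    have hm := L.rep_sub_mem (k + a)
    rw [LinearMap.comp_apply, L.proj_apply h hv, L.proj_apply h (L.c_degree a ha k v hv),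
      ← Module.End.mul_apply, ← L.c_add _ hm _ ha, hr]
    congr 2
    abel
  exact LinearMap.congr_fun this v

lemma proj_apply_proj {y : Module.End ℂ T} (hc : ∀ a ∈ L.Γ', Commute (L.c a) y) (v : T) :
    L.proj h (y (L.proj h v)) = L.proj h (y v) := by
  have : L.proj h ∘ₗ y ∘ₗ L.proj h = L.proj h ∘ₗ y := h.ext_hom fun k v hv => by
    have hm := L.rep_sub_mem k
    have := LinearMap.congr_fun (hc _ hm) v
    rw [Module.End.mul_apply, Module.End.mul_apply] at this
    rw [LinearMap.comp_apply, LinearMap.comp_apply, LinearMap.comp_apply, L.proj_apply h hv, ← this,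
      L.proj_c h hm]
  exact LinearMap.congr_fun this v

lemma comp_proj_eq_zero {k : I} (hk : L.rep k ≠ k) (v : T) : h.comp k (L.proj h v) = 0 := by
  have : h.comp k ∘ₗ L.proj h = 0 := h.ext_hom fun j v hv => by
    rw [LinearMap.comp_apply, h.comp_ne _ (L.proj_mem h hv)]
    · rfl
    · rintro rfl
      exact hk (L.rep_rep j)
  exact LinearMap.congr_fun this v

omit h in
lemma exists_factor {X Y Z : Type*} [AddCommGroup X] [Module ℂ X] [AddCommGroup Y] [Module ℂ Y]
    [AddCommGroup Z] [Module ℂ Z] (f : Y →ₗ[ℂ] X) (hf : Function.Surjective f) (g : Y →ₗ[ℂ] Z)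
    (hfg : ∀ y, f y = 0 → g y = 0) : ∃ φ : X →ₗ[ℂ] Z, ∀ y, φ (f y) = g y := by
  obtain ⟨σ, hσ⟩ := f.exists_rightInverse_of_surjective (LinearMap.range_eq_top.mpr hf)
  refine ⟨g ∘ₗ σ, fun y => ?_⟩
  have : f (σ (f y) - y) = 0 := by
    rw [map_sub, sub_eq_zero]
    exact LinearMap.congr_fun hσ (f y)
  have := hfg _ this
  rw [map_sub, sub_eq_zero] at this
  exact this

/-- The fundamental domain is simple as an ungraded module. -/
theorem eq_bot_or_eq_range (N : Submodule ℂ T) (hN : N ≤ LinearMap.range (L.proj h))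
    (hS : ∀ y ∈ S, ∀ v ∈ N, L.proj h (y v) ∈ N) : N = ⊥ ∨ N = LinearMap.range (L.proj h) := by
  classical
  by_cases hbot : N = ⊥
  · exact Or.inl hbot
  refine Or.inr (le_antisymm hN ?_)
  have hNp : ∀ w ∈ N, L.proj h w = w := by
    intro w hw
    obtain ⟨v, rfl⟩ := hN hw
    exact L.proj_proj h v
  let supp : T → Set I := fun w => {k | h.comp k w ≠ 0}
  have hfin : ∀ w, (supp w).Finite := by
    intro w
    obtain ⟨F, hF⟩ := h.exists_finset w
    exact F.finite_toSet.subset fun k hk => by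
      by_contra hkF
      exact hk (hF k hkF)
  obtain ⟨w₁, hw₁, hw₁0⟩ := Submodule.exists_mem_ne_zero_of_ne_bot hbot
  obtain ⟨w, ⟨hwN, hw0⟩, hmin⟩ := exists_minimalFor_of_wellFoundedLT (fun w => w ∈ N ∧ w ≠ 0)
    (fun w => (supp w).ncard) ⟨w₁, hw₁, hw₁0⟩
  have hsr : ∀ k ∈ supp w, L.rep k = k := by
    intro k hk
    by_contra hne
    refine hk ?_
    rw [← hNp w hwN]
    exact L.comp_proj_eq_zero h hne w
  obtain ⟨k₀, hk₀⟩ : ∃ k, h.comp k w ≠ 0 := by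
    by_contra! hall
    exact hw0 (h.ext_comp fun k => by rw [hall, map_zero])
  by_cases hone : ∀ k, h.comp k w ≠ 0 → k = k₀
  · have hwk : h.comp k₀ w = w := by
      refine h.ext_comp fun k => ?_
      by_cases hk : k = k₀
      · rw [hk, h.comp_same (h.comp_mem _ _)]
      · rw [h.comp_ne (Ne.symm hk) (h.comp_mem _ _)]
        by_contra hne
        exact hk (hone k (Ne.symm hne))
    let P : Submodule ℂ T :=
      { carrier := {v | ∀ k, L.proj h (h.comp k v) ∈ N}
        zero_mem' := fun k => by simp
        add_mem' := fun ha hb k => by rw [map_add, map_add]; exact add_mem (ha k) (hb k)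
        smul_mem' := fun a v hv k => by rw [map_smul, map_smul]; exact N.smul_mem a (hv k) }
    have hP : P = ⊤ := by
      refine (h.eq_bot_or_eq_top P (fun y hy v hv k => ?_) fun j v hv k => ?_).resolve_left fun hb => ?_
      · obtain ⟨d, hd⟩ := h.degree y hy
        have := h.apply_comp hd (k - d) v
        rw [sub_add_cancel] at this
        rw [← this, ← L.proj_apply_proj h fun a ha => L.c_comm a ha y hy]
        exact hS y hy _ (hv _)
      · by_cases hjk : j = k
        · subst hjk
          rw [h.comp_same (h.comp_mem _ _)]
          exact hv j
        · rw [h.comp_ne hjk (h.comp_mem _ _), map_zero]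
          exact zero_mem _
      · have : w ∈ P := fun k => by
          by_cases hk : k = k₀
          · rw [hk, hwk, hNp w hwN]; exact hwN
          · have : h.comp k w = 0 := by
              by_contra hne
              exact hk (hone k hne)
            rw [this, map_zero]; exact zero_mem _
        rw [hb, Submodule.mem_bot] at this
        exact hw0 this
    rintro _ ⟨v, rfl⟩
    have hv : v ∈ P := hP ▸ Submodule.mem_top
    obtain ⟨F, hF⟩ := h.exists_finset v
    rw [h.eq_sum hF, map_sum]
    exact sum_mem fun k _ => hv k
  · push Not at hone
    obtain ⟨k₁, hk₁, hk10⟩ := hone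
    exfalso
    let Y : I → Submodule ℂ (Module.End ℂ T) := fun e =>
      { carrier := {y | HasDegree Tk y e ∧ (∀ a ∈ L.Γ', Commute (L.c a) y) ∧
          ∀ v, L.proj h v ∈ N → L.proj h (y v) ∈ N}
        zero_mem' := ⟨fun k v _ => zero_mem _, fun a _ => Commute.zero_right _, fun v _ => by simp⟩
        add_mem' := fun ha hb => ⟨ha.1.add hb.1, fun a h' => (ha.2.1 a h').add_right (hb.2.1 a h'),
          fun v hv => by
            rw [LinearMap.add_apply, map_add]; exact add_mem (ha.2.2 v hv) (hb.2.2 v hv)⟩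
        smul_mem' := fun a y hy => ⟨hy.1.smul a, fun a' h' => (hy.2.1 a' h').smul_right a,
          fun v hv => by
            rw [LinearMap.smul_apply, map_smul]; exact N.smul_mem a (hy.2.2 v hv)⟩ }
    have hYmul : ∀ {d e y y'}, y ∈ Y d → y' ∈ Y e → y * y' ∈ Y (d + e) := fun hy hy' =>
      ⟨hy.1.mul hy'.1, fun a ha => (hy.2.1 a ha).mul_right (hy'.2.1 a ha),
        fun v hv => hy.2.2 _ (hy'.2.2 v hv)⟩
    have hYone : (1 : Module.End ℂ T) ∈ Y 0 :=
      ⟨HasDegree.one, fun a _ => Commute.one_right _, fun v hv => hv⟩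
    have hYS : ∀ y ∈ S, ∃ d, y ∈ Y d := by
      intro y hy
      obtain ⟨d, hd⟩ := h.degree y hy
      refine ⟨d, hd, fun a ha => L.c_comm a ha y hy, fun v hv => ?_⟩
      rw [← L.proj_apply_proj h fun a ha => L.c_comm a ha y hy]
      exact hS y hy _ hv
    have hYc : ∀ a ∈ L.Γ', L.c a ∈ Y a := fun a ha =>
      ⟨L.c_degree a ha, fun b hb => L.c_commute hb ha, fun v hv => by rwa [L.proj_c h ha]⟩
    have key : ∀ e, ∀ y ∈ Y e, y (h.comp k₀ w) = 0 → y (h.comp k₁ w) = 0 := by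
      intro e y hy hy0
      by_contra hne
      obtain ⟨F, hF⟩ := h.exists_finset w
      have hu : L.proj h (y w) = ∑ k ∈ F, L.proj h (y (h.comp k w)) := by
        conv_lhs => rw [h.eq_sum hF, map_sum, map_sum]
      have hmem : ∀ k, L.proj h (y (h.comp k w)) ∈ Tk (L.rep (k + e)) := fun k =>
        L.proj_mem h (hy.1 _ _ (h.comp_mem k w))
      have huN : L.proj h (y w) ∈ N := hy.2.2 w (by rwa [hNp w hwN])
      have hinj : ∀ k ∈ supp w, ∀ k' ∈ supp w, L.rep (k + e) = L.rep (k' + e) → k = k' := by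
        intro k hk k' hk' heq
        rw [L.rep_eq_iff, QuotientAddGroup.eq] at heq
        rw [← hsr k hk, ← hsr k' hk', L.rep_eq_iff, QuotientAddGroup.eq]
        convert heq using 1
        abel
      have hu0 : L.proj h (y w) ≠ 0 := by
        intro h0
        have h1 : h.comp (L.rep (k₁ + e)) (L.proj h (y w)) = L.proj h (y (h.comp k₁ w)) := by
          rw [hu, map_sum, Finset.sum_eq_single k₁]
          · exact h.comp_same (hmem k₁)
          · intro k _ hk
            by_cases hks : h.comp k w = 0
            · simp [hks]
            · exact h.comp_ne (fun he => hk (hinj k hks k₁ hk₁ he)) (hmem k)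
          · intro hk
            simp [hF k₁ hk]
        rw [h0, map_zero] at h1
        exact hne (L.eq_zero_of_proj h (hy.1 _ _ (h.comp_mem k₁ w)) h1.symm)
      have hsub : supp (L.proj h (y w)) ⊆ (fun k => L.rep (k + e)) '' (supp w \ {k₀}) := by
        intro j hj
        have hj' : h.comp j (L.proj h (y w)) ≠ 0 := hj
        rw [hu, map_sum] at hj'
        obtain ⟨k, -, hk⟩ := Finset.exists_ne_zero_of_sum_ne_zero hj'
        refine ⟨k, ⟨fun h0 => hk (by rw [h0]; simp), ?_⟩, ?_⟩
        · rintro rfl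
          exact hk (by rw [hy0]; simp)
        · by_contra hne'
          exact hk (h.comp_ne hne' (hmem k))
      have hlt : (supp (L.proj h (y w))).ncard < (supp w).ncard := by
        calc _ ≤ _ := Set.ncard_le_ncard hsub (((hfin w).sdiff).image _)
          _ ≤ _ := Set.ncard_image_le (hfin w).sdiff
          _ < _ := Set.ncard_sdiff_singleton_lt_of_mem hk₀ (hfin w)
      exact absurd (hmin ⟨huN, hu0⟩ hlt.le) (not_le.mpr hlt)
    let Q : Submodule ℂ T :=
      { carrier := {v | ∀ k, ∃ y ∈ Y (k - k₀), y (h.comp k₀ w) = h.comp k v}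
        zero_mem' := fun k => ⟨0, zero_mem _, by simp⟩
        add_mem' := fun ha hb k => by
          obtain ⟨y, hy, hy'⟩ := ha k
          obtain ⟨z, hz, hz'⟩ := hb k
          exact ⟨y + z, add_mem hy hz, by rw [LinearMap.add_apply, hy', hz', map_add]⟩
        smul_mem' := fun a v hv k => by
          obtain ⟨y, hy, hy'⟩ := hv k
          exact ⟨a • y, Submodule.smul_mem _ a hy, by rw [LinearMap.smul_apply, hy', map_smul]⟩ }
    have hQ : Q = ⊤ := by
      refine (h.eq_bot_or_eq_top Q (fun z hz v hv k => ?_) fun j v hv k => ?_).resolve_left fun hb => ?_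
      · obtain ⟨d, hd⟩ := hYS z hz
        obtain ⟨y, hy, hy'⟩ := hv (k - d)
        refine ⟨z * y, ?_, ?_⟩
        · have := hYmul hd hy
          rwa [show d + (k - d - k₀) = k - k₀ by abel] at this
        · rw [Module.End.mul_apply, hy', h.apply_comp hd.1, sub_add_cancel]
      · by_cases hjk : j = k
        · subst hjk
          rw [h.comp_same (h.comp_mem _ _)]
          exact hv j
        · rw [h.comp_ne hjk (h.comp_mem _ _)]
          exact ⟨0, zero_mem _, by simp⟩
      · have : h.comp k₀ w ∈ Q := fun k => by
          by_cases hk : k₀ = k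
          · subst hk
            refine ⟨1, by rw [sub_self]; exact hYone, ?_⟩
            rw [h.comp_same (h.comp_mem _ _)]; rfl
          · rw [h.comp_ne hk (h.comp_mem _ _)]
            exact ⟨0, zero_mem _, by simp⟩
        rw [hb, Submodule.mem_bot] at this
        exact hk₀ this
    have hgen : ∀ k, ∀ v ∈ Tk k, ∃ y ∈ Y (k - k₀), y (h.comp k₀ w) = v := by
      intro k v hv
      have : v ∈ Q := hQ ▸ Submodule.mem_top
      obtain ⟨y, hy, hy'⟩ := this k
      exact ⟨y, hy, by rw [hy', h.comp_same hv]⟩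
    have hF : ∀ k, ∃ φ : Tk k →ₗ[ℂ] T, ∀ y ∈ Y (k - k₀), ∀ hm : y (h.comp k₀ w) ∈ Tk k,
        φ ⟨y (h.comp k₀ w), hm⟩ = y (h.comp k₁ w) := by
      intro k
      have hm : ∀ y : Y (k - k₀), (y : Module.End ℂ T) (h.comp k₀ w) ∈ Tk k := fun y => by
        simpa using y.2.1 _ _ (h.comp_mem k₀ w)
      obtain ⟨φ, hφ⟩ := exists_factor
        (((LinearMap.applyₗ (h.comp k₀ w)) ∘ₗ (Y (k - k₀)).subtype).codRestrict (Tk k) hm)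
        (fun v => by
          obtain ⟨y, hy, hy'⟩ := hgen k v v.2
          exact ⟨⟨y, hy⟩, Subtype.ext hy'⟩)
        ((LinearMap.applyₗ (h.comp k₁ w)) ∘ₗ (Y (k - k₀)).subtype)
        (fun y hy => key _ y y.2 (congrArg Subtype.val hy))
      exact ⟨φ, fun y hy _ => hφ ⟨y, hy⟩⟩
    choose φ hφ using hF
    let b : Module.End ℂ T := h.lift φ
    have hb : ∀ e, ∀ y ∈ Y e, b (y (h.comp k₀ w)) = y (h.comp k₁ w) := by
      intro e y hy
      have hm : y (h.comp k₀ w) ∈ Tk (k₀ + e) := hy.1 _ _ (h.comp_mem k₀ w)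
      simp only [b]
      rw [h.lift_apply _ hm]
      exact hφ _ y (by rwa [add_sub_cancel_left]) hm
    have hbY : ∀ d, ∀ z ∈ Y d, Commute b z := by
      intro d z hz
      refine h.ext_hom fun k v hv => ?_
      obtain ⟨y, hy, rfl⟩ := hgen k v hv
      rw [Module.End.mul_apply, Module.End.mul_apply, hb _ y hy, ← Module.End.mul_apply z y,
        hb _ _ (hYmul hz hy), Module.End.mul_apply]
    have hb0 : b ≠ 0 := by
      intro h0
      have := hb 0 1 hYone
      rw [h0] at this
      exact hk₁ this.symm
    have hbd : HasDegree Tk b (k₁ - k₀) := by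
      intro k v hv
      obtain ⟨y, hy, rfl⟩ := hgen k v hv
      rw [hb _ y hy]
      have := hy.1 _ _ (h.comp_mem k₁ w)
      rwa [show k₁ + (k - k₀) = k + (k₁ - k₀) by abel] at this
    have := L.mem_of_commute b _ hbd (fun s hs => (hYS s hs).elim fun d hd => hbY d s hd)
      (fun a ha => hbY a _ (hYc a ha)) hb0
    refine hk10 ?_
    rw [← hsr k₀ hk₀, ← hsr k₁ hk₁, L.rep_eq_iff, eq_comm, QuotientAddGroup.eq, neg_add_eq_sub]
    exact this

end LoopData

end LoopData

/-! ### Irreducible modules for two commuting actions are tensor products -/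

section Tensor

variable {W : Type*} [AddCommGroup W] [Module ℂ W]

/-- A family of operators without proper stable subspaces. -/
def IsSimpleFamily {X : Type*} (ρ : X → Module.End ℂ W) : Prop :=
  ∀ N : Submodule ℂ W, (∀ x, ∀ v ∈ N, ρ x v ∈ N) → N = ⊥ ∨ N = ⊤

lemma IsSimpleFamily.conj {X : Type*} {ρ : X → Module.End ℂ W} (h : IsSimpleFamily ρ)
    {W' : Type*} [AddCommGroup W'] [Module ℂ W'] (f : W ≃ₗ[ℂ] W') :
    IsSimpleFamily fun x => f.conj (ρ x) := by
  intro N hN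
  rcases h (N.comap f.toLinearMap) (fun x v hv => by
    have := hN x _ hv
    simpa [LinearEquiv.conj_apply] using this) with h | h
  · left
    rw [eq_bot_iff]
    intro v hv
    have : f.symm v ∈ N.comap f.toLinearMap := by simpa using hv
    rw [h, Submodule.mem_bot] at this
    simpa using this
  · right
    rw [eq_top_iff]
    intro v _
    have : f.symm v ∈ N.comap f.toLinearMap := h ▸ Submodule.mem_top
    simpa using this

/-- Schur's lemma. -/
lemma IsSimpleFamily.exists_eq_smul [FiniteDimensional ℂ W] [Nontrivial W] {X : Type*}
    {ρ : X → Module.End ℂ W} (h : IsSimpleFamily ρ) {θ : Module.End ℂ W}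
    (hθ : ∀ x v, θ (ρ x v) = ρ x (θ v)) : ∃ a : ℂ, ∀ v, θ v = a • v := by
  obtain ⟨a, ha⟩ := Module.End.exists_eigenvalue θ
  refine ⟨a, fun v => ?_⟩
  have := (h (θ.eigenspace a) fun x v hv => by
    rw [Module.End.mem_eigenspace_iff] at *
    rw [hθ, hv, map_smul]).resolve_left ha
  have hv : v ∈ θ.eigenspace a := this ▸ Submodule.mem_top
  exact Module.End.mem_eigenspace_iff.mp hv

section Hom

variable {X : Type*} (ρ : X → Module.End ℂ W) {V₁ : Type*} [AddCommGroup V₁] [Module ℂ V₁]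
  (r : X → Module.End ℂ V₁)

/-- The intertwining operators between two families. -/
def homSpace : Submodule ℂ (V₁ →ₗ[ℂ] W) where
  carrier := {φ | ∀ x v, φ (r x v) = ρ x (φ v)}
  zero_mem' x v := by simp
  add_mem' ha hb x v := by rw [LinearMap.add_apply, ha, hb, LinearMap.add_apply, map_add]
  smul_mem' a φ h x v := by rw [LinearMap.smul_apply, h, LinearMap.smul_apply, map_smul]

variable {ρ r}

lemma homSpace_sum_eq_zero [FiniteDimensional ℂ V₁] [Nontrivial V₁] (hr : IsSimpleFamily r)
    {κ : Type*} {φ : κ → homSpace ρ r} (hφ : LinearIndependent ℂ φ) (s : Finset κ) :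
    ∀ v : κ → V₁, ∑ i ∈ s, (φ i : V₁ →ₗ[ℂ] W) (v i) = 0 → ∀ i ∈ s, v i = 0 := by
  classical
  induction s using Finset.induction_on with
  | empty => simp
  | insert a s ha ih =>
    intro v hv
    rw [Finset.sum_insert ha] at hv
    let N : Submodule ℂ V₁ :=
      { carrier := {u | ∃ w : κ → V₁, (φ a : V₁ →ₗ[ℂ] W) u = ∑ i ∈ s, (φ i : V₁ →ₗ[ℂ] W) (w i)}
        zero_mem' := ⟨0, by simp⟩
        add_mem' := fun ⟨w, hw⟩ ⟨w', hw'⟩ => ⟨w + w', by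
          simp only [Pi.add_apply, map_add, Finset.sum_add_distrib, hw, hw']⟩
        smul_mem' := fun c u ⟨w, hw⟩ => ⟨c • w, by
          simp only [Pi.smul_apply, map_smul, hw, Finset.smul_sum]⟩ }
    rcases hr N (fun x u ⟨w, hw⟩ => ⟨fun i => r x (w i), by
      rw [(φ a).2, hw, map_sum]
      exact Finset.sum_congr rfl fun i _ => ((φ i).2 x (w i)).symm⟩) with hN | hN
    · have h1 : v a ∈ N := ⟨fun i => -v i, by
        simp only [map_neg, Finset.sum_neg_distrib]
        exact eq_neg_of_add_eq_zero_left hv⟩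
      rw [hN, Submodule.mem_bot] at h1
      rw [h1, map_zero, zero_add] at hv
      intro i hi
      rcases Finset.mem_insert.mp hi with rfl | hi
      · exact h1
      · exact ih v hv i hi
    · exfalso
      have hall : ∀ u, ∃ w : κ → V₁, (φ a : V₁ →ₗ[ℂ] W) u = ∑ i ∈ s, (φ i : V₁ →ₗ[ℂ] W) (w i) :=
        fun u => (hN ▸ Submodule.mem_top : u ∈ N)
      choose w hw using hall
      have huniq : ∀ u (w' : κ → V₁), (φ a : V₁ →ₗ[ℂ] W) u = ∑ i ∈ s, (φ i : V₁ →ₗ[ℂ] W) (w' i) →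
          ∀ i ∈ s, w u i = w' i := by
        intro u w' hw' i hi
        rw [← sub_eq_zero]
        refine ih (fun i => w u i - w' i) ?_ i hi
        simp only [map_sub, Finset.sum_sub_distrib]
        rw [← hw, ← hw', sub_self]
      have hsc : ∀ i, ∃ c : ℂ, i ∈ s → ∀ u, w u i = c • u := by
        intro i
        by_cases hi : i ∈ s
        · let θ : Module.End ℂ V₁ :=
            { toFun := fun u => w u i
              map_add' := fun u u' => huniq _ (fun i => w u i + w u' i) (by
                simp only [map_add, Finset.sum_add_distrib, ← hw]) i hi
              map_smul' := fun c u => huniq _ (fun i => c • w u i) (by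
                simp only [map_smul, ← Finset.smul_sum, ← hw]) i hi }
          obtain ⟨c, hc⟩ := hr.exists_eq_smul (θ := θ) fun x u =>
            huniq _ (fun i => r x (w u i)) (by
              rw [(φ a).2, hw, map_sum]
              exact Finset.sum_congr rfl fun i _ => ((φ i).2 x _).symm) i hi
          exact ⟨c, fun _ => hc⟩
        · exact ⟨0, fun h => absurd h hi⟩
      choose c hc using hsc
      have hlin : φ a = ∑ i ∈ s, c i • φ i := by
        refine Subtype.ext (LinearMap.ext fun u => ?_)
        rw [hw]
        simp only [Submodule.coe_sum, Submodule.coe_smul, LinearMap.sum_apply, LinearMap.smul_apply]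
        exact Finset.sum_congr rfl fun i hi => by rw [hc i hi, map_smul]
      have := hφ.notMem_span_image (s := (s : Set κ)) (x := a) (by simpa using ha)
      rw [hlin] at this
      exact this (sum_mem fun i hi => Submodule.smul_mem _ _ (Submodule.subset_span ⟨i, hi, rfl⟩))

variable (ρ r)

/-- The evaluation map. -/
noncomputable def homEval : V₁ ⊗[ℂ] homSpace ρ r →ₗ[ℂ] W :=
  TensorProduct.lift (homSpace ρ r).subtype.flip

@[simp] lemma homEval_tmul (v : V₁) (φ : homSpace ρ r) :
    homEval ρ r (v ⊗ₜ φ) = (φ : V₁ →ₗ[ℂ] W) v := rfl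

variable {ρ r}

lemma homEval_injective [FiniteDimensional ℂ W] [FiniteDimensional ℂ V₁] [Nontrivial V₁]
    (hr : IsSimpleFamily r) : Function.Injective (homEval ρ r) := by
  rw [injective_iff_map_eq_zero]
  intro x hx
  obtain ⟨c, rfl⟩ := TensorProduct.eq_repr_basis_right (Module.finBasis ℂ (homSpace ρ r)) x
  rw [Finsupp.sum, map_sum] at hx
  rw [Finsupp.sum]
  refine Finset.sum_eq_zero fun i hi => ?_
  rw [homSpace_sum_eq_zero hr (Module.finBasis ℂ (homSpace ρ r)).linearIndependent _ c hx i hi,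
    TensorProduct.zero_tmul]

lemma homEval_rTensor (x : X) (z : V₁ ⊗[ℂ] homSpace ρ r) :
    homEval ρ r ((r x).rTensor _ z) = ρ x (homEval ρ r z) := by
  have : homEval ρ r ∘ₗ (r x).rTensor _ = ρ x ∘ₗ homEval ρ r :=
    TensorProduct.ext' fun v φ => φ.2 x v
  exact LinearMap.congr_fun this z

/-- Composition with an operator commuting with the family. -/
noncomputable def homComp (y : Module.End ℂ W) (hy : ∀ x v, y (ρ x v) = ρ x (y v)) :
    Module.End ℂ (homSpace ρ r) :=
  ((LinearMap.compRight ℂ y) ∘ₗ (homSpace ρ r).subtype).codRestrict _ fun φ x v => by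
    change y ((φ : V₁ →ₗ[ℂ] W) (r x v)) = ρ x (y ((φ : V₁ →ₗ[ℂ] W) v))
    rw [φ.2, hy]

lemma homComp_apply (y : Module.End ℂ W) (hy : ∀ x v, y (ρ x v) = ρ x (y v)) (φ : homSpace ρ r)
    (v : V₁) : (homComp y hy φ : V₁ →ₗ[ℂ] W) v = y ((φ : V₁ →ₗ[ℂ] W) v) := rfl

lemma homEval_lTensor (y : Module.End ℂ W) (hy : ∀ x v, y (ρ x v) = ρ x (y v))
    (z : V₁ ⊗[ℂ] homSpace ρ r) : homEval ρ r ((homComp y hy).lTensor _ z) = y (homEval ρ r z) := by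
  have : homEval ρ r ∘ₗ (homComp y hy).lTensor _ = y ∘ₗ homEval ρ r :=
    TensorProduct.ext' fun v φ => rfl
  exact LinearMap.congr_fun this z

end Hom

/-- Projections determine a grading. -/
lemma isGrading_of_proj {Q : Type*} [Fintype Q] {Wq : Q → Submodule ℂ W} (P : Q → Module.End ℂ W)
    (hmem : ∀ q v, P q v ∈ Wq q) (hsame : ∀ q, ∀ v ∈ Wq q, P q v = v)
    (hne : ∀ q q', q ≠ q' → ∀ v ∈ Wq q, P q' v = 0) (hsum : ∀ v, v = ∑ q, P q v) :
    IsGrading Wq where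
  indep := by
    intro q
    rw [Submodule.disjoint_def]
    intro v hv hv'
    have : (⨆ (j) (_ : j ≠ q), Wq j) ≤ LinearMap.ker (P q) :=
      iSup₂_le fun j hj w hw => hne j q hj w hw
    rw [← hsame q v hv]
    exact this hv'
  iSup_eq := by
    rw [eq_top_iff]
    intro v _
    rw [hsum v]
    exact sum_mem fun q _ => Submodule.mem_iSup_of_mem q (hmem q v)

variable {L₁ L₂ : Type*} [LieRing L₁] [LieAlgebra ℂ L₁] [LieRing L₂] [LieAlgebra ℂ L₂]

/-- A decomposition of a graded module with two commuting actions as a tensor product of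
irreducible modules, the second of which is graded. -/
structure TensorDecomp (ρ₁ : L₁ →ₗ⁅ℂ⁆ Module.End ℂ W) (ρ₂ : L₂ →ₗ⁅ℂ⁆ Module.End ℂ W) {Q : Type*}
    (Wq : Q → Submodule ℂ W) (V₁ V₂ : Type*) [AddCommGroup V₁] [Module ℂ V₁] [AddCommGroup V₂]
    [Module ℂ V₂] where
  r₁ : L₁ →ₗ⁅ℂ⁆ Module.End ℂ V₁
  r₂ : L₂ →ₗ⁅ℂ⁆ Module.End ℂ V₂
  gr : Q → Submodule ℂ V₂
  e : V₁ ⊗[ℂ] V₂ ≃ₗ[ℂ] W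
  simple₁ : IsSimpleFamily r₁
  simple₂ : IsSimpleFamily r₂
  isGrading : IsGrading gr
  map_r₁ : ∀ x z, e ((r₁ x).rTensor V₂ z) = ρ₁ x (e z)
  map_r₂ : ∀ y z, e ((r₂ y).lTensor V₁ z) = ρ₂ y (e z)
  mem_iff : ∀ q z, e z ∈ Wq q ↔ z ∈ LinearMap.range ((gr q).subtype.lTensor V₁)
  shift : ∀ y q q', (∀ w ∈ Wq q, ρ₂ y w ∈ Wq q') → ∀ v ∈ gr q, r₂ y v ∈ gr q'

lemma lieHom_conj_lie {V V' : Type*} [AddCommGroup V] [Module ℂ V] [AddCommGroup V'] [Module ℂ V']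
    (f : V ≃ₗ[ℂ] V') (a b : Module.End ℂ V) : f.conj (a * b - b * a) =
      f.conj a * f.conj b - f.conj b * f.conj a := by
  ext v
  simp [LinearEquiv.conj_apply]

/-- Transport of a representation along a linear equivalence. -/
noncomputable def lieHomConj {V V' : Type*} [AddCommGroup V] [Module ℂ V] [AddCommGroup V']
    [Module ℂ V'] (f : V ≃ₗ[ℂ] V') (r : L₁ →ₗ⁅ℂ⁆ Module.End ℂ V) : L₁ →ₗ⁅ℂ⁆ Module.End ℂ V' where
  toFun x := f.conj (r x)
  map_add' x y := by rw [map_add, map_add]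
  map_smul' a x := by rw [map_smul, map_smul]; rfl
  map_lie' {x y} := by
    rw [LieHom.map_lie, end_lie_eq, end_lie_eq, lieHom_conj_lie]

lemma lTensor_range_congr {V₁ V₂ V₁' V₂' : Type*} [AddCommGroup V₁] [Module ℂ V₁] [AddCommGroup V₂]
    [Module ℂ V₂] [AddCommGroup V₁'] [Module ℂ V₁'] [AddCommGroup V₂'] [Module ℂ V₂']
    (f₁ : V₁ ≃ₗ[ℂ] V₁') (f₂ : V₂ ≃ₗ[ℂ] V₂') (U : Submodule ℂ V₂) (z : V₁ ⊗[ℂ] V₂)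
    (hz : z ∈ LinearMap.range (U.subtype.lTensor V₁)) : TensorProduct.congr f₁ f₂ z ∈
      LinearMap.range ((U.map f₂.toLinearMap).subtype.lTensor V₁') := by
  obtain ⟨z, rfl⟩ := hz
  induction z using TensorProduct.induction_on with
  | zero => simp
  | tmul a b =>
    exact ⟨f₁ a ⊗ₜ ⟨f₂ b, Submodule.mem_map_of_mem b.2⟩, by simp⟩
  | add a b ha hb => rw [map_add, map_add]; exact add_mem ha hb

/-- Transport of a tensor decomposition along linear equivalences. -/
noncomputable def TensorDecomp.congr {ρ₁ : L₁ →ₗ⁅ℂ⁆ Module.End ℂ W} {ρ₂ : L₂ →ₗ⁅ℂ⁆ Module.End ℂ W}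
    {Q : Type*} {Wq : Q → Submodule ℂ W} {V₁ V₂ V₁' V₂' : Type*} [AddCommGroup V₁] [Module ℂ V₁]
    [AddCommGroup V₂] [Module ℂ V₂] [AddCommGroup V₁'] [Module ℂ V₁'] [AddCommGroup V₂']
    [Module ℂ V₂'] (t : TensorDecomp ρ₁ ρ₂ Wq V₁ V₂) (f₁ : V₁ ≃ₗ[ℂ] V₁') (f₂ : V₂ ≃ₗ[ℂ] V₂') :
    TensorDecomp ρ₁ ρ₂ Wq V₁' V₂' where
  r₁ := lieHomConj f₁ t.r₁
  r₂ := lieHomConj f₂ t.r₂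
  gr q := (t.gr q).map f₂.toLinearMap
  e := (TensorProduct.congr f₁ f₂).symm ≪≫ₗ t.e
  simple₁ := t.simple₁.conj f₁
  simple₂ := t.simple₂.conj f₂
  isGrading :=
    { indep := t.isGrading.indep.map_orderIso (Submodule.orderIsoMapComap f₂)
      iSup_eq := by
        rw [← Submodule.map_iSup, t.isGrading.iSup_eq, Submodule.map_top, LinearEquiv.range] }
  map_r₁ x z := by
    have h : (TensorProduct.congr f₁ f₂).symm.toLinearMap ∘ₗ (f₁.conj (t.r₁ x)).rTensor V₂' =
        (t.r₁ x).rTensor V₂ ∘ₗ (TensorProduct.congr f₁ f₂).symm.toLinearMap :=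
      TensorProduct.ext' fun a b => by simp [LinearEquiv.conj_apply]
    have := LinearMap.congr_fun h z
    rw [LinearEquiv.trans_apply, LinearEquiv.trans_apply, ← t.map_r₁]
    exact congrArg t.e this
  map_r₂ y z := by
    have h : (TensorProduct.congr f₁ f₂).symm.toLinearMap ∘ₗ (f₂.conj (t.r₂ y)).lTensor V₁' =
        (t.r₂ y).lTensor V₁ ∘ₗ (TensorProduct.congr f₁ f₂).symm.toLinearMap :=
      TensorProduct.ext' fun a b => by simp [LinearEquiv.conj_apply]
    have := LinearMap.congr_fun h z
    rw [LinearEquiv.trans_apply, LinearEquiv.trans_apply, ← t.map_r₂]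
    exact congrArg t.e this
  mem_iff q z := by
    rw [LinearEquiv.trans_apply, t.mem_iff]
    constructor
    · intro h
      have := lTensor_range_congr f₁ f₂ _ _ h
      rwa [LinearEquiv.apply_symm_apply] at this
    · intro h
      have := lTensor_range_congr f₁.symm f₂.symm _ _ h
      have e : ((t.gr q).map f₂.toLinearMap).map f₂.symm.toLinearMap = t.gr q := by
        rw [← Submodule.map_comp, LinearEquiv.comp_coe, LinearEquiv.self_trans_symm,
          LinearEquiv.refl_toLinearMap, Submodule.map_id]
      rw [e] at this
      exact this
  shift y q q' h := by
    rintro _ ⟨v, hv, rfl⟩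
    refine ⟨t.r₂ y v, t.shift y q q' h v hv, ?_⟩
    change f₂ (t.r₂ y v) = f₂.conj (t.r₂ y) (f₂ v)
    simp [LinearEquiv.conj_apply]

variable [FiniteDimensional ℂ W] [Nontrivial W]

/-- A minimal nonzero stable subspace. -/
lemma exists_simple_submodule {X : Type*} (ρ : X → Module.End ℂ W) : ∃ V₁ : Submodule ℂ W, V₁ ≠ ⊥ ∧
    ∃ h : ∀ x, ∀ v ∈ V₁, ρ x v ∈ V₁, IsSimpleFamily fun x => (ρ x).restrict (h x) := by
  obtain ⟨V₁, ⟨hne, hst⟩, hmin⟩ := exists_minimalFor_of_wellFoundedLT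
    (fun N : Submodule ℂ W => N ≠ ⊥ ∧ ∀ x, ∀ v ∈ N, ρ x v ∈ N) id ⟨⊤, top_ne_bot, fun _ _ _ => trivial⟩
  refine ⟨V₁, hne, hst, fun N hN => ?_⟩
  by_cases hb : N = ⊥
  · exact Or.inl hb
  right
  have h1 : N.map V₁.subtype ≤ V₁ := Submodule.map_subtype_le V₁ N
  have h2 := hmin (j := N.map V₁.subtype) ⟨fun h => hb ?_, ?_⟩ h1
  · rw [eq_top_iff]
    rintro v -
    obtain ⟨w, hw, hwv⟩ := h2 v.2
    have : w = v := Subtype.ext hwv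
    exact this ▸ hw
  · exact Submodule.map_injective_of_injective V₁.injective_subtype (h.trans (Submodule.map_bot _).symm)
  · rintro x _ ⟨v, hv, rfl⟩
    exact ⟨_, hN x v hv, rfl⟩

omit [FiniteDimensional ℂ W] [Nontrivial W] in
lemma eq_top_of_lTensor_surjective {V₁ H : Type*} [AddCommGroup V₁] [Module ℂ V₁] [AddCommGroup H]
    [Module ℂ H] [FiniteDimensional ℂ V₁] [Nontrivial V₁] [FiniteDimensional ℂ H]
    (N : Submodule ℂ H) (h : Function.Surjective (N.subtype.lTensor V₁)) : N = ⊤ := by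
  have h2 := LinearMap.finrank_le_finrank_of_surjective h
  rw [Module.finrank_tensorProduct, Module.finrank_tensorProduct] at h2
  have h3 : 0 < Module.finrank ℂ V₁ := Module.finrank_pos
  exact Submodule.eq_top_of_finrank_eq (le_antisymm (Submodule.finrank_le N)
    (Nat.le_of_mul_le_mul_left h2 h3))

/-- A module which is irreducible for two commuting actions is a tensor product. -/
theorem exists_tensorDecomp (ρ₁ : L₁ →ₗ⁅ℂ⁆ Module.End ℂ W) (ρ₂ : L₂ →ₗ⁅ℂ⁆ Module.End ℂ W)
    (hcomm : ∀ x y v, ρ₂ y (ρ₁ x v) = ρ₁ x (ρ₂ y v))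
    (hirr : ∀ N : Submodule ℂ W, (∀ x, ∀ v ∈ N, ρ₁ x v ∈ N) → (∀ y, ∀ v ∈ N, ρ₂ y v ∈ N) →
      N = ⊥ ∨ N = ⊤) {Q : Type*} [AddCommGroup Q] [Finite Q] (Wq : Q → Submodule ℂ W)
    (hq : IsGrading Wq) (hρ₁ : ∀ x q, ∀ v ∈ Wq q, ρ₁ x v ∈ Wq q) :
    ∃ d₁ d₂ : ℕ, 0 < d₁ ∧ 0 < d₂ ∧
      Nonempty (TensorDecomp ρ₁ ρ₂ Wq (Fin d₁ → ℂ) (Fin d₂ → ℂ)) := by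
  classical
  have := Fintype.ofFinite Q
  obtain ⟨V₁, hne, hst, hsimple⟩ := exists_simple_submodule (fun x => ρ₁ x)
  have hV₁ : Nontrivial V₁ := Submodule.nontrivial_iff_ne_bot.mpr hne
  let r : L₁ → Module.End ℂ V₁ := fun x => (ρ₁ x).restrict (hst x)
  let H := homSpace (fun x => ρ₁ x) r
  let ev := homEval (fun x => ρ₁ x) r
  have hinj : Function.Injective ev := homEval_injective hsimple
  let j : H := ⟨V₁.subtype, fun x v => rfl⟩
  have hsurj : ∀ N : Submodule ℂ H, (∀ y, ∀ φ ∈ N, homComp (ρ₂ y) (fun x v => hcomm x y v) φ ∈ N) →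
      N = ⊥ ∨ LinearMap.range (ev ∘ₗ N.subtype.lTensor V₁) = ⊤ := by
    intro N hN
    rcases hirr (LinearMap.range (ev ∘ₗ N.subtype.lTensor V₁)) (by
        rintro x _ ⟨z, rfl⟩
        refine ⟨(r x).rTensor _ z, ?_⟩
        rw [LinearMap.comp_apply, LinearMap.comp_apply,
          ← homEval_rTensor (ρ := fun x => ρ₁ x) (r := r) x]
        congr 1
        rw [← LinearMap.comp_apply, ← LinearMap.comp_apply, LinearMap.lTensor_comp_rTensor,
          LinearMap.rTensor_comp_lTensor]) (by
        rintro y _ ⟨z, rfl⟩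
        let c := homComp (ρ := fun x => ρ₁ x) (r := r) (ρ₂ y) (fun x v => hcomm x y v)
        refine ⟨(c.restrict (hN y)).lTensor _ z, ?_⟩
        rw [LinearMap.comp_apply, LinearMap.comp_apply,
          ← homEval_lTensor (ρ := fun x => ρ₁ x) (r := r) _ (fun x v => hcomm x y v)]
        congr 1
        rw [← LinearMap.comp_apply, ← LinearMap.comp_apply, ← LinearMap.lTensor_comp,
          ← LinearMap.lTensor_comp]
        rfl) with h | h
    · left
      rw [eq_bot_iff]
      intro φ hφ
      rw [Submodule.mem_bot]
      refine Subtype.ext (LinearMap.ext fun v => ?_)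
      have : (φ : V₁ →ₗ[ℂ] W) v ∈ LinearMap.range (ev ∘ₗ N.subtype.lTensor V₁) :=
        ⟨v ⊗ₜ ⟨φ, hφ⟩, rfl⟩
      rw [h, Submodule.mem_bot] at this
      exact this
    · exact Or.inr h
  have hj : j ≠ 0 := by
    intro h
    obtain ⟨v, hv⟩ := exists_ne (0 : V₁)
    have := LinearMap.congr_fun (congrArg Subtype.val h) v
    exact hv (Subtype.ext this)
  have hH : Nontrivial H := ⟨⟨j, 0, hj⟩⟩
  have hevs : Function.Surjective ev := by
    have := (hsurj ⊤ fun _ _ _ => trivial).resolve_left top_ne_bot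
    rw [← LinearMap.range_eq_top, eq_top_iff, ← this]
    exact LinearMap.range_comp_le_range _ _
  let r₁ : L₁ →ₗ⁅ℂ⁆ Module.End ℂ V₁ :=
    { toFun := r
      map_add' := fun x y => by ext v; simp [r]
      map_smul' := fun a x => by ext v; simp [r]
      map_lie' := fun {x y} => by
        rw [end_lie_eq]
        ext v
        have := LinearMap.congr_fun ((LieHom.map_lie ρ₁ x y).trans (end_lie_eq _ _)) (v : W)
        exact this }
  let r₂ : L₂ →ₗ⁅ℂ⁆ Module.End ℂ H :=
    { toFun := fun y => homComp (ρ₂ y) (fun x v => hcomm x y v)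
      map_add' := fun x y => by
        ext φ v
        simp [homComp_apply]
      map_smul' := fun a x => by
        ext φ v
        simp [homComp_apply]
      map_lie' := fun {x y} => by
        rw [end_lie_eq]
        ext φ v
        have := LinearMap.congr_fun ((LieHom.map_lie ρ₂ x y).trans (end_lie_eq _ _))
          ((φ : V₁ →ₗ[ℂ] W) v)
        exact this }
  have hpc : ∀ q x v, hq.comp q (ρ₁ x v) = ρ₁ x (hq.comp q v) := by
    intro q x v
    have := hq.apply_comp (y := ρ₁ x) (d := 0) (fun k v hv => by simpa using hρ₁ x k v hv) q v
    rw [add_zero] at this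
    exact this.symm
  let P : Q → Module.End ℂ H := fun q => homComp (hq.comp q) (fun x v => hpc q x v)
  let gr : Q → Submodule ℂ H := fun q =>
    { carrier := {φ | ∀ v, (φ : V₁ →ₗ[ℂ] W) v ∈ Wq q}
      zero_mem' := fun v => zero_mem _
      add_mem' := fun ha hb v => add_mem (ha v) (hb v)
      smul_mem' := fun a φ h v => Submodule.smul_mem _ a (h v) }
  have hPmem : ∀ q φ, P q φ ∈ gr q := fun q φ v => hq.comp_mem q _
  let t : TensorDecomp ρ₁ ρ₂ Wq V₁ H :=
    { r₁ := r₁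
      r₂ := r₂
      gr := gr
      e := LinearEquiv.ofBijective ev ⟨hinj, hevs⟩
      simple₁ := hsimple
      simple₂ := by
        intro N hN
        rcases hsurj N hN with h | h
        · exact Or.inl h
        right
        have h1 : Function.Surjective (N.subtype.lTensor V₁) := by
          intro z
          have : ev z ∈ LinearMap.range (ev ∘ₗ N.subtype.lTensor V₁) := h ▸ Submodule.mem_top
          obtain ⟨z', hz'⟩ := this
          exact ⟨z', hinj hz'⟩
        exact eq_top_of_lTensor_surjective N h1
      isGrading := by
        refine isGrading_of_proj P hPmem (fun q φ hφ => ?_) (fun q q' hqq φ hφ => ?_) fun φ => ?_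
        · exact Subtype.ext (LinearMap.ext fun v => hq.comp_same (hφ v))
        · exact Subtype.ext (LinearMap.ext fun v => hq.comp_ne hqq (hφ v))
        · refine Subtype.ext (LinearMap.ext fun v => ?_)
          rw [Submodule.coe_sum, LinearMap.sum_apply]
          exact hq.eq_sum (F := Finset.univ) fun k hk => absurd (Finset.mem_univ k) hk
      map_r₁ := fun x z => homEval_rTensor (ρ := fun x => ρ₁ x) (r := r) x z
      map_r₂ := fun y z => homEval_lTensor (ρ := fun x => ρ₁ x) (r := r) _ (fun x v => hcomm x y v) z
      mem_iff := by
        intro q z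
        constructor
        · intro hz
          have h1 : (P q).lTensor V₁ z = z := hinj (by
            rw [homEval_lTensor (ρ := fun x => ρ₁ x) (r := r) _ (fun x v => hpc q x v)]
            exact hq.comp_same hz)
          rw [← h1]
          refine ⟨((P q).codRestrict (gr q) (hPmem q)).lTensor V₁ z, ?_⟩
          rw [← LinearMap.comp_apply, ← LinearMap.lTensor_comp]
          rfl
        · rintro ⟨z, rfl⟩
          change ev _ ∈ Wq q
          induction z using TensorProduct.induction_on with
          | zero => simp
          | tmul v φ => exact φ.2 v
          | add a b ha hb => rw [map_add, map_add]; exact add_mem ha hb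
      shift := fun y q q' h φ hφ v => h _ (hφ v) }
  exact ⟨_, _, Module.finrank_pos, Module.finrank_pos,
    ⟨t.congr (Module.finBasis ℂ V₁).equivFun (Module.finBasis ℂ H).equivFun⟩⟩

end Tensor

/-! ### Realization of current modules -/

section Realization

/-- A representation of `gl_n` from operators satisfying the relations of the matrix units. -/
noncomputable def glHom {n : ℕ} {W : Type*} [AddCommGroup W] [Module ℂ W]
    (e : Fin n → Fin n → Module.End ℂ W)
    (he : ∀ j i l k, e j i * e l k = e l k * e j i + (if i = l then e j k else 0) -
      (if k = j then e l i else 0)) : Matrix (Fin n) (Fin n) ℂ →ₗ⁅ℂ⁆ Module.End ℂ W where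
  toFun M := ∑ j, ∑ i, M j i • e j i
  map_add' M N := by simp only [Matrix.add_apply, add_smul, Finset.sum_add_distrib]
  map_smul' a M := by
    simp only [Matrix.smul_apply, smul_assoc, ← Finset.smul_sum, RingHom.id_apply]
  map_lie' {M N} := by
    rw [end_lie_eq, LieRing.of_associative_ring_bracket]
    have key : (∑ j, ∑ i, M j i • e j i) * (∑ l, ∑ k, N l k • e l k) -
        (∑ l, ∑ k, N l k • e l k) * (∑ j, ∑ i, M j i • e j i) =
        ∑ j, ∑ i, ∑ l, ∑ k, ((M j i * N l k) • (if i = l then e j k else 0) -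
          (M j i * N l k) • (if k = j then e l i else 0)) := by
      have h1 : (∑ l, ∑ k, N l k • e l k) * (∑ j, ∑ i, M j i • e j i) =
          ∑ j, ∑ i, ∑ l, ∑ k, (M j i * N l k) • (e l k * e j i) := by
        simp only [Finset.mul_sum]
        refine Finset.sum_congr rfl fun j _ => Finset.sum_congr rfl fun i _ => ?_
        simp only [Finset.sum_mul]
        refine Finset.sum_congr rfl fun l _ => Finset.sum_congr rfl fun k _ => ?_
        rw [smul_mul_smul_comm, mul_comm]
      have h2 : (∑ j, ∑ i, M j i • e j i) * (∑ l, ∑ k, N l k • e l k) =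
          ∑ j, ∑ i, ∑ l, ∑ k, (M j i * N l k) • (e j i * e l k) := by
        simp only [Finset.sum_mul]
        refine Finset.sum_congr rfl fun j _ => Finset.sum_congr rfl fun i _ => ?_
        simp only [Finset.mul_sum]
        refine Finset.sum_congr rfl fun l _ => Finset.sum_congr rfl fun k _ => ?_
        rw [smul_mul_smul_comm]
      rw [h1, h2, ← Finset.sum_sub_distrib]
      refine Finset.sum_congr rfl fun j _ => ?_
      rw [← Finset.sum_sub_distrib]
      refine Finset.sum_congr rfl fun i _ => ?_
      rw [← Finset.sum_sub_distrib]
      refine Finset.sum_congr rfl fun l _ => ?_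
      rw [← Finset.sum_sub_distrib]
      refine Finset.sum_congr rfl fun k _ => ?_
      rw [← smul_sub, ← smul_sub, he j i l k]
      congr 1
      abel
    rw [key]
    simp only [Finset.sum_sub_distrib, smul_ite, smul_zero, Matrix.sub_apply, sub_smul]
    congr 1
    · refine Finset.sum_congr rfl fun j _ => ?_
      simp only [Matrix.mul_apply, Finset.sum_smul]
      rw [Finset.sum_comm]
      refine Finset.sum_congr rfl fun i _ => ?_
      rw [Finset.sum_comm]
      simp
    · have : ∀ j i, (∑ l, ∑ k, if k = j then (M j i * N l k) • e l i else 0) =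
          ∑ l, (N l j * M j i) • e l i := fun j i => Finset.sum_congr rfl fun l _ => by
        simp [mul_comm]
      simp only [this, Matrix.mul_apply, Finset.sum_smul]
      rw [Finset.sum_comm]
      conv_rhs => rw [Finset.sum_comm]
      exact Finset.sum_congr rfl fun i _ => Finset.sum_comm

lemma glHom_apply {n : ℕ} {W : Type*} [AddCommGroup W] [Module ℂ W]
    (e : Fin n → Fin n → Module.End ℂ W)
    (he : ∀ j i l k, e j i * e l k = e l k * e j i + (if i = l then e j k else 0) -
      (if k = j then e l i else 0)) (M : Matrix (Fin n) (Fin n) ℂ) :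
    glHom e he M = ∑ j, ∑ i, M j i • e j i := rfl

lemma glHom_single {n : ℕ} {W : Type*} [AddCommGroup W] [Module ℂ W]
    (e : Fin n → Fin n → Module.End ℂ W)
    (he : ∀ j i l k, e j i * e l k = e l k * e j i + (if i = l then e j k else 0) -
      (if k = j then e l i else 0)) (j i : Fin n) : glHom e he (Matrix.single j i 1) = e j i := by
  rw [glHom_apply, Finset.sum_eq_single j, Finset.sum_eq_single i]
  · simp
  · intro b _ hb; simp [Matrix.single_apply, hb.symm]
  · simp
  · intro b _ hb
    exact Finset.sum_eq_zero fun i _ => by simp [Matrix.single_apply, hb.symm]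
  · simp

namespace CurrentRep

variable {n : ℕ} {G : Type*} [LieRing G] [LieAlgebra ℂ G] {T : Type*} [AddCommGroup T]
  [Module ℂ T] (R : CurrentRep n G T)

/-- A realization of a current module on a loop module. -/
structure Realization where
  Γ' : AddSubgroup (Fin n → ℤ)
  mem_Γ' : ∀ a, scaleLat R.m a ∈ Γ'
  d₁ : ℕ
  d₂ : ℕ
  d₁_pos : 0 < d₁
  d₂_pos : 0 < d₂
  r₁ : Matrix (Fin n) (Fin n) ℂ →ₗ⁅ℂ⁆ Module.End ℂ (Fin d₁ → ℂ)
  r₂ : G →ₗ⁅ℂ⁆ Module.End ℂ (Fin d₂ → ℂ)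
  gr : (Fin n → ℤ) ⧸ Γ' → Submodule ℂ (Fin d₂ → ℂ)
  simple₁ : IsSimpleFamily r₁
  simple₂ : IsSimpleFamily r₂
  isGrading : IsGrading gr
  shift : ∀ (l : Fin n → ℤ), ∀ X ∈ R.gr l, ∀ (q : (Fin n → ℤ) ⧸ Γ'), ∀ w ∈ gr q,
    r₂ X w ∈ gr (q + (l : (Fin n → ℤ) ⧸ Γ'))
  Ψ₀ : T →ₗ[ℂ] (Fin d₁ → ℂ) ⊗[ℂ] (Fin d₂ → ℂ)
  eq_zero : ∀ k, ∀ v ∈ R.Tk k, Ψ₀ v = 0 → v = 0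
  mem_range_iff : ∀ (k : Fin n → ℤ) z,
    z ∈ LinearMap.range ((gr (k : (Fin n → ℤ) ⧸ Γ')).subtype.lTensor (Fin d₁ → ℂ)) ↔
      ∃ v ∈ R.Tk k, Ψ₀ v = z
  map_t : ∀ a v, Ψ₀ (R.t a v) = Ψ₀ v
  map_x : ∀ l, ∀ X ∈ R.gr l, ∀ v, Ψ₀ (R.x l X v) = (r₂ X).lTensor _ (Ψ₀ v)
  map_gl : ∀ j i v, (R.m i / R.m j : ℂ) • Ψ₀ (R.glOp j i v) =
    (r₁ (Matrix.single j i 1)).rTensor _ (Ψ₀ v)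

/-- The operators generating the action on a current module. -/
def ops : Set (Module.End ℂ T) :=
  {y | (∃ a, y = R.t a) ∨ (∃ l, ∃ X ∈ R.gr l, y = R.x l X) ∨ ∃ j i, y = R.glOp j i}

lemma scaleLat_injective : Function.Injective (scaleLat R.m) := by
  intro a c h
  funext i
  have := congrFun h i
  have hm := R.m_pos i
  exact mul_left_cancel₀ (by exact_mod_cast hm.ne') this

lemma finite_quotient (Γ' : AddSubgroup (Fin n → ℤ)) (h : ∀ a, scaleLat R.m a ∈ Γ') :
    Finite ((Fin n → ℤ) ⧸ Γ') := by
  refine Finite.of_surjective (α := ∀ i, Fin (R.m i))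
    (fun b => (((fun i => (b i : ℤ)) : Fin n → ℤ) : (Fin n → ℤ) ⧸ Γ')) fun q => ?_
  obtain ⟨k, rfl⟩ := QuotientAddGroup.mk_surjective q
  have hm : ∀ i, (0 : ℤ) < R.m i := fun i => by exact_mod_cast R.m_pos i
  refine ⟨fun i => ⟨(k i % R.m i).toNat, ?_⟩, ?_⟩
  · have := Int.emod_lt_of_pos (k i) (hm i)
    have := Int.emod_nonneg (k i) (hm i).ne'
    omega
  · rw [QuotientAddGroup.eq]
    convert h (fun i => k i / R.m i) using 1
    funext i
    have h1 := Int.emod_nonneg (k i) (hm i).ne'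
    have h2 := Int.emod_add_mul_ediv (k i) (R.m i)
    simp only [Pi.add_apply, Pi.neg_apply, scaleLat]
    rw [Int.toNat_of_nonneg h1]
    linarith

variable [Nontrivial T] (hn : 0 < n)

lemma isGrading : IsGrading R.Tk := ⟨R.indep, R.iSup_eq⟩

include hn in
lemma isGradedSimple : IsGradedSimple R.Tk R.ops where
  toIsGrading := R.isGrading
  finite := R.finite
  degree := by
    rintro y (⟨a, rfl⟩ | ⟨l, X, hX, rfl⟩ | ⟨j, i, rfl⟩)
    · exact ⟨_, R.t_mem a⟩
    · exact ⟨_, R.x_mem l X hX⟩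
    · exact ⟨_, R.glOp_hasDegree j i⟩
  eq_bot_or_eq_top := by
    intro N hN hgr
    refine R.eq_bot_or_eq_top N (fun a => hN _ (Or.inl ⟨a, rfl⟩)) (fun a u v hv => ?_)
      fun l X hX => hN _ (Or.inr (Or.inl ⟨l, X, hX, rfl⟩))
    rw [R.D_eq hn, Module.End.mul_apply]
    refine hN _ (Or.inl ⟨a, rfl⟩) _ ?_
    rw [LinearMap.add_apply]
    refine add_mem ?_ ?_
    · obtain ⟨F, hF⟩ := R.isGrading.exists_finset v
      rw [R.isGrading.eq_sum hF, map_sum]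
      refine sum_mem fun k _ => ?_
      rw [R.D_zero k _ (R.isGrading.comp_mem k v)]
      exact N.smul_mem _ (hgr k v hv)
    · rw [LinearMap.sum_apply]
      refine sum_mem fun i _ => ?_
      rw [LinearMap.sum_apply]
      exact sum_mem fun j _ => N.smul_mem _ (hN _ (Or.inr (Or.inr ⟨j, i, rfl⟩)) v hv)

include hn in
lemma exists_loopData_t : ∃ L : LoopData R.Tk R.ops,
    ∀ a, scaleLat R.m a ∈ L.Γ' ∧ L.c (scaleLat R.m a) = R.t a :=
  (R.isGradedSimple hn).exists_loopData
    { toFun := scaleLat R.m, map_zero' := scaleLat_zero _, map_add' := scaleLat_add _ }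
    R.scaleLat_injective R.t R.t_zero R.t_add R.t_mem (fun a => Or.inl ⟨a, rfl⟩) (by
      rintro a y (⟨c, rfl⟩ | ⟨l, X, hX, rfl⟩ | ⟨j, i, rfl⟩)
      · exact R.t_comm a c
      · exact (R.x_t l X hX a).symm
      · exact (R.glOp_t j i a).symm)

include hn in
theorem exists_realization {Λ : AddSubgroup (Fin n → ℤ)} (hΛ : ∀ l ∈ Λ, ∃ a, l = scaleLat R.m a)
    (hG : IsGrading fun q : (Fin n → ℤ) ⧸ Λ => R.gr q.out) : Nonempty R.Realization := by
  classical
  obtain ⟨L, hL⟩ := R.exists_loopData_t hn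
  have h := R.isGradedSimple hn
  have hfinQ := R.finite_quotient L.Γ' fun a => (hL a).1
  have := Fintype.ofFinite ((Fin n → ℤ) ⧸ L.Γ')
  set π := L.proj h with hπ
  let W : Submodule ℂ T := LinearMap.range π
  have hππ : ∀ v, π (π v) = π v := L.proj_proj h
  have hWπ : ∀ w ∈ W, π w = w := by
    rintro _ ⟨v, rfl⟩
    exact hππ v
  have hπt : ∀ a v, π (R.t a v) = π v := fun a v => by
    rw [← (hL a).2]
    exact L.proj_c h (hL a).1 v
  have hπy : ∀ y ∈ R.ops, ∀ v, π (y (π v)) = π (y v) := fun y hy v =>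
    L.proj_apply_proj h (fun a ha => L.c_comm a ha y hy) v
  have hxS : ∀ l, ∀ X ∈ R.gr l, R.x l X ∈ R.ops := fun l X hX => Or.inr (Or.inl ⟨l, X, hX, rfl⟩)
  have hgS : ∀ j i, R.glOp j i ∈ R.ops := fun j i => Or.inr (Or.inr ⟨j, i, rfl⟩)
  -- the currents
  have hout : ∀ l : Fin n → ℤ, ∃ a, l = (l : (Fin n → ℤ) ⧸ Λ).out + scaleLat R.m a := by
    intro l
    have h1 : ((l : (Fin n → ℤ) ⧸ Λ).out : (Fin n → ℤ) ⧸ Λ) = l := QuotientAddGroup.out_eq' _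
    rw [QuotientAddGroup.eq] at h1
    obtain ⟨a, ha⟩ := hΛ _ h1
    exact ⟨a, by rw [← ha]; abel⟩
  let ρ : G →ₗ[ℂ] Module.End ℂ T := hG.lift fun q =>
    { toFun := fun X => π * R.x q.out X
      map_add' := fun X Y => by
        rw [Submodule.coe_add, R.x_add _ _ X.2 _ Y.2, mul_add]
      map_smul' := fun c X => by
        rw [Submodule.coe_smul, R.x_smul _ _ _ X.2, mul_smul_comm, RingHom.id_apply] }
  have hρ : ∀ l, ∀ X ∈ R.gr l, ρ X = π * R.x l X := by
    intro l X hX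
    obtain ⟨a, ha⟩ := hout l
    set q : (Fin n → ℤ) ⧸ Λ := (l : (Fin n → ℤ) ⧸ Λ)
    have hXq : X ∈ R.gr q.out := by rwa [ha, R.gr_add] at hX
    have h1 : ρ X = π * R.x q.out X := hG.lift_apply _ hXq
    rw [h1, ha, R.x_add_scaleLat hn _ _ hXq]
    ext v
    rw [Module.End.mul_apply, Module.End.mul_apply, Module.End.mul_apply, hπt]
  have hG_ind : ∀ {P : G → Prop}, (∀ l, ∀ X ∈ R.gr l, P X) → P 0 →
      (∀ X Y, P X → P Y → P (X + Y)) → ∀ X, P X := by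
    intro P h1 h2 h3 X
    have hX : X ∈ ⨆ q : (Fin n → ℤ) ⧸ Λ, R.gr q.out := hG.iSup_eq ▸ Submodule.mem_top
    induction hX using Submodule.iSup_induction' with
    | mem q X hX => exact h1 _ X hX
    | zero => exact h2
    | add X Y _ _ hX hY => exact h3 X Y hX hY
  have hρlie : ∀ X Y, ρ ⁅X, Y⁆ = ρ X * ρ Y - ρ Y * ρ X := by
    intro X Y
    refine hG_ind (P := fun X => ρ ⁅X, Y⁆ = ρ X * ρ Y - ρ Y * ρ X) (fun l X hX => ?_) (by simp)
      (fun X X' hX hX' => by rw [add_lie, map_add, hX, hX', map_add, add_mul, mul_add]; abel) X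
    refine hG_ind (P := fun Y => ρ ⁅X, Y⁆ = ρ X * ρ Y - ρ Y * ρ X) (fun k Y hY => ?_) (by simp)
      (fun X X' hX hX' => by rw [lie_add, map_add, hX, hX', map_add, add_mul, mul_add]; abel) Y
    rw [hρ _ _ (R.lie_mem l k X Y hX hY), hρ l X hX, hρ k Y hY]
    ext v
    simp only [LinearMap.sub_apply, Module.End.mul_apply]
    rw [hπy _ (hxS l X hX), hπy _ (hxS k Y hY), ← map_sub]
    congr 1
    have := LinearMap.congr_fun (R.x_x l k X hX Y hY) v
    rw [LinearMap.add_apply, Module.End.mul_apply, Module.End.mul_apply] at this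
    rw [this, add_sub_cancel_left]
  have hρW : ∀ X v, ρ X v ∈ W := by
    intro X v
    refine hG_ind (P := fun X => ρ X v ∈ W) (fun l X hX => ?_) (by simp)
      (fun X X' hX hX' => by rw [map_add, LinearMap.add_apply]; exact add_mem hX hX') X
    rw [hρ l X hX]
    exact ⟨_, rfl⟩
  let ρ₂ : G →ₗ⁅ℂ⁆ Module.End ℂ W :=
    { toFun := fun X => (ρ X).restrict fun v _ => hρW X v
      map_add' := fun X Y => by ext v; simp
      map_smul' := fun a X => by ext v; simp
      map_lie' := fun {X Y} => by
        rw [end_lie_eq]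
        ext v
        exact LinearMap.congr_fun (hρlie X Y) (v : T) }
  -- the matrices
  have hgπ : ∀ j i v, π (R.glOp j i v) = R.glOp j i (π v) := by
    intro j i v
    have : π ∘ₗ R.glOp j i = R.glOp j i ∘ₗ π := h.ext_hom fun k v hv => by
      have hm := R.glOp_hasDegree j i k v hv
      rw [add_zero] at hm
      rw [LinearMap.comp_apply, LinearMap.comp_apply, hπ, L.proj_apply h hv, L.proj_apply h hm]
      exact LinearMap.congr_fun (L.c_comm _ (L.rep_sub_mem k) _ (hgS j i)) v
    exact LinearMap.congr_fun this v
  have hgW : ∀ j i, ∀ v ∈ W, R.glOp j i v ∈ W := by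
    rintro j i _ ⟨v, rfl⟩
    exact ⟨_, hgπ j i v⟩
  have hm : ∀ i, (R.m i : ℂ) ≠ 0 := fun i => by exact_mod_cast (R.m_pos i).ne'
  let e : Fin n → Fin n → Module.End ℂ W := fun j i =>
    (R.m i / R.m j : ℂ) • (R.glOp j i).restrict (hgW j i)
  have he : ∀ j i l k, e j i * e l k = e l k * e j i + (if i = l then e j k else 0) -
      (if k = j then e l i else 0) := by
    intro j i l k
    ext v
    have h1 := LinearMap.congr_fun (R.glOp_glOp hn j i l k) (v : T)
    have h2 : ∀ (j i l k : Fin n) (v : W), ((e j i * e l k) v : T) =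
        ((R.m i / R.m j) * (R.m k / R.m l) : ℂ) • R.glOp j i (R.glOp l k (v : T)) := by
      intro j i l k v
      change (R.m i / R.m j : ℂ) • R.glOp j i ((R.m k / R.m l : ℂ) • R.glOp l k (v : T)) = _
      rw [map_smul, smul_smul]
    have h3 : ∀ (p : Prop) [Decidable p] (j i : Fin n) (v : W), (((if p then e j i else 0) v : W) : T) =
        if p then (R.m i / R.m j : ℂ) • R.glOp j i (v : T) else 0 := by
      intro p _ j i v
      split_ifs <;> rfl
    have h4 : ∀ (p : Prop) [Decidable p] (f : Module.End ℂ T) (v : T), (if p then f else 0) v =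
        if p then f v else 0 := by
      intro p _ f v
      split_ifs <;> rfl
    rw [LinearMap.sub_apply, LinearMap.add_apply, Submodule.coe_sub, Submodule.coe_add, h2, h2, h3, h3]
    rw [LinearMap.sub_apply, LinearMap.add_apply, Module.End.mul_apply, Module.End.mul_apply, h4, h4] at h1
    rw [h1, smul_sub, smul_add, mul_comm]
    congr 1
    · congr 1
      split_ifs with hil
      · subst hil
        congr 1
        have := hm i
        have := hm j
        field_simp
      · simp
    · split_ifs with hkj
      · subst hkj
        congr 1
        have := hm k
        have := hm l
        field_simp
      · simp
  let ρ₁ := glHom e he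
  have he_coe : ∀ j i (v : W), ((e j i v : W) : T) = (R.m i / R.m j : ℂ) • R.glOp j i (v : T) :=
    fun j i v => rfl
  have hρ₁ : ∀ M (v : W), ((ρ₁ M v : W) : T) =
      ∑ j, ∑ i, (M j i * (R.m i / R.m j : ℂ)) • R.glOp j i (v : T) := by
    intro M v
    rw [glHom_apply]
    simp only [LinearMap.sum_apply, Submodule.coe_sum, LinearMap.smul_apply, Submodule.coe_smul, he_coe,
      smul_smul]
  have hρg : ∀ X j i v, R.glOp j i (ρ X v) = ρ X (R.glOp j i v) := by
    intro X j i v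
    refine hG_ind (P := fun X => R.glOp j i (ρ X v) = ρ X (R.glOp j i v)) (fun l X hX => ?_) (by simp)
      (fun X X' hX hX' => by
        rw [map_add, LinearMap.add_apply, map_add, hX, hX', LinearMap.add_apply]) X
    rw [hρ l X hX, Module.End.mul_apply, Module.End.mul_apply, ← hgπ]
    congr 1
    exact LinearMap.congr_fun (R.glOp_x hn j i l hX) v
  -- the grading
  let Wq : (Fin n → ℤ) ⧸ L.Γ' → Submodule ℂ W := fun q => (R.Tk q.out).comap W.subtype
  have hrep : ∀ k : Fin n → ℤ, L.rep k = (k : (Fin n → ℤ) ⧸ L.Γ').out := fun k => rfl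
  have hrepq : ∀ q : (Fin n → ℤ) ⧸ L.Γ', L.rep q.out = q.out := fun q => by
    rw [hrep]; congr 1; exact QuotientAddGroup.out_eq' _
  have hcW : ∀ (q : (Fin n → ℤ) ⧸ L.Γ') v, h.comp q.out v ∈ W := fun q v =>
    ⟨_, L.proj_eq_self h (hrepq q) (h.comp_mem _ v)⟩
  have hWq : IsGrading Wq := by
    refine isGrading_of_proj (fun q => (h.comp q.out).restrict fun v _ => hcW q v) (fun q v => ?_)
      (fun q v hv => ?_) (fun q q' hqq v hv => ?_) fun v => ?_
    · exact h.comp_mem _ _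
    · exact Subtype.ext (h.comp_same hv)
    · refine Subtype.ext (h.comp_ne (fun he => hqq ?_) hv)
      rw [← QuotientAddGroup.out_eq' q, he, QuotientAddGroup.out_eq']
    · refine Subtype.ext ?_
      rw [Submodule.coe_sum]
      have h1 : ∀ k ∉ Finset.univ.image (fun q : (Fin n → ℤ) ⧸ L.Γ' => q.out),
          h.comp k (v : T) = 0 := by
        intro k hk
        have : L.rep k ≠ k := by
          intro h'
          exact hk (Finset.mem_image.mpr ⟨_, Finset.mem_univ _, h'⟩)
        rw [← hWπ v v.2]
        exact L.comp_proj_eq_zero h this _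
      have h2 := h.eq_sum h1
      rw [Finset.sum_image fun q _ q' _ he => by
        have he' : q.out = q'.out := he
        rw [← QuotientAddGroup.out_eq' q, he', QuotientAddGroup.out_eq']] at h2
      exact h2
  have hWle : W ≤ ⨆ q : (Fin n → ℤ) ⧸ L.Γ', R.Tk q.out := by
    intro w hw
    have := hWq.eq_sum (v := ⟨w, hw⟩) (F := Finset.univ) fun k hk => absurd (Finset.mem_univ k) hk
    have := congrArg Subtype.val this
    rw [Submodule.coe_sum] at this
    change w = _ at this
    rw [this]
    exact sum_mem fun q _ => Submodule.mem_iSup_of_mem q (hWq.comp_mem q _)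
  have hfin : FiniteDimensional ℂ W := by
    have := R.finite
    exact Submodule.finiteDimensional_of_le hWle
  have hWnt : Nontrivial W := by
    obtain ⟨k, hk⟩ := h.exists_ne_bot
    obtain ⟨v, hv, hv0⟩ := Submodule.exists_mem_ne_zero_of_ne_bot hk
    exact ⟨⟨⟨π v, v, rfl⟩, 0, fun h' => hv0 (L.eq_zero_of_proj h hv (congrArg Subtype.val h'))⟩⟩
  obtain ⟨d₁, d₂, hd₁, hd₂, ⟨t⟩⟩ := exists_tensorDecomp ρ₁ ρ₂ (by
      intro M X v
      refine Subtype.ext ?_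
      change ρ X ((ρ₁ M v : W) : T) = _
      rw [hρ₁, hρ₁, map_sum]
      refine Finset.sum_congr rfl fun j _ => ?_
      rw [map_sum]
      refine Finset.sum_congr rfl fun i _ => ?_
      rw [map_smul, ← hρg]
      rfl) (by
      intro N hN₁ hN₂
      rcases L.eq_bot_or_eq_range h (N.map W.subtype) (Submodule.map_subtype_le W N) (by
          rintro y (⟨a, rfl⟩ | ⟨l, X, hX, rfl⟩ | ⟨j, i, rfl⟩) _ ⟨v, hv, rfl⟩
          · have : π (R.t a (v : T)) = v := by rw [hπt, hWπ _ v.2]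
            change π (R.t a (v : T)) ∈ _
            rw [this]
            exact ⟨v, hv, rfl⟩
          · refine ⟨_, hN₂ X v hv, ?_⟩
            change ρ X (v : T) = _
            rw [hρ l X hX]; rfl
          · refine ⟨(R.m j / R.m i : ℂ) • ρ₁ (Matrix.single j i 1) v,
              N.smul_mem _ (hN₁ _ v hv), ?_⟩
            change (R.m j / R.m i : ℂ) • ((ρ₁ (Matrix.single j i 1) v : W) : T) =
              π (R.glOp j i (v : T))
            rw [glHom_single, he_coe, smul_smul, hgπ, hWπ _ v.2]
            have := hm i
            have := hm j
            have : (R.m j / R.m i * (R.m i / R.m j) : ℂ) = 1 := by field_simp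
            rw [this, one_smul]) with h' | h'
      · left
        exact Submodule.map_injective_of_injective W.injective_subtype (h'.trans (Submodule.map_bot _).symm)
      · right
        refine Submodule.map_injective_of_injective W.injective_subtype (h'.trans ?_)
        rw [Submodule.map_top, Submodule.range_subtype]) Wq hWq (by
      intro M q v hv
      change ((ρ₁ M v : W) : T) ∈ R.Tk q.out
      rw [hρ₁]
      refine sum_mem fun j _ => sum_mem fun i _ => Submodule.smul_mem _ _ ?_
      simpa using R.glOp_hasDegree j i _ _ hv)
  let πW : T →ₗ[ℂ] W := π.codRestrict W fun v => ⟨v, rfl⟩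
  let Ψ₀ : T →ₗ[ℂ] (Fin d₁ → ℂ) ⊗[ℂ] (Fin d₂ → ℂ) := t.e.symm.toLinearMap ∘ₗ πW
  have heΨ : ∀ v, t.e (Ψ₀ v) = πW v := fun v => t.e.apply_symm_apply _
  refine ⟨
    { Γ' := L.Γ'
      mem_Γ' := fun a => (hL a).1
      d₁ := d₁
      d₂ := d₂
      d₁_pos := hd₁
      d₂_pos := hd₂
      r₁ := t.r₁
      r₂ := t.r₂
      gr := t.gr
      simple₁ := t.simple₁
      simple₂ := t.simple₂
      isGrading := t.isGrading
      shift := ?_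
      Ψ₀ := Ψ₀
      eq_zero := ?_
      mem_range_iff := ?_
      map_t := ?_
      map_x := ?_
      map_gl := ?_ }⟩
  · intro l X hX q
    refine t.shift X q _ fun w hw => ?_
    change ρ X (w : T) ∈ R.Tk _
    rw [hρ l X hX, Module.End.mul_apply]
    have h1 := L.proj_mem h (R.x_mem l X hX _ _ hw)
    rw [hrep, QuotientAddGroup.mk_add, QuotientAddGroup.out_eq'] at h1
    exact h1
  · intro k v hv h0
    refine L.eq_zero_of_proj h hv ?_
    have := heΨ v
    rw [h0, map_zero] at this
    exact (congrArg Subtype.val this).symm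
  · intro k z
    rw [← t.mem_iff]
    constructor
    · intro hz
      have hz' : ((t.e z : W) : T) ∈ R.Tk (L.rep k) := hz
      have hmem : k - L.rep k ∈ L.Γ' := by
        rw [← neg_sub]; exact neg_mem (L.rep_sub_mem k)
      refine ⟨L.c (k - L.rep k) (t.e z : W), ?_, ?_⟩
      · have := L.c_degree _ hmem _ _ hz'
        rwa [add_sub_cancel] at this
      · refine t.e.injective (Subtype.ext ?_)
        rw [heΨ]
        change π _ = _
        rw [hπ, L.proj_c h hmem]
        exact hWπ _ (t.e z).2
    · rintro ⟨v, hv, rfl⟩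
      rw [heΨ]
      exact L.proj_mem h hv
  · intro a v
    refine t.e.injective (Subtype.ext ?_)
    rw [heΨ, heΨ]
    exact hπt a v
  · intro l X hX v
    refine t.e.injective (Subtype.ext ?_)
    rw [t.map_r₂, heΨ, heΨ]
    change π (R.x l X v) = ρ X (π v)
    rw [hρ l X hX, Module.End.mul_apply, hπy _ (hxS l X hX)]
  · intro j i v
    refine t.e.injective (Subtype.ext ?_)
    rw [t.map_r₁, map_smul, heΨ, heΨ, glHom_single]
    change (R.m i / R.m j : ℂ) • π (R.glOp j i v) = (R.m i / R.m j : ℂ) • R.glOp j i (π v)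
    rw [hgπ]

end CurrentRep

end Realization

lemma isIrreducible_of_isSimpleFamily {L W : Type*} [LieRing L] [LieAlgebra ℂ L] [AddCommGroup W]
    [Module ℂ W] [LieRingModule L W] [LieModule ℂ L W] [Nontrivial W]
    (h : IsSimpleFamily fun x => LieModule.toEnd ℂ L W x) : LieModule.IsIrreducible ℂ L W := by
  refine LieModule.IsIrreducible.mk fun N hN => ?_
  rcases h N.toSubmodule fun x v hv => N.lie_mem hv with h1 | h1
  · exact absurd ((LieSubmodule.toSubmodule_eq_bot N).mp h1) hN
  · exact (LieSubmodule.toSubmodule_eq_top N).mp h1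

lemma LinearMap.map_inv_smul_smul {W W' : Type*} [AddCommGroup W] [Module ℂ W] [AddCommGroup W']
    [Module ℂ W'] (f : W →ₗ[ℂ] W') {c : ℂ} (hc : c ≠ 0) (a : ℂ) {x : W} {y : W'} (h : f x = c • y) :
    f (c⁻¹ • a • x) = a • y := by
  rw [map_smul, map_smul, h, smul_comm a, inv_smul_smul₀ hc]

namespace CurrentRep.Realization

variable {n : ℕ} {G : Type*} [LieRing G] [LieAlgebra ℂ G] {T : Type*} [AddCommGroup T]
  [Module ℂ T] [Nontrivial T] {R : CurrentRep n G T} (S : R.Realization)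

/-- The map to the graded loop module. -/
noncomputable def Ψ : T →ₗ[ℂ] ((Fin n → ℤ) →₀ (Fin S.d₁ → ℂ) ⊗[ℂ] (Fin S.d₂ → ℂ)) :=
  R.isGrading.lift (X := (Fin n → ℤ) →₀ (Fin S.d₁ → ℂ) ⊗[ℂ] (Fin S.d₂ → ℂ)) fun k =>
    Finsupp.lsingle k ∘ₗ S.Ψ₀ ∘ₗ (R.Tk k).subtype

lemma Ψ_apply {k : Fin n → ℤ} {v : T} (hv : v ∈ R.Tk k) : S.Ψ v = Finsupp.single k (S.Ψ₀ v) :=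
  R.isGrading.lift_apply (X := (Fin n → ℤ) →₀ (Fin S.d₁ → ℂ) ⊗[ℂ] (Fin S.d₂ → ℂ)) _ hv

lemma Ψ_apply_apply (v : T) (k : Fin n → ℤ) : S.Ψ v k = S.Ψ₀ (R.isGrading.comp k v) := by
  have : Finsupp.lapply k ∘ₗ S.Ψ = S.Ψ₀ ∘ₗ R.isGrading.comp k := by
    refine R.isGrading.ext_hom fun j v hv => ?_
    rw [LinearMap.comp_apply, LinearMap.comp_apply, S.Ψ_apply hv, Finsupp.lapply_apply]
    by_cases hjk : j = k
    · subst hjk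
      rw [R.isGrading.comp_same hv, Finsupp.single_eq_same]
    · rw [R.isGrading.comp_ne hjk hv, map_zero, Finsupp.single_eq_of_ne' hjk]
  exact LinearMap.congr_fun this v

lemma Ψ_injective : Function.Injective S.Ψ := by
  refine (injective_iff_map_eq_zero _).mpr fun v hv => R.isGrading.ext_comp fun k => ?_
  have h1 := DFunLike.congr_fun hv k
  rw [Ψ_apply_apply] at h1
  rw [map_zero]
  exact S.eq_zero k _ (R.isGrading.comp_mem k v) h1

lemma range_Ψ : LinearMap.range S.Ψ = gradedLoop (Fin S.d₁ → ℂ) S.gr := by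
  ext z
  rw [gradedLoop, Submodule.mem_iInf]
  constructor
  · rintro ⟨v, rfl⟩ k
    rw [Submodule.mem_comap, Finsupp.lapply_apply, Ψ_apply_apply]
    exact (S.mem_range_iff k _).mpr ⟨_, R.isGrading.comp_mem k v, rfl⟩
  · intro h
    choose v hv hvz using fun k => (S.mem_range_iff k _).mp (h k)
    refine ⟨∑ k ∈ z.support, v k, ?_⟩
    rw [map_sum]
    conv_rhs => rw [← Finsupp.sum_single z]
    exact Finset.sum_congr rfl fun k _ => by rw [S.Ψ_apply (hv k), hvz, Finsupp.lapply_apply]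

lemma Ψ_of_hasDegree {y : Module.End ℂ T} {d : Fin n → ℤ} (hy : HasDegree R.Tk y d)
    {F : (Fin n → ℤ) → Module.End ℂ ((Fin S.d₁ → ℂ) ⊗[ℂ] (Fin S.d₂ → ℂ))}
    (hF : ∀ k, ∀ v ∈ R.Tk k, S.Ψ₀ (y v) = F k (S.Ψ₀ v)) (v : T) : S.Ψ (y v) = loopOp d F (S.Ψ v) := by
  have : S.Ψ ∘ₗ y = loopOp d F ∘ₗ S.Ψ := by
    refine R.isGrading.ext_hom (X := (Fin n → ℤ) →₀ (Fin S.d₁ → ℂ) ⊗[ℂ] (Fin S.d₂ → ℂ)) fun k v hv => ?_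
    rw [LinearMap.comp_apply, LinearMap.comp_apply, S.Ψ_apply hv, S.Ψ_apply (hy k v hv), hF k v hv]
    simp [loopOp]
  exact LinearMap.congr_fun this v

lemma Ψ₀_D (hn : 0 < n) (a : Fin n → ℤ) (u : Fin n → ℂ) {k : Fin n → ℤ} {v : T} (hv : v ∈ R.Tk k) :
    S.Ψ₀ (R.D a (fun i => u i * R.m i) v) = (∑ i, u i * (k i + R.α i)) • S.Ψ₀ v +
      (S.r₁ (∑ i, ∑ j, Matrix.single j i (u i * (scaleLat R.m a j : ℤ)))).rTensor _ (S.Ψ₀ v) := by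
  have hm : ∀ i, (R.m i : ℂ) ≠ 0 := fun i => by exact_mod_cast (R.m_pos i).ne'
  rw [R.D_eq hn, Module.End.mul_apply, S.map_t, LinearMap.add_apply, map_add, R.D_zero k v hv, map_smul]
  congr 1
  · congr 1
    refine Finset.sum_congr rfl fun i _ => ?_
    have := hm i
    field_simp
  · rw [← LinearMap.coe_rTensorHom]
    simp only [LinearMap.sum_apply, map_sum]
    refine Finset.sum_congr rfl fun i _ => Finset.sum_congr rfl fun j _ => ?_
    have h1 := S.map_gl j i v
    have h2 : Matrix.single j i (u i * (scaleLat R.m a j : ℤ)) =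
        (u i * (scaleLat R.m a j : ℤ)) • Matrix.single j i (1 : ℂ) := by
      rw [Matrix.smul_single, smul_eq_mul, mul_one]
    rw [h2, map_smul, map_smul, LinearMap.smul_apply, LinearMap.smul_apply, map_smul,
      LinearMap.coe_rTensorHom]
    refine Eq.trans ?_ (congrArg _ h1)
    rw [smul_smul]
    congr 1
    have := hm i
    have := hm j
    simp only [scaleLat]
    push_cast
    field_simp

end CurrentRep.Realization

/-! ### The top space as a current module -/

lemma iSupIndep_of_eigenvalues {κ ι W : Type*} [AddCommGroup W] [Module ℂ W] (f : ι → Module.End ℂ W)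
    (hc : ∀ i j, Commute (f i) (f j)) (S : κ → Submodule ℂ W) {χ : κ → ι → ℂ}
    (hχ : Function.Injective χ) (hS : ∀ k, ∀ v ∈ S k, ∀ i, f i v = χ k i • v) : iSupIndep S := by
  have h := Module.End.independent_iInf_maxGenEigenspace_of_forall_mapsTo f fun i j φ =>
    Module.End.mapsTo_maxGenEigenspace_of_comm (hc j i) φ
  refine (h.comp hχ).mono fun k v hv => ?_
  refine (Submodule.mem_iInf _).mpr fun i => ?_
  exact (Module.End.genEigenspace (f i) _).monotone le_top
    (Module.End.mem_eigenspace_iff.mpr (hS k v hv i))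

lemma isSemisimple_of_pow_eq_one {W : Type*} [AddCommGroup W] [Module ℂ W] [FiniteDimensional ℂ W]
    {f : Module.End ℂ W} {m : ℕ} (hm : 0 < m) (hf : f ^ m = 1) : f.IsSemisimple := by
  refine Module.End.isSemisimple_of_squarefree_aeval_eq_zero
    (p := Polynomial.X ^ m - 1) ?_ (by simp [hf])
  exact (Polynomial.X_pow_sub_one_separable_iff.mpr (by exact_mod_cast hm.ne')).squarefree

lemma mul_smul_eq_of_mul_eq {A : Type*} [Ring A] [Algebra ℂ A] {x y z : A} {s c : ℂ}
    (h : x * y = y * x + s • z) : x * c • y = c • y * x + s • c • z := by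
  rw [mul_smul_comm, smul_mul_assoc, h, smul_add, smul_comm]

namespace TwistData

section CircGrading

variable {n : ℕ} {g : Type*} [LieRing g] [LieAlgebra ℂ g] (D : TwistData n g)
variable (h₀ : LieSubalgebra ℂ D.fixed)

lemma gCircGrad_congr {l k : Fin n → ℤ} (hlk : l - k ∈ D.Γ) : D.gCircGrad h₀ l = D.gCircGrad h₀ k := by
  have key : ∀ i : Fin n, D.ξ i.succ ^ l i = D.ξ i.succ ^ k i := fun i => by
    have h1 : D.ξ i.succ ^ (l i - k i) = 1 := ((D.ξ_prim i.succ).zpow_eq_one_iff_dvd _).mpr (hlk i)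
    rw [← sub_add_cancel (l i) (k i), zpow_add₀ (D.ξ_ne_zero _), h1, one_mul]
  ext X
  exact forall_congr' fun i => by rw [key i]

/-- The action of `σᵢ` on `g°`. -/
noncomputable def gCircAut (i : Fin n) : Module.End ℂ (D.gCirc h₀) :=
  ((D.σ i.succ : g →ₗ⁅ℂ⁆ g) : g →ₗ[ℂ] g).restrict (p := (D.gCirc h₀).toSubmodule)
    (q := (D.gCirc h₀).toSubmodule) fun X hX => by
      refine ⟨(D.σ_comm _ _ _).trans (congrArg _ hX.1), fun h => ?_⟩
      have h1 := congrArg (D.σ i.succ) (hX.2 h)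
      rw [LieEquiv.map_lie, h.1.2 i.succ, map_zero] at h1
      exact h1

lemma gCircAut_apply (i : Fin n) (X : D.gCirc h₀) : (D.gCircAut h₀ i X : g) = D.σ i.succ X := rfl

lemma gCircAut_pow_apply (i : Fin n) (k : ℕ) (X : D.gCirc h₀) :
    ((D.gCircAut h₀ i ^ k) X : g) = (D.σ i.succ)^[k] X := by
  induction k with
  | zero => rfl
  | succ k ih =>
    rw [pow_succ', Module.End.mul_apply, gCircAut_apply, ih, Function.iterate_succ_apply']

lemma gCircAut_pow (i : Fin n) : D.gCircAut h₀ i ^ D.m i.succ = 1 := by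
  ext1 X
  exact Subtype.ext ((D.gCircAut_pow_apply h₀ i _ X).trans ((D.σ_order i.succ _).mpr dvd_rfl _))

lemma isGrading_gCircGrad [FiniteDimensional ℂ g] :
    IsGrading fun q : (Fin n → ℤ) ⧸ D.Γ => D.gCircGrad h₀ q.out := by
  have hc : ∀ i j, Commute (D.gCircAut h₀ i) (D.gCircAut h₀ j) := fun i j => by
    refine LinearMap.ext fun X => Subtype.ext ?_
    exact D.σ_comm _ _ _
  refine ⟨iSupIndep_of_eigenvalues (D.gCircAut h₀) hc _
    (χ := fun q i => D.ξ i.succ ^ (q.out : Fin n → ℤ) i) (fun q q' hq => ?_)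
    fun q X hX i => Subtype.ext (hX i), eq_top_iff.mpr ?_⟩
  · rw [← QuotientAddGroup.out_eq' q, ← QuotientAddGroup.out_eq' q', QuotientAddGroup.eq]
    intro i
    have h1 : D.ξ i.succ ^ (q.out : Fin n → ℤ) i = D.ξ i.succ ^ (q'.out : Fin n → ℤ) i := congrFun hq i
    rw [← (D.ξ_prim i.succ).zpow_eq_one_iff_dvd, Pi.add_apply, Pi.neg_apply,
      zpow_add₀ (D.ξ_ne_zero _), ← h1, ← zpow_add₀ (D.ξ_ne_zero _), neg_add_cancel, zpow_zero]
  · refine (Submodule.le_iSup_inf_iInf_eigenspace (D.gCircAut h₀) hc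
      (fun i => isSemisimple_of_pow_eq_one (D.m_pos _) (D.gCircAut_pow h₀ i)) ⊤
      (fun _ _ _ => trivial)).trans (iSup_le fun χ X hX => ?_)
    rw [top_inf_eq, Submodule.mem_iInf] at hX
    by_cases h0 : X = 0
    · rw [h0]; exact zero_mem _
    have hχ : ∀ i, ∃ l : ℕ, D.ξ i.succ ^ l = χ i := fun i => by
      have h1 := Module.End.mem_eigenspace_iff.mp (hX i)
      have h2 : ∀ k, (D.gCircAut h₀ i ^ k) X = χ i ^ k • X := fun k => by
        induction k with
        | zero => simp
        | succ k ih => rw [pow_succ', Module.End.mul_apply, ih, map_smul, h1, smul_smul, pow_succ]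
      have h3 := h2 (D.m i.succ)
      rw [gCircAut_pow, Module.End.one_apply] at h3
      have h4 : χ i ^ D.m i.succ = 1 :=
        smul_left_injective ℂ h0 ((one_smul ℂ X).trans h3).symm
      have := D.m_pos i.succ
      have : NeZero (D.m i.succ) := ⟨this.ne'⟩
      obtain ⟨l, -, hl⟩ := (D.ξ_prim i.succ).eq_pow_of_pow_eq_one h4
      exact ⟨l, hl⟩
    choose l hl using hχ
    have h1 : X ∈ D.gCircGrad h₀ (fun i => (l i : ℤ)) := fun i => by
      have h1 := congrArg Subtype.val (Module.End.mem_eigenspace_iff.mp (hX i))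
      rw [zpow_natCast, hl]
      exact h1
    refine Submodule.mem_iSup_of_mem (((fun i => (l i : ℤ) : Fin n → ℤ)) : (Fin n → ℤ) ⧸ D.Γ) ?_
    rwa [D.gCircGrad_congr h₀ (k := fun i => (l i : ℤ))]
    rw [sub_eq_neg_add, ← neg_mem_iff, neg_add, neg_neg, ← sub_eq_add_neg, sub_eq_neg_add,
      ← QuotientAddGroup.eq, QuotientAddGroup.out_eq']

end CircGrading

variable {n : ℕ} {g : Type*} [LieRing g] [LieAlgebra ℂ g] {D : TwistData n g}
variable {h₀ : LieSubalgebra ℂ D.fixed}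
variable {V : Type*} [AddCommGroup V] [Module ℂ V] [LieRingModule D.tau V] [LieModule ℂ D.tau V]
variable [FiniteDimensional ℂ g] [LieAlgebra.IsSimple ℂ g]
variable [LieAlgebra.IsSimple ℂ D.fixed] [h₀.IsCartanSubalgebra]
variable {b : (D.roots h₀).Base} {wt : D.Weight h₀}

lemma topD_zero_single_apply {k : Fin n → ℤ} {v : D.topSpace V b} (hv : v ∈ D.topGrade wt k)
    (i : Fin n) : topD V b 0 (Pi.single i 1) v = (k i + wt.onD i.succ) • v := by
  refine Subtype.ext ?_
  refine (congrArg (fun x : D.tau => ⁅x, (v : V)⁆) (?_ : _ = D.d i.succ)).trans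
    (((mem_topGrade.mp hv).2.2 i.succ).trans (congrArg (· • (v : V)) (?_ : _ = (k i + wt.onD i.succ))))
  · refine D.derEl_congr ?_ ?_ (D.expo0_mem (0 : D.Γ).2)
    · funext j
      refine Fin.cases ?_ (fun j => ?_) j <;> simp
    · funext j
      refine Fin.cases ?_ (fun j => ?_) j <;> simp [Pi.single_apply]
  · simp [Expo.toCoef, add_comm]

lemma topD_zero_apply {k : Fin n → ℤ} {v : D.topSpace V b} (hv : v ∈ D.topGrade wt k)
    (u : Fin n → ℂ) : topD V b 0 u v = (∑ i, u i * (k i + wt.onD i.succ)) • v := by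
  have h1 : u = ∑ i, u i • Pi.single i 1 := by
    funext j
    simp [Finset.sum_apply, Pi.single_apply]
  conv_lhs => rw [h1, map_sum, LinearMap.sum_apply]
  rw [Finset.sum_smul]
  refine Finset.sum_congr rfl fun i _ => ?_
  rw [map_smul, LinearMap.smul_apply, topD_zero_single_apply hv, smul_smul]

lemma iSupIndep_topGrade (h0 : ∀ (d : D.Γ) (w : Coef n), w 0 = 0 → topC V b d w = 0) :
    iSupIndep fun k => (D.topGrade wt k : Submodule ℂ (D.topSpace V b)) := by
  refine iSupIndep_of_eigenvalues (fun i => topD V b 0 (Pi.single i 1)) (fun i j => ?_) _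
    (χ := fun k i => (k i : ℂ) + wt.onD i.succ) (fun k k' h => ?_)
    fun k v hv i => topD_zero_single_apply hv i
  · refine sub_eq_zero.mp ((commutator_topD_topD h0 0 0 _ _).trans ?_)
    simp
  · funext i
    exact_mod_cast add_right_cancel (congrFun h i)

/-- The element of `Γ` with coordinates `a`. -/
def lat (D : TwistData n g) (a : Fin n → ℤ) : D.Γ :=
  ⟨scaleLat (fun i => D.m i.succ) a, fun _ => dvd_mul_right _ _⟩

lemma lat_add (a c : Fin n → ℤ) : D.lat (a + c) = D.lat a + D.lat c :=
  Subtype.ext (scaleLat_add _ a c)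

lemma lat_zero : D.lat 0 = 0 := Subtype.ext (scaleLat_zero _)

lemma exists_eq_lat (d : D.Γ) : ∃ a, d = D.lat a := by
  choose a ha using d.2
  exact ⟨a, Subtype.ext (funext ha)⟩

variable (V b) in
open Classical in
/-- The operator `X(l)` on `T`, extended by zero. -/
noncomputable def topX' (l : Fin n → ℤ) (X : D.gCirc h₀) : Module.End ℂ (D.topSpace V b) :=
  if h : X ∈ D.gCircGrad h₀ l then topX V b l ⟨X, h⟩ else 0

lemma topX'_of_mem {l : Fin n → ℤ} {X : D.gCirc h₀} (h : X ∈ D.gCircGrad h₀ l) :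
    topX' V b l X = topX V b l ⟨X, h⟩ := dif_pos h

/-- Division of the coordinates by the orders. -/
noncomputable def coordDiv (D : TwistData n g) : (Fin n → ℂ) →ₗ[ℂ] (Fin n → ℂ) where
  toFun u i := u i / D.m i.succ
  map_add' _ _ := funext fun _ => add_div _ _ _
  map_smul' _ _ := funext fun _ => mul_div_assoc _ _ _

lemma m_ne_zero (D : TwistData n g) (i : Fin (n + 1)) : (D.m i : ℂ) ≠ 0 := by
  exact_mod_cast (D.m_pos i).ne'

lemma sum_coordDiv_lat (u : Fin n → ℂ) (a : Fin n → ℤ) :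
    ∑ i, D.coordDiv u i * ((D.lat a : Fin n → ℤ) i : ℂ) = ∑ i, u i * a i := by
  refine Finset.sum_congr rfl fun i _ => ?_
  have := D.m_ne_zero i.succ
  simp only [coordDiv, LinearMap.coe_mk, AddHom.coe_mk, lat, scaleLat]
  push_cast
  field_simp

lemma gCircGrad_add_lat (l a : Fin n → ℤ) :
    D.gCircGrad h₀ (l + scaleLat (fun i => D.m i.succ) a) = D.gCircGrad h₀ l :=
  D.gCircGrad_congr h₀ (by rw [add_sub_cancel_left]; exact (D.lat a).2)

lemma topD_mul_topX' (a : Fin n → ℤ) (u : Fin n → ℂ) (l : Fin n → ℤ) {X : D.gCirc h₀}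
    (hX : X ∈ D.gCircGrad h₀ l) : topD V b (D.lat a) (D.coordDiv u) * topX' V b l X =
      topX' V b l X * topD V b (D.lat a) (D.coordDiv u) +
      (∑ i, u i * (l i / D.m i.succ)) • topX' V b (l + scaleLat (fun i => D.m i.succ) a) X := by
  have hX' : X ∈ D.gCircGrad h₀ ((D.lat a : Fin n → ℤ) + l) := by
    rw [add_comm]
    exact (gCircGrad_add_lat (h₀ := h₀) l a).ge hX
  have h1 := commutator_topD_topX (V := V) (b := b) (D.lat a) (D.coordDiv u) l X hX hX'
  have h2 : ∑ i, D.coordDiv u i * (l i : ℂ) = ∑ i, u i * (l i / D.m i.succ) :=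
    Finset.sum_congr rfl fun i _ => div_mul_eq_mul_div₀ _ _ _ |>.trans (mul_div_assoc _ _ _)
  rw [← topX'_of_mem, ← topX'_of_mem, sub_eq_iff_eq_add', h2] at h1
  rw [h1, add_comm (D.lat a : Fin n → ℤ) l]
  rfl

lemma HasTorus.topD₀_eq_smul {C₀ : ℝ} {a₀ : ℂ} (H : HasTorus b V C₀ a₀) (hC : (C₀ : ℂ) ≠ 0)
    (d : D.Γ) : topD₀ V b d = (C₀ : ℂ)⁻¹ • a₀ • topK V b d :=
  (eq_inv_smul_iff₀ hC).mpr (H.topD₀_eq d)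

lemma topD_mul_topD (h0 : ∀ (d : D.Γ) (w : Coef n), w 0 = 0 → topC V b d w = 0) (a c : Fin n → ℤ)
    (u v : Fin n → ℂ) : topD V b (D.lat a) (D.coordDiv u) * topD V b (D.lat c) (D.coordDiv v) =
      topD V b (D.lat c) (D.coordDiv v) * topD V b (D.lat a) (D.coordDiv u) +
      topD V b (D.lat (a + c)) (D.coordDiv ((∑ i, u i * c i) • v - (∑ i, v i * a i) • u)) := by
  have h1 := commutator_topD_topD h0 (D.lat a) (D.lat c) (D.coordDiv u) (D.coordDiv v)
  rw [sum_coordDiv_lat, sum_coordDiv_lat, ← lat_add, ← map_smul, ← map_smul, ← map_sub] at h1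
  exact sub_eq_iff_eq_add'.mp h1

lemma eq_bot_or_eq_top_of_current_stable
    [LieModule.IsIrreducible ℂ (D.tauNonneg b) (D.topSpace V b)] {C₀ : ℝ} {a₀ : ℂ}
    (H : HasTorus b V C₀ a₀) (hC : (C₀ : ℂ) ≠ 0) (N : Submodule ℂ (D.topSpace V b))
    (ht : ∀ a, ∀ v ∈ N, ((C₀ : ℂ)⁻¹ • topK V b (D.lat a)) v ∈ N)
    (hD : ∀ a u, ∀ v ∈ N, topD V b (D.lat a) (D.coordDiv u) v ∈ N)
    (hx : ∀ l, ∀ X ∈ D.gCircGrad h₀ l, ∀ v ∈ N, topX' V b l X v ∈ N) : N = ⊥ ∨ N = ⊤ := by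
  have hK : ∀ d, ∀ v ∈ N, topK V b d v ∈ N := fun d v hv => by
    obtain ⟨a, rfl⟩ := exists_eq_lat d
    have := N.smul_mem (C₀ : ℂ) (ht a v hv)
    rwa [LinearMap.smul_apply, smul_smul, mul_inv_cancel₀ hC, one_smul] at this
  refine eq_bot_or_eq_top_of_op_stable H.topC_eq_zero N (fun l X v hv => ?_) hK (fun d v hv => ?_)
    fun d u v hv => ?_
  · have := hx l X X.2 v hv
    rwa [topX'_of_mem X.2] at this
  · rw [H.topD₀_eq_smul hC]
    exact N.smul_mem _ (N.smul_mem _ (hK d v hv))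
  · obtain ⟨a, rfl⟩ := exists_eq_lat d
    have h1 : D.coordDiv (fun i => u i * D.m i.succ) = u := funext fun i =>
      mul_div_cancel_right₀ _ (D.m_ne_zero i.succ)
    have := hD a (fun i => u i * D.m i.succ) v hv
    rwa [h1] at this

/-- The top space as a module for the current algebra of vector fields. -/
noncomputable def currentRep [LieModule.IsIrreducible ℂ (D.tauNonneg b) (D.topSpace V b)]
    (hV : D.IsIntegrable h₀ V) {v₀ : V} (hv₀ : v₀ ∈ D.topSpace V b) (hne : v₀ ≠ 0)
    (hw : v₀ ∈ D.weightSpace V wt) {C₀ : ℝ} {a₀ : ℂ} (hC : (C₀ : ℂ) ≠ 0)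
    (H : HasTorus b V C₀ a₀) : CurrentRep n (D.gCirc h₀) (D.topSpace V b) where
  m i := D.m i.succ
  m_pos i := D.m_pos _
  gr := D.gCircGrad h₀
  gr_add := gCircGrad_add_lat
  lie_mem _ _ _ _ hX hY := D.lie_mem_gCircGrad hX hY
  α i := wt.onD i.succ
  Tk k := D.topGrade wt k
  finite k := finiteDimensional_topGrade hV wt k
  indep := iSupIndep_topGrade H.topC_eq_zero
  iSup_eq := iSup_topGrade hv₀ hne hw
  t a := (C₀ : ℂ)⁻¹ • topK V b (D.lat a)
  D a := topD V b (D.lat a) ∘ₗ D.coordDiv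
  x := topX' V b
  t_mem a := (hasDegree_topC (D.lat a) _).smul _
  D_mem a u := hasDegree_topD (D.lat a) _
  x_mem l X hX := by
    rw [topX'_of_mem hX]
    exact hasDegree_topX l _
  t_zero := by rw [lat_zero, H.topK_zero, smul_smul, inv_mul_cancel₀ hC, one_smul]
  t_add a c := by
    rw [smul_mul_smul_comm, H.topK_mul, smul_smul, mul_assoc, inv_mul_cancel₀ hC, mul_one, lat_add]
  D_zero k v hv u := by
    rw [lat_zero, LinearMap.comp_apply, topD_zero_apply hv]
    congr 1
    exact Finset.sum_congr rfl fun i _ => by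
      simp only [coordDiv, LinearMap.coe_mk, AddHom.coe_mk]
      ring
  x_add l X hX Y hY := by
    rw [topX'_of_mem hX, topX'_of_mem hY, topX'_of_mem (add_mem hX hY), ← map_add]
    rfl
  x_smul l c X hX := by
    rw [topX'_of_mem hX, topX'_of_mem (Submodule.smul_mem _ c hX), ← map_smul]
    rfl
  D_t a u c := by
    have h1 := commutator_topD_topK (V := V) (b := b) (D.lat a) (D.lat c) (D.coordDiv u)
    rw [sum_coordDiv_lat, ← lat_add, sub_eq_iff_eq_add'] at h1
    exact mul_smul_eq_of_mul_eq h1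
  D_D a u c v := topD_mul_topD H.topC_eq_zero a c u v
  D_x a u l X hX := topD_mul_topX' a u l hX
  x_t l X hX a := by
    rw [topX'_of_mem hX]
    exact ((commute_topX_topC l _ (D.lat a) _).smul_right _).eq
  x_x l k X hX Y hY := by
    rw [topX'_of_mem hX, topX'_of_mem hY, topX'_of_mem (D.lie_mem_gCircGrad hX hY)]
    exact sub_eq_iff_eq_add'.mp (commutator_topX_topX H.topC_eq_zero l k X Y hX hY)
  eq_bot_or_eq_top N ht hD hx := eq_bot_or_eq_top_of_current_stable H hC N ht hD hx

section LoopRealization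

variable [LieModule.IsIrreducible ℂ (D.tauNonneg b) (D.topSpace V b)] [Nontrivial (D.topSpace V b)]
    (hV : D.IsIntegrable h₀ V) {v₀ : V} (hv₀ : v₀ ∈ D.topSpace V b) (hne : v₀ ≠ 0)
    (hw : v₀ ∈ D.weightSpace V wt) {C₀ : ℝ} {a₀ : ℂ} (hC : (C₀ : ℂ) ≠ 0)
    (H : HasTorus b V C₀ a₀) (S : (currentRep hV hv₀ hne hw hC H).Realization)

include hC H in
lemma Ψ₀_topK (d : D.Γ) (v : D.topSpace V b) : S.Ψ₀ (topK V b d v) = (C₀ : ℂ) • S.Ψ₀ v := by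
  obtain ⟨a, rfl⟩ := exists_eq_lat d
  have h1 : S.Ψ₀ ((C₀ : ℂ)⁻¹ • topK V b (D.lat a) v) = S.Ψ₀ v := S.map_t a v
  rw [← h1, map_smul, smul_smul, mul_inv_cancel₀ hC, one_smul]

lemma Ψ₀_topD₀ (d : D.Γ) (v : D.topSpace V b) : S.Ψ₀ (topD₀ V b d v) = a₀ • S.Ψ₀ v := by
  exact (congrArg S.Ψ₀ (LinearMap.congr_fun (H.topD₀_eq_smul hC d) v)).trans
    (S.Ψ₀.map_inv_smul_smul hC a₀ (Ψ₀_topK hV hv₀ hne hw hC H S d v))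

lemma Ψ₀_topX {l : Fin n → ℤ} {X : D.gCirc h₀} (hX : X ∈ D.gCircGrad h₀ l) (v : D.topSpace V b) :
    S.Ψ₀ (topX V b l ⟨X, hX⟩ v) = (S.r₂ X).lTensor _ (S.Ψ₀ v) := by
  rw [← topX'_of_mem hX]
  exact S.map_x l X hX v

lemma Ψ₀_topD (hn : 0 < n) (d : D.Γ) (u : Fin n → ℂ) {k : Fin n → ℤ} {v : D.topSpace V b}
    (hv : v ∈ D.topGrade wt k) :
    S.Ψ₀ (topD V b d u v) = (∑ i, u i * (k i + wt.onD i.succ)) • S.Ψ₀ v +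
      (S.r₁ (∑ i, ∑ j, Matrix.single j i (u i * ((d : Fin n → ℤ) j : ℤ)))).rTensor _ (S.Ψ₀ v) := by
  obtain ⟨a, rfl⟩ := exists_eq_lat d
  have h1 : D.coordDiv (fun i => u i * D.m i.succ) = u := funext fun i =>
    mul_div_cancel_right₀ _ (D.m_ne_zero i.succ)
  conv_lhs => rw [← h1]
  exact S.Ψ₀_D hn a u hv

include hC H in
lemma isLoopRealization (hn : 0 < n) [LieRingModule (Matrix (Fin n) (Fin n) ℂ) (Fin S.d₁ → ℂ)]
    [LieModule ℂ (Matrix (Fin n) (Fin n) ℂ) (Fin S.d₁ → ℂ)]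
    [LieRingModule (D.gCirc h₀) (Fin S.d₂ → ℂ)] [LieModule ℂ (D.gCirc h₀) (Fin S.d₂ → ℂ)]
    (h₁ : ∀ A, LieModule.toEnd ℂ (Matrix (Fin n) (Fin n) ℂ) (Fin S.d₁ → ℂ) A = S.r₁ A)
    (h₂ : ∀ X, LieModule.toEnd ℂ (D.gCirc h₀) (Fin S.d₂ → ℂ) X = S.r₂ X) :
    D.IsLoopRealization b (C₀ : ℂ) a₀ (fun i => wt.onD i.succ) S.gr S.Ψ where
  injective := S.Ψ_injective
  range_eq := S.range_Ψ
  map_D u r hr v := by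
    simp only [h₁]
    exact S.Ψ_of_hasDegree (y := topD V b ⟨r, hr⟩ u) (hasDegree_topD ⟨r, hr⟩ u)
      (fun k v hv => Ψ₀_topD hV hv₀ hne hw hC H S hn ⟨r, hr⟩ u hv) v
  map_X l X hX v := by
    simp only [h₂]
    exact S.Ψ_of_hasDegree (y := topX V b l ⟨X, hX⟩) (hasDegree_topX l ⟨X, hX⟩)
      (fun k v _ => Ψ₀_topX hV hv₀ hne hw hC H S hX v) v
  map_K₀ r hr v := S.Ψ_of_hasDegree (y := topK V b ⟨r, hr⟩) (F := fun _ => (C₀ : ℂ) • LinearMap.id)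
    (hasDegree_topC ⟨r, hr⟩ _) (fun _ v _ => Ψ₀_topK hV hv₀ hne hw hC H S ⟨r, hr⟩ v) v
  map_K r hr p v := by
    have h3 := LinearMap.congr_fun (H.topC_eq_zero ⟨r, hr⟩ (Pi.single p.succ 1) (by simp)) v
    exact (congrArg S.Ψ h3).trans (map_zero _)
  map_D₀ r hr v := S.Ψ_of_hasDegree (y := topD₀ V b ⟨r, hr⟩) (F := fun _ => a₀ • LinearMap.id)
    (hasDegree_topD₀ ⟨r, hr⟩) (fun _ v _ => Ψ₀_topD₀ hV hv₀ hne hw hC H S ⟨r, hr⟩ v) v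

end LoopRealization

lemma HeightData.mem_opWeight (H : D.HeightData b) {v : V} (hv : v ∈ D.weightSpace V wt) :
    v ∈ opWeight H.el V (wt.onCartan H.ρ + H.bound * wt.onD 0) := by
  rw [_root_.mem_opWeight, HeightData.el, add_lie, smul_lie, hv.1, hv.2.2, smul_smul, add_smul]

end TwistData

theorem theorem9p7 {n : ℕ} (hn : 0 < n)
    {g : Type*} [LieRing g] [LieAlgebra ℂ g] [FiniteDimensional ℂ g] [LieAlgebra.IsSimple ℂ g]
    (D : TwistData n g)
    -- the standing assumptions on `L(g, σ)`
    [LieAlgebra.IsSimple ℂ D.fixed]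
    (h₀ : LieSubalgebra ℂ D.fixed) [h₀.IsCartanSubalgebra]
    (h : LieSubalgebra ℂ g) [h.IsCartanSubalgebra]
    (hh : ∀ x : h₀, ((x : D.fixed) : g) ∈ h)
    (hΔ : D.weightsOfG h₀ ⊆ D.enlargedRoots h₀)
    -- the choice of simple roots
    (b : (D.roots h₀).Base)
    -- the irreducible integrable module
    {V : Type*} [AddCommGroup V] [Module ℂ V] [LieRingModule D.tau V] [LieModule ℂ D.tau V]
    [LieModule.IsIrreducible ℂ D.tau V] (hV : D.IsIntegrable h₀ V)
    (C₀ : ℝ) (hC₀ : 0 < C₀) (hK₀ : ∀ v : V, ⁅D.K 0, v⁆ = (C₀ : ℂ) • v)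
    (hK : ∀ (i : Fin n) (v : V), ⁅D.K i.succ, v⁆ = 0) :
    -- `T` is an irreducible `τ⁰`-module (`τ⁺` acts on it by zero)
    LieModule.IsIrreducible ℂ (D.tauNonneg b) (D.topSpace V b) ∧
    -- `M` has a unique maximal submodule meeting `T` trivially, and `V ≅ M / M^rad`
    (∃ Mrad : LieSubmodule ℂ D.tau (LieInd (D.tauNonneg b) (D.topSpace V b)),
      IsGreatest {N : LieSubmodule ℂ D.tau (LieInd (D.tauNonneg b) (D.topSpace V b)) |
        (N : Submodule ℂ (LieInd (D.tauNonneg b) (D.topSpace V b))) ⊓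
          LinearMap.range (LieInd.ofBase (D.tauNonneg b) (D.topSpace V b)) = ⊥} Mrad ∧
      Nonempty (V ≃ₗ⁅ℂ, D.tau⁆ (LieInd (D.tauNonneg b) (D.topSpace V b) ⧸ Mrad))) ∧
    -- the description of `T`, for any weight `wt` of `T`
    (∀ wt : D.Weight h₀, (∃ v ∈ D.topSpace V b, v ≠ 0 ∧ v ∈ D.weightSpace V wt) →
      ∃ (Γ' : AddSubgroup (Fin n → ℤ)) (V₁ V₂ : Type)
        (_ : AddCommGroup V₁) (_ : Module ℂ V₁)
        (_ : LieRingModule (Matrix (Fin n) (Fin n) ℂ) V₁)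
        (_ : LieModule ℂ (Matrix (Fin n) (Fin n) ℂ) V₁)
        (_ : AddCommGroup V₂) (_ : Module ℂ V₂)
        (_ : LieRingModule (D.gCirc h₀) V₂) (_ : LieModule ℂ (D.gCirc h₀) V₂)
        (gr : (Fin n → ℤ) ⧸ Γ' → Submodule ℂ V₂)
        (Ψ : D.topSpace V b →ₗ[ℂ] ((Fin n → ℤ) →₀ V₁ ⊗[ℂ] V₂)),
        D.Γ ≤ Γ' ∧
        FiniteDimensional ℂ V₁ ∧ FiniteDimensional ℂ V₂ ∧
        LieModule.IsIrreducible ℂ (Matrix (Fin n) (Fin n) ℂ) V₁ ∧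
        LieModule.IsIrreducible ℂ (D.gCirc h₀) V₂ ∧
        iSupIndep gr ∧ (⨆ q, gr q) = ⊤ ∧
        (∀ (l : Fin n → ℤ) (X : D.gCirc h₀), X ∈ D.gCircGrad h₀ l →
          ∀ (q : (Fin n → ℤ) ⧸ Γ'), ∀ w ∈ gr q, ⁅X, w⁆ ∈ gr (q + (l : (Fin n → ℤ) ⧸ Γ'))) ∧
        D.IsLoopRealization b (C₀ : ℂ) (wt.onD 0) (fun i => wt.onD i.succ) gr Ψ) := by
  have hL : D.HasLevel V C₀ := ⟨hC₀, hK₀, hK⟩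
  have : Nontrivial V := LieModule.nontrivial_of_isIrreducible ℂ D.tau V
  obtain ⟨H⟩ := D.exists_heightData b
  obtain ⟨v₁, hv₁, hne₁, wt₁, hw₁⟩ := TwistData.exists_mem_topSpace b H hV hL hh hΔ
  have hT : ∀ v, v ∈ D.topSpace V b ↔ ∀ x ∈ D.tauPos b, ⁅x, v⁆ = 0 := fun _ => Iff.rfl
  have htri := H.isTriangular hh hΔ
  have hirr := htri.isIrreducible_highest _ hT hne₁ hv₁ (H.mem_opWeight hw₁)
  refine ⟨hirr, htri.exists_isGreatest (D.topSpace V b) hT hne₁ hv₁ (H.mem_opWeight hw₁), ?_⟩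
  rintro wt ⟨v₀, hv₀, hne, hw⟩
  have hC : (C₀ : ℂ) ≠ 0 := by exact_mod_cast hC₀.ne'
  have : Nontrivial (D.topSpace V b) := ⟨⟨v₀, hv₀⟩, 0, fun h => hne (congrArg Subtype.val h)⟩
  obtain ⟨S⟩ := (TwistData.currentRep hV hv₀ hne hw hC
    (TwistData.hasTorus hn hV hL hh hΔ hv₀ hne hw)).exists_realization hn (Λ := D.Γ)
    (fun l hl => (TwistData.exists_eq_lat ⟨l, hl⟩).imp fun a ha => congrArg Subtype.val ha)
    (D.isGrading_gCircGrad h₀)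
  let i₁ : LieRingModule (Matrix (Fin n) (Fin n) ℂ) (Fin S.d₁ → ℂ) :=
    LieRingModule.compLieHom (Fin S.d₁ → ℂ) S.r₁
  let j₁ : LieModule ℂ (Matrix (Fin n) (Fin n) ℂ) (Fin S.d₁ → ℂ) :=
    LieModule.compLieHom (Fin S.d₁ → ℂ) S.r₁
  let i₂ : LieRingModule (D.gCirc h₀) (Fin S.d₂ → ℂ) :=
    LieRingModule.compLieHom (Fin S.d₂ → ℂ) S.r₂
  let j₂ : LieModule ℂ (D.gCirc h₀) (Fin S.d₂ → ℂ) :=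
    LieModule.compLieHom (Fin S.d₂ → ℂ) S.r₂
  have : NeZero S.d₁ := ⟨S.d₁_pos.ne'⟩
  have : NeZero S.d₂ := ⟨S.d₂_pos.ne'⟩
  refine ⟨S.Γ', Fin S.d₁ → ℂ, Fin S.d₂ → ℂ, inferInstance, inferInstance, i₁, j₁, inferInstance,
    inferInstance, i₂, j₂, S.gr, S.Ψ, fun l hl => ?_, inferInstance, inferInstance,
    isIrreducible_of_isSimpleFamily S.simple₁, isIrreducible_of_isSimpleFamily S.simple₂,
    S.isGrading.indep, S.isGrading.iSup_eq, S.shift,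
    TwistData.isLoopRealization hV hv₀ hne hw hC _ S hn (fun _ => rfl) fun _ => rfl⟩
  obtain ⟨a, ha⟩ := TwistData.exists_eq_lat (D := D) ⟨l, hl⟩
  have hl' : l = scaleLat (fun i => D.m i.succ) a := congrArg Subtype.val ha
  rw [hl']
  exact S.mem_Γ' a
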